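/- Let $d\ge 1$ and let $U\subset\mathbb R^d$ be a bounded simply connected domain. Let $g\in L^1(U\times U)\cap C(U\times U)$ be real-valued and bounded from above on $U\times U$, and suppose that $$C_X(x,y)=\log\frac1{|x-y|}+g(x,y)\quad\text{for }(x,y)\in U\times U,\qquad C_X(x,y)=0\quad\text{otherwise},$$ is a covariance kernel, i.e. symmetric with $\int\!\!\int C_X(x,y)\varphi(x)\overline{\varphi(y)}\,dx\,dy\ge 0$ for all $\varphi\in C_c^\infty(\mathbb R^d)$. Let $X$ be a log-correlated field with this covariance: a real centered Gaussian random tempered distribution on $\mathbb R^d$ with $\mathbb E[X(\varphi)X(\psi)]=\int\!\!\int C_X(x,y)\varphi(x)\psi(y)\,dx\,dy$. Let $\eta\in C_c^\infty(\mathbb R^d)$ be non-negative and radially symmetric with $\int\eta=1$ and $\operatorname{supp}\eta\subset B(0,1)$, put $\eta_\varepsilon(y)=\varepsilon^{-d}\eta(y/\varepsilon)$ and $X_\varepsilon=X*\eta_\varepsilon$. For $0<\beta<\sqrt d$ let $\mu_\beta$ denote the imaginary chaos "$e^{i\beta X}$" on $U$, i.e. the random generalized function determined (up to almost sure equality) by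 $$\mu_\beta(\varphi)=\lim_{\varepsilon\downarrow0}\int_U \varphi(x)\,e^{i\beta X_\varepsilon(x)+\frac{\beta^2}{2}\mathbb E[X_\varepsilon(x)^2]}\,dx\quad\text{in probability},\qquad \varphi\in C_c^\infty(U)$$ (these limits exist). Then for every complex-valued $f\in C_c^\infty(U)$, as $\beta\nearrow\sqrt d$, $$\sqrt{\frac{d-\beta^2}{|S^{d-1}|}}\;\mu_\beta(f)\;\longrightarrow\;\int_U f(x)\,e^{\frac d2 g(x,x)}\,W(dx)\quad\text{in law},$$ where $|S^{d-1}|$ is the surface area of the unit sphere of $\mathbb R^d$ and $W$ is standard complex white noise on $U$; that is, the limit is the centered complex Gaussian random variable $Z$ with $\mathbb E[Z^2]=0$ and $\mathbb E|Z|^2=\int_U|f(x)|^2e^{d\,g(x,x)}\,dx$. -/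

import Mathlib

open MeasureTheory ProbabilityTheory Filter Topology TopologicalSpace Set
open scoped SchwartzMap Distributions NNReal

noncomputable section

namespace ImagChaos

/-- The covariance kernel `C(x, y) = log (1 / |x - y|) + g (x, y)` on `U × U`,
extended by zero outside `U × U`. -/
def logCov {d : ℕ} (U : Opens (EuclideanSpace ℝ (Fin d)))
    (g : EuclideanSpace ℝ (Fin d) × EuclideanSpace ℝ (Fin d) → ℝ)
    (x y : EuclideanSpace ℝ (Fin d)) : ℝ :=
  ((U : Set (EuclideanSpace ℝ (Fin d))) ×ˢ (U : Set (EuclideanSpace ℝ (Fin d)))).indicator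
    (fun z => Real.log (1 / ‖z.1 - z.2‖) + g z) (x, y)

/-- The standing assumptions on `U` and `g`: `U` is a bounded simply connected domain,
`g ∈ L¹(U × U) ∩ C(U × U)` is bounded from above on `U × U`, and the kernel
`log (1 / |x - y|) + g (x, y)` is a covariance kernel (symmetric and positive semi-definite). -/
structure IsLogCovKernel {d : ℕ} (U : Opens (EuclideanSpace ℝ (Fin d)))
    (g : EuclideanSpace ℝ (Fin d) × EuclideanSpace ℝ (Fin d) → ℝ) : Prop where
  bounded : Bornology.IsBounded (U : Set (EuclideanSpace ℝ (Fin d)))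
  simplyConnected : IsSimplyConnected (U : Set (EuclideanSpace ℝ (Fin d)))
  integrable : IntegrableOn g
    ((U : Set (EuclideanSpace ℝ (Fin d))) ×ˢ (U : Set (EuclideanSpace ℝ (Fin d))))
  continuousOn : ContinuousOn g
    ((U : Set (EuclideanSpace ℝ (Fin d))) ×ˢ (U : Set (EuclideanSpace ℝ (Fin d))))
  bddAbove : BddAbove (g ''
    ((U : Set (EuclideanSpace ℝ (Fin d))) ×ˢ (U : Set (EuclideanSpace ℝ (Fin d)))))
  symm : ∀ x y, logCov U g x y = logCov U g y x
  posSemidef : ∀ f : EuclideanSpace ℝ (Fin d) → ℂ, ContDiff ℝ ((⊤ : ℕ∞) : WithTop ℕ∞) f → HasCompactSupport f →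
    0 ≤ (∫ z : EuclideanSpace ℝ (Fin d) × EuclideanSpace ℝ (Fin d),
      (logCov U g z.1 z.2 : ℂ) * f z.1 * (starRingEnd ℂ) (f z.2)).re

/-- `X` is a centered Gaussian random (real) tempered distribution with covariance kernel
`logCov U g`, i.e. a log-correlated Gaussian field on `U`. -/
structure IsLogCorrelatedField {d : ℕ} {Ω : Type*} [MeasurableSpace Ω] (P : Measure Ω)
    (U : Opens (EuclideanSpace ℝ (Fin d)))
    (g : EuclideanSpace ℝ (Fin d) × EuclideanSpace ℝ (Fin d) → ℝ)
    (X : Ω → (𝓢(EuclideanSpace ℝ (Fin d), ℝ) →L[ℝ] ℝ)) : Prop where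
  measurable : ∀ φ, Measurable (fun ω => X ω φ)
  gaussian : IsGaussianProcess (fun φ ω => X ω φ) P
  centered : ∀ φ, ∫ ω, X ω φ ∂P = 0
  covariance : ∀ φ ψ, ∫ ω, X ω φ * X ω ψ ∂P =
    ∫ z : EuclideanSpace ℝ (Fin d) × EuclideanSpace ℝ (Fin d),
      logCov U g z.1 z.2 * φ z.1 * ψ z.2

/-- Non-negative, radially symmetric `η ∈ C_c^∞(ℝ^d)` of unit mass with support in `B(0, 1)`. -/
structure Mollifier (d : ℕ) where
  toFun : EuclideanSpace ℝ (Fin d) → ℝ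
  contDiff : ContDiff ℝ ((⊤ : ℕ∞) : WithTop ℕ∞) toFun
  nonneg : ∀ x, 0 ≤ toFun x
  radial : ∀ x y, ‖x‖ = ‖y‖ → toFun x = toFun y
  integral_eq_one : ∫ x, toFun x = 1
  tsupport_subset : tsupport toFun ⊆ Metric.ball 0 1

namespace Mollifier

variable {d : ℕ}

/-- The function `y ↦ η_ε (x - y)`, where `η_ε (z) = ε ^ (-d) η (z / ε)`. -/
def bumpFun (η : Mollifier d) (ε : ℝ) (x y : EuclideanSpace ℝ (Fin d)) : ℝ :=
  (ε ^ d)⁻¹ * η.toFun (ε⁻¹ • (x - y))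

theorem contDiff_bumpFun (η : Mollifier d) (ε : ℝ) (x : EuclideanSpace ℝ (Fin d)) :
    ContDiff ℝ ((⊤ : ℕ∞) : WithTop ℕ∞) (η.bumpFun ε x) := by
  unfold bumpFun
  have h : ContDiff ℝ ((⊤ : ℕ∞) : WithTop ℕ∞)
      (fun y : EuclideanSpace ℝ (Fin d) => ε⁻¹ • (x - y)) := by fun_prop
  exact contDiff_const.mul (η.contDiff.comp h)

theorem hasCompactSupport_bumpFun (η : Mollifier d) {ε : ℝ} (hε : 0 < ε)
    (x : EuclideanSpace ℝ (Fin d)) : HasCompactSupport (η.bumpFun ε x) := by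
  refine HasCompactSupport.intro (isCompact_closedBall x ε) fun y hy => ?_
  have h : η.toFun (ε⁻¹ • (x - y)) = 0 := by
    by_contra hne
    have hmem := η.tsupport_subset (subset_tsupport _ (Function.mem_support.mpr hne))
    rw [Metric.mem_ball, dist_zero_right, norm_smul, Real.norm_eq_abs, abs_of_pos (inv_pos.mpr hε),
      inv_mul_lt_iff₀ hε, mul_one] at hmem
    apply hy
    rw [Metric.mem_closedBall, dist_comm, dist_eq_norm]
    exact hmem.le
  simp [bumpFun, h]

/-- `y ↦ η_ε (x - y)` as a Schwartz function (only `ε > 0` matters). -/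
def bump (η : Mollifier d) (ε : ℝ) (x : EuclideanSpace ℝ (Fin d)) :
    𝓢(EuclideanSpace ℝ (Fin d), ℝ) :=
  if hε : 0 < ε then
    (η.hasCompactSupport_bumpFun hε x).toSchwartzMap (η.contDiff_bumpFun ε x)
  else 0

theorem bump_apply (η : Mollifier d) {ε : ℝ} (hε : 0 < ε) (x y : EuclideanSpace ℝ (Fin d)) :
    η.bump ε x y = (ε ^ d)⁻¹ * η.toFun (ε⁻¹ • (x - y)) := by
  simp [bump, hε, bumpFun]

end Mollifier

variable {d : ℕ} {Ω : Type*} [MeasurableSpace Ω]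

/-- The convolution approximation `X_ε(x) = (X * η_ε)(x)`. -/
def mollifiedField (X : Ω → (𝓢(EuclideanSpace ℝ (Fin d), ℝ) →L[ℝ] ℝ)) (η : Mollifier d)
    (ε : ℝ) (ω : Ω) (x : EuclideanSpace ℝ (Fin d)) : ℝ :=
  X ω (η.bump ε x)

/-- The renormalised exponential `exp (i β X_ε(x) + (β² / 2) E[X_ε(x)²])`. -/
def approxChaosDensity (P : Measure Ω) (X : Ω → (𝓢(EuclideanSpace ℝ (Fin d), ℝ) →L[ℝ] ℝ))
    (η : Mollifier d) (β ε : ℝ) (ω : Ω) (x : EuclideanSpace ℝ (Fin d)) : ℂ :=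
  Complex.exp (Complex.I * (β * mollifiedField X η ε ω x : ℝ) +
    (β ^ 2 / 2 * ∫ ω', mollifiedField X η ε ω' x ^ 2 ∂P : ℝ))

/-- The pairing `∫_U φ(x) exp (i β X_ε(x) + (β² / 2) E[X_ε(x)²]) dx`. -/
def approxChaos (P : Measure Ω) (X : Ω → (𝓢(EuclideanSpace ℝ (Fin d), ℝ) →L[ℝ] ℝ))
    (η : Mollifier d) (U : Opens (EuclideanSpace ℝ (Fin d))) (β ε : ℝ) (φ : 𝓓(U, ℂ)) (ω : Ω) : ℂ :=
  ∫ x in (U : Set (EuclideanSpace ℝ (Fin d))), φ x * approxChaosDensity P X η β ε ω x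

/-- The family of random variables `φ ↦ μ φ`, indexed by the test functions on `U`, is the
imaginary chaos `exp (i β X)`: each `μ φ` is the limit in probability, as `ε ↓ 0`, of the
renormalised exponentials of the convolution approximations of `X`, tested against `φ`. -/
structure IsImaginaryChaos (P : Measure Ω) (X : Ω → (𝓢(EuclideanSpace ℝ (Fin d), ℝ) →L[ℝ] ℝ))
    (η : Mollifier d) (U : Opens (EuclideanSpace ℝ (Fin d))) (β : ℝ)
    (μ : 𝓓(U, ℂ) → Ω → ℂ) : Prop where
  aemeasurable : ∀ φ, AEMeasurable (μ φ) P
  tendsto : ∀ φ, TendstoInMeasure P (fun ε ω => approxChaos P X η U β ε φ ω) (𝓝[>] 0) (μ φ)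

/-- The surface area `|S^{d-1}|` of the unit sphere of `ℝ^d`. -/
def sphereArea (d : ℕ) : ℝ :=
  (volume : Measure (EuclideanSpace ℝ (Fin d))).toSphere.real univ

/-- The law of `A + i B` with `A`, `B` independent real centered Gaussians of variance `v / 2`. -/
def complexGaussian (v : ℝ≥0) : Measure ℂ :=
  ((gaussianReal 0 (v / 2)).prod (gaussianReal 0 (v / 2))).map Complex.equivRealProdCLM.symm

instance isGaussian_complexGaussian (v : ℝ≥0) : IsGaussian (complexGaussian v) := by
  unfold complexGaussian
  infer_instance

/-- The law of the white noise integral `∫_U h(x) W(dx)`, with `W` standard complex white noise on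
`U`: the centered complex Gaussian `Z` with `E[Z²] = 0` and `E[|Z|²] = ∫_U |h(x)|² dx`. -/
def whiteNoiseIntegralLaw (U : Opens (EuclideanSpace ℝ (Fin d)))
    (h : EuclideanSpace ℝ (Fin d) → ℂ) : Measure ℂ :=
  complexGaussian (∫ x in (U : Set (EuclideanSpace ℝ (Fin d))), ‖h x‖ ^ 2).toNNReal

instance isGaussian_whiteNoiseIntegralLaw (U : Opens (EuclideanSpace ℝ (Fin d)))
    (h : EuclideanSpace ℝ (Fin d) → ℂ) : IsGaussian (whiteNoiseIntegralLaw U h) := by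
  unfold whiteNoiseIntegralLaw
  infer_instance

theorem integral_gaussianReal_sq (v : ℝ≥0) : ∫ x, x ^ 2 ∂(gaussianReal 0 v) = v := by
  have h := variance_id_gaussianReal (μ := 0) (v := v)
  rw [variance_eq_integral (by fun_prop)] at h
  simpa using h

theorem integrable_gaussianReal_sq (v : ℝ≥0) :
    Integrable (fun x : ℝ => x ^ 2) (gaussianReal 0 v) :=
  (memLp_id_gaussianReal (μ := 0) (v := v) 2).integrable_sq

theorem integrable_gaussianReal_id (v : ℝ≥0) :
    Integrable (fun x : ℝ => x) (gaussianReal 0 v) :=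
  (memLp_id_gaussianReal (μ := 0) (v := v) 1).integrable le_rfl

theorem integral_ofReal_gaussianReal (v : ℝ≥0) :
    ∫ x : ℝ, (x : ℂ) ∂(gaussianReal 0 v) = 0 := by
  rw [integral_complex_ofReal, integral_id_gaussianReal, Complex.ofReal_zero]

theorem integral_complexGaussian {F : Type*} [NormedAddCommGroup F] [NormedSpace ℝ F] (v : ℝ≥0)
    (k : ℂ → F) : ∫ z, k z ∂(complexGaussian v) =
      ∫ p : ℝ × ℝ, k (p.1 + p.2 * Complex.I)
        ∂((gaussianReal 0 (v / 2)).prod (gaussianReal 0 (v / 2))) := by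
  rw [complexGaussian]
  rw [show (⇑Complex.equivRealProdCLM.symm : ℝ × ℝ → ℂ)
    = ⇑Complex.equivRealProdCLM.symm.toHomeomorph.toMeasurableEquiv from rfl]
  rw [integral_map_equiv]
  refine integral_congr_ae (Eventually.of_forall fun p => ?_)
  change k (Complex.equivRealProd.symm p) = _
  rw [Complex.equivRealProd_symm_apply]

/-- `E[Z] = 0`. -/
theorem integral_id_complexGaussian (v : ℝ≥0) : ∫ z, z ∂(complexGaussian v) = 0 := by
  rw [integral_complexGaussian]
  have h := integrable_gaussianReal_id (v / 2)
  rw [integral_add (h.ofReal.comp_fst _) ((h.ofReal.comp_snd _).mul_const _),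
    integral_mul_const]
  simp only [integral_fun_fst (μ := gaussianReal 0 (v / 2)) (ν := gaussianReal 0 (v / 2))
      (fun x : ℝ => (x : ℂ)),
    integral_fun_snd (μ := gaussianReal 0 (v / 2)) (ν := gaussianReal 0 (v / 2))
      (fun x : ℝ => (x : ℂ)), integral_ofReal_gaussianReal]
  simp

/-- `E[Z²] = 0`. -/
theorem integral_sq_complexGaussian (v : ℝ≥0) : ∫ z, z ^ 2 ∂(complexGaussian v) = 0 := by
  rw [integral_complexGaussian]
  have h := integrable_gaussianReal_id (v / 2)
  have h2 : Integrable (fun x : ℝ => ((x ^ 2 : ℝ) : ℂ)) (gaussianReal 0 (v / 2)) :=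
    (integrable_gaussianReal_sq (v / 2)).ofReal
  have e : ∀ p : ℝ × ℝ, ((p.1 : ℂ) + p.2 * Complex.I) ^ 2 =
      (((p.1 ^ 2 : ℝ) : ℂ) - ((p.2 ^ 2 : ℝ) : ℂ)) + ((p.1 : ℂ) * (p.2 : ℂ)) * (2 * Complex.I) := by
    intro p
    push_cast
    linear_combination (p.2 : ℂ) ^ 2 * Complex.I_sq
  simp only [e]
  rw [integral_add, integral_sub, integral_mul_const]
  · simp only [integral_fun_fst (μ := gaussianReal 0 (v / 2)) (ν := gaussianReal 0 (v / 2))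
        (fun x : ℝ => ((x ^ 2 : ℝ) : ℂ)),
      integral_fun_snd (μ := gaussianReal 0 (v / 2)) (ν := gaussianReal 0 (v / 2))
        (fun x : ℝ => ((x ^ 2 : ℝ) : ℂ)),
      integral_prod_mul (μ := gaussianReal 0 (v / 2)) (ν := gaussianReal 0 (v / 2))
        (fun x : ℝ => (x : ℂ)) (fun x : ℝ => (x : ℂ)),
      integral_complex_ofReal, integral_ofReal_gaussianReal]
    simp
  · exact h2.comp_fst _
  · exact h2.comp_snd _
  · exact (h2.comp_fst _).sub (h2.comp_snd _)
  · exact (h.ofReal.mul_prod h.ofReal).mul_const _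

/-- `E[|Z|²] = v`. -/
theorem integral_norm_sq_complexGaussian (v : ℝ≥0) :
    ∫ z, ‖z‖ ^ 2 ∂(complexGaussian v) = v := by
  rw [integral_complexGaussian]
  have h2 := integrable_gaussianReal_sq (v / 2)
  have e : ∀ p : ℝ × ℝ, ‖(p.1 : ℂ) + p.2 * Complex.I‖ ^ 2 = p.1 ^ 2 + p.2 ^ 2 := by
    intro p
    rw [Complex.sq_norm, Complex.normSq_add_mul_I]
  simp only [e]
  rw [integral_add (h2.comp_fst _) (h2.comp_snd _)]
  simp only [integral_fun_fst (μ := gaussianReal 0 (v / 2)) (ν := gaussianReal 0 (v / 2))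
      (fun x : ℝ => x ^ 2),
    integral_fun_snd (μ := gaussianReal 0 (v / 2)) (ν := gaussianReal 0 (v / 2))
      (fun x : ℝ => x ^ 2), integral_gaussianReal_sq]
  simp

end ImagChaos

end

set_option linter.unusedSectionVars false

noncomputable section

/-! Write b = β² and let K be the support of f, a compact subset of U. By Lévy's theorem it suffices
that the characteristic function of the normalised chaos Z converges to exp(-|t|² v / 4), where v =
∫ |f|² e^{d g(x,x)}.

The route is a Malliavin–Stein argument. For S = Re(t̄ Z), Gaussian integration by parts shows that
r ↦ E e^{irS} solves the differential equation of a Gaussian characteristic function up to three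
errors: |∫ f|, E|T₋ - v| and E|T₊|. Here T_± is the bilinear functional b ∫₀¹ ds ∫∫ f(x) f'(y)
C(x,y) :e^{isβX(x)}: :e^{±iβX(y)}: with f' = f for the sign + and f' = f̄ for the sign -
(`norm_charFun_chaosFun_sub_le`). No Malliavin derivative is needed. Integration by parts is encoded
in `HasInterpolation`, which is stable under products with integrals of phases, sums and bounded
limits, hence under exponentials.

The first error vanishes with the normalising factor. The mean of T₋ is ∫∫ f(x) f̄(y) (e^{bC(x,y)} -
1). Once normalised it contains (d - b)/|S^{d-1}| |x - y|^{-b}, an approximate identity as b ↗ d, so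
it tends to v (`tendsto_first_moment`). What remains is that the variance of T₋ and the second
moment of T₊ are o((d - b)^{-2}) before normalisation. Both are integrals of the four-point function
`fourCorr` (`integral_normSq_pairFun_sub`). The parameters σ = -1, θ = 1 give the variance of T₋,
and σ = 1, θ = 0 the second moment of T₊.

An Onsager inequality (`exists_onsager`) bounds the energy of four charges by half the sum, over the
points, of their largest logarithmic interaction. Together with the integration over s and s' this
dominates the four-point function by products |p - q|^{-b} |r - t|^{-b} over the three pairings, of
order (d - b)^{-2}, plus chains of order (d - b)^{-1} only (`exists_fourPoint_le`). The leading
order comes solely from two short pairs at a macroscopic distance from each other. There an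
arbitrarily small factor τ is gained. For opposite charges the two dipoles decouple and the
truncation cancels the main term. Equal charges within a pair repel. In the two crossed pairings the
singular pair is not the one carrying the prefactor, and the integration over s gains the inverse of
a large logarithm. This is collected in `exists_fourCorrInt_le_majorant`.

All identities are proved for the mollified field, where every random variable is bounded. For fixed
β the mollification is then removed by dominated convergence, using bounds uniform in ε
(`exists_isLogKernelOn`). The same two-point computation shows that the mollified chaoses are Cauchy
in L², which gives the existence of the imaginary chaos. -/

namespace ImagChaos

/-! ### Centered Gaussian functionals, Wick phases and the interpolation formula. -/

section GaussianField

variable {V Ω : Type*} [AddCommGroup V] [Module ℝ V] [TopologicalSpace V] [MeasurableSpace Ω]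

/-- A random continuous linear functional which is centered Gaussian with covariance form `q`,
expressed through its characteristic functional. -/
structure IsCenteredGaussian (P : Measure Ω) (X : Ω → V →L[ℝ] ℝ) (q : LinearMap.BilinForm ℝ V) :
    Prop where
  measurable : ∀ φ, Measurable (fun ω => X ω φ)
  charFun : ∀ φ, ∫ ω, Complex.exp (Complex.I * (X ω φ : ℝ)) ∂P = Complex.exp ((-(q φ φ) / 2 : ℝ))
  symm : ∀ φ ψ, q φ ψ = q ψ φ
  nonneg : ∀ φ, 0 ≤ q φ φ

/-- The random phase `exp (i X(φ))`. -/
def phase (X : Ω → V →L[ℝ] ℝ) (φ : V) (ω : Ω) : ℂ := Complex.exp (Complex.I * (X ω φ : ℝ))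

/-- The Wick-ordered phase `exp (i X(φ) + E[X(φ)²] / 2)`. -/
def wick (X : Ω → V →L[ℝ] ℝ) (q : LinearMap.BilinForm ℝ V) (φ : V) (ω : Ω) : ℂ :=
  Complex.exp ((q φ φ / 2 : ℝ)) * phase X φ ω

variable {P : Measure Ω} {X : Ω → V →L[ℝ] ℝ} {q : LinearMap.BilinForm ℝ V}

theorem norm_phase (φ : V) (ω : Ω) : ‖phase X φ ω‖ = 1 := by
  rw [phase, mul_comm, Complex.norm_exp_ofReal_mul_I]

theorem phase_add (φ ψ : V) (ω : Ω) : phase X (φ + ψ) ω = phase X φ ω * phase X ψ ω := by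
  simp only [phase, map_add, ← Complex.exp_add]
  push_cast
  ring_nf

theorem phase_zero (ω : Ω) : phase X 0 ω = 1 := by simp [phase]

theorem conj_phase (φ : V) (ω : Ω) : (starRingEnd ℂ) (phase X φ ω) = phase X (-φ) ω := by
  simp only [phase, ← Complex.exp_conj, map_mul, Complex.conj_I, Complex.conj_ofReal, map_neg]
  push_cast
  ring_nf

theorem norm_wick (φ : V) (ω : Ω) : ‖wick X q φ ω‖ = Real.exp (q φ φ / 2) := by
  rw [wick, norm_mul, norm_phase, mul_one, Complex.norm_exp_ofReal]

theorem measurable_phase_of {A : Type*} [MeasurableSpace A] {Φ : A → V}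
    (h : Measurable (fun p : A × Ω => X p.2 (Φ p.1))) :
    Measurable (fun p : A × Ω => phase X (Φ p.1) p.2) := by
  unfold phase
  exact Complex.measurable_exp.comp
    (measurable_const.mul (Complex.measurable_ofReal.comp h))

theorem integrable_of_norm_le {α G : Type*} [MeasurableSpace α] {μ : Measure α} [IsFiniteMeasure μ]
    [NormedAddCommGroup G] {F : α → G} (hF : AEStronglyMeasurable F μ) {C : ℝ}
    (hC : ∀ a, ‖F a‖ ≤ C) : Integrable F μ :=
  Integrable.of_bound hF C (Eventually.of_forall hC)

namespace IsCenteredGaussian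

variable (hG : IsCenteredGaussian P X q)
include hG

theorem measurable_phase (φ : V) : Measurable (phase X φ) :=
  Complex.measurable_exp.comp
    (measurable_const.mul (Complex.measurable_ofReal.comp (hG.measurable φ)))

theorem measurable_wick (φ : V) : Measurable (wick X q φ) :=
  measurable_const.mul (hG.measurable_phase φ)

theorem integral_phase (φ : V) : ∫ ω, phase X φ ω ∂P = Complex.exp ((-(q φ φ) / 2 : ℝ)) :=
  hG.charFun φ

/-- The Wick factor cancels the variance of X(φ) in the variance of X(φ + ψ), so only the cross term
and the variance of X(ψ) survive. -/
theorem integral_wick_mul_phase (φ ψ : V) :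
    ∫ ω, wick X q φ ω * phase X ψ ω ∂P = Complex.exp ((-(q ψ ψ) / 2 - q φ ψ : ℝ)) := by
  simp only [wick, mul_assoc, ← phase_add]
  rw [integral_const_mul, hG.integral_phase, ← Complex.exp_add]
  congr 1
  simp only [map_add, LinearMap.add_apply]
  rw [hG.symm ψ φ]
  push_cast
  ring

/-- The characteristic functional at 0 is the total mass, and its value 1 also excludes an infinite
measure. -/
theorem isProbabilityMeasure : IsProbabilityMeasure P := by
  have h := hG.charFun 0
  simp only [map_zero, Complex.ofReal_zero, mul_zero, Complex.exp_zero, integral_const,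
    neg_zero, zero_div] at h
  refine ⟨?_⟩
  have h1 : P.real univ = 1 := by
    have : ((P.real univ : ℝ) : ℂ) = 1 := by simpa using h
    exact_mod_cast this
  rw [Measure.real] at h1
  rw [← ENNReal.ofReal_toReal (a := P univ) (by intro h0; simp [h0] at h1), h1, ENNReal.ofReal_one]

end IsCenteredGaussian

/-- `F'` is a derivative of the random variable `F` in the direction `χ`, in the sense that the
Gaussian interpolation formula along `s ↦ s χ` holds. -/
structure HasInterpolation (P : Measure Ω) (X : Ω → V →L[ℝ] ℝ) (q : LinearMap.BilinForm ℝ V)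
    (χ : V) (F F' : Ω → ℂ) : Prop where
  measurable : Measurable F
  measurable_deriv : Measurable F'
  bounded : ∃ C, ∀ ω, ‖F ω‖ ≤ C
  bounded_deriv : ∃ C, ∀ ω, ‖F' ω‖ ≤ C
  interpolation : ∀ φ, ∫ ω, (wick X q χ ω - 1) * F ω * phase X φ ω ∂P =
    Complex.I * ∫ p : unitInterval × Ω, wick X q ((p.1 : ℝ) • χ) p.2 *
      (F' p.2 + Complex.I * (q χ φ : ℝ) * F p.2) * phase X φ p.2 ∂(volume.prod P)

theorem measurable_wick_smul (hG : IsCenteredGaussian P X q) (χ : V) :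
    Measurable (fun p : unitInterval × Ω => wick X q ((p.1 : ℝ) • χ) p.2) := by
  have h := hG.measurable χ
  simp only [wick, phase, map_smul, LinearMap.smul_apply, smul_eq_mul]
  fun_prop

theorem norm_wick_smul_le (hG : IsCenteredGaussian P X q) (χ : V) (s : unitInterval) (ω : Ω) :
    ‖wick X q ((s : ℝ) • χ) ω‖ ≤ Real.exp (q χ χ / 2) := by
  rw [norm_wick, Real.exp_le_exp]
  simp only [map_smul, LinearMap.smul_apply, smul_eq_mul]
  have h0 := hG.nonneg χ
  have h1 := s.2.1
  have h2 := s.2.2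
  have : (s : ℝ) * ((s : ℝ) * q χ χ) ≤ 1 * (1 * q χ χ) := by gcongr
  linarith

theorem integral_unitInterval {G : Type*} [NormedAddCommGroup G] [NormedSpace ℝ G] (f : ℝ → G) :
    ∫ s : unitInterval, f s = ∫ s in (0 : ℝ)..1, f s := by
  rw [intervalIntegral.integral_of_le zero_le_one, ← integral_Icc_eq_integral_Ioc]
  exact integral_subtype measurableSet_Icc f

/-- Base case from which all other interpolation formulas are built. Both expectations are explicit
exponentials, and the formula is the fundamental theorem of calculus for s ↦ e^{-s q(χ,φ)}. -/
theorem hasInterpolation_one (hG : IsCenteredGaussian P X q) (χ : V) :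
    HasInterpolation P X q χ (fun _ => 1) (fun _ => 0) where
  measurable := measurable_const
  measurable_deriv := measurable_const
  bounded := ⟨1, by simp⟩
  bounded_deriv := ⟨0, by simp⟩
  interpolation := by
    intro φ
    have := hG.isProbabilityMeasure
    have hi : ∀ ψ, Integrable (fun ω => wick X q ψ ω * phase X φ ω) P := fun ψ =>
      integrable_of_norm_le
        ((hG.measurable_wick ψ).mul (hG.measurable_phase φ)).aestronglyMeasurable
        (C := Real.exp (q ψ ψ / 2)) (fun ω => by rw [norm_mul, norm_wick, norm_phase, mul_one])
    have hi2 : Integrable (phase X φ) P :=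
      integrable_of_norm_le (hG.measurable_phase φ).aestronglyMeasurable
        (C := 1) (fun ω => by rw [norm_phase])
    simp only [mul_one, sub_mul, one_mul, zero_add]
    rw [integral_sub (hi χ) hi2, hG.integral_wick_mul_phase, hG.integral_phase]
    have hint : Integrable (fun p : unitInterval × Ω => wick X q ((p.1 : ℝ) • χ) p.2 *
        (Complex.I * (q χ φ : ℝ)) * phase X φ p.2) (volume.prod P) := by
      refine integrable_of_norm_le (((measurable_wick_smul hG χ).mul measurable_const).mul
        ((hG.measurable_phase φ).comp measurable_snd)).aestronglyMeasurable
        (C := Real.exp (q χ χ / 2) * |q χ φ|) fun p => ?_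
      rw [norm_mul, norm_mul, norm_phase, mul_one, norm_mul, Complex.norm_I, one_mul,
        Complex.norm_real, Real.norm_eq_abs]
      exact mul_le_mul_of_nonneg_right (norm_wick_smul_le hG χ _ _) (abs_nonneg _)
    rw [integral_prod _ hint]
    have e1 : ∀ s : unitInterval, ∫ ω, wick X q ((s : ℝ) • χ) ω * (Complex.I * (q χ φ : ℝ)) *
        phase X φ ω ∂P = (fun s : ℝ => (Complex.I * (q χ φ : ℝ)) *
          Complex.exp ((-(q φ φ) / 2 - s * q χ φ : ℝ))) s := by
      intro s
      have := hG.integral_wick_mul_phase ((s : ℝ) • χ) φ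
      simp only [map_smul, LinearMap.smul_apply, smul_eq_mul] at this
      beta_reduce
      rw [← this, ← integral_const_mul]
      congr 1
      ext ω
      ring
    simp only [e1]
    rw [integral_unitInterval (fun s : ℝ => (Complex.I * (q χ φ : ℝ)) *
          Complex.exp ((-(q φ φ) / 2 - s * q χ φ : ℝ)))]
    have hd : ∀ s ∈ uIcc (0:ℝ) 1, HasDerivAt
        (fun s : ℝ => -Complex.I * Complex.exp ((-(q φ φ) / 2 - s * q χ φ : ℝ)))
        ((Complex.I * (q χ φ : ℝ)) * Complex.exp ((-(q φ φ) / 2 - s * q χ φ : ℝ))) s := by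
      intro s _
      have h1 : HasDerivAt (fun s : ℝ => (-(q φ φ) / 2 - s * q χ φ : ℝ)) (-(q χ φ)) s := by
        have := ((hasDerivAt_id s).mul_const (q χ φ)).const_sub (-(q φ φ) / 2)
        simpa using this
      have h2 := (h1.ofReal_comp.cexp).const_mul (-Complex.I)
      refine h2.congr_deriv ?_
      rw [Complex.ofReal_neg]
      ring
    rw [intervalIntegral.integral_eq_sub_of_hasDerivAt hd
      (Continuous.intervalIntegrable (by fun_prop) _ _)]
    simp only [one_mul, zero_mul, sub_zero]
    linear_combination (Complex.exp ((-(q φ φ) / 2 - q χ φ : ℝ)) -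
      Complex.exp ((-(q φ φ) / 2 : ℝ))) * Complex.I_sq

end GaussianField

/-! ### Stability of the interpolation formula: products with integrals of phases, sums, limits. -/

section Interpolation

variable {V Ω : Type*} [AddCommGroup V] [Module ℝ V] [TopologicalSpace V] [MeasurableSpace Ω]
variable {P : Measure Ω} {X : Ω → V →L[ℝ] ℝ} {q : LinearMap.BilinForm ℝ V}

/-- The integral of random phases `∫ h(a) exp (i X(Φ a)) μ(da)`. -/
def phaseIntegral {A : Type*} [MeasurableSpace A] (μ : Measure A) (X : Ω → V →L[ℝ] ℝ) (h : A → ℂ)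
    (Φ : A → V) (ω : Ω) : ℂ := ∫ a, h a * phase X (Φ a) ω ∂μ

section
variable {A : Type*} [MeasurableSpace A] {μ : Measure A} [IsFiniteMeasure μ] {h : A → ℂ} {Φ : A → V}

theorem measurable_phaseIntegral (hΦ : Measurable (fun p : A × Ω => X p.2 (Φ p.1)))
    (hh : Measurable h) : Measurable (phaseIntegral μ X h Φ) := by
  have h1 : Measurable (fun p : Ω × A => h p.2 * phase X (Φ p.2) p.1) :=
    (hh.comp measurable_snd).mul ((measurable_phase_of hΦ).comp measurable_swap)
  exact (h1.stronglyMeasurable.integral_prod_right').measurable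

theorem norm_phaseIntegral_le {C : ℝ} (hC : ∀ a, ‖h a‖ ≤ C) (ω : Ω) :
    ‖phaseIntegral μ X h Φ ω‖ ≤ C * μ.real univ := by
  refine norm_integral_le_of_norm_le_const (Eventually.of_forall fun a => ?_)
  rw [norm_mul, norm_phase, mul_one]
  exact hC a

theorem integrable_phase_mul (hΦ : Measurable (fun p : A × Ω => X p.2 (Φ p.1)))
    (hh : Measurable h) {C : ℝ} (hC : ∀ a, ‖h a‖ ≤ C) (ω : Ω) :
    Integrable (fun a => h a * phase X (Φ a) ω) μ := by
  have h1 : Measurable (fun a => h a * phase X (Φ a) ω) :=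
    hh.mul ((measurable_phase_of hΦ).comp (measurable_id.prodMk measurable_const))
  exact integrable_of_norm_le h1.aestronglyMeasurable (C := C)
    fun a => by rw [norm_mul, norm_phase, mul_one]; exact hC a

end

namespace HasInterpolation

/-- Leibniz rule, using that the derivative of e^{iX(ψ)} in the direction χ is i q(χ,ψ) e^{iX(ψ)}.
The phase of Φ a is absorbed into the test phase, which turns φ into Φ a + φ, and Fubini integrates
over a. This is the reason why the interpolation formula is demanded for every test phase. -/
theorem mul_phaseIntegral (hG : IsCenteredGaussian P X q) {χ : V} {F F' : Ω → ℂ}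
    (hF : HasInterpolation P X q χ F F')
    {A : Type*} [MeasurableSpace A] {μ : Measure A} [IsFiniteMeasure μ] {h : A → ℂ} {Φ : A → V}
    (hΦ : Measurable (fun p : A × Ω => X p.2 (Φ p.1))) (hh : Measurable h)
    {C : ℝ} (hC : ∀ a, ‖h a‖ ≤ C) (hq : Measurable (fun a => q χ (Φ a)))
    {M : ℝ} (hM : ∀ a, |q χ (Φ a)| ≤ M) :
    HasInterpolation P X q χ (fun ω => F ω * phaseIntegral μ X h Φ ω)
      (fun ω => F' ω * phaseIntegral μ X h Φ ω +
        F ω * phaseIntegral μ X (fun a => Complex.I * (q χ (Φ a) : ℝ) * h a) Φ ω) := by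
  have hP := hG.isProbabilityMeasure
  obtain ⟨B, hB⟩ := hF.bounded
  obtain ⟨B', hB'⟩ := hF.bounded_deriv
  obtain ⟨ω₀⟩ : Nonempty Ω := P.nonempty_of_neZero
  have hB0 : 0 ≤ B := (norm_nonneg _).trans (hB ω₀)
  have hB'0 : 0 ≤ B' := (norm_nonneg _).trans (hB' ω₀)
  set h' : A → ℂ := fun a => Complex.I * (q χ (Φ a) : ℝ) * h a with hh'
  have hh'm : Measurable h' := (measurable_const.mul (Complex.measurable_ofReal.comp hq)).mul hh
  have hC' : ∀ a, ‖h' a‖ ≤ M * C := fun a => by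
    simp only [hh', norm_mul, Complex.norm_I, one_mul, Complex.norm_real, Real.norm_eq_abs]
    exact mul_le_mul (hM a) (hC a) (norm_nonneg _) ((abs_nonneg _).trans (hM a))
  have hW := measurable_phaseIntegral (μ := μ) hΦ hh
  have hW' := measurable_phaseIntegral (μ := μ) hΦ hh'm
  have bW := norm_phaseIntegral_le (μ := μ) (X := X) (Φ := Φ) hC
  have bW' := norm_phaseIntegral_le (μ := μ) (X := X) (Φ := Φ) hC'
  have hFm := hF.measurable
  have hFm' := hF.measurable_deriv
  refine ⟨hFm.mul hW, (hFm'.mul hW).add (hFm.mul hW'), ⟨B * (C * μ.real univ), fun ω => ?_⟩,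
    ⟨B' * (C * μ.real univ) + B * (M * C * μ.real univ), fun ω => ?_⟩, fun φ => ?_⟩
  · rw [norm_mul]
    exact mul_le_mul (hB ω) (bW ω) (norm_nonneg _) hB0
  · refine (norm_add_le _ _).trans (add_le_add ?_ ?_)
    · rw [norm_mul]
      exact mul_le_mul (hB' ω) (bW ω) (norm_nonneg _) hB'0
    · rw [norm_mul]
      exact mul_le_mul (hB ω) (bW' ω) (norm_nonneg _) hB0
  have hwm := hG.measurable_wick χ
  have hpm := hG.measurable_phase φ
  have hΦm := measurable_phase_of hΦ
  have hwsm := measurable_wick_smul hG χ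
  have hphase : ∀ a ω, phase X (Φ a + φ) ω = phase X (Φ a) ω * phase X φ ω :=
    fun a ω => phase_add _ _ _
  -- left-hand side
  have hL : ∫ ω, (wick X q χ ω - 1) * (F ω * phaseIntegral μ X h Φ ω) * phase X φ ω ∂P =
      ∫ a, h a * ∫ ω, (wick X q χ ω - 1) * F ω * phase X (Φ a + φ) ω ∂P ∂μ := by
    have e1 : ∀ ω, (wick X q χ ω - 1) * (F ω * phaseIntegral μ X h Φ ω) * phase X φ ω =
        ∫ a, h a * ((wick X q χ ω - 1) * F ω * phase X (Φ a + φ) ω) ∂μ := by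
      intro ω
      rw [phaseIntegral, ← integral_const_mul, ← integral_const_mul, ← integral_mul_const]
      congr 1
      ext a
      rw [hphase]
      ring
    simp only [e1]
    rw [integral_integral_swap]
    · simp only [integral_const_mul]
    · refine integrable_of_norm_le (C := C * ((Real.exp (q χ χ / 2) + 1) * B)) ?_ ?_
      · refine Measurable.aestronglyMeasurable ?_
        simp only [hphase]
        exact (hh.comp measurable_snd).mul
          ((((hwm.comp measurable_fst).sub_const 1).mul (hFm.comp measurable_fst)).mul
            ((hΦm.comp measurable_swap).mul (hpm.comp measurable_fst)))
      · rintro ⟨ω, a⟩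
        simp only [Function.uncurry, norm_mul, norm_phase, mul_one]
        refine mul_le_mul (hC a) (mul_le_mul ?_ (hB ω) (norm_nonneg _) (by positivity))
          (by positivity) ((norm_nonneg _).trans (hC a))
        refine (norm_sub_le _ _).trans ?_
        rw [norm_wick, norm_one]
  have hR : ∫ a, h a * ∫ p : unitInterval × Ω, wick X q ((p.1 : ℝ) • χ) p.2 *
      (F' p.2 + Complex.I * (q χ (Φ a + φ) : ℝ) * F p.2) * phase X (Φ a + φ) p.2 ∂(volume.prod P) ∂μ
      = ∫ p : unitInterval × Ω, wick X q ((p.1 : ℝ) • χ) p.2 *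
      ((F' p.2 * phaseIntegral μ X h Φ p.2 + F p.2 * phaseIntegral μ X h' Φ p.2) +
        Complex.I * (q χ φ : ℝ) * (F p.2 * phaseIntegral μ X h Φ p.2)) * phase X φ p.2
        ∂(volume.prod P) := by
    have e1 : ∀ p : unitInterval × Ω, wick X q ((p.1 : ℝ) • χ) p.2 *
      ((F' p.2 * phaseIntegral μ X h Φ p.2 + F p.2 * phaseIntegral μ X h' Φ p.2) +
        Complex.I * (q χ φ : ℝ) * (F p.2 * phaseIntegral μ X h Φ p.2)) * phase X φ p.2 =
        ∫ a, h a * (wick X q ((p.1 : ℝ) • χ) p.2 *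
      (F' p.2 + Complex.I * (q χ (Φ a + φ) : ℝ) * F p.2) * phase X (Φ a + φ) p.2) ∂μ := by
      intro p
      have i1 := integrable_phase_mul (μ := μ) hΦ hh hC p.2
      have i2 := integrable_phase_mul (μ := μ) hΦ hh'm hC' p.2
      -- The covariance q(χ, Φ a + φ) splits. The φ part reproduces the term already present in the
      -- formula, and the Φ a part is the derivative of the new factor.
      have e2 : ∀ a, h a * (wick X q ((p.1 : ℝ) • χ) p.2 *
        (F' p.2 + Complex.I * (q χ (Φ a + φ) : ℝ) * F p.2) * phase X (Φ a + φ) p.2) =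
        (wick X q ((p.1 : ℝ) • χ) p.2 * (F' p.2 + Complex.I * (q χ φ : ℝ) * F p.2) * phase X φ p.2)
          * (h a * phase X (Φ a) p.2) + (wick X q ((p.1 : ℝ) • χ) p.2 * F p.2 * phase X φ p.2) *
          (h' a * phase X (Φ a) p.2) := by
        intro a
        rw [hphase, map_add, hh']
        push_cast
        ring
      simp only [e2]
      rw [integral_add (i1.const_mul _) (i2.const_mul _), integral_const_mul, integral_const_mul]
      simp only [phaseIntegral]
      ring
    simp only [e1]
    simp only [← integral_const_mul]
    refine integral_integral_swap (μ := μ) (ν := (volume : Measure unitInterval).prod P)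
      (f := fun a p => h a * (wick X q ((p.1 : ℝ) • χ) p.2 *
      (F' p.2 + Complex.I * (q χ (Φ a + φ) : ℝ) * F p.2) * phase X (Φ a + φ) p.2)) ?_
    refine integrable_of_norm_le
      (C := C * (Real.exp (q χ χ / 2) * (B' + (M + |q χ φ|) * B))) ?_ ?_
    · refine Measurable.aestronglyMeasurable ?_
      simp only [hphase, map_add, Function.uncurry_def]
      refine (hh.comp measurable_fst).mul ((((hwsm.comp measurable_snd).mul
        ((hFm'.comp (measurable_snd.comp measurable_snd)).add ((measurable_const.mul
        (Complex.measurable_ofReal.comp ((hq.comp measurable_fst).add_const _))).mul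
        (hFm.comp (measurable_snd.comp measurable_snd))))).mul
        ((hΦm.comp (measurable_fst.prodMk (measurable_snd.comp measurable_snd))).mul
        (hpm.comp (measurable_snd.comp measurable_snd)))))
    · rintro ⟨a, p⟩
      simp only [Function.uncurry, norm_mul, norm_phase, mul_one]
      refine mul_le_mul (hC a) (mul_le_mul (norm_wick_smul_le hG χ _ _) ?_ (norm_nonneg _)
        (Real.exp_pos _).le) (by positivity) ((norm_nonneg _).trans (hC a))
      refine (norm_add_le _ _).trans (add_le_add (hB' _) ?_)
      rw [norm_mul, norm_mul, Complex.norm_I, one_mul, Complex.norm_real, Real.norm_eq_abs, map_add]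
      refine mul_le_mul ((abs_add_le _ _).trans (add_le_add (hM a) le_rfl)) (hB _) (norm_nonneg _)
        (add_nonneg ((abs_nonneg _).trans (hM a)) (abs_nonneg _))
  rw [hL, ← hR, ← integral_const_mul]
  congr 1
  ext a
  rw [hF.interpolation]
  ring

theorem add (hG : IsCenteredGaussian P X q) {χ : V} {F F' G G' : Ω → ℂ}
    (hF : HasInterpolation P X q χ F F') (hG' : HasInterpolation P X q χ G G') :
    HasInterpolation P X q χ (fun ω => F ω + G ω) (fun ω => F' ω + G' ω) := by
  have hP := hG.isProbabilityMeasure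
  obtain ⟨B, hB⟩ := hF.bounded
  obtain ⟨B', hB'⟩ := hF.bounded_deriv
  obtain ⟨D, hD⟩ := hG'.bounded
  obtain ⟨D', hD'⟩ := hG'.bounded_deriv
  refine ⟨hF.measurable.add hG'.measurable, hF.measurable_deriv.add hG'.measurable_deriv,
    ⟨B + D, fun ω => norm_add_le_of_le (hB ω) (hD ω)⟩,
    ⟨B' + D', fun ω => norm_add_le_of_le (hB' ω) (hD' ω)⟩, fun φ => ?_⟩
  have e1 : ∀ ω, (wick X q χ ω - 1) * (F ω + G ω) * phase X φ ω =
      (wick X q χ ω - 1) * F ω * phase X φ ω + (wick X q χ ω - 1) * G ω * phase X φ ω := by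
    intro ω; ring
  have e2 : ∀ p : unitInterval × Ω, wick X q ((p.1 : ℝ) • χ) p.2 *
      ((F' p.2 + G' p.2) + Complex.I * (q χ φ : ℝ) * (F p.2 + G p.2)) * phase X φ p.2 =
      wick X q ((p.1 : ℝ) • χ) p.2 *
      (F' p.2 + Complex.I * (q χ φ : ℝ) * F p.2) * phase X φ p.2 +
      wick X q ((p.1 : ℝ) • χ) p.2 *
      (G' p.2 + Complex.I * (q χ φ : ℝ) * G p.2) * phase X φ p.2 := by
    intro p; ring
  simp only [e1, e2]
  have i1 : ∀ {F F' : Ω → ℂ} {B : ℝ}, HasInterpolation P X q χ F F' → (∀ ω, ‖F ω‖ ≤ B) →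
      Integrable (fun ω => (wick X q χ ω - 1) * F ω * phase X φ ω) P := by
    intro F F' B hF hB
    refine integrable_of_norm_le ((((hG.measurable_wick χ).sub_const 1).mul hF.measurable).mul
      (hG.measurable_phase φ)).aestronglyMeasurable
      (C := (Real.exp (q χ χ / 2) + 1) * B) fun ω => ?_
    rw [norm_mul, norm_mul, norm_phase, mul_one]
    refine mul_le_mul ((norm_sub_le _ _).trans ?_) (hB ω) (norm_nonneg _) (by positivity)
    rw [norm_wick, norm_one]
  have i2 : ∀ {F F' : Ω → ℂ} {B B' : ℝ}, HasInterpolation P X q χ F F' → (∀ ω, ‖F ω‖ ≤ B) →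
      (∀ ω, ‖F' ω‖ ≤ B') →
      Integrable (fun p : unitInterval × Ω => wick X q ((p.1 : ℝ) • χ) p.2 *
      (F' p.2 + Complex.I * (q χ φ : ℝ) * F p.2) * phase X φ p.2) (volume.prod P) := by
    intro F F' B B' hF hB hB'
    refine integrable_of_norm_le (((measurable_wick_smul hG χ).mul
      ((hF.measurable_deriv.comp measurable_snd).add
      (measurable_const.mul (hF.measurable.comp measurable_snd)))).mul
      ((hG.measurable_phase φ).comp measurable_snd)).aestronglyMeasurable
      (C := Real.exp (q χ χ / 2) * (B' + |q χ φ| * B)) fun p => ?_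
    rw [norm_mul, norm_mul, norm_phase, mul_one]
    refine mul_le_mul (norm_wick_smul_le hG χ _ _) ((norm_add_le _ _).trans
      (add_le_add (hB' _) ?_)) (norm_nonneg _) (by positivity)
    rw [norm_mul, norm_mul, Complex.norm_I, one_mul, Complex.norm_real, Real.norm_eq_abs]
    exact mul_le_mul_of_nonneg_left (hB _) (abs_nonneg _)
  rw [integral_add (i1 hF hB) (i1 hG' hD), integral_add (i2 hF hB hB') (i2 hG' hD hD'),
    hF.interpolation, hG'.interpolation, mul_add]

theorem const_mul {χ : V} {F F' : Ω → ℂ} (hF : HasInterpolation P X q χ F F') (c : ℂ) :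
    HasInterpolation P X q χ (fun ω => c * F ω) (fun ω => c * F' ω) := by
  obtain ⟨B, hB⟩ := hF.bounded
  obtain ⟨B', hB'⟩ := hF.bounded_deriv
  refine ⟨hF.measurable.const_mul c, hF.measurable_deriv.const_mul c,
    ⟨‖c‖ * B, fun ω => by rw [norm_mul]; exact mul_le_mul_of_nonneg_left (hB ω) (norm_nonneg _)⟩,
    ⟨‖c‖ * B', fun ω => by rw [norm_mul]; exact mul_le_mul_of_nonneg_left (hB' ω) (norm_nonneg _)⟩,
    fun φ => ?_⟩
  have e1 : ∀ ω, (wick X q χ ω - 1) * (c * F ω) * phase X φ ω =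
      c * ((wick X q χ ω - 1) * F ω * phase X φ ω) := by
    intro ω; ring
  have e2 : ∀ p : unitInterval × Ω, wick X q ((p.1 : ℝ) • χ) p.2 *
      (c * F' p.2 + Complex.I * (q χ φ : ℝ) * (c * F p.2)) * phase X φ p.2 =
      c * (wick X q ((p.1 : ℝ) • χ) p.2 *
      (F' p.2 + Complex.I * (q χ φ : ℝ) * F p.2) * phase X φ p.2) := by
    intro p; ring
  simp only [e1, e2, integral_const_mul, hF.interpolation]
  ring

/-- Interpolation formulas pass to uniformly bounded pointwise limits. -/
theorem tendsto (hG : IsCenteredGaussian P X q) {χ : V} {F F' : ℕ → Ω → ℂ} {G G' : Ω → ℂ}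
    (hF : ∀ n, HasInterpolation P X q χ (F n) (F' n)) {B B' : ℝ} (hB : ∀ n ω, ‖F n ω‖ ≤ B)
    (hB' : ∀ n ω, ‖F' n ω‖ ≤ B') (hl : ∀ ω, Tendsto (fun n => F n ω) atTop (𝓝 (G ω)))
    (hl' : ∀ ω, Tendsto (fun n => F' n ω) atTop (𝓝 (G' ω))) :
    HasInterpolation P X q χ G G' := by
  have hP := hG.isProbabilityMeasure
  refine ⟨measurable_of_tendsto_metrizable (fun n => (hF n).measurable) (tendsto_pi_nhds.2 hl),
    measurable_of_tendsto_metrizable (fun n => (hF n).measurable_deriv) (tendsto_pi_nhds.2 hl'),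
    ⟨B, fun ω => le_of_tendsto (hl ω).norm (Eventually.of_forall fun n => hB n ω)⟩,
    ⟨B', fun ω => le_of_tendsto (hl' ω).norm (Eventually.of_forall fun n => hB' n ω)⟩,
    fun φ => ?_⟩
  have h1 : Tendsto (fun n => ∫ ω, (wick X q χ ω - 1) * F n ω * phase X φ ω ∂P) atTop
      (𝓝 (∫ ω, (wick X q χ ω - 1) * G ω * phase X φ ω ∂P)) := by
    refine tendsto_integral_of_dominated_convergence
      (fun _ => (Real.exp (q χ χ / 2) + 1) * B) (fun n => ?_) (integrable_const _)
      (fun n => Eventually.of_forall fun ω => ?_) (Eventually.of_forall fun ω => ?_)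
    · exact ((((hG.measurable_wick χ).sub_const 1).mul (hF n).measurable).mul
        (hG.measurable_phase φ)).aestronglyMeasurable
    · rw [norm_mul, norm_mul, norm_phase, mul_one]
      refine mul_le_mul ((norm_sub_le _ _).trans ?_) (hB n ω) (norm_nonneg _) (by positivity)
      rw [norm_wick, norm_one]
    · exact ((hl ω).const_mul _).mul_const _
  have h2 : Tendsto (fun n => Complex.I * ∫ p : unitInterval × Ω, wick X q ((p.1 : ℝ) • χ) p.2 *
      (F' n p.2 + Complex.I * (q χ φ : ℝ) * F n p.2) * phase X φ p.2 ∂(volume.prod P)) atTop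
      (𝓝 (Complex.I * ∫ p : unitInterval × Ω, wick X q ((p.1 : ℝ) • χ) p.2 *
      (G' p.2 + Complex.I * (q χ φ : ℝ) * G p.2) * phase X φ p.2 ∂(volume.prod P))) := by
    refine Tendsto.const_mul _ (tendsto_integral_of_dominated_convergence
      (fun _ => Real.exp (q χ χ / 2) * (B' + |q χ φ| * B)) (fun n => ?_) (integrable_const _)
      (fun n => Eventually.of_forall fun p => ?_) (Eventually.of_forall fun p => ?_))
    · exact (((measurable_wick_smul hG χ).mul
        (((hF n).measurable_deriv.comp measurable_snd).add
        (measurable_const.mul ((hF n).measurable.comp measurable_snd)))).mul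
        ((hG.measurable_phase φ).comp measurable_snd)).aestronglyMeasurable
    · rw [norm_mul, norm_mul, norm_phase, mul_one]
      refine mul_le_mul (norm_wick_smul_le hG χ _ _) ((norm_add_le _ _).trans
        (add_le_add (hB' _ _) ?_)) (norm_nonneg _) (by positivity)
      rw [norm_mul, norm_mul, Complex.norm_I, one_mul, Complex.norm_real, Real.norm_eq_abs]
      exact mul_le_mul_of_nonneg_left (hB _ _) (abs_nonneg _)
    · exact ((((hl' _).add ((hl _).const_mul _)).const_mul _).mul_const _)
  refine tendsto_nhds_unique h1 (h2.congr fun n => ?_)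
  exact ((hF n).interpolation φ).symm

end HasInterpolation
end Interpolation

/-! ### Exponentials of bounded functionals and the bilinear functionals of the Stein method. -/

section Stein

variable {V Ω : Type*} [AddCommGroup V] [Module ℝ V] [TopologicalSpace V] [MeasurableSpace Ω]
variable {P : Measure Ω} {X : Ω → V →L[ℝ] ℝ} {q : LinearMap.BilinForm ℝ V}

/-- The product rule `hS` gives powers of S by induction, hence the partial sums of the exponential
series. These and their derivatives are bounded uniformly by means of e^{|c| B}, so the formula
passes to the limit. -/
theorem HasInterpolation.exp_mul (hG : IsCenteredGaussian P X q) {χ : V} {S S' : Ω → ℂ}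
    (hS : ∀ F F', HasInterpolation P X q χ F F' →
      HasInterpolation P X q χ (fun ω => F ω * S ω) (fun ω => F' ω * S ω + F ω * S' ω))
    {B B' : ℝ} (hB : ∀ ω, ‖S ω‖ ≤ B) (hB' : ∀ ω, ‖S' ω‖ ≤ B') (c : ℂ) :
    HasInterpolation P X q χ (fun ω => Complex.exp (c * S ω))
      (fun ω => c * S' ω * Complex.exp (c * S ω)) := by
  have hP := hG.isProbabilityMeasure
  obtain ⟨ω₀⟩ : Nonempty Ω := P.nonempty_of_neZero
  have hB'0 : 0 ≤ B' := (norm_nonneg _).trans (hB' ω₀)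
  have hterm : ∀ k : ℕ, HasInterpolation P X q χ
      (fun ω => (c * S ω) ^ (k + 1) / ((k + 1).factorial : ℂ))
      (fun ω => c * S' ω * ((c * S ω) ^ k / (k.factorial : ℂ))) := by
    intro k
    induction k with
    | zero =>
      have h := (hS _ _ (hasInterpolation_one hG χ)).const_mul c
      simpa using h
    | succ k ih =>
      -- Multiplying (cS)^{k+1}/(k+1)! by cS/(k+2) produces the next term of the series. In the
      -- derivative, the k+1 equal contributions of the old factor and the one of the new factor add
      -- up to k+2.
      have h := (hS _ _ ih).const_mul (c / (k + 2))
      have h2 : (k : ℂ) + 2 ≠ 0 := by exact_mod_cast (by omega : k + 2 ≠ 0)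
      have h1 : (k : ℂ) + 1 ≠ 0 := by exact_mod_cast (by omega : k + 1 ≠ 0)
      have h3 : (k.factorial : ℂ) ≠ 0 := by exact_mod_cast k.factorial_ne_zero
      have h4 : (k : ℂ) + 1 + 1 ≠ 0 := by exact_mod_cast (by omega : k + 1 + 1 ≠ 0)
      convert h using 2 with ω ω
      · rw [Nat.factorial_succ (k + 1), Nat.factorial_succ k]
        push_cast
        field_simp
        ring
      · rw [Nat.factorial_succ k]
        push_cast
        field_simp
        ring
  have hsum : ∀ n : ℕ, HasInterpolation P X q χ
      (fun ω => ∑ k ∈ Finset.range (n + 1), (c * S ω) ^ k / (k.factorial : ℂ))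
      (fun ω => c * S' ω * ∑ k ∈ Finset.range n, (c * S ω) ^ k / (k.factorial : ℂ)) := by
    intro n
    induction n with
    | zero => simpa using hasInterpolation_one hG χ
    | succ n ih =>
      have h := HasInterpolation.add hG ih (hterm n)
      convert h using 2 with ω ω
      · rw [Finset.sum_range_succ]
      · rw [Finset.sum_range_succ, mul_add]
  have hlim : ∀ ω, Tendsto (fun n => ∑ k ∈ Finset.range n, (c * S ω) ^ k / (k.factorial : ℂ)) atTop
      (𝓝 (Complex.exp (c * S ω))) := by
    intro ω
    have h := (NormedSpace.expSeries_div_hasSum_exp (c * S ω)).tendsto_sum_nat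
    rwa [← Complex.exp_eq_exp_ℂ] at h
  have hbd : ∀ n ω, ‖∑ k ∈ Finset.range n, (c * S ω) ^ k / (k.factorial : ℂ)‖ ≤
      Real.exp (‖c‖ * B) := by
    intro n ω
    have h0 : ‖c * S ω‖ ≤ ‖c‖ * B := by
      rw [norm_mul]; exact mul_le_mul_of_nonneg_left (hB ω) (norm_nonneg _)
    calc ‖∑ k ∈ Finset.range n, (c * S ω) ^ k / (k.factorial : ℂ)‖
        ≤ ∑ k ∈ Finset.range n, ‖c * S ω‖ ^ k / (k.factorial : ℝ) := by
          refine (norm_sum_le _ _).trans (Finset.sum_le_sum fun k _ => ?_)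
          rw [norm_div, norm_pow, Complex.norm_natCast]
      _ ≤ Real.exp ‖c * S ω‖ := Real.sum_le_exp_of_nonneg (norm_nonneg _) n
      _ ≤ _ := Real.exp_le_exp.2 h0
  refine HasInterpolation.tendsto hG hsum (B := Real.exp (‖c‖ * B))
    (B' := ‖c‖ * B' * Real.exp (‖c‖ * B)) (fun n ω => hbd _ ω) (fun n ω => ?_)
    (fun ω => (hlim ω).comp (tendsto_add_atTop_nat 1)) (fun ω => (hlim ω).const_mul _)
  rw [norm_mul, norm_mul]
  exact mul_le_mul (mul_le_mul_of_nonneg_left (hB' ω) (norm_nonneg _)) (hbd n ω) (norm_nonneg _)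
    (by positivity)

variable {A : Type*} [MeasurableSpace A]

/-- Weight of the bilinear functional `pairFun`. -/
def pairWeight (q : LinearMap.BilinForm ℝ V) (β : ℝ) (f f' : A → ℂ) (Φ : A → V)
    (p : unitInterval × A × A) : ℂ :=
  (β ^ 2 * q (Φ p.2.1) (Φ p.2.2) * (Real.exp (((p.1 : ℝ) * β) ^ 2 * q (Φ p.2.1) (Φ p.2.1) / 2) *
    Real.exp (β ^ 2 * q (Φ p.2.2) (Φ p.2.2) / 2)) : ℝ) * (f p.2.1 * f' p.2.2)

/-- The test vector of the bilinear functional `pairFun`. -/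
def pairVec (β β' : ℝ) (Φ : A → V) (p : unitInterval × A × A) : V :=
  ((p.1 : ℝ) * β) • Φ p.2.1 + β' • Φ p.2.2

/-- The random variable `β² ∫ ds ∫∫ f(x) f'(y) q(x, y) :exp (i s β X(x)): :exp (i β' X(y)):`. -/
def pairFun (μ : Measure A) (X : Ω → V →L[ℝ] ℝ) (q : LinearMap.BilinForm ℝ V) (β β' : ℝ)
    (f f' : A → ℂ) (Φ : A → V) : Ω → ℂ :=
  phaseIntegral ((volume : Measure unitInterval).prod (μ.prod μ)) X (pairWeight q β f f' Φ)
    (pairVec β β' Φ)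

/-- The regularised chaos `∫ f(x) :exp (i β X(x)):`. -/
def chaosFun (μ : Measure A) (X : Ω → V →L[ℝ] ℝ) (q : LinearMap.BilinForm ℝ V) (β : ℝ)
    (f : A → ℂ) (Φ : A → V) : Ω → ℂ :=
  phaseIntegral μ X (fun a => (Real.exp (β ^ 2 * q (Φ a) (Φ a) / 2) : ℝ) * f a) (fun a => β • Φ a)

/-- Standing assumptions on a bounded measurable family of test vectors. -/
structure IsRegularFamily (X : Ω → V →L[ℝ] ℝ) (q : LinearMap.BilinForm ℝ V) (Φ : A → V)
    (M : ℝ) : Prop where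
  measurable : Measurable (fun p : A × Ω => X p.2 (Φ p.1))
  measurable_cov : Measurable (fun p : A × A => q (Φ p.1) (Φ p.2))
  bounded : ∀ a b, |q (Φ a) (Φ b)| ≤ M

namespace IsRegularFamily

variable {Φ : A → V} {M : ℝ} (hΦ : IsRegularFamily X q Φ M)
include hΦ

theorem measurable_smul (c : ℝ) : Measurable (fun p : A × Ω => X p.2 (c • Φ p.1)) := by
  simp only [map_smul, smul_eq_mul]
  exact hΦ.measurable.const_mul c

theorem measurable_pairVec (β β' : ℝ) :
    Measurable (fun p : (unitInterval × A × A) × Ω => X p.2 (pairVec β β' Φ p.1)) := by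
  simp only [pairVec, map_add, map_smul, smul_eq_mul]
  have h1 : Measurable (fun p : (unitInterval × A × A) × Ω => X p.2 (Φ p.1.2.1)) :=
    hΦ.measurable.comp ((measurable_fst.comp (measurable_snd.comp measurable_fst)).prodMk
      measurable_snd)
  have h2 : Measurable (fun p : (unitInterval × A × A) × Ω => X p.2 (Φ p.1.2.2)) :=
    hΦ.measurable.comp ((measurable_snd.comp (measurable_snd.comp measurable_fst)).prodMk
      measurable_snd)
  have h3 : Measurable (fun p : (unitInterval × A × A) × Ω => ((p.1.1 : ℝ))) :=
    measurable_subtype_coe.comp (measurable_fst.comp measurable_fst)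
  exact ((h3.mul_const β).mul h1).add (h2.const_mul β')

theorem measurable_diag : Measurable (fun a => q (Φ a) (Φ a)) :=
  hΦ.measurable_cov.comp (measurable_id.prodMk measurable_id)

theorem measurable_pairWeight {f f' : A → ℂ} (hf : Measurable f) (hf' : Measurable f') (β : ℝ) :
    Measurable (pairWeight q β f f' Φ) := by
  have h1 : Measurable (fun p : unitInterval × A × A => q (Φ p.2.1) (Φ p.2.2)) :=
    hΦ.measurable_cov.comp measurable_snd
  have h2 : Measurable (fun p : unitInterval × A × A => q (Φ p.2.1) (Φ p.2.1)) :=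
    hΦ.measurable_diag.comp (measurable_fst.comp measurable_snd)
  have h3 : Measurable (fun p : unitInterval × A × A => q (Φ p.2.2) (Φ p.2.2)) :=
    hΦ.measurable_diag.comp (measurable_snd.comp measurable_snd)
  have h4 : Measurable (fun p : unitInterval × A × A => (p.1 : ℝ)) :=
    measurable_subtype_coe.comp measurable_fst
  have h5 : Measurable (fun p : unitInterval × A × A => f p.2.1) :=
    hf.comp (measurable_fst.comp measurable_snd)
  have h6 : Measurable (fun p : unitInterval × A × A => f' p.2.2) :=
    hf'.comp (measurable_snd.comp measurable_snd)
  unfold pairWeight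
  refine Measurable.mul (Complex.measurable_ofReal.comp ?_) (h5.mul h6)
  exact ((measurable_const.mul h1)).mul
    ((Real.measurable_exp.comp ((((h4.mul_const β).pow_const 2).mul h2).div_const 2)).mul
    (Real.measurable_exp.comp ((h3.const_mul _).div_const 2)))

theorem norm_pairWeight_le {f f' : A → ℂ} {C : ℝ} (hf : ∀ a, ‖f a‖ ≤ C) (hf' : ∀ a, ‖f' a‖ ≤ C)
    (β : ℝ) (p : unitInterval × A × A) : ‖pairWeight q β f f' Φ p‖ ≤
      β ^ 2 * M * (Real.exp (β ^ 2 * M / 2) * Real.exp (β ^ 2 * M / 2)) * (C * C) := by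
  have hM : 0 ≤ M := (abs_nonneg _).trans (hΦ.bounded p.2.1 p.2.1)
  have hC : 0 ≤ C := (norm_nonneg _).trans (hf p.2.1)
  rw [pairWeight, norm_mul, norm_mul, Complex.norm_real, Real.norm_eq_abs, abs_mul, abs_mul,
    abs_mul, Real.abs_exp, Real.abs_exp, abs_of_nonneg (sq_nonneg β)]
  have hq : ∀ a, q (Φ a) (Φ a) ≤ M := fun a => (le_abs_self _).trans (hΦ.bounded a a)
  have hs : ((p.1 : ℝ) * β) ^ 2 ≤ β ^ 2 := by
    rw [mul_pow]
    exact mul_le_of_le_one_left (sq_nonneg β) (pow_le_one₀ p.1.2.1 p.1.2.2)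
  have h1 : ((p.1 : ℝ) * β) ^ 2 * q (Φ p.2.1) (Φ p.2.1) ≤ β ^ 2 * M :=
    (mul_le_mul_of_nonneg_left (hq _) (sq_nonneg _)).trans (mul_le_mul_of_nonneg_right hs hM)
  have h2 : β ^ 2 * q (Φ p.2.2) (Φ p.2.2) ≤ β ^ 2 * M :=
    mul_le_mul_of_nonneg_left (hq _) (sq_nonneg _)
  gcongr
  · exact hΦ.bounded _ _
  · exact hf _
  · exact hf' _

end IsRegularFamily

/-- Conjugation flips the charge, so that the real part of t̄ Z is a combination of two chaoses with
charges β and -β. -/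
theorem conj_chaosFun (μ : Measure A) (β : ℝ) (f : A → ℂ) (Φ : A → V) (ω : Ω) :
    (starRingEnd ℂ) (chaosFun μ X q β f Φ ω) =
      chaosFun μ X q (-β) (fun a => (starRingEnd ℂ) (f a)) Φ ω := by
  simp only [chaosFun, phaseIntegral, ← integral_conj, map_mul, conj_phase, Complex.conj_ofReal,
    neg_smul, neg_sq]

theorem wick_smul (c : ℝ) (φ : V) (ω : Ω) :
    wick X q (c • φ) ω = (Real.exp (c ^ 2 * q φ φ / 2) : ℝ) * phase X (c • φ) ω := by
  rw [wick, ← Complex.ofReal_exp]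
  congr 3
  simp only [map_smul, LinearMap.smul_apply, smul_eq_mul]
  ring_nf

end Stein

/-! ### Gaussian integration by parts for the regularised chaos. -/

section SteinIdentity

variable {V Ω : Type*} [AddCommGroup V] [Module ℝ V] [TopologicalSpace V] [MeasurableSpace Ω]
variable {P : Measure Ω} {X : Ω → V →L[ℝ] ℝ} {q : LinearMap.BilinForm ℝ V}
variable {A : Type*} [MeasurableSpace A] {μ : Measure A} [IsFiniteMeasure μ] {Φ : A → V} {M : ℝ}

/-- Weight of the regularised chaos as an integral of phases. -/
def chaosWeight (q : LinearMap.BilinForm ℝ V) (β : ℝ) (f : A → ℂ) (Φ : A → V) (a : A) : ℂ :=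
  (Real.exp (β ^ 2 * q (Φ a) (Φ a) / 2) : ℝ) * f a

theorem IsRegularFamily.measurable_chaosWeight (hΦ : IsRegularFamily X q Φ M) {f : A → ℂ}
    (hf : Measurable f) (β : ℝ) : Measurable (chaosWeight q β f Φ) :=
  (Complex.measurable_ofReal.comp
    (Real.measurable_exp.comp ((hΦ.measurable_diag.const_mul _).div_const 2))).mul hf

theorem IsRegularFamily.norm_chaosWeight_le (hΦ : IsRegularFamily X q Φ M) {f : A → ℂ} {C : ℝ}
    (hC : ∀ a, ‖f a‖ ≤ C) (β : ℝ) (a : A) :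
    ‖chaosWeight q β f Φ a‖ ≤ Real.exp (β ^ 2 * M / 2) * C := by
  rw [chaosWeight, norm_mul, Complex.norm_real, Real.norm_eq_abs, Real.abs_exp]
  have : q (Φ a) (Φ a) ≤ M := (le_abs_self _).trans (hΦ.bounded a a)
  gcongr
  exact hC a

/-- The derivative of the regularised chaos in the direction of the test vector `Φ x`. -/
def crossFun (μ : Measure A) (X : Ω → V →L[ℝ] ℝ) (q : LinearMap.BilinForm ℝ V) (β : ℝ)
    (f : A → ℂ) (Φ : A → V) (x : A) : Ω → ℂ :=
  phaseIntegral μ X (fun b => (q (Φ x) (Φ b) : ℝ) * chaosWeight q β f Φ b) (fun b => β • Φ b)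

theorem IsRegularFamily.measurable_chaosFun (hΦ : IsRegularFamily X q Φ M) {f : A → ℂ}
    (hf : Measurable f) (β : ℝ) : Measurable (chaosFun μ X q β f Φ) :=
  measurable_phaseIntegral (hΦ.measurable_smul β) (hΦ.measurable_chaosWeight hf β)

theorem IsRegularFamily.norm_chaosFun_le (hΦ : IsRegularFamily X q Φ M) {f : A → ℂ} {C : ℝ}
    (hC : ∀ a, ‖f a‖ ≤ C) (β : ℝ) (ω : Ω) : ‖chaosFun μ X q β f Φ ω‖ ≤
      Real.exp (β ^ 2 * M / 2) * C * μ.real univ :=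
  norm_phaseIntegral_le (hΦ.norm_chaosWeight_le hC β) ω

theorem IsRegularFamily.measurable_cov_left (hΦ : IsRegularFamily X q Φ M) (x : A) :
    Measurable (fun b => q (Φ x) (Φ b)) :=
  hΦ.measurable_cov.comp (measurable_const.prodMk measurable_id)

theorem IsRegularFamily.norm_crossFun_le (hΦ : IsRegularFamily X q Φ M) {f : A → ℂ} {C : ℝ}
    (hC : ∀ a, ‖f a‖ ≤ C) (β : ℝ) (x : A) (ω : Ω) : ‖crossFun μ X q β f Φ x ω‖ ≤
      M * (Real.exp (β ^ 2 * M / 2) * C) * μ.real univ := by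
  refine norm_phaseIntegral_le (fun b => ?_) ω
  rw [norm_mul, Complex.norm_real, Real.norm_eq_abs]
  exact mul_le_mul (hΦ.bounded _ _) (hΦ.norm_chaosWeight_le hC β b) (norm_nonneg _)
    ((abs_nonneg _).trans (hΦ.bounded x x))

/-- Leibniz rule for a chaos of charge β' in the direction β Φ x: each phase contributes i β β' q(Φ
x, Φ b), and these contributions are gathered in `crossFun`. -/
theorem HasInterpolation.mul_chaosFun (hG : IsCenteredGaussian P X q)
    (hΦ : IsRegularFamily X q Φ M) {f : A → ℂ} (hf : Measurable f) {C : ℝ} (hC : ∀ a, ‖f a‖ ≤ C)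
    (β β' : ℝ) (x : A) {F F' : Ω → ℂ} (hF : HasInterpolation P X q (β • Φ x) F F') :
    HasInterpolation P X q (β • Φ x) (fun ω => F ω * chaosFun μ X q β' f Φ ω)
      (fun ω => F' ω * chaosFun μ X q β' f Φ ω +
        F ω * (Complex.I * (β * β' : ℝ) * crossFun μ X q β' f Φ x ω)) := by
  have h := hF.mul_phaseIntegral hG (μ := μ) (hΦ.measurable_smul β')
    (hΦ.measurable_chaosWeight hf β') (hΦ.norm_chaosWeight_le hC β')
    (show Measurable (fun a => q (β • Φ x) (β' • Φ a)) by
      simp only [map_smul, LinearMap.smul_apply, smul_eq_mul]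
      exact ((hΦ.measurable_cov_left x).const_mul β).const_mul β')
    (M := |β'| * (|β| * M))
    (by
      intro a
      simp only [map_smul, LinearMap.smul_apply, smul_eq_mul, abs_mul]
      exact mul_le_mul_of_nonneg_left
        (mul_le_mul_of_nonneg_left (hΦ.bounded _ _) (abs_nonneg _)) (abs_nonneg _))
  have e : ∀ ω, Complex.I * (β * β' : ℝ) * crossFun μ X q β' f Φ x ω =
      phaseIntegral μ X (fun a => Complex.I * (q (β • Φ x) (β' • Φ a) : ℝ) *
        chaosWeight q β' f Φ a) (fun a => β' • Φ a) ω := by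
    intro ω
    rw [crossFun, phaseIntegral, phaseIntegral, ← integral_const_mul]
    congr 1
    ext a
    simp only [map_smul, LinearMap.smul_apply, smul_eq_mul]
    push_cast
    ring
  simp only [e]
  exact h

/-- The right-hand side is the term delivered by the interpolation formula after integrating over x.
Fubini reassembles it into the bilinear functional. The hypothesis β'² = β² enters because the Wick
factor of the second point is written with β on one side and with β' on the other. -/
theorem integral_mul_pairFun (hG : IsCenteredGaussian P X q) (hΦ : IsRegularFamily X q Φ M)
    {f f' : A → ℂ} (hf : Measurable f) (hf' : Measurable f') {C : ℝ} (hC : ∀ a, ‖f a‖ ≤ C)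
    (hC' : ∀ a, ‖f' a‖ ≤ C) (β β' : ℝ) (hβ : β' ^ 2 = β ^ 2) {F : Ω → ℂ} (hF : Measurable F) {B : ℝ}
    (hB : ∀ ω, ‖F ω‖ ≤ B) :
    ∫ ω, pairFun μ X q β β' f f' Φ ω * F ω ∂P = ∫ x, f x * ∫ p : unitInterval × Ω,
      wick X q ((p.1 : ℝ) • β • Φ x) p.2 *
        ((β ^ 2 : ℝ) * crossFun μ X q β' f' Φ x p.2 * F p.2) ∂(volume.prod P) ∂μ := by
  have hP := hG.isProbabilityMeasure
  set K := β ^ 2 * M * (Real.exp (β ^ 2 * M / 2) * Real.exp (β ^ 2 * M / 2)) * (C * C) with hK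
  have hwt := hΦ.measurable_pairWeight hf hf' β
  have hph := measurable_phase_of (hΦ.measurable_pairVec β β')
  obtain ⟨R, hR⟩ : ∃ R : (unitInterval × A × A) → Ω → ℂ, R = fun p ω =>
    pairWeight q β f f' Φ p * phase X (pairVec β β' Φ p) ω * F ω := ⟨_, rfl⟩
  have hRm : Measurable (Function.uncurry R) := by
    rw [hR]
    exact ((hwt.comp measurable_fst).mul hph).mul (hF.comp measurable_snd)
  have hRb : ∀ p ω, ‖R p ω‖ ≤ K * B := fun p ω => by
    have h1 := hΦ.norm_pairWeight_le hC hC' β p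
    simp only [hR, norm_mul, norm_phase, mul_one]
    exact mul_le_mul h1 (hB ω) (norm_nonneg _) ((norm_nonneg _).trans h1)
  obtain ⟨G, hGdef⟩ : ∃ G : unitInterval × A × A → ℂ, G = fun p => ∫ ω, R p ω ∂P := ⟨_, rfl⟩
  have hGm : Measurable G := by
    rw [hGdef]
    exact (hRm.stronglyMeasurable.integral_prod_right').measurable
  have hGb : ∀ p, ‖G p‖ ≤ K * B := fun p => by
    have h := norm_integral_le_of_norm_le_const (μ := P) (Eventually.of_forall (hRb p))
    simpa [hGdef] using h
  have h1 : ∫ ω, pairFun μ X q β β' f f' Φ ω * F ω ∂P =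
      ∫ s : unitInterval, ∫ x, ∫ b, G (s, x, b) ∂μ ∂μ := by
    have e1 : ∀ ω, pairFun μ X q β β' f f' Φ ω * F ω =
        ∫ p, R p ω ∂((volume : Measure unitInterval).prod (μ.prod μ)) := fun ω => by
      rw [pairFun, phaseIntegral, ← integral_mul_const, hR]
    simp only [e1]
    rw [integral_integral_swap (f := fun ω p => R p ω)
      (integrable_of_norm_le (hRm.comp measurable_swap).aestronglyMeasurable
        (C := K * B) fun p => hRb _ _)]
    simp only [← congrFun hGdef _]
    rw [integral_prod _ (integrable_of_norm_le hGm.aestronglyMeasurable hGb)]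
    congr 1
    ext s
    exact integral_prod _ (integrable_of_norm_le
      (hGm.comp (measurable_const.prodMk measurable_id)).aestronglyMeasurable fun p => hGb _)
  rw [h1]
  have e2 : ∀ (s : unitInterval) x ω, f x * (wick X q ((s : ℝ) • β • Φ x) ω *
        ((β ^ 2 : ℝ) * crossFun μ X q β' f' Φ x ω * F ω)) = ∫ b, R (s, x, b) ω ∂μ := by
    intro s x ω
    rw [smul_smul, wick_smul, crossFun, phaseIntegral, ← integral_const_mul,
      ← integral_mul_const, ← integral_const_mul, ← integral_const_mul]
    congr 1
    ext b
    simp only [hR, pairWeight, chaosWeight, pairVec, phase_add, hβ]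
    push_cast
    ring
  have h2 : ∀ x, f x * ∫ p : unitInterval × Ω, wick X q ((p.1 : ℝ) • β • Φ x) p.2 *
        ((β ^ 2 : ℝ) * crossFun μ X q β' f' Φ x p.2 * F p.2) ∂(volume.prod P) =
      ∫ s : unitInterval, ∫ b, G (s, x, b) ∂μ := by
    intro x
    rw [← integral_const_mul]
    simp only [e2]
    have hT : Measurable (fun p : (unitInterval × Ω) × A => ((p.1.1, x, p.2), p.1.2)) := by
      fun_prop
    have hm : Measurable (fun p : (unitInterval × Ω) × A => R (p.1.1, x, p.2) p.1.2) := hRm.comp hT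
    have hm' : Measurable (fun p : unitInterval × Ω => ∫ b, R (p.1, x, b) p.2 ∂μ) :=
      (hm.stronglyMeasurable.integral_prod_right').measurable
    have hi : Integrable (fun p : unitInterval × Ω => ∫ b, R (p.1, x, b) p.2 ∂μ)
        ((volume : Measure unitInterval).prod P) :=
      integrable_of_norm_le hm'.aestronglyMeasurable (C := K * B * μ.real univ) fun p =>
        norm_integral_le_of_norm_le_const (Eventually.of_forall fun b => hRb _ _)
    rw [integral_prod _ hi]
    congr 1
    ext s
    simp only [hGdef]
    refine integral_integral_swap (f := fun ω b => R (s, x, b) ω)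
      (integrable_of_norm_le (C := K * B) ?_ fun p => hRb _ _)
    have hT' : Measurable (fun p : Ω × A => ((s, x, p.2), p.1)) := by fun_prop
    exact (hRm.comp hT').aestronglyMeasurable
  simp only [h2]
  refine integral_integral_swap (μ := (volume : Measure unitInterval)) (ν := μ)
    (f := fun s x => ∫ b, G (s, x, b) ∂μ)
    (integrable_of_norm_le (C := K * B * μ.real univ) ?_ fun p =>
        norm_integral_le_of_norm_le_const (Eventually.of_forall fun b => hGb _))
  have hT : Measurable (fun p : (unitInterval × A) × A => (p.1.1, p.1.2, p.2)) := by fun_prop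
  have hm : Measurable (fun p : (unitInterval × A) × A => G (p.1.1, p.1.2, p.2)) := hGm.comp hT
  exact (hm.stronglyMeasurable.integral_prod_right').aestronglyMeasurable

theorem IsRegularFamily.measurable_crossFun (hΦ : IsRegularFamily X q Φ M) {f : A → ℂ}
    (hf : Measurable f) (β : ℝ) :
    Measurable (fun p : A × Ω => crossFun μ X q β f Φ p.1 p.2) := by
  have hT1 : Measurable (fun p : (A × Ω) × A => (p.1.1, p.2)) := by fun_prop
  have hT2 : Measurable (fun p : (A × Ω) × A => (p.2, p.1.2)) := by fun_prop
  have h1 := Complex.measurable_ofReal.comp (hΦ.measurable_cov.comp hT1)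
  have h2 := (hΦ.measurable_chaosWeight hf β).comp
    (measurable_snd : Measurable (Prod.snd : (A × Ω) × A → A))
  have h3 := (measurable_phase_of (Φ := fun x => β • Φ x) (hΦ.measurable_smul β)).comp hT2
  exact (((h1.mul h2).mul h3).stronglyMeasurable.integral_prod_right').measurable

theorem IsRegularFamily.measurable_crossFun_comp (hΦ : IsRegularFamily X q Φ M) {f : A → ℂ}
    (hf : Measurable f) (β : ℝ) {T : Type*} [MeasurableSpace T] {u : T → A} {v : T → Ω}
    (hu : Measurable u) (hv : Measurable v) :
    Measurable (fun p => crossFun μ X q β f Φ (u p) (v p)) := by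
  have h := hΦ.measurable_crossFun (μ := μ) hf β
  generalize crossFun μ X q β f Φ = D at h ⊢
  exact h.comp (hu.prodMk hv)

theorem IsRegularFamily.measurable_wick_smul_smul (hΦ : IsRegularFamily X q Φ M) (β : ℝ) :
    Measurable (fun p : A × (unitInterval × Ω) =>
        wick X q ((p.2.1 : ℝ) • β • Φ p.1) p.2.2) := by
  have hs : Measurable (fun p : A × (unitInterval × Ω) => ((p.2.1 : ℝ))) :=
    measurable_subtype_coe.comp (measurable_fst.comp measurable_snd)
  have hT : Measurable (fun p : A × (unitInterval × Ω) => (p.1, p.2.2)) := by fun_prop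
  have hX1 : Measurable (fun p : A × (unitInterval × Ω) => X p.2.2 (Φ p.1)) :=
    hΦ.measurable.comp hT
  have hd := hΦ.measurable_diag.comp
    (measurable_fst : Measurable (Prod.fst : A × (unitInterval × Ω) → A))
  simp only [Function.comp_def] at hd
  simp only [wick, phase, map_smul, LinearMap.smul_apply, smul_eq_mul]
  exact (Complex.measurable_exp.comp (Complex.measurable_ofReal.comp
    ((hs.mul ((hs.mul (hd.const_mul β)).const_mul β)).div_const 2))).mul
    (Complex.measurable_exp.comp (measurable_const.mul
      (Complex.measurable_ofReal.comp (hs.mul (hX1.const_mul β)))))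

theorem integral_sub_const_mul_sub {u v w : A → ℂ} (hu : Integrable u μ) (hv : Integrable v μ)
    (hw : Integrable w μ) (c a₁ a₂ : ℂ) :
    ∫ x, (u x - c * (a₁ * v x - a₂ * w x)) ∂μ =
      ∫ x, u x ∂μ - c * (a₁ * ∫ x, v x ∂μ - a₂ * ∫ x, w x ∂μ) := by
  have h1 : Integrable (fun x => a₁ * v x - a₂ * w x) μ :=
    (hv.const_mul a₁).sub (hw.const_mul a₂)
  rw [integral_sub hu (h1.const_mul c), integral_const_mul, integral_sub (hv.const_mul a₁) (hw.const_mul a₂), integral_const_mul,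
    integral_const_mul]

theorem IsRegularFamily.norm_wick_le (hΦ : IsRegularFamily X q Φ M) (β : ℝ) (x : A) (ω : Ω) :
    ‖wick X q (β • Φ x) ω‖ ≤ Real.exp (β ^ 2 * M / 2) := by
  rw [norm_wick, Real.exp_le_exp]
  have h := (le_abs_self _).trans (hΦ.bounded x x)
  simp only [map_smul, LinearMap.smul_apply, smul_eq_mul]
  have : β ^ 2 * q (Φ x) (Φ x) ≤ β ^ 2 * M := mul_le_mul_of_nonneg_left h (sq_nonneg _)
  linarith [this, show β * (β * q (Φ x) (Φ x)) = β ^ 2 * q (Φ x) (Φ x) by ring]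

theorem IsRegularFamily.norm_wick_mul_crossFun_le (hG : IsCenteredGaussian P X q)
    (hΦ : IsRegularFamily X q Φ M) {f : A → ℂ} {C : ℝ} (hC : ∀ a, ‖f a‖ ≤ C) (β β' : ℝ)
    {F : Ω → ℂ} {B : ℝ} (hB : ∀ ω, ‖F ω‖ ≤ B) (x : A) (p : unitInterval × Ω) :
    ‖wick X q ((p.1 : ℝ) • β • Φ x) p.2 *
      ((β ^ 2 : ℝ) * crossFun μ X q β' f Φ x p.2 * F p.2)‖ ≤ Real.exp (β ^ 2 * M / 2) *
        (β ^ 2 * (M * (Real.exp (β' ^ 2 * M / 2) * C) * μ.real univ) * B) := by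
  have hbc := hΦ.norm_crossFun_le (μ := μ) hC β' x p.2
  have hw : ‖wick X q ((p.1 : ℝ) • β • Φ x) p.2‖ ≤ Real.exp (β ^ 2 * M / 2) := by
    refine (norm_wick_smul_le hG _ _ p.2).trans ?_
    rw [← norm_wick (X := X) (q := q) (β • Φ x) p.2]
    exact hΦ.norm_wick_le β x p.2
  have h1 : ‖((β ^ 2 : ℝ) : ℂ) * crossFun μ X q β' f Φ x p.2‖ ≤
      β ^ 2 * (M * (Real.exp (β' ^ 2 * M / 2) * C) * μ.real univ) := by
    rw [norm_mul, Complex.norm_real, Real.norm_eq_abs, abs_of_nonneg (sq_nonneg β)]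
    exact mul_le_mul_of_nonneg_left hbc (sq_nonneg _)
  rw [norm_mul, norm_mul]
  exact mul_le_mul hw (mul_le_mul h1 (hB _) (norm_nonneg _) ((norm_nonneg _).trans h1))
    (mul_nonneg (norm_nonneg _) (norm_nonneg _)) (Real.exp_pos _).le

theorem IsRegularFamily.integrable_wick_mul_crossFun (hG : IsCenteredGaussian P X q)
    (hΦ : IsRegularFamily X q Φ M)
    {f f' : A → ℂ} (hf : Measurable f) (hf' : Measurable f') {C : ℝ} (hC : ∀ a, ‖f a‖ ≤ C)
    (hC' : ∀ a, ‖f' a‖ ≤ C) (β β' : ℝ) {F : Ω → ℂ} (hF : Measurable F) {B : ℝ}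
    (hB : ∀ ω, ‖F ω‖ ≤ B) :
    Integrable (fun x => f x * ∫ p : unitInterval × Ω, wick X q ((p.1 : ℝ) • β • Φ x) p.2 *
      ((β ^ 2 : ℝ) * crossFun μ X q β' f' Φ x p.2 * F p.2) ∂(volume.prod P)) μ := by
  have hP := hG.isProbabilityMeasure
  have hT2 : Measurable (fun p : A × (unitInterval × Ω) => p.2.2) := by fun_prop
  have hm1 : Measurable (fun p : A × (unitInterval × Ω) =>
      crossFun μ X q β' f' Φ p.1 p.2.2) :=
    hΦ.measurable_crossFun_comp hf' β' measurable_fst hT2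
  have hm2 := hΦ.measurable_wick_smul_smul β
  have h4 : Measurable (fun p : A × (unitInterval × Ω) =>
      wick X q ((p.2.1 : ℝ) • β • Φ p.1) p.2.2 *
        ((β ^ 2 : ℝ) * crossFun μ X q β' f' Φ p.1 p.2.2 * F p.2.2)) := by
    have h5 := hF.comp hT2
    simp only [Function.comp_def] at h5
    exact hm2.mul ((hm1.const_mul _).mul h5)
  have hbd := fun x => hΦ.norm_wick_mul_crossFun_le hG (μ := μ) hC' β β' hB x
  generalize Real.exp (β ^ 2 * M / 2) *
    (β ^ 2 * (M * (Real.exp (β' ^ 2 * M / 2) * C) * μ.real univ) * B) = K at hbd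
  obtain ⟨R, hR⟩ : ∃ R : A × (unitInterval × Ω) → ℂ, R = fun p =>
      wick X q ((p.2.1 : ℝ) • β • Φ p.1) p.2.2 *
        ((β ^ 2 : ℝ) * crossFun μ X q β' f' Φ p.1 p.2.2 * F p.2.2) := ⟨_, rfl⟩
  have hRb : ∀ x p, ‖R (x, p)‖ ≤ K := fun x p => by
    rw [hR]
    exact hbd x p
  rw [← hR] at h4
  have hm3 : Measurable (fun x => ∫ p : unitInterval × Ω, R (x, p) ∂(volume.prod P)) :=
    (h4.stronglyMeasurable.integral_prod_right').measurable
  have hfin : Integrable (fun x => f x * ∫ p : unitInterval × Ω, R (x, p) ∂(volume.prod P)) μ := by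
    refine integrable_of_norm_le (hf.mul hm3).aestronglyMeasurable (C := C * K) fun x => ?_
    have hb := norm_integral_le_of_norm_le_const (μ := (volume : Measure unitInterval).prod P)
      (Eventually.of_forall (hRb x))
    rw [probReal_univ, mul_one] at hb
    rw [norm_mul]
    exact mul_le_mul (hC x) hb (norm_nonneg _) ((norm_nonneg _).trans (hC x))
  rw [hR] at hfin
  exact hfin

set_option maxHeartbeats 1000000 in
/-- Gaussian integration by parts for the regularised chaos. -/
theorem integral_chaosFun_mul_exp (hG : IsCenteredGaussian P X q) (hΦ : IsRegularFamily X q Φ M)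
    {f f₂ : A → ℂ} (hf : Measurable f) (hf₂ : Measurable f₂) {C : ℝ} (hC : ∀ a, ‖f a‖ ≤ C)
    (hC₂ : ∀ a, ‖f₂ a‖ ≤ C) (β : ℝ) (a₁ a₂ c : ℂ) {F : Ω → ℂ}
    (hF : F = fun ω => Complex.exp (c * (a₁ * chaosFun μ X q β f Φ ω +
      a₂ * chaosFun μ X q (-β) f₂ Φ ω))) :
    ∫ ω, chaosFun μ X q β f Φ ω * F ω ∂P = (∫ x, f x ∂μ) * ∫ ω, F ω ∂P -
      c * (a₁ * ∫ ω, pairFun μ X q β β f f Φ ω * F ω ∂P -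
        a₂ * ∫ ω, pairFun μ X q β (-β) f f₂ Φ ω * F ω ∂P) := by
  have hP := hG.isProbabilityMeasure
  obtain ⟨ω₀⟩ : Nonempty Ω := P.nonempty_of_neZero
  set Z₁ := chaosFun μ X q β f Φ with hZ₁
  set Z₂ := chaosFun μ X q (-β) f₂ Φ with hZ₂
  set D₁ : A → Ω → ℂ := crossFun μ X q β f Φ with hD₁
  set D₂ : A → Ω → ℂ := crossFun μ X q (-β) f₂ Φ with hD₂
  have bZ₁ := hΦ.norm_chaosFun_le (μ := μ) hC β
  have bZ₂ := hΦ.norm_chaosFun_le (μ := μ) hC₂ (-β)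
  have bD₁ := fun x => hΦ.norm_crossFun_le (μ := μ) hC β x
  have bD₂ := fun x => hΦ.norm_crossFun_le (μ := μ) hC₂ (-β) x
  -- The exponent is a combination of chaoses of charges β and -β, so its derivative in the
  -- direction β Φ x has the coefficients i β² and -i β².
  have hint : ∀ x, HasInterpolation P X q (β • Φ x) F
      (fun ω => c * (a₁ * (Complex.I * (β * β : ℝ) * D₁ x ω) +
        a₂ * (Complex.I * (β * (-β) : ℝ) * D₂ x ω)) * F ω) := by
    intro x
    rw [hF]
    refine HasInterpolation.exp_mul hG (fun F F' h => ?_)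
      (B := ‖a₁‖ * (Real.exp (β ^ 2 * M / 2) * C * μ.real univ) +
        ‖a₂‖ * (Real.exp ((-β) ^ 2 * M / 2) * C * μ.real univ))
      (B' := ‖a₁‖ * (|β * β| * (M * (Real.exp (β ^ 2 * M / 2) * C) * μ.real univ)) +
        ‖a₂‖ * (|β * (-β)| * (M * (Real.exp ((-β) ^ 2 * M / 2) * C) * μ.real univ))) ?_ ?_ c
    · have h1 := (h.mul_chaosFun hG (μ := μ) hΦ hf hC β β x).const_mul a₁
      have h2 := (h.mul_chaosFun hG (μ := μ) hΦ hf₂ hC₂ β (-β) x).const_mul a₂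
      have h3 := HasInterpolation.add hG h1 h2
      convert h3 using 2 with ω ω
      · ring
      · ring
    · intro ω
      refine (norm_add_le _ _).trans (add_le_add ?_ ?_)
      · rw [norm_mul]; exact mul_le_mul_of_nonneg_left (bZ₁ ω) (norm_nonneg _)
      · rw [norm_mul]; exact mul_le_mul_of_nonneg_left (bZ₂ ω) (norm_nonneg _)
    · intro ω
      refine (norm_add_le _ _).trans (add_le_add ?_ ?_)
      · rw [norm_mul, norm_mul, norm_mul, Complex.norm_I, one_mul, Complex.norm_real,
          Real.norm_eq_abs]
        exact mul_le_mul_of_nonneg_left (mul_le_mul_of_nonneg_left (bD₁ x ω) (abs_nonneg _))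
          (norm_nonneg _)
      · rw [norm_mul, norm_mul, norm_mul, Complex.norm_I, one_mul, Complex.norm_real,
          Real.norm_eq_abs]
        exact mul_le_mul_of_nonneg_left (mul_le_mul_of_nonneg_left (bD₂ x ω) (abs_nonneg _))
          (norm_nonneg _)
  -- Measurability and boundedness of F are read off from the interpolation formula at one point x₀.
  -- When there is no point, μ is zero and both sides vanish.
  by_cases hne : Nonempty A
  swap
  · rw [not_nonempty_iff] at hne
    have : μ = 0 := Measure.eq_zero_of_isEmpty μ
    simp [hZ₁, chaosFun, pairFun, phaseIntegral, this]
  obtain ⟨x₀⟩ := hne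
  have hFm : Measurable F := (hint x₀).measurable
  obtain ⟨B, hB⟩ := (hint x₀).bounded
  have hFi : Integrable F P := integrable_of_norm_le hFm.aestronglyMeasurable hB
  have hwx : Measurable (fun p : A × Ω => wick X q (β • Φ p.1) p.2) := by
    simp only [wick_smul]
    exact (Complex.measurable_ofReal.comp (Real.measurable_exp.comp
      (((hΦ.measurable_diag.comp measurable_fst).const_mul _).div_const 2))).mul
      (measurable_phase_of (Φ := fun x => β • Φ x) (hΦ.measurable_smul β))
  have bw := fun x ω => hΦ.norm_wick_le β x ω
  have hx : ∀ x, f x * ∫ ω, wick X q (β • Φ x) ω * F ω ∂P = f x * ∫ ω, F ω ∂P -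
      c * (a₁ * (f x * ∫ p : unitInterval × Ω, wick X q ((p.1 : ℝ) • β • Φ x) p.2 *
          ((β ^ 2 : ℝ) * D₁ x p.2 * F p.2) ∂(volume.prod P)) -
        a₂ * (f x * ∫ p : unitInterval × Ω, wick X q ((p.1 : ℝ) • β • Φ x) p.2 *
          ((β ^ 2 : ℝ) * D₂ x p.2 * F p.2) ∂(volume.prod P))) := by
    intro x
    -- The trivial test phase suffices here. Other test phases were needed only to establish the
    -- product rule.
    have h := (hint x).interpolation 0
    have h1 : ∫ ω, (wick X q (β • Φ x) ω - 1) * F ω * phase X 0 ω ∂P =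
        ∫ ω, wick X q (β • Φ x) ω * F ω ∂P - ∫ ω, F ω ∂P := by
      simp only [phase_zero, mul_one, sub_mul, one_mul]
      refine integral_sub (integrable_of_norm_le
        ((hG.measurable_wick _).mul hFm).aestronglyMeasurable
        (C := Real.exp (β ^ 2 * M / 2) * B) fun ω => ?_) hFi
      rw [norm_mul]
      exact mul_le_mul (bw x ω) (hB ω) (norm_nonneg _) (Real.exp_pos _).le
    have hDi : ∀ (β' : ℝ) (f' : A → ℂ), Measurable f' → (∀ a, ‖f' a‖ ≤ C) →
        Integrable (fun p : unitInterval × Ω => wick X q ((p.1 : ℝ) • β • Φ x) p.2 *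
          ((β ^ 2 : ℝ) * crossFun μ X q β' f' Φ x p.2 * F p.2)) (volume.prod P) := by
      intro β' f' hf' hC'
      have hm : Measurable (crossFun μ X q β' f' Φ x) :=
        measurable_phaseIntegral (hΦ.measurable_smul β')
          ((Complex.measurable_ofReal.comp (hΦ.measurable_cov_left x)).mul
            (hΦ.measurable_chaosWeight hf' β'))
      refine integrable_of_norm_le (((measurable_wick_smul hG _).mul
        ((measurable_const.mul (hm.comp measurable_snd)).mul
        (hFm.comp measurable_snd))).aestronglyMeasurable)
        (hΦ.norm_wick_mul_crossFun_le hG hC' β β' hB x)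
    have h2 : ∫ p : unitInterval × Ω, wick X q ((p.1 : ℝ) • β • Φ x) p.2 *
        (c * (a₁ * (Complex.I * (β * β : ℝ) * D₁ x p.2) +
        a₂ * (Complex.I * (β * (-β) : ℝ) * D₂ x p.2)) * F p.2 +
          Complex.I * (q (β • Φ x) 0 : ℝ) * F p.2) * phase X 0 p.2 ∂(volume.prod P) =
        c * a₁ * Complex.I * (∫ p : unitInterval × Ω, wick X q ((p.1 : ℝ) • β • Φ x) p.2 *
          ((β ^ 2 : ℝ) * D₁ x p.2 * F p.2) ∂(volume.prod P)) -
        c * a₂ * Complex.I * (∫ p : unitInterval × Ω, wick X q ((p.1 : ℝ) • β • Φ x) p.2 *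
          ((β ^ 2 : ℝ) * D₂ x p.2 * F p.2) ∂(volume.prod P)) := by
      rw [← integral_const_mul, ← integral_const_mul,
        ← integral_sub ((hDi β f hf hC).const_mul _) ((hDi (-β) f₂ hf₂ hC₂).const_mul _)]
      congr 1
      ext p
      simp only [phase_zero, map_zero]
      push_cast
      ring
    rw [h1, h2] at h
    linear_combination f x * h + f x * (c * a₁ * (∫ p : unitInterval × Ω,
      wick X q ((p.1 : ℝ) • β • Φ x) p.2 * ((β ^ 2 : ℝ) * D₁ x p.2 * F p.2) ∂(volume.prod P)) -
        c * a₂ * (∫ p : unitInterval × Ω, wick X q ((p.1 : ℝ) • β • Φ x) p.2 *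
          ((β ^ 2 : ℝ) * D₂ x p.2 * F p.2) ∂(volume.prod P))) * Complex.I_sq
  have hL : ∫ ω, Z₁ ω * F ω ∂P = ∫ x, f x * ∫ ω, wick X q (β • Φ x) ω * F ω ∂P ∂μ := by
    have e1 : ∀ ω, Z₁ ω * F ω = ∫ x, f x * (wick X q (β • Φ x) ω * F ω) ∂μ := fun ω => by
      rw [hZ₁, chaosFun, phaseIntegral, ← integral_mul_const]
      congr 1
      ext x
      rw [wick_smul]
      ring
    simp only [e1]
    rw [integral_integral_swap]
    · simp only [integral_const_mul]
    · refine integrable_of_norm_le (((hf.comp measurable_snd).mul ((hwx.comp measurable_swap).mul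
        (hFm.comp measurable_fst))).aestronglyMeasurable)
        (C := C * (Real.exp (β ^ 2 * M / 2) * B)) fun p => ?_
      simp only [Function.uncurry, norm_mul]
      exact mul_le_mul (hC _) (mul_le_mul (bw _ _) (hB _) (norm_nonneg _) (Real.exp_pos _).le)
        (by positivity) ((norm_nonneg _).trans (hC x₀))
  have hfi : Integrable f μ := integrable_of_norm_le hf.aestronglyMeasurable hC
  have hIx := fun (β' : ℝ) (f' : A → ℂ) (hf' : Measurable f') (hC' : ∀ a, ‖f' a‖ ≤ C) =>
    hΦ.integrable_wick_mul_crossFun hG hf hf' hC hC' β β' (μ := μ) hFm hB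
  have i1 := hIx β f hf hC
  have i2 := hIx (-β) f₂ hf₂ hC₂
  rw [integral_mul_pairFun hG hΦ hf hf hC hC β β rfl hFm hB,
    integral_mul_pairFun hG hΦ hf hf₂ hC hC₂ β (-β) (neg_sq β) hFm hB, hL]
  simp only [hx]
  refine (integral_sub_const_mul_sub (hfi.mul_const _) i1 i2 c a₁ a₂).trans ?_
  rw [integral_mul_const]

end SteinIdentity

/-! ### The Malliavin–Stein bound for the characteristic function. -/

section SteinBound

variable {V Ω : Type*} [AddCommGroup V] [Module ℝ V] [TopologicalSpace V] [MeasurableSpace Ω]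
variable {P : Measure Ω} {X : Ω → V →L[ℝ] ℝ} {q : LinearMap.BilinForm ℝ V}
variable {A : Type*} [MeasurableSpace A] {μ : Measure A} [IsFiniteMeasure μ] {Φ : A → V} {M : ℝ}

theorem norm_integral_mul_le_of_norm_le_one [IsFiniteMeasure P] {T F : Ω → ℂ} (hT : Integrable T P)
    (hF : ∀ ω, ‖F ω‖ ≤ 1) : ‖∫ ω, T ω * F ω ∂P‖ ≤ ∫ ω, ‖T ω‖ ∂P := by
  refine norm_integral_le_of_norm_le hT.norm (Eventually.of_forall fun ω => ?_)
  rw [norm_mul]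
  exact mul_le_of_le_one_right (norm_nonneg _) (hF ω)

theorem hasDerivAt_charFun_real [IsFiniteMeasure P] {S : Ω → ℝ} (hS : Measurable S) {B : ℝ}
    (hB : ∀ ω, |S ω| ≤ B) (r : ℝ) :
    HasDerivAt (fun r : ℝ => ∫ ω, Complex.exp ((Complex.I * r) * S ω) ∂P)
      (∫ ω, Complex.I * (S ω * Complex.exp ((Complex.I * r) * S ω)) ∂P) r := by
  have hnorm : ∀ (r : ℝ) ω, ‖Complex.exp ((Complex.I * r) * S ω)‖ = 1 := by
    intro r ω
    rw [show (Complex.I * r) * S ω = ((r * S ω : ℝ) : ℂ) * Complex.I by push_cast; ring,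
      Complex.norm_exp_ofReal_mul_I]
  have hm : ∀ r : ℝ, Measurable (fun ω => Complex.exp ((Complex.I * r) * S ω)) := fun r =>
    Complex.measurable_exp.comp ((Complex.measurable_ofReal.comp hS).const_mul _)
  refine (hasDerivAt_integral_of_dominated_loc_of_deriv_le (μ := P) (𝕜 := ℝ) (x₀ := r) (s := univ)
    (F := fun (r : ℝ) ω => Complex.exp ((Complex.I * r) * S ω)) (bound := fun _ => B)
    (F' := fun (r : ℝ) ω => Complex.I * (S ω * Complex.exp ((Complex.I * r) * S ω)))
    univ_mem (Eventually.of_forall fun r => (hm r).aestronglyMeasurable)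
    (integrable_of_norm_le (hm r).aestronglyMeasurable (C := 1) fun ω => (hnorm r ω).le)
    (((Complex.measurable_ofReal.comp hS).mul (hm r)).const_mul _).aestronglyMeasurable
    (Eventually.of_forall fun ω x _ => ?_) (integrable_const _)
    (Eventually.of_forall fun ω x _ => ?_)).2
  · rw [norm_mul, norm_mul, hnorm, Complex.norm_I, one_mul, mul_one, Complex.norm_real,
      Real.norm_eq_abs]
    exact hB ω
  · have h1 : HasDerivAt (fun y : ℝ => (Complex.I * y) * (S ω : ℂ)) (Complex.I * S ω) x := by
      have := ((hasDerivAt_id x).ofReal_comp.const_mul Complex.I).mul_const (S ω : ℂ)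
      simpa using this
    refine h1.cexp.congr_deriv ?_
    ring

/-- A bounded differentiable function with `Φ(0) = 1` that almost solves `Φ' = - 2 a r Φ` is close
to the Gaussian `exp (-a)` at time one. -/
theorem norm_sub_exp_le_of_deriv {φ φ' : ℝ → ℂ} (h : ∀ r, HasDerivAt φ (φ' r) r) (h0 : φ 0 = 1)
    {a K : ℝ} (ha : 0 ≤ a) (hK : ∀ r ∈ Ico (0 : ℝ) 1, ‖φ' r + (2 * a * r : ℝ) * φ r‖ ≤ K) :
    ‖φ 1 - Real.exp (-a)‖ ≤ Real.exp a * K := by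
  -- With the integrating factor e^{a r²} the approximate equation says that the product is nearly
  -- constant on [0, 1].
  have hd : ∀ r : ℝ, HasDerivAt (fun r : ℝ => (Real.exp (a * r ^ 2) : ℂ) * φ r)
      ((Real.exp (a * r ^ 2) : ℂ) * (φ' r + (2 * a * r : ℝ) * φ r)) r := by
    intro r
    have h1 : HasDerivAt (fun r : ℝ => Real.exp (a * r ^ 2))
        (Real.exp (a * r ^ 2) * (a * (2 * r))) r := by
      have := ((hasDerivAt_pow 2 r).const_mul a).exp
      simpa using this
    refine (h1.ofReal_comp.mul (h r)).congr_deriv ?_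
    push_cast
    ring
  have hb := norm_image_sub_le_of_norm_deriv_le_segment_01'
    (f := fun r : ℝ => (Real.exp (a * r ^ 2) : ℂ) * φ r) (C := Real.exp a * K)
    (fun r _ => (hd r).hasDerivWithinAt) (fun r hr => by
      rw [norm_mul, Complex.norm_real, Real.norm_eq_abs, Real.abs_exp]
      have h2 : a * r ^ 2 ≤ a := mul_le_of_le_one_right ha (pow_le_one₀ hr.1 hr.2.le)
      exact mul_le_mul (Real.exp_le_exp.2 h2) (hK r hr) (norm_nonneg _) (Real.exp_pos _).le)
  simp only [one_pow, mul_one, ne_eq, OfNat.ofNat_ne_zero, not_false_eq_true, zero_pow, mul_zero,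
    Real.exp_zero, Complex.ofReal_one, h0] at hb
  have e : φ 1 - Real.exp (-a) = (Real.exp (-a) : ℂ) * ((Real.exp a : ℂ) * φ 1 - 1) := by
    rw [mul_sub, ← mul_assoc, ← Complex.ofReal_mul, ← Real.exp_add]
    simp
  rw [e, norm_mul, Complex.norm_real, Real.norm_eq_abs, Real.abs_exp]
  exact (mul_le_of_le_one_left (norm_nonneg _) (Real.exp_le_one_iff.2 (neg_nonpos.2 ha))).trans hb

/-- The Malliavin–Stein bound for the regularised chaos. -/
theorem norm_charFun_chaosFun_sub_le (hG : IsCenteredGaussian P X q)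
    (hΦ : IsRegularFamily X q Φ M) {f : A → ℂ} (hf : Measurable f) {C : ℝ} (hC : ∀ a, ‖f a‖ ≤ C)
    (β : ℝ) (t : ℂ) {v : ℝ} (hv : 0 ≤ v) :
    ‖∫ ω, Complex.exp (Complex.I * ((starRingEnd ℂ) t * chaosFun μ X q β f Φ ω).re) ∂P -
      Real.exp (-(‖t‖ ^ 2 * v / 4))‖ ≤ Real.exp (‖t‖ ^ 2 * v / 4) *
      (‖t‖ * ‖∫ x, f x ∂μ‖ + ‖t‖ ^ 2 *
        (∫ ω, ‖pairFun μ X q β (-β) f (fun a => (starRingEnd ℂ) (f a)) Φ ω - v‖ ∂P +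
          ∫ ω, ‖pairFun μ X q β β f f Φ ω‖ ∂P)) := by
  have hP := hG.isProbabilityMeasure
  have hf₂ : Measurable (fun a => (starRingEnd ℂ) (f a)) :=
    Complex.continuous_conj.measurable.comp hf
  have hC₂ : ∀ a, ‖(starRingEnd ℂ) (f a)‖ ≤ C := fun a => by rw [RCLike.norm_conj]; exact hC a
  have hZm := hΦ.measurable_chaosFun (μ := μ) hf β
  have bZ := hΦ.norm_chaosFun_le (μ := μ) hC β
  have hZc := conj_chaosFun (X := X) (q := q) μ β f Φ
  -- The coefficients come from Re(t̄ Z) = (t̄/2) Z + (t/2) Z̄. The identity will be used with c =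
  -- ir.
  have hibp := fun (c : ℂ) => integral_chaosFun_mul_exp hG hΦ hf hf₂ hC hC₂ (μ := μ) β
    ((starRingEnd ℂ) t / 2) (t / 2) c rfl
  simp only [← hZc] at hibp
  have hT₁ : Integrable (pairFun μ X q β (-β) f (fun a => (starRingEnd ℂ) (f a)) Φ) P :=
    integrable_of_norm_le (measurable_phaseIntegral (hΦ.measurable_pairVec β (-β))
      (hΦ.measurable_pairWeight hf hf₂ β)).aestronglyMeasurable
      (fun ω => norm_phaseIntegral_le (hΦ.norm_pairWeight_le hC hC₂ β) ω)
  have hT₂ : Integrable (pairFun μ X q β β f f Φ) P :=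
    integrable_of_norm_le (measurable_phaseIntegral (hΦ.measurable_pairVec β β)
      (hΦ.measurable_pairWeight hf hf β)).aestronglyMeasurable
      (fun ω => norm_phaseIntegral_le (hΦ.norm_pairWeight_le hC hC β) ω)
  generalize pairFun μ X q β (-β) f (fun a => (starRingEnd ℂ) (f a)) Φ = T₁ at *
  generalize pairFun μ X q β β f f Φ = T₂ at *
  generalize chaosFun μ X q β f Φ = Z at *
  generalize (∫ x, f x ∂μ) = m at *
  set S : Ω → ℝ := fun ω => ((starRingEnd ℂ) t * Z ω).re with hSdef
  have hS : ∀ ω, (S ω : ℂ) = (starRingEnd ℂ) t / 2 * Z ω + t / 2 * (starRingEnd ℂ) (Z ω) := by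
    intro ω
    rw [hSdef, Complex.re_eq_add_conj]
    simp only [map_mul, Complex.conj_conj]
    ring
  simp only [← hS] at hibp
  have hSm : Measurable S := Complex.measurable_re.comp (hZm.const_mul _)
  have hSb : ∀ ω, |S ω| ≤ ‖t‖ * (Real.exp (β ^ 2 * M / 2) * C * μ.real univ) := fun ω => by
    refine (Complex.abs_re_le_norm _).trans ?_
    rw [norm_mul, RCLike.norm_conj]
    exact mul_le_mul_of_nonneg_left (bZ ω) (norm_nonneg _)
  set φ : ℝ → ℂ := fun r => ∫ ω, Complex.exp ((Complex.I * r) * S ω) ∂P with hφ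
  have hnorm : ∀ (r : ℝ) ω, ‖Complex.exp ((Complex.I * r) * S ω)‖ ≤ 1 := by
    intro r ω
    rw [show (Complex.I * r) * S ω = ((r * S ω : ℝ) : ℂ) * Complex.I by push_cast; ring,
      Complex.norm_exp_ofReal_mul_I]
  have hFm : ∀ r : ℝ, Measurable (fun ω => Complex.exp ((Complex.I * r) * S ω)) := fun r =>
    Complex.measurable_exp.comp ((Complex.measurable_ofReal.comp hSm).const_mul _)
  have hφb : ∀ r, ‖φ r‖ ≤ 1 := fun r => by
    have := norm_integral_le_of_norm_le_const (μ := P) (Eventually.of_forall (hnorm r))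
    simpa using this
  have hconjF : ∀ (r : ℝ) ω, (starRingEnd ℂ) (Complex.exp ((Complex.I * (-r : ℝ)) * S ω)) =
      Complex.exp ((Complex.I * r) * S ω) := by
    intro r ω
    rw [← Complex.exp_conj]
    simp only [map_mul, Complex.conj_I, Complex.conj_ofReal]
    push_cast
    ring_nf
  have hφc : ∀ r : ℝ, (starRingEnd ℂ) (φ (-r)) = φ r := fun r => by
    simp only [hφ, ← integral_conj, hconjF]
  set N₁ := ∫ ω, ‖T₁ ω - v‖ ∂P with hN₁
  set N₂ := ∫ ω, ‖T₂ ω‖ ∂P with hN₂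
  have hN₁0 : 0 ≤ N₁ := integral_nonneg fun _ => norm_nonneg _
  have hN₂0 : 0 ≤ N₂ := integral_nonneg fun _ => norm_nonneg _
  set E₁ : ℝ → ℂ := fun r => ∫ ω, Z ω * Complex.exp ((Complex.I * r) * S ω) ∂P with hE₁
  -- Q is the defect of the differential equation caused by the Z half of S, with half of the
  -- expected term a · 2r · φ added. The Z̄ half is its conjugate at -r, up to sign, so only Q has
  -- to be estimated.
  set Q : ℝ → ℂ := fun r => Complex.I * ((starRingEnd ℂ) t / 2) * E₁ r +
    (r * (‖t‖ ^ 2 / 4) * v : ℝ) * φ r with hQ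
  have htt : (starRingEnd ℂ) t * t = (‖t‖ ^ 2 : ℝ) := by
    rw [Complex.conj_mul']
    push_cast
    rfl
  have hQb : ∀ r : ℝ, |r| ≤ 1 → ‖Q r‖ ≤ ‖t‖ / 2 * ‖m‖ + ‖t‖ ^ 2 / 4 * (N₁ + N₂) := by
    intro r hr
    have hsub : ∫ ω, T₁ ω * Complex.exp ((Complex.I * r) * S ω) ∂P =
        ∫ ω, (T₁ ω - v) * Complex.exp ((Complex.I * r) * S ω) ∂P + v * φ r := by
      have i1 : Integrable (fun ω => (T₁ ω - v) * Complex.exp ((Complex.I * r) * S ω)) P :=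
        (hT₁.sub (integrable_const _)).mul_bdd (c := 1) (hFm r).aestronglyMeasurable
          (Eventually.of_forall (hnorm r))
      have i2 : Integrable (fun ω => (v : ℂ) * Complex.exp ((Complex.I * r) * S ω)) P :=
        (integrable_of_norm_le (hFm r).aestronglyMeasurable (hnorm r)).const_mul _
      rw [hφ, ← integral_const_mul, ← integral_add i1 i2]
      congr 1
      ext ω
      ring
    have e : Q r = Complex.I * ((starRingEnd ℂ) t / 2) * m * φ r +
        r * ((starRingEnd ℂ) t / 2) ^ 2 *
          ∫ ω, T₂ ω * Complex.exp ((Complex.I * r) * S ω) ∂P -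
        r * ((‖t‖ ^ 2 / 4 : ℝ) : ℂ) *
          ∫ ω, (T₁ ω - v) * Complex.exp ((Complex.I * r) * S ω) ∂P := by
      simp only [hQ, hE₁]
      rw [hibp (Complex.I * r), hsub]
      have htt' : (((starRingEnd ℂ) t / 2) * (t / 2)) = ((‖t‖ ^ 2 / 4 : ℝ) : ℂ) := by
        push_cast
        push_cast at htt
        linear_combination htt / 4
      push_cast
      push_cast at htt'
      linear_combination (r : ℂ) * ((starRingEnd ℂ) t / 2) *
        (-((starRingEnd ℂ) t / 2) * (∫ ω, T₂ ω * Complex.exp ((Complex.I * r) * S ω) ∂P) +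
          (t / 2) * (∫ ω, (T₁ ω - v) * Complex.exp ((Complex.I * r) * S ω) ∂P + v * φ r)) *
          Complex.I_sq - (r : ℂ) * (∫ ω, (T₁ ω - v) * Complex.exp ((Complex.I * r) * S ω) ∂P +
            v * φ r) * htt'
    rw [e]
    have b2 := norm_integral_mul_le_of_norm_le_one hT₂ (hnorm r)
    have b1 := norm_integral_mul_le_of_norm_le_one (hT₁.sub (integrable_const (v : ℂ))) (hnorm r)
    simp only [Pi.sub_apply] at b1
    refine (norm_sub_le _ _).trans ((add_le_add (norm_add_le _ _) le_rfl).trans ?_)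
    simp only [norm_mul, norm_div, norm_pow, RCLike.norm_conj, Complex.norm_I, one_mul,
      Complex.norm_real, Real.norm_eq_abs, Complex.norm_ofNat, abs_norm, Nat.abs_ofNat]
    have hr0 := abs_nonneg r
    have ht0 := norm_nonneg t
    have c1 : ‖t‖ / 2 * ‖m‖ * ‖φ r‖ ≤ ‖t‖ / 2 * ‖m‖ :=
      mul_le_of_le_one_right (by positivity) (hφb r)
    have c2 : |r| * (‖t‖ / 2) ^ 2 *
        ‖∫ ω, T₂ ω * Complex.exp ((Complex.I * r) * S ω) ∂P‖ ≤ 1 * (‖t‖ / 2) ^ 2 * N₂ := by gcongr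
    have c3 : |r| * (‖t‖ ^ 2 / 4) *
        ‖∫ ω, (T₁ ω - v) * Complex.exp ((Complex.I * r) * S ω) ∂P‖ ≤
        1 * (‖t‖ ^ 2 / 4) * N₁ := by gcongr
    nlinarith [c1, c2, c3]
  have hder : ∀ r : ℝ, ∫ ω, Complex.I * (S ω * Complex.exp ((Complex.I * r) * S ω)) ∂P +
      (2 * (‖t‖ ^ 2 * v / 4) * r : ℝ) * φ r = Q r - (starRingEnd ℂ) (Q (-r)) := by
    intro r
    have iZ : ∀ r : ℝ, Integrable (fun ω => Z ω * Complex.exp ((Complex.I * r) * S ω)) P := fun r =>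
      (integrable_of_norm_le hZm.aestronglyMeasurable bZ).mul_bdd (c := 1)
        (hFm r).aestronglyMeasurable (Eventually.of_forall (hnorm r))
    have iZc : Integrable (fun ω => (starRingEnd ℂ) (Z ω) *
        Complex.exp ((Complex.I * r) * S ω)) P :=
      (integrable_of_norm_le (Complex.continuous_conj.measurable.comp hZm).aestronglyMeasurable
        (fun ω => (RCLike.norm_conj (Z ω)).le.trans (bZ ω))).mul_bdd (c := 1)
        (hFm r).aestronglyMeasurable (Eventually.of_forall (hnorm r))
    have e1 : ∫ ω, Complex.I * (S ω * Complex.exp ((Complex.I * r) * S ω)) ∂P =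
        Complex.I * ((starRingEnd ℂ) t / 2) * E₁ r + Complex.I * (t / 2) *
          ∫ ω, (starRingEnd ℂ) (Z ω) * Complex.exp ((Complex.I * r) * S ω) ∂P := by
      rw [hE₁, ← integral_const_mul, ← integral_const_mul,
        ← integral_add ((iZ r).const_mul _) (iZc.const_mul _)]
      congr 1
      ext ω
      rw [hS]
      ring
    have e2 : ∫ ω, (starRingEnd ℂ) (Z ω) * Complex.exp ((Complex.I * r) * S ω) ∂P =
        (starRingEnd ℂ) (E₁ (-r)) := by
      simp only [hE₁, ← integral_conj, map_mul, hconjF]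
    rw [e1, e2]
    simp only [hQ, map_add, map_mul, map_div₀, Complex.conj_conj, Complex.conj_I, hφc,
      Complex.conj_ofReal, Complex.conj_ofNat]
    push_cast
    ring
  have hφ0 : φ 0 = 1 := by simp [hφ]
  have key := norm_sub_exp_le_of_deriv (φ := φ) (fun r => hasDerivAt_charFun_real hSm hSb r) hφ0
    (a := ‖t‖ ^ 2 * v / 4) (K := ‖t‖ * ‖m‖ + ‖t‖ ^ 2 * (N₁ + N₂)) (by positivity) (fun r hr => ?_)
  · simp only [hφ, Complex.ofReal_one, mul_one] at key
    exact key
  · rw [hder]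
    have hr1 : |r| ≤ 1 := by rw [abs_of_nonneg hr.1]; exact hr.2.le
    have h1 := hQb r hr1
    have h2 := hQb (-r) (by rwa [abs_neg])
    refine (norm_sub_le _ _).trans ?_
    rw [RCLike.norm_conj]
    nlinarith [mul_nonneg (sq_nonneg ‖t‖) (add_nonneg hN₁0 hN₂0)]

end SteinBound

/-! ### Moments of integrals of phases. -/

section SecondMoment

variable {V Ω : Type*} [AddCommGroup V] [Module ℝ V] [TopologicalSpace V] [MeasurableSpace Ω]
variable {P : Measure Ω} {X : Ω → V →L[ℝ] ℝ} {q : LinearMap.BilinForm ℝ V}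
variable {A B : Type*} [MeasurableSpace A] [MeasurableSpace B] {μ : Measure A} [IsFiniteMeasure μ]
  {μ' : Measure B} [IsFiniteMeasure μ'] {Φ : A → V} {Ψ : B → V} {h : A → ℂ} {h' : B → ℂ}

theorem integral_phaseIntegral (hG : IsCenteredGaussian P X q)
    (hΦ : Measurable (fun p : A × Ω => X p.2 (Φ p.1))) (hh : Measurable h) {C : ℝ}
    (hC : ∀ a, ‖h a‖ ≤ C) : ∫ ω, phaseIntegral μ X h Φ ω ∂P =
      ∫ a, h a * Complex.exp ((-(q (Φ a) (Φ a)) / 2 : ℝ)) ∂μ := by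
  have hP := hG.isProbabilityMeasure
  simp only [phaseIntegral]
  rw [integral_integral_swap]
  · simp only [integral_const_mul, hG.integral_phase]
  · refine integrable_of_norm_le (((hh.comp measurable_snd).mul
      ((measurable_phase_of hΦ).comp measurable_swap)).aestronglyMeasurable) (C := C) fun p => ?_
    simp only [Function.uncurry, norm_mul, norm_phase, mul_one]
    exact hC _

/-- Since conjugating a phase negates its vector, the product is itself an integral of phases over
the product space, with vectors Φ - Ψ. The first moment formula then applies. -/
theorem integral_phaseIntegral_mul_conj (hG : IsCenteredGaussian P X q)
    (hΦ : Measurable (fun p : A × Ω => X p.2 (Φ p.1))) (hh : Measurable h) {C : ℝ}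
    (hC : ∀ a, ‖h a‖ ≤ C)
    (hΨ : Measurable (fun p : B × Ω => X p.2 (Ψ p.1))) (hh' : Measurable h') {C' : ℝ}
    (hC' : ∀ a, ‖h' a‖ ≤ C') :
    ∫ ω, phaseIntegral μ X h Φ ω * (starRingEnd ℂ) (phaseIntegral μ' X h' Ψ ω) ∂P =
      ∫ p : A × B, h p.1 * (starRingEnd ℂ) (h' p.2) *
        Complex.exp ((-(q (Φ p.1 - Ψ p.2) (Φ p.1 - Ψ p.2)) / 2 : ℝ)) ∂(μ.prod μ') := by
  have e : ∀ ω, phaseIntegral μ X h Φ ω * (starRingEnd ℂ) (phaseIntegral μ' X h' Ψ ω) =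
      phaseIntegral (μ.prod μ') X (fun p => h p.1 * (starRingEnd ℂ) (h' p.2))
        (fun p => Φ p.1 - Ψ p.2) ω := by
    intro ω
    simp only [phaseIntegral, ← integral_conj, map_mul, conj_phase]
    rw [← integral_prod_mul]
    congr 1
    ext p
    rw [sub_eq_add_neg, phase_add]
    ring
  simp only [e]
  have hm : Measurable (fun p : (A × B) × Ω => X p.2 (Φ p.1.1 - Ψ p.1.2)) := by
    simp only [map_sub]
    have h1 : Measurable (fun p : (A × B) × Ω => (p.1.1, p.2)) := by fun_prop
    have h2 : Measurable (fun p : (A × B) × Ω => (p.1.2, p.2)) := by fun_prop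
    exact (hΦ.comp h1).sub (hΨ.comp h2)
  refine integral_phaseIntegral hG hm ((hh.comp measurable_fst).mul
    (Complex.continuous_conj.measurable.comp (hh'.comp measurable_snd))) (C := C * C') fun p => ?_
  rw [norm_mul, RCLike.norm_conj]
  exact mul_le_mul (hC _) (hC' _) (norm_nonneg _) ((norm_nonneg _).trans (hC p.1))

end SecondMoment

/-! ### The log-correlated field as a centered Gaussian functional. -/

section Field

variable {d : ℕ} {Ω : Type*} [MeasurableSpace Ω] {P : Measure Ω} [IsProbabilityMeasure P]
  {U : Opens (EuclideanSpace ℝ (Fin d))}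
  {g : EuclideanSpace ℝ (Fin d) × EuclideanSpace ℝ (Fin d) → ℝ}
  {X : Ω → (𝓢(EuclideanSpace ℝ (Fin d), ℝ) →L[ℝ] ℝ)}

namespace IsLogCorrelatedField

variable (hX : IsLogCorrelatedField P U g X)
include hX

theorem memLp_two (φ : 𝓢(EuclideanSpace ℝ (Fin d), ℝ)) : MemLp (fun ω => X ω φ) 2 P :=
  (hX.gaussian.hasGaussianLaw_eval φ).memLp_two

/-- The covariance form of the field. -/
def covForm : LinearMap.BilinForm ℝ 𝓢(EuclideanSpace ℝ (Fin d), ℝ) :=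
  LinearMap.mk₂ ℝ (fun φ ψ => ∫ ω, X ω φ * X ω ψ ∂P)
    (fun φ₁ φ₂ ψ => by
      simp only [map_add, add_mul]
      exact integral_add ((hX.memLp_two φ₁).integrable_mul (hX.memLp_two ψ))
        ((hX.memLp_two φ₂).integrable_mul (hX.memLp_two ψ)))
    (fun c φ ψ => by
      simp only [map_smul, smul_eq_mul, mul_assoc, integral_const_mul])
    (fun φ ψ₁ ψ₂ => by
      simp only [map_add, mul_add]
      exact integral_add ((hX.memLp_two φ).integrable_mul (hX.memLp_two ψ₁))
        ((hX.memLp_two φ).integrable_mul (hX.memLp_two ψ₂)))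
    (fun c φ ψ => by
      simp only [map_smul, smul_eq_mul, mul_left_comm _ c, integral_const_mul])

theorem covForm_apply (φ ψ : 𝓢(EuclideanSpace ℝ (Fin d), ℝ)) :
    hX.covForm φ ψ = ∫ ω, X ω φ * X ω ψ ∂P := rfl

/-- Each X(φ) is a centered real Gaussian with variance E[X(φ)²]. The characteristic functional is
its characteristic function at 1. -/
theorem isCenteredGaussian : IsCenteredGaussian P X hX.covForm where
  measurable := hX.measurable
  charFun φ := by
    have hlaw := (hX.gaussian.hasGaussianLaw_eval φ).map_eq_gaussianReal
    have h := congrArg (fun m : Measure ℝ => MeasureTheory.charFun m 1) hlaw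
    simp only at h
    rw [charFun_gaussianReal, charFun_apply_real,
      integral_map (hX.measurable φ).aemeasurable (by fun_prop)] at h
    have hv : Var[fun ω => X ω φ; P] = hX.covForm φ φ := by
      rw [variance_eq_integral (hX.measurable φ).aemeasurable, hX.covForm_apply]
      simp only [hX.centered, sub_zero, sq]
    have h0 : 0 ≤ hX.covForm φ φ := by rw [← hv]; exact variance_nonneg _ _
    simp only [hX.centered, hv, Complex.ofReal_one, one_mul, Complex.ofReal_zero, mul_zero, zero_mul,
      zero_sub, one_pow, mul_one, Real.coe_toNNReal _ h0] at h
    simp only [mul_comm Complex.I]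
    rw [h]
    push_cast
    ring_nf
  symm φ ψ := by simp only [covForm_apply, mul_comm]
  nonneg φ := by
    rw [covForm_apply]
    exact integral_nonneg fun ω => mul_self_nonneg _

theorem covForm_eq (φ ψ : 𝓢(EuclideanSpace ℝ (Fin d), ℝ)) : hX.covForm φ ψ =
    ∫ z : EuclideanSpace ℝ (Fin d) × EuclideanSpace ℝ (Fin d),
      logCov U g z.1 z.2 * φ z.1 * ψ z.2 := hX.covariance φ ψ

end IsLogCorrelatedField

end Field

/-! ### Continuity of the mollifiers in the Schwartz topology and joint measurability of the
mollified field. -/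

/-- Each derivative of φ is uniformly continuous by compact support. For translations close to a
given one the supports stay in a fixed ball, on which the polynomial weights of the Schwartz
seminorms are bounded. -/
theorem continuous_compSubConst {E : Type*} [NormedAddCommGroup E] [NormedSpace ℝ E]
    {φ : 𝓢(E, ℝ)} (hφ : HasCompactSupport φ) :
    Continuous (fun a : E => SchwartzMap.compSubConstCLM ℝ a φ) := by
  rw [continuous_iff_continuousAt]
  intro a
  rw [ContinuousAt, (schwartz_withSeminorms ℝ E ℝ).tendsto_nhds]
  rintro ⟨k, n⟩ τ hτ
  have hD : HasCompactSupport (iteratedFDeriv ℝ n φ) := hφ.iteratedFDeriv n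
  have hDc : Continuous (iteratedFDeriv ℝ n φ) :=
    (φ.smooth n).continuous_iteratedFDeriv le_rfl
  obtain ⟨R, hR0, hR⟩ := hD.isCompact.isBounded.exists_pos_norm_le
  have hDu := hD.uniformContinuous_of_continuous hDc
  rw [Metric.uniformContinuous_iff] at hDu
  -- The n-th derivative of φ vanishes outside the ball of radius R. Its translates by vectors at
  -- distance less than 1 from a therefore vanish outside the ball of radius R + ‖a‖ + 1, and L is
  -- the largest weight there.
  set L := (R + ‖a‖ + 1) ^ k with hL
  have hLpos : 0 < L := by positivity
  obtain ⟨δ, hδ, hδ'⟩ := hDu (τ / (2 * L)) (by positivity)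
  filter_upwards [Metric.ball_mem_nhds a (lt_min hδ one_pos)] with b hb
  rw [Metric.mem_ball, lt_min_iff] at hb
  have hb1 : ‖b‖ ≤ ‖a‖ + 1 := by
    have := norm_le_norm_add_norm_sub' b a
    rw [dist_eq_norm] at hb
    linarith [hb.2]
  refine lt_of_le_of_lt (SchwartzMap.seminorm_le_bound ℝ k n _ (M := τ / 2) (by positivity)
    fun x => ?_) (half_lt_self hτ)
  have hsub : iteratedFDeriv ℝ n (SchwartzMap.compSubConstCLM ℝ b φ -
      SchwartzMap.compSubConstCLM ℝ a φ : 𝓢(E, ℝ)) x =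
      iteratedFDeriv ℝ n φ (x - b) - iteratedFDeriv ℝ n φ (x - a) := by
    have h1 : ((SchwartzMap.compSubConstCLM ℝ b φ -
      SchwartzMap.compSubConstCLM ℝ a φ : 𝓢(E, ℝ)) : E → ℝ) =
      (fun z => φ (z - b)) - (fun z => φ (z - a)) := by
      ext z
      simp
    rw [h1, iteratedFDeriv_sub_apply, iteratedFDeriv_comp_sub, iteratedFDeriv_comp_sub]
    · exact ((φ.smooth n).comp (contDiff_id.sub contDiff_const)).contDiffAt
    · exact ((φ.smooth n).comp (contDiff_id.sub contDiff_const)).contDiffAt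
  rw [hsub]
  by_cases hx : ‖x‖ ≤ R + ‖a‖ + 1
  · have h1 : dist (x - b) (x - a) < δ := by
      rw [dist_sub_left]
      exact hb.1
    have h2 := hδ' h1
    rw [dist_eq_norm] at h2
    calc ‖x‖ ^ k * ‖iteratedFDeriv ℝ n φ (x - b) - iteratedFDeriv ℝ n φ (x - a)‖
        ≤ L * (τ / (2 * L)) := by
          refine mul_le_mul (pow_le_pow_left₀ (norm_nonneg _) hx k) h2.le (norm_nonneg _) hLpos.le
      _ = τ / 2 := by field_simp
  · push Not at hx
    have hz : ∀ c : E, ‖c‖ ≤ ‖a‖ + 1 → iteratedFDeriv ℝ n φ (x - c) = 0 := by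
      intro c hc
      refine image_eq_zero_of_notMem_tsupport fun hmem => ?_
      have h1 := hR _ hmem
      have h2 := norm_sub_norm_le x c
      linarith
    rw [hz b hb1, hz a (by linarith [norm_nonneg a]), sub_zero, norm_zero, mul_zero]
    positivity

namespace Mollifier

variable {d : ℕ} (η : Mollifier d)

theorem bump_eq_translate {ε : ℝ} (hε : 0 < ε) (x : EuclideanSpace ℝ (Fin d)) :
    η.bump ε x = SchwartzMap.compSubConstCLM ℝ x (η.bump ε 0) := by
  ext y
  rw [SchwartzMap.compSubConstCLM_apply, η.bump_apply hε, η.bump_apply hε]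
  congr 1
  refine η.radial _ _ ?_
  rw [zero_sub, smul_neg, norm_neg, norm_smul, norm_smul, norm_sub_rev]

theorem continuous_bump {ε : ℝ} (hε : 0 < ε) : Continuous (η.bump ε) := by
  have h : η.bump ε = fun x => SchwartzMap.compSubConstCLM ℝ x (η.bump ε 0) :=
    funext (η.bump_eq_translate hε)
  rw [h]
  refine continuous_compSubConst ?_
  have e : (η.bump ε 0 : EuclideanSpace ℝ (Fin d) → ℝ) = η.bumpFun ε 0 := by
    ext y
    rw [η.bump_apply hε, bumpFun]
  rw [e]
  exact η.hasCompactSupport_bumpFun hε 0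

end Mollifier

/-- A Carathéodory function: continuous in the point because X ω is a continuous functional, and
measurable in ω for each point. -/
theorem measurable_field_bump {d : ℕ} {Ω : Type*} [MeasurableSpace Ω]
    {X : Ω → (𝓢(EuclideanSpace ℝ (Fin d), ℝ) →L[ℝ] ℝ)} (hX : ∀ φ, Measurable (fun ω => X ω φ))
    (η : Mollifier d) {ε : ℝ} (hε : 0 < ε) :
    Measurable (fun p : EuclideanSpace ℝ (Fin d) × Ω => X p.2 (η.bump ε p.1)) :=
  measurable_uncurry_of_continuous_of_measurable
    (u := fun (x : EuclideanSpace ℝ (Fin d)) (ω : Ω) => X ω (η.bump ε x))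
    (fun ω => (X ω).continuous.comp (η.continuous_bump hε)) (fun _ => hX _)

/-- Euclidean space. -/
abbrev Eu (d : ℕ) := EuclideanSpace ℝ (Fin d)

/-! ### Mollifications of the logarithm. -/

section Bump

variable {d : ℕ} (η : Mollifier d)

namespace Mollifier

theorem exists_bound : ∃ C, 0 ≤ C ∧ ∀ z, η.toFun z ≤ C := by
  have hc : HasCompactSupport η.toFun :=
    HasCompactSupport.of_support_subset_isCompact (isCompact_closedBall (0 : Eu d) 1)
      ((subset_tsupport _).trans (η.tsupport_subset.trans Metric.ball_subset_closedBall))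
  obtain ⟨C, hC⟩ := hc.exists_bound_of_continuous η.contDiff.continuous
  exact ⟨C, (norm_nonneg _).trans (hC 0), fun z => (le_abs_self _).trans (hC z)⟩

theorem bump_nonneg {ε : ℝ} (hε : 0 < ε) (x y : Eu d) : 0 ≤ η.bump ε x y := by
  rw [η.bump_apply hε]
  exact mul_nonneg (by positivity) (η.nonneg _)

theorem bump_eq_zero {ε : ℝ} (hε : 0 < ε) {x y : Eu d} (h : ε ≤ ‖x - y‖) : η.bump ε x y = 0 := by
  have hnot : ε⁻¹ • (x - y) ∉ tsupport η.toFun := by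
    intro hmem
    have := η.tsupport_subset hmem
    rw [Metric.mem_ball, dist_zero_right, norm_smul, Real.norm_eq_abs, abs_of_pos (inv_pos.2 hε),
      inv_mul_lt_iff₀ hε, mul_one] at this
    linarith
  rw [η.bump_apply hε, image_eq_zero_of_notMem_tsupport hnot, mul_zero]

theorem norm_sub_lt_of_bump_ne_zero {ε : ℝ} (hε : 0 < ε) {x y : Eu d} (h : η.bump ε x y ≠ 0) :
    ‖x - y‖ < ε := by
  by_contra hn
  exact h (η.bump_eq_zero hε (not_lt.1 hn))

theorem bump_le {ε : ℝ} (hε : 0 < ε) {C : ℝ} (hC : ∀ z, η.toFun z ≤ C) (x y : Eu d) :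
    η.bump ε x y ≤ (ε ^ d)⁻¹ * C := by
  rw [η.bump_apply hε]
  exact mul_le_mul_of_nonneg_left (hC _) (by positivity)

theorem integral_bump {ε : ℝ} (hε : 0 < ε) (x : Eu d) : ∫ y, η.bump ε x y = 1 := by
  simp only [η.bump_apply hε, integral_const_mul]
  rw [integral_sub_left_eq_self (fun y : Eu d => η.toFun (ε⁻¹ • y)) volume x,
    Measure.integral_comp_inv_smul_of_nonneg _ _ hε.le, η.integral_eq_one, finrank_euclideanSpace,
    Fintype.card_fin, smul_eq_mul, mul_one, inv_mul_cancel₀ (by positivity)]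

theorem integrable_bump (ε : ℝ) (x : Eu d) : Integrable (η.bump ε x) := SchwartzMap.integrable _

theorem integrable_bump_mul_bump (ε δ : ℝ) (x y : Eu d) :
    Integrable (fun z : Eu d × Eu d => η.bump ε x z.1 * η.bump δ y z.2) :=
  (η.integrable_bump ε x).mul_prod (η.integrable_bump δ y)

theorem integral_bump_mul_bump {ε δ : ℝ} (hε : 0 < ε) (hδ : 0 < δ) (x y : Eu d) :
    ∫ z : Eu d × Eu d, η.bump ε x z.1 * η.bump δ y z.2 = 1 := by
  have h := integral_prod_mul (μ := (volume : Measure (Eu d))) (ν := (volume : Measure (Eu d)))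
    (fun z => η.bump ε x z) (fun z => η.bump δ y z)
  rw [η.integral_bump hε, η.integral_bump hδ, mul_one] at h
  exact h

end Mollifier

/-- The singular kernel `|u| ^ (-1/2)` truncated to the unit ball. -/
def sqrtKernel (u : Eu d) : ℝ := (Metric.ball (0 : Eu d) 1).indicator (fun u => ‖u‖ ^ (-(1 / 2) : ℝ)) u

theorem sqrtKernel_nonneg (u : Eu d) : 0 ≤ sqrtKernel u :=
  indicator_nonneg (fun _ _ => Real.rpow_nonneg (norm_nonneg _) _) _

theorem integrable_sqrtKernel [NeZero d] : Integrable (sqrtKernel (d := d)) := by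
  have hd : 1 ≤ d := NeZero.one_le
  refine (integrable_indicator_iff measurableSet_ball).2 ?_
  refine integrableOn_ball_of_norm_le_rpow (C := 1) (α := 1 / 2) (by simpa using hd) ?_ ?_ ?_
  · rw [finrank_euclideanSpace, Fintype.card_fin]
    have : (1 : ℝ) ≤ d := by exact_mod_cast hd
    linarith
  · refine Eventually.of_forall fun x => ?_
    rw [one_mul, Real.norm_eq_abs, abs_of_nonneg (Real.rpow_nonneg (norm_nonneg _) _)]
  · exact (measurable_norm.pow_const _).aestronglyMeasurable

/-- From log t ≤ 2 t^{1/2}, with the logarithm being nonpositive outside the ball. The exponent 1/2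
is chosen because it is below d for every d ≥ 1. -/
theorem log_div_le_sqrtKernel {ε : ℝ} (hε : 0 < ε) (u : Eu d) :
    Real.log (ε / ‖u‖) ≤ 2 * sqrtKernel (ε⁻¹ • u) := by
  by_cases hu : ‖u‖ < ε
  · have hn : ‖ε⁻¹ • u‖ = ‖u‖ / ε := by
      rw [norm_smul, Real.norm_eq_abs, abs_of_pos (inv_pos.2 hε), inv_mul_eq_div]
    have hmem : ε⁻¹ • u ∈ Metric.ball (0 : Eu d) 1 := by
      rw [mem_ball_zero_iff, hn, div_lt_one hε]
      exact hu
    rw [sqrtKernel, indicator_of_mem hmem, hn]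
    have h0 : 0 ≤ ε / ‖u‖ := by positivity
    have h1 := Real.log_le_rpow_div h0 (ε := 1 / 2) (by norm_num)
    rw [Real.rpow_neg (by positivity), ← Real.inv_rpow (by positivity), inv_div]
    linarith
  · push Not at hu
    have h1 : Real.log (ε / ‖u‖) ≤ 0 := Real.log_nonpos (by positivity) (by
      rw [div_le_one (hε.trans_le hu)]; exact hu)
    have := sqrtKernel_nonneg (ε⁻¹ • u)
    linarith

theorem integral_sqrtKernel_smul {ε : ℝ} (hε : 0 < ε) (y : Eu d) :
    ∫ x : Eu d, sqrtKernel (ε⁻¹ • (x - y)) = ε ^ d * ∫ u : Eu d, sqrtKernel u := by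
  rw [integral_sub_right_eq_self (fun x : Eu d => sqrtKernel (ε⁻¹ • x)) y,
    Measure.integral_comp_inv_smul_of_nonneg _ _ hε.le, finrank_euclideanSpace, Fintype.card_fin,
    smul_eq_mul]

theorem integrable_sqrtKernel_smul [NeZero d] {ε : ℝ} (hε : 0 < ε) :
    Integrable (fun x : Eu d => sqrtKernel (ε⁻¹ • x)) :=
  integrable_sqrtKernel.comp_smul (inv_ne_zero hε.ne')

theorem integrable_sqrtKernel_mul [NeZero d] {ε : ℝ} (hε : 0 < ε) {b : Eu d → ℝ}
    (hb : Integrable b) :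
    Integrable (fun z : Eu d × Eu d => b z.2 * sqrtKernel (ε⁻¹ • (z.1 - z.2))) :=
  Integrable.convolution_integrand (ContinuousLinearMap.mul ℝ ℝ) hb
    (integrable_sqrtKernel_smul hε)

theorem integral_sqrtKernel_mul [NeZero d] {ε : ℝ} (hε : 0 < ε) {b : Eu d → ℝ}
    (hb : Integrable b) :
    ∫ z : Eu d × Eu d, b z.2 * sqrtKernel (ε⁻¹ • (z.1 - z.2)) =
      (∫ y, b y) * (ε ^ d * ∫ u : Eu d, sqrtKernel u) := by
  rw [Measure.volume_eq_prod, integral_prod_symm _ (integrable_sqrtKernel_mul hε hb)]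
  simp only [integral_const_mul, integral_sqrtKernel_smul hε, integral_mul_const]

theorem ae_ne_prod [NeZero d] : ∀ᵐ z : Eu d × Eu d, z.1 ≠ z.2 := by
  rw [ae_iff]
  simp only [ne_eq, not_not]
  rw [Measure.volume_eq_prod, Measure.measure_prod_null
    (measurableSet_eq_fun measurable_fst measurable_snd)]
  refine Eventually.of_forall fun x => ?_
  have : Prod.mk x ⁻¹' {a : Eu d × Eu d | a.1 = a.2} = {x} := by
    ext y
    simp [eq_comm]
  change volume (Prod.mk x ⁻¹' {a : Eu d × Eu d | a.1 = a.2}) = 0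
  rw [this]
  exact measure_singleton x

/-- The two-point function of the mollified logarithmic kernel is logarithmic at the scale
`max (|x - y|, ε, δ)`, with a bounded error. -/
theorem exists_bound_log_bump [NeZero d] : ∃ M, 0 ≤ M ∧ ∀ ε δ : ℝ, 0 < ε → 0 < δ → ∀ x y : Eu d,
    Integrable (fun z : Eu d × Eu d =>
      Real.log (1 / ‖z.1 - z.2‖) * (η.bump ε x z.1 * η.bump δ y z.2)) ∧
    |(∫ z : Eu d × Eu d, Real.log (1 / ‖z.1 - z.2‖) * (η.bump ε x z.1 * η.bump δ y z.2)) -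
      Real.log (1 / max ‖x - y‖ (max ε δ))| ≤ M := by
  obtain ⟨C, hC0, hC⟩ := η.exists_bound
  set I := ∫ u : Eu d, sqrtKernel u with hI
  have hI0 : 0 ≤ I := integral_nonneg sqrtKernel_nonneg
  have hl4 : 0 < Real.log 4 := Real.log_pos (by norm_num)
  refine ⟨Real.log 4 + 2 * C * I + 2 * C * I, by positivity, fun ε δ hε hδ x y => ?_⟩
  set m := max ‖x - y‖ (max ε δ) with hm
  have hεm : ε ≤ m := (le_max_left _ _).trans (le_max_right _ _)
  have hδm : δ ≤ m := (le_max_right _ _).trans (le_max_right _ _)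
  have hxm : ‖x - y‖ ≤ m := le_max_left _ _
  have hm0 : 0 < m := hε.trans_le hεm
  set b : Eu d × Eu d → ℝ := fun z => η.bump ε x z.1 * η.bump δ y z.2 with hb
  have hb0 : ∀ z, 0 ≤ b z := fun z => mul_nonneg (η.bump_nonneg hε _ _) (η.bump_nonneg hδ _ _)
  have hbi : Integrable b := η.integrable_bump_mul_bump ε δ x y
  -- Majorant of log(m / |z₁ - z₂|) against the two bumps. In each singular term one bump is
  -- replaced by its supremum, a multiple of ε^{-d} or δ^{-d}, and this cancels the factor produced
  -- by rescaling the kernel. The integral of D is therefore independent of ε and δ.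
  set D : Eu d × Eu d → ℝ := fun z => Real.log 4 * b z +
    2 * ((ε ^ d)⁻¹ * C) * (η.bump δ y z.2 * sqrtKernel (ε⁻¹ • (z.1 - z.2))) +
    2 * ((δ ^ d)⁻¹ * C) * (η.bump ε x z.1 * sqrtKernel (δ⁻¹ • (z.2 - z.1))) with hD
  have i2 := integrable_sqrtKernel_mul hε (η.integrable_bump δ y)
  have i3 : Integrable (fun z : Eu d × Eu d =>
      η.bump ε x z.1 * sqrtKernel (δ⁻¹ • (z.2 - z.1))) :=
    (integrable_sqrtKernel_mul hδ (η.integrable_bump ε x)).swap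
  have hDi : Integrable D := ((hbi.const_mul _).add (i2.const_mul _)).add (i3.const_mul _)
  have hDint : ∫ z, D z = Real.log 4 + 2 * C * I + 2 * C * I := by
    have e3 : ∫ z : Eu d × Eu d, η.bump ε x z.1 * sqrtKernel (δ⁻¹ • (z.2 - z.1)) =
        ∫ z : Eu d × Eu d, η.bump ε x z.2 * sqrtKernel (δ⁻¹ • (z.1 - z.2)) :=
      integral_prod_swap (μ := (volume : Measure (Eu d))) (ν := (volume : Measure (Eu d)))
        (fun z : Eu d × Eu d => η.bump ε x z.2 * sqrtKernel (δ⁻¹ • (z.1 - z.2)))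
    have i12 : Integrable (fun z : Eu d × Eu d => Real.log 4 * b z +
      2 * ((ε ^ d)⁻¹ * C) * (η.bump δ y z.2 * sqrtKernel (ε⁻¹ • (z.1 - z.2)))) :=
      (hbi.const_mul _).add (i2.const_mul _)
    rw [hD, integral_add i12 (i3.const_mul _), integral_add (hbi.const_mul _) (i2.const_mul _),
      integral_const_mul, integral_const_mul, integral_const_mul, e3,
      integral_sqrtKernel_mul hε (η.integrable_bump δ y),
      integral_sqrtKernel_mul hδ (η.integrable_bump ε x), η.integral_bump hε, η.integral_bump hδ,
      hb, η.integral_bump_mul_bump hε hδ, ← hI]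
    have : (0 : ℝ) < ε ^ d := by positivity
    have : (0 : ℝ) < δ ^ d := by positivity
    field_simp
  have hpt : ∀ z, ‖Real.log (m / ‖z.1 - z.2‖) * b z‖ ≤ D z := by
    intro z
    have hk1 := sqrtKernel_nonneg (ε⁻¹ • (z.1 - z.2))
    have hk2 := sqrtKernel_nonneg (δ⁻¹ • (z.2 - z.1))
    have hB1 := η.bump_nonneg hε x z.1
    have hB2 := η.bump_nonneg hδ y z.2
    have hU1 := η.bump_le hε hC x z.1
    have hU2 := η.bump_le hδ hC y z.2
    by_cases hz : b z = 0
    · rw [hz, mul_zero, norm_zero]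
      simp only [hD, hz]
      positivity
    have h1 := η.norm_sub_lt_of_bump_ne_zero hε (left_ne_zero_of_mul hz)
    have h2 := η.norm_sub_lt_of_bump_ne_zero hδ (right_ne_zero_of_mul hz)
    have hk : |Real.log (m / ‖z.1 - z.2‖)| ≤ Real.log 4 +
        2 * sqrtKernel (ε⁻¹ • (z.1 - z.2)) + 2 * sqrtKernel (δ⁻¹ • (z.2 - z.1)) := by
      rcases eq_or_ne z.1 z.2 with h0 | h0
      · rw [h0, sub_self, norm_zero, div_zero, Real.log_zero, abs_zero]
        rw [h0] at hk1 hk2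
        rw [sub_self] at hk1 hk2
        positivity
      have hr : 0 < ‖z.1 - z.2‖ := norm_pos_iff.2 (sub_ne_zero.2 h0)
      have hr3 : ‖z.1 - z.2‖ ≤ 3 * m := by
        have : z.1 - z.2 = -(x - z.1) + (x - y) + (y - z.2) := by abel
        rw [this]
        refine (norm_add₃_le).trans ?_
        rw [norm_neg]
        linarith
      rw [abs_le]
      constructor
      · have : -Real.log 4 ≤ Real.log (m / ‖z.1 - z.2‖) := by
          rw [← Real.log_inv]
          refine Real.log_le_log (by norm_num) ?_
          rw [le_div_iff₀ hr]
          linarith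
        linarith
      · have hmr : 0 < m / ‖z.1 - z.2‖ := by positivity
        have l1 := log_div_le_sqrtKernel hε (z.1 - z.2)
        have l2 := log_div_le_sqrtKernel hδ (z.2 - z.1)
        rw [norm_sub_rev z.2 z.1] at l2
        have gen : ∀ t : ℝ, 0 < t → m ≤ 4 * t → Real.log (m / ‖z.1 - z.2‖) ≤
            Real.log 4 + Real.log (t / ‖z.1 - z.2‖) := by
          intro t ht hmt
          rw [← Real.log_mul (by norm_num) (by positivity)]
          refine Real.log_le_log hmr ?_
          rw [mul_div_assoc']
          exact div_le_div_of_nonneg_right hmt hr.le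
        -- If m is comparable to one of the mollification scales, the singular kernel at that scale
        -- controls the logarithm. Otherwise m = |x - y|, and the supports are so small that |z₁ -
        -- z₂| is comparable to m.
        by_cases c1 : m ≤ 4 * ε
        · linarith [gen ε hε c1]
        by_cases c2 : m ≤ 4 * δ
        · linarith [gen δ hδ c2]
        push Not at c1 c2
        have hmx : m = ‖x - y‖ := by
          rcases max_cases ‖x - y‖ (max ε δ) with h | h
          · exact h.1
          · exfalso
            rw [← hm] at h
            rcases max_cases ε δ with h' | h' <;> linarith [h.1, h'.1]
        have hr2 : m ≤ 4 * ‖z.1 - z.2‖ := by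
          have : x - y = (x - z.1) + (z.1 - z.2) + -(y - z.2) := by abel
          have h3 : ‖x - y‖ ≤ ‖x - z.1‖ + ‖z.1 - z.2‖ + ‖y - z.2‖ := by
            rw [this]
            refine (norm_add₃_le).trans ?_
            rw [norm_neg]
          linarith
        have := gen _ hr hr2
        rw [div_self hr.ne', Real.log_one] at this
        linarith
    rw [norm_mul, Real.norm_eq_abs, Real.norm_eq_abs, abs_of_nonneg (hb0 z)]
    refine (mul_le_mul_of_nonneg_right hk (hb0 z)).trans ?_
    simp only [hD, hb]
    have e1 : sqrtKernel (ε⁻¹ • (z.1 - z.2)) * (η.bump ε x z.1 * η.bump δ y z.2) ≤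
        (ε ^ d)⁻¹ * C * (η.bump δ y z.2 * sqrtKernel (ε⁻¹ • (z.1 - z.2))) := by
      have := mul_le_mul_of_nonneg_right hU1 (mul_nonneg hB2 hk1)
      linarith
    have e2 : sqrtKernel (δ⁻¹ • (z.2 - z.1)) * (η.bump ε x z.1 * η.bump δ y z.2) ≤
        (δ ^ d)⁻¹ * C * (η.bump ε x z.1 * sqrtKernel (δ⁻¹ • (z.2 - z.1))) := by
      have := mul_le_mul_of_nonneg_right hU2 (mul_nonneg hB1 hk2)
      linarith
    linarith
  have hmeas : AEStronglyMeasurable (fun z : Eu d × Eu d => Real.log (m / ‖z.1 - z.2‖) * b z) :=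
    (Real.measurable_log.comp (measurable_const.div
      (measurable_fst.sub measurable_snd).norm)).aestronglyMeasurable.mul hbi.aestronglyMeasurable
  have hi : Integrable (fun z : Eu d × Eu d => Real.log (m / ‖z.1 - z.2‖) * b z) :=
    hDi.mono' hmeas (Eventually.of_forall hpt)
  have hae : (fun z : Eu d × Eu d => Real.log (1 / ‖z.1 - z.2‖) * b z) =ᵐ[volume]
      fun z => Real.log (m / ‖z.1 - z.2‖) * b z - Real.log m * b z := by
    filter_upwards [ae_ne_prod] with z hz
    have hr : ‖z.1 - z.2‖ ≠ 0 := norm_ne_zero_iff.2 (sub_ne_zero.2 hz)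
    rw [Real.log_div hm0.ne' hr, Real.log_div one_ne_zero hr, Real.log_one]
    ring
  refine ⟨(hi.sub (hbi.const_mul _)).congr hae.symm, ?_⟩
  change |(∫ z : Eu d × Eu d, Real.log (1 / ‖z.1 - z.2‖) * b z) - Real.log (1 / m)| ≤ _
  rw [integral_congr_ae hae, integral_sub hi (hbi.const_mul _), integral_const_mul, hb,
    η.integral_bump_mul_bump hε hδ, one_div, Real.log_inv, mul_one, sub_neg_eq_add, sub_add_cancel,
    ← hDint]
  exact norm_integral_le_of_norm_le hDi (Eventually.of_forall hpt)

end Bump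

/-! ### The covariance kernel and its mollifications. -/

section Covariance

variable {d : ℕ} [NeZero d] {U : Opens (Eu d)} {g : Eu d × Eu d → ℝ}

/-- Near the origin and at bounded distance alike, |log |u|| is at most a multiple of |u|^{-1/2},
which is locally integrable in every dimension d ≥ 1. -/
theorem integrableOn_log_norm (R : ℝ) :
    IntegrableOn (fun u : Eu d => Real.log (1 / ‖u‖)) (Metric.ball 0 R) := by
  have hd : 1 ≤ d := NeZero.one_le
  have hm : Measurable (fun u : Eu d => Real.log (1 / ‖u‖)) :=
    Real.measurable_log.comp (measurable_const.div measurable_norm)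
  refine integrableOn_ball_of_norm_le_rpow (C := 2 + 2 * |R|) (α := 1 / 2)
    (by simpa using hd) ?_ ?_ hm.aestronglyMeasurable
  · rw [finrank_euclideanSpace, Fintype.card_fin]
    have : (1 : ℝ) ≤ d := by exact_mod_cast hd
    linarith
  · filter_upwards [ae_restrict_mem measurableSet_ball] with x hx
    rw [mem_ball_zero_iff] at hx
    rcases eq_or_ne x 0 with rfl | h0
    · simp only [norm_zero, div_zero, Real.log_zero]
      positivity
    have hx0 : 0 < ‖x‖ := norm_pos_iff.2 h0
    rw [one_div, Real.log_inv, norm_neg, Real.norm_eq_abs]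
    have hp : 0 < ‖x‖ ^ (-(1 / 2) : ℝ) := Real.rpow_pos_of_pos hx0 _
    have h1 : -Real.log ‖x‖ ≤ 2 * ‖x‖ ^ (-(1 / 2) : ℝ) := by
      have := Real.log_le_rpow_div (inv_nonneg.2 hx0.le) (ε := 1 / 2) (by norm_num)
      rw [Real.log_inv, Real.inv_rpow hx0.le, ← Real.rpow_neg hx0.le] at this
      linarith
    have h2 : Real.log ‖x‖ ≤ 2 * |R| * ‖x‖ ^ (-(1 / 2) : ℝ) := by
      have := Real.log_le_rpow_div hx0.le (ε := 1 / 2) (by norm_num)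
      have e : ‖x‖ ^ (1 / 2 : ℝ) = ‖x‖ * ‖x‖ ^ (-(1 / 2) : ℝ) := by
        nth_rewrite 2 [← Real.rpow_one ‖x‖]
        rw [← Real.rpow_add hx0]
        norm_num
      have h3 : ‖x‖ * ‖x‖ ^ (-(1 / 2) : ℝ) ≤ |R| * ‖x‖ ^ (-(1 / 2) : ℝ) :=
        mul_le_mul_of_nonneg_right (hx.le.trans (le_abs_self R)) hp.le
      linarith
    have h3 : 0 ≤ 2 * |R| * ‖x‖ ^ (-(1 / 2) : ℝ) := by positivity
    rw [abs_le]
    constructor <;> nlinarith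

/-- The logarithmic part on the bounded set U × U is a convolution integrand: the indicator of U
against the logarithm truncated to a ball containing all differences. -/
theorem integrable_logCov (hg : IsLogCovKernel U g) :
    Integrable (fun z : Eu d × Eu d => logCov U g z.1 z.2) := by
  have hUm : MeasurableSet ((U : Set (Eu d)) ×ˢ (U : Set (Eu d))) :=
    U.isOpen.measurableSet.prod U.isOpen.measurableSet
  change Integrable (((U : Set (Eu d)) ×ˢ (U : Set (Eu d))).indicator
    (fun z => Real.log (1 / ‖z.1 - z.2‖) + g z))
  rw [integrable_indicator_iff hUm]
  refine Integrable.add ?_ hg.integrable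
  obtain ⟨R, hR0, hR⟩ := hg.bounded.exists_pos_norm_lt
  set f₁ : Eu d → ℝ := (U : Set (Eu d)).indicator (fun _ => 1) with hf₁
  set f₂ : Eu d → ℝ := (Metric.ball (0 : Eu d) (2 * R)).indicator
    (fun u => Real.log (1 / ‖u‖)) with hf₂
  have i1 : Integrable f₁ := by
    rw [hf₁, integrable_indicator_iff U.isOpen.measurableSet]
    exact integrableOn_const (hg.bounded.measure_lt_top.ne)
  have i2 : Integrable f₂ := by
    rw [hf₂, integrable_indicator_iff measurableSet_ball]
    exact integrableOn_log_norm _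
  have h := (Integrable.convolution_integrand (ContinuousLinearMap.mul ℝ ℝ) i1 i2).integrableOn
    (s := (U : Set (Eu d)) ×ˢ (U : Set (Eu d)))
  refine h.congr_fun (fun z hz => ?_) hUm
  have h1 := hR _ hz.1
  have h2 := hR _ hz.2
  have h3 : z.1 - z.2 ∈ Metric.ball (0 : Eu d) (2 * R) := by
    rw [mem_ball_zero_iff]
    exact (norm_sub_le _ _).trans_lt (by linarith)
  simp only [hf₁, hf₂, indicator_of_mem hz.2, indicator_of_mem h3, ContinuousLinearMap.mul_apply',
    one_mul]

theorem continuousAt_logCov (hg : IsLogCovKernel U g) {x y : Eu d} (hx : x ∈ U) (hy : y ∈ U)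
    (hxy : x ≠ y) : ContinuousAt (fun z : Eu d × Eu d => logCov U g z.1 z.2) (x, y) := by
  have hopen : IsOpen ((U : Set (Eu d)) ×ˢ (U : Set (Eu d))) := U.isOpen.prod U.isOpen
  have hnhds := hopen.mem_nhds (show (x, y) ∈ (U : Set (Eu d)) ×ˢ (U : Set (Eu d)) from ⟨hx, hy⟩)
  have h1 : ContinuousAt (fun z : Eu d × Eu d => Real.log (1 / ‖z.1 - z.2‖) + g z) (x, y) := by
    refine ContinuousAt.add ?_ (hg.continuousOn.continuousAt hnhds)
    have hne : ‖x - y‖ ≠ 0 := norm_ne_zero_iff.2 (sub_ne_zero.2 hxy)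
    have h2 : ContinuousAt (fun z : Eu d × Eu d => 1 / ‖z.1 - z.2‖) (x, y) :=
      continuousAt_const.div (continuous_fst.sub continuous_snd).norm.continuousAt hne
    exact h2.log (div_ne_zero one_ne_zero hne)
  refine h1.congr ?_
  filter_upwards [hnhds] with z hz
  exact (indicator_of_mem (M := ℝ) hz (fun z => Real.log (1 / ‖z.1 - z.2‖) + g z)).symm

theorem logCov_of_mem {x y : Eu d} (hx : x ∈ U) (hy : y ∈ U) :
    logCov U g x y = Real.log (1 / ‖x - y‖) + g (x, y) :=
  indicator_of_mem (show (x, y) ∈ (U : Set (Eu d)) ×ˢ (U : Set (Eu d)) from ⟨hx, hy⟩) _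

theorem integrable_logCov_mul_bump (hg : IsLogCovKernel U g) (η : Mollifier d) {ε δ : ℝ}
    (hε : 0 < ε) (hδ : 0 < δ) (x y : Eu d) : Integrable (fun z : Eu d × Eu d =>
      logCov U g z.1 z.2 * (η.bump ε x z.1 * η.bump δ y z.2)) := by
  obtain ⟨C, hC0, hC⟩ := η.exists_bound
  refine (integrable_logCov hg).mul_bdd (c := (ε ^ d)⁻¹ * C * ((δ ^ d)⁻¹ * C))
    (η.integrable_bump_mul_bump ε δ x y).aestronglyMeasurable (Eventually.of_forall fun z => ?_)
  have h1 := η.bump_nonneg hε x z.1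
  have h2 := η.bump_nonneg hδ y z.2
  rw [Real.norm_eq_abs, abs_of_nonneg (mul_nonneg h1 h2)]
  exact mul_le_mul (η.bump_le hε hC _ _) (η.bump_le hδ hC _ _) h2 (by positivity)

/-- The covariance of the mollified fields. -/
def mollCov (U : Opens (Eu d)) (g : Eu d × Eu d → ℝ) (η : Mollifier d) (ε δ : ℝ) (x y : Eu d) : ℝ :=
  ∫ z : Eu d × Eu d, logCov U g z.1 z.2 * (η.bump ε x z.1 * η.bump δ y z.2)

/-- Integrability of the kernel and boundedness of the bumps suffice since ε is fixed. The bound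
blows up as ε → 0 and serves only to make the regularised random variables bounded. -/
theorem exists_bound_mollCov (hg : IsLogCovKernel U g) (η : Mollifier d) {ε : ℝ} (hε : 0 < ε) :
    ∃ M, ∀ x y, |mollCov U g η ε ε x y| ≤ M := by
  obtain ⟨C, hC0, hC⟩ := η.exists_bound
  have hi := (integrable_logCov hg).norm.mul_const ((ε ^ d)⁻¹ * C * ((ε ^ d)⁻¹ * C))
  refine ⟨∫ z : Eu d × Eu d, ‖logCov U g z.1 z.2‖ * ((ε ^ d)⁻¹ * C * ((ε ^ d)⁻¹ * C)),
    fun x y => ?_⟩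
  rw [mollCov, ← Real.norm_eq_abs]
  refine norm_integral_le_of_norm_le hi (Eventually.of_forall fun z => ?_)
  have h1 := η.bump_nonneg hε x z.1
  have h2 := η.bump_nonneg hε y z.2
  rw [norm_mul]
  refine mul_le_mul_of_nonneg_left ?_ (norm_nonneg _)
  rw [Real.norm_eq_abs, abs_of_nonneg (mul_nonneg h1 h2)]
  exact mul_le_mul (η.bump_le hε hC _ _) (η.bump_le hε hC _ _) h2 (by positivity)

/-- The kernel is continuous off the diagonal and the bumps are probability densities shrinking to x
and y. Independent parameters are needed for the Cauchy property in L² of the mollified chaoses. -/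
theorem tendsto_mollCov (hg : IsLogCovKernel U g) (η : Mollifier d) {x y : Eu d} (hx : x ∈ U)
    (hy : y ∈ U) (hxy : x ≠ y) :
    Tendsto (fun p : ℝ × ℝ => mollCov U g η p.1 p.2 x y) (𝓝[>] 0 ×ˢ 𝓝[>] 0)
      (𝓝 (logCov U g x y)) := by
  rw [Metric.tendsto_nhds]
  intro τ hτ
  have hc := Metric.continuousAt_iff.1 (continuousAt_logCov hg hx hy hxy) (τ / 2) (by positivity)
  obtain ⟨r, hr, hr'⟩ := hc
  have hev : ∀ᶠ ε : ℝ in 𝓝[>] 0, ε ∈ Ioo 0 r := Ioo_mem_nhdsGT hr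
  filter_upwards [hev.prod_mk hev] with p hp
  obtain ⟨⟨hp1, hp1'⟩, hp2, hp2'⟩ := hp
  have hb := η.integrable_bump_mul_bump p.1 p.2 x y
  have e : mollCov U g η p.1 p.2 x y - logCov U g x y =
      ∫ z : Eu d × Eu d, (logCov U g z.1 z.2 - logCov U g x y) *
        (η.bump p.1 x z.1 * η.bump p.2 y z.2) := by
    simp only [sub_mul]
    rw [integral_sub (integrable_logCov_mul_bump hg η hp1 hp2 x y) (hb.const_mul _),
      integral_const_mul, η.integral_bump_mul_bump hp1 hp2, mul_one, mollCov]
  rw [Real.dist_eq, e]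
  refine lt_of_le_of_lt ?_ (half_lt_self hτ)
  have h := norm_integral_le_of_norm_le (f := fun z : Eu d × Eu d =>
    (logCov U g z.1 z.2 - logCov U g x y) * (η.bump p.1 x z.1 * η.bump p.2 y z.2))
    (hb.const_mul (τ / 2)) (Eventually.of_forall fun z => ?_)
  · rw [integral_const_mul, η.integral_bump_mul_bump hp1 hp2, mul_one] at h
    exact h
  · have h1 := η.bump_nonneg hp1 x z.1
    have h2 := η.bump_nonneg hp2 y z.2
    rw [norm_mul, Real.norm_eq_abs (η.bump p.1 x z.1 * _), abs_of_nonneg (mul_nonneg h1 h2)]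
    by_cases hz : η.bump p.1 x z.1 * η.bump p.2 y z.2 = 0
    · rw [hz, mul_zero, mul_zero]
    refine mul_le_mul_of_nonneg_right ?_ (mul_nonneg h1 h2)
    have d1 := η.norm_sub_lt_of_bump_ne_zero hp1 (left_ne_zero_of_mul hz)
    have d2 := η.norm_sub_lt_of_bump_ne_zero hp2 (right_ne_zero_of_mul hz)
    refine (hr' (x := z) ?_).le
    rw [Prod.dist_eq, max_lt_iff, dist_comm, dist_eq_norm, dist_comm z.2, dist_eq_norm]
    exact ⟨d1.trans hp1', d2.trans hp2'⟩

/-- Uniform logarithmic bound for the covariance of the mollified fields on compact sets. -/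
theorem exists_bound_mollCov_sub_log (hg : IsLogCovKernel U g) (η : Mollifier d) {K : Set (Eu d)}
    (hK : IsCompact K) (hKU : K ⊆ U) : ∃ ε₀ M : ℝ, 0 < ε₀ ∧ 0 ≤ M ∧
    ∀ ε δ : ℝ, 0 < ε → ε < ε₀ → 0 < δ → δ < ε₀ → ∀ x ∈ K, ∀ y ∈ K,
      |mollCov U g η ε δ x y - Real.log (1 / max ‖x - y‖ (max ε δ))| ≤ M := by
  obtain ⟨ε₀, hε₀, hsub⟩ := hK.exists_cthickening_subset_open U.isOpen hKU
  have hK' : IsCompact (Metric.cthickening ε₀ K) := hK.cthickening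
  obtain ⟨G, hG⟩ := (hK'.prod hK').exists_bound_of_continuousOn
    (hg.continuousOn.mono (prod_mono hsub hsub))
  obtain ⟨M, hM0, hM⟩ := exists_bound_log_bump η
  refine ⟨ε₀, M + |G|, hε₀, by positivity, fun ε δ hε hε' hδ hδ' x hx y hy => ?_⟩
  obtain ⟨hi, hb⟩ := hM ε δ hε hδ x y
  have hmem : ∀ {t : ℝ} {a u : Eu d}, a ∈ K → ‖a - u‖ < t → t < ε₀ →
      u ∈ Metric.cthickening ε₀ K := by
    intro t a u ha h1 h2
    refine Metric.mem_cthickening_of_dist_le u a ε₀ K ha ?_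
    rw [dist_comm, dist_eq_norm]
    linarith
  have hbi := η.integrable_bump_mul_bump ε δ x y
  have hi2 := integrable_logCov_mul_bump hg η hε hδ x y
  have hsplit : mollCov U g η ε δ x y -
      ∫ z : Eu d × Eu d, Real.log (1 / ‖z.1 - z.2‖) * (η.bump ε x z.1 * η.bump δ y z.2) =
      ∫ z : Eu d × Eu d, (logCov U g z.1 z.2 * (η.bump ε x z.1 * η.bump δ y z.2) -
        Real.log (1 / ‖z.1 - z.2‖) * (η.bump ε x z.1 * η.bump δ y z.2)) :=
    (integral_sub hi2 hi).symm
  have hrem : |∫ z : Eu d × Eu d, (logCov U g z.1 z.2 * (η.bump ε x z.1 * η.bump δ y z.2) -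
        Real.log (1 / ‖z.1 - z.2‖) * (η.bump ε x z.1 * η.bump δ y z.2))| ≤ |G| := by
    have h := norm_integral_le_of_norm_le (f := fun z : Eu d × Eu d =>
      (logCov U g z.1 z.2 * (η.bump ε x z.1 * η.bump δ y z.2) -
        Real.log (1 / ‖z.1 - z.2‖) * (η.bump ε x z.1 * η.bump δ y z.2)))
      (hbi.const_mul |G|) (Eventually.of_forall fun z => ?_)
    · rw [integral_const_mul, η.integral_bump_mul_bump hε hδ, mul_one] at h
      exact h
    · by_cases hz : η.bump ε x z.1 * η.bump δ y z.2 = 0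
      · simp [hz]
      have h1 := η.bump_nonneg hε x z.1
      have h2 := η.bump_nonneg hδ y z.2
      have m1 := hmem hx (η.norm_sub_lt_of_bump_ne_zero hε (left_ne_zero_of_mul hz)) hε'
      have m2 := hmem hy (η.norm_sub_lt_of_bump_ne_zero hδ (right_ne_zero_of_mul hz)) hδ'
      rw [← sub_mul, logCov_of_mem (hsub m1) (hsub m2), add_sub_cancel_left, norm_mul,
        Real.norm_eq_abs (η.bump ε x z.1 * _), abs_of_nonneg (mul_nonneg h1 h2)]
      exact mul_le_mul_of_nonneg_right ((hG _ ⟨m1, m2⟩).trans (le_abs_self G)) (mul_nonneg h1 h2)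
  rw [← hsplit] at hrem
  rw [abs_le] at hb hrem ⊢
  constructor <;> linarith [hb.1, hb.2, hrem.1, hrem.2]

end Covariance

/-! ### Onsager's electrostatic inequality. -/

section Onsager

variable {d : ℕ} [NeZero d] {Ω : Type*} [MeasurableSpace Ω] {P : Measure Ω}
  [IsProbabilityMeasure P] {U : Opens (Eu d)} {g : Eu d × Eu d → ℝ}
  {X : Ω → (𝓢(Eu d, ℝ) →L[ℝ] ℝ)}

theorem IsLogCorrelatedField.covForm_bump (hX : IsLogCorrelatedField P U g X) (η : Mollifier d)
    (ε δ : ℝ) (x y : Eu d) : hX.covForm (η.bump ε x) (η.bump δ y) = mollCov U g η ε δ x y := by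
  rw [hX.covForm_eq, mollCov]
  simp only [mul_assoc]

/-- An Onsager type inequality for the mollified covariance. -/
theorem exists_onsager (hg : IsLogCovKernel U g) (hX : IsLogCorrelatedField P U g X)
    (η : Mollifier d) {K : Set (Eu d)} (hK : IsCompact K) (hKU : K ⊆ U) {D : ℝ} (hD : 0 < D) :
    ∃ ε₀ M : ℝ, 0 < ε₀ ∧ 0 ≤ M ∧ ∀ ε : ℝ, 0 < ε → ε < ε₀ → ∀ z : Fin 4 → Eu d, (∀ i, z i ∈ K) →
      ∀ ℓ : Fin 4 → ℝ, (∀ i, 0 ≤ ℓ i) →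
      (∀ i j, i ≠ j → D * Real.exp (-ℓ i) ≤ ‖z i - z j‖) → ∀ c : Fin 4 → ℝ, (∀ i, |c i| ≤ 1) →
      0 ≤ ∑ i, ∑ j, (if i = j then c i ^ 2 * ℓ i else c i * c j * mollCov U g η ε ε (z i) (z j)) +
        M := by
  obtain ⟨ε₀, M, hε₀, hM0, hM⟩ := exists_bound_mollCov_sub_log hg η hK hKU
  set κ : ℝ := min D (ε₀ / 2) with hκ
  have hκ0 : 0 < κ := lt_min hD (by positivity)
  set M₃ : ℝ := 2 * M + |Real.log (1 / κ)| with hM₃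
  refine ⟨ε₀, 16 * M₃, hε₀, by positivity, fun ε hε hε' z hz ℓ hℓ hsep c hc => ?_⟩
  set m : Fin 4 → ℝ := fun i => D * Real.exp (-ℓ i) with hm
  have hmpos : ∀ i, 0 < m i := fun i => by positivity
  -- Onsager's smearing: each charge is spread at its own scale, up to the distance to the other
  -- points, but not below ε. The cap ε₀ / 2 keeps the scale inside the range of the logarithmic
  -- estimate.
  set ρ : Fin 4 → ℝ := fun i => max ε (min (ε₀ / 2) (m i)) with hρ
  have hρ0 : ∀ i, 0 < ρ i := fun i => hε.trans_le (le_max_left _ _)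
  have hρ1 : ∀ i, ρ i < ε₀ := fun i =>
    max_lt hε' ((min_le_left _ _).trans_lt (half_lt_self hε₀))
  have hdiag : ∀ i, mollCov U g η (ρ i) (ρ i) (z i) (z i) ≤ ℓ i + M₃ := by
    intro i
    have h := (abs_le.1 (hM (ρ i) (ρ i) (hρ0 i) (hρ1 i) (hρ0 i) (hρ1 i) _ (hz i) _ (hz i))).2
    rw [sub_self, norm_zero, max_self, max_eq_right (hρ0 i).le] at h
    have h1 : κ * Real.exp (-ℓ i) ≤ ρ i := by
      refine le_trans (le_min ?_ ?_) (le_max_right _ _)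
      · have : Real.exp (-ℓ i) ≤ 1 := Real.exp_le_one_iff.2 (neg_nonpos.2 (hℓ i))
        exact (mul_le_of_le_one_right hκ0.le this).trans (min_le_right _ _)
      · exact mul_le_mul_of_nonneg_right (min_le_left _ _) (Real.exp_pos _).le
    have h2 : Real.log (1 / ρ i) ≤ ℓ i + Real.log (1 / κ) := by
      have := Real.log_le_log (by positivity) h1
      rw [Real.log_mul hκ0.ne' (Real.exp_pos _).ne', Real.log_exp] at this
      rw [one_div, Real.log_inv, one_div, Real.log_inv]
      linarith
    have h3 := le_abs_self (Real.log (1 / κ))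
    linarith
  -- Smearing up to the mutual distance changes an interaction by a bounded amount only: the
  -- effective scale max(|z i - z j|, ρ i, ρ j) is the same as for the common scale ε.
  have hoff : ∀ i j, i ≠ j → |mollCov U g η (ρ i) (ρ j) (z i) (z j) -
      mollCov U g η ε ε (z i) (z j)| ≤ M₃ := by
    intro i j hij
    have h1 := hM (ρ i) (ρ j) (hρ0 i) (hρ1 i) (hρ0 j) (hρ1 j) _ (hz i) _ (hz j)
    have h2 := hM ε ε hε hε' hε hε' _ (hz i) _ (hz j)
    have e : max ‖z i - z j‖ (max (ρ i) (ρ j)) = max ‖z i - z j‖ (max ε ε) := by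
      rw [max_self]
      have a1 : ρ i ≤ max ‖z i - z j‖ ε := by
        refine max_le (le_max_right _ _) ((min_le_right _ _).trans ?_)
        exact (hsep i j hij).trans (le_max_left _ _)
      have a2 : ρ j ≤ max ‖z i - z j‖ ε := by
        refine max_le (le_max_right _ _) ((min_le_right _ _).trans ?_)
        rw [norm_sub_rev]
        exact (hsep j i hij.symm).trans (le_max_left _ _)
      refine le_antisymm (max_le (le_max_left _ _) (max_le a1 a2)) (max_le (le_max_left _ _) ?_)
      exact ((le_max_left _ _).trans (le_max_left _ _)).trans (le_max_right ‖z i - z j‖ _)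
    rw [e] at h1
    have h3 := abs_nonneg (Real.log (1 / κ))
    rw [abs_le] at h1 h2 ⊢
    constructor <;> linarith [h1.1, h1.2, h2.1, h2.2]
  -- Positivity of the variance of the smeared charge distribution is the whole content of the
  -- inequality. Replacing each of the 16 entries costs at most M₃.
  have hpos := hX.isCenteredGaussian.nonneg (∑ i, c i • η.bump (ρ i) (z i))
  simp only [map_sum, LinearMap.sum_apply, map_smul, LinearMap.smul_apply, smul_eq_mul,
    hX.covForm_bump, Finset.mul_sum] at hpos
  have hterm : ∀ i j : Fin 4, c i * (c j * mollCov U g η (ρ j) (ρ i) (z j) (z i)) ≤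
      (if j = i then c j ^ 2 * ℓ j else c j * c i * mollCov U g η ε ε (z j) (z i)) + M₃ := by
    intro i j
    have hM₃0 : 0 ≤ M₃ := by positivity
    split_ifs with h
    · subst h
      have h1 : c j ^ 2 ≤ 1 := by
        rw [← sq_abs]; exact pow_le_one₀ (abs_nonneg _) (hc j)
      have h2 := mul_le_mul_of_nonneg_left (hdiag j) (sq_nonneg (c j))
      have h3 := mul_le_mul_of_nonneg_right h1 hM₃0
      linarith
    · have h1 : |c j * c i| ≤ 1 := by
        rw [abs_mul]; exact mul_le_one₀ (hc j) (abs_nonneg _) (hc i)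
      have h2 : c j * c i * (mollCov U g η (ρ j) (ρ i) (z j) (z i) -
          mollCov U g η ε ε (z j) (z i)) ≤ M₃ := by
        refine (le_abs_self _).trans ?_
        rw [abs_mul]
        exact (mul_le_of_le_one_left (abs_nonneg _) h1).trans (hoff j i h)
      linarith
  have hsum := hpos.trans (Finset.sum_le_sum fun i _ => Finset.sum_le_sum fun j _ => hterm i j)
  simp only [Finset.sum_add_distrib, Finset.sum_const, Finset.card_univ, Fintype.card_fin,
    nsmul_eq_mul] at hsum
  rw [Finset.sum_comm] at hsum
  push_cast at hsum
  linarith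

/-- The logarithmic kernel `log (D / |x - y|)`. -/
def logDist (D : ℝ) (x y : Eu d) : ℝ := Real.log (D / ‖x - y‖)

theorem logDist_comm (D : ℝ) (x y : Eu d) : logDist D x y = logDist D y x := by
  rw [logDist, logDist, norm_sub_rev]

theorem logDist_nonneg {D : ℝ} {x y : Eu d} (h : ‖x - y‖ ≤ D) : 0 ≤ logDist D x y := by
  rcases eq_or_ne x y with rfl | hne
  · simp [logDist]
  · have h0 : 0 < ‖x - y‖ := norm_pos_iff.2 (sub_ne_zero.2 hne)
    exact Real.log_nonneg ((one_le_div h0).2 h)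

/-- The largest value of the logarithmic kernel between `x` and three other points. -/
def maxLog (D : ℝ) (x a b c : Eu d) : ℝ := max (logDist D x a) (max (logDist D x b) (logDist D x c))

/-- The interaction energy of the four-point configuration with charges `s, σ, -s', -σ`. -/
def energy (C : Eu d → Eu d → ℝ) (σ s s' : ℝ) (x y x' y' : Eu d) : ℝ :=
  -(s * σ * C x y) + s * s' * C x x' + s * σ * C x y' + s' * σ * C y x' + C y y' -
    s' * σ * C x' y'

/-- Converts a bound on logarithmic interactions into the separation hypothesis of the Onsager
inequality. -/
theorem exp_neg_maxLog_le {D : ℝ} (hD : 0 < D) {x y : Eu d} (hxy : x ≠ y) {t : ℝ}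
    (ht : logDist D x y ≤ t) : D * Real.exp (-t) ≤ ‖x - y‖ := by
  have h0 : 0 < ‖x - y‖ := norm_pos_iff.2 (sub_ne_zero.2 hxy)
  have h1 : Real.exp (-t) ≤ ‖x - y‖ / D := by
    rw [← Real.le_log_iff_exp_le (by positivity)]
    rw [logDist, ← inv_div, Real.log_inv] at ht
    rw [← neg_le_neg_iff] at ht
    simpa using ht
  calc D * Real.exp (-t) ≤ D * (‖x - y‖ / D) := mul_le_mul_of_nonneg_left h1 hD.le
    _ = ‖x - y‖ := by field_simp

theorem mollCov_comm (hX : IsLogCorrelatedField P U g X) (η : Mollifier d) (ε : ℝ) (x y : Eu d) :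
    mollCov U g η ε ε x y = mollCov U g η ε ε y x := by
  rw [← hX.covForm_bump, ← hX.covForm_bump]
  exact hX.isCenteredGaussian.symm _ _

/-- The Onsager inequality for the charges s, σ, -s', -σ, with D e^{-ℓ} at each point at most its
distance to the nearest other point. The energy is minus the sum of the interactions over unordered
pairs, whence the factor 1/2, and the self-energies carry the squared charges. -/
theorem exists_energy_mollCov_le (hg : IsLogCovKernel U g) (hX : IsLogCorrelatedField P U g X)
    (η : Mollifier d) {K : Set (Eu d)} (hK : IsCompact K) (hKU : K ⊆ U) {D : ℝ} (hD : 0 < D)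
    (hKD : ∀ x ∈ K, ∀ y ∈ K, ‖x - y‖ ≤ D) :
    ∃ ε₀ M : ℝ, 0 < ε₀ ∧ 0 ≤ M ∧ ∀ ε : ℝ, 0 < ε → ε < ε₀ → ∀ x ∈ K, ∀ y ∈ K, ∀ x' ∈ K, ∀ y' ∈ K,
      x ≠ y → x ≠ x' → x ≠ y' → y ≠ x' → y ≠ y' → x' ≠ y' →
      ∀ σ s s' : ℝ, σ ^ 2 = 1 → s ∈ Icc (0 : ℝ) 1 → s' ∈ Icc (0 : ℝ) 1 →
      energy (mollCov U g η ε ε) σ s s' x y x' y' ≤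
        (s ^ 2 * maxLog D x y x' y' + maxLog D y x x' y' + s' ^ 2 * maxLog D x' x y y' +
          maxLog D y' x y x') / 2 + M := by
  obtain ⟨ε₀, M, hε₀, hM0, hM⟩ := exists_onsager hg hX η hK hKU hD
  refine ⟨ε₀, M / 2, hε₀, by positivity, ?_⟩
  intro ε hε hε' x hx y hy x' hx' y' hy' h1 h2 h3 h4 h5 h6 σ s s' hσ hs hs'
  have hσ1 : |σ| ≤ 1 := by
    rw [← abs_one, ← sq_le_sq, hσ, one_pow]
  have hpos : ∀ {a b u v : Eu d}, a ∈ K → b ∈ K → 0 ≤ maxLog D a b u v := fun ha hb =>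
    (logDist_nonneg (hKD _ ha _ hb)).trans (le_max_left _ _)
  have h := hM ε hε hε' ![x, y, x', y'] (by
      intro i; fin_cases i <;> assumption)
    ![maxLog D x y x' y', maxLog D y x x' y', maxLog D x' x y y', maxLog D y' x y x'] (by
      intro i
      fin_cases i
      exacts [hpos hx hy, hpos hy hx, hpos hx' hx, hpos hy' hx]) (by
      have A : ∀ a b u v : Eu d, logDist D a b ≤ maxLog D a b u v := fun a b u v => le_max_left _ _
      have B : ∀ a b u v : Eu d, logDist D a u ≤ maxLog D a b u v := fun a b u v =>
        (le_max_left _ _).trans (le_max_right _ _)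
      have C : ∀ a b u v : Eu d, logDist D a v ≤ maxLog D a b u v := fun a b u v =>
        (le_max_right _ _).trans (le_max_right _ _)
      intro i j hij
      fin_cases i <;> fin_cases j <;> first
        | exact absurd rfl hij
        | exact exp_neg_maxLog_le hD (by first | assumption | (apply Ne.symm; assumption))
            (by first | exact A _ _ _ _ | exact B _ _ _ _ | exact C _ _ _ _))
    ![s, σ, -s', -σ] (by
      intro i
      fin_cases i
      · change |s| ≤ 1
        exact abs_le.2 ⟨by linarith [hs.1], hs.2⟩
      · exact hσ1
      · change |-s'| ≤ 1
        rw [abs_neg]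
        exact abs_le.2 ⟨by linarith [hs'.1], hs'.2⟩
      · change |-σ| ≤ 1
        rwa [abs_neg])
  simp only [Fin.sum_univ_four, Fin.isValue, Matrix.cons_val_zero, Matrix.cons_val_one,
    Matrix.cons_val, if_true, if_false, Fin.reduceEq] at h
  rw [mollCov_comm hX η ε y x, mollCov_comm hX η ε x' x, mollCov_comm hX η ε x' y,
    mollCov_comm hX η ε y' x, mollCov_comm hX η ε y' y, mollCov_comm hX η ε y' x'] at h
  have e : (-σ) ^ 2 = 1 := by rw [neg_sq, hσ]
  rw [e, hσ] at h
  have e2 : σ * -σ = -1 := by linarith [hσ, sq σ]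
  have e3 : -σ * σ = -1 := by linarith [hσ, sq σ]
  rw [e2, e3] at h
  unfold energy
  linarith

end Onsager

/-! ### Riesz kernels and their integrals near the critical exponent. -/

section Riesz

open scoped ENNReal

variable {d : ℕ} [NeZero d]

theorem sphereArea_eq : sphereArea d = d * volume.real (Metric.ball (0 : Eu d) 1) := by
  rw [sphereArea, Measure.toSphere_real_apply_univ, finrank_euclideanSpace, Fintype.card_fin]

theorem sphereArea_pos : 0 < sphereArea d := by
  rw [sphereArea_eq]
  have h1 : (0 : ℝ) < d := by exact_mod_cast NeZero.pos d
  have h2 : 0 < volume.real (Metric.ball (0 : Eu d) 1) :=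
    ENNReal.toReal_pos (Metric.measure_ball_pos _ _ one_pos).ne' measure_ball_lt_top.ne
  positivity

theorem integrableOn_norm_rpow {b : ℝ} (hb : b < d) (R : ℝ) :
    IntegrableOn (fun u : Eu d => ‖u‖ ^ (-b)) (Metric.ball 0 R) := by
  have hd : 1 ≤ d := NeZero.one_le
  refine integrableOn_ball_of_norm_le_rpow (C := 1) (α := b) (by simpa using hd)
    (by simpa using hb) (ae_of_all _ fun x => ?_)
    (measurable_norm.pow_const _).aestronglyMeasurable
  rw [one_mul, Real.norm_of_nonneg (Real.rpow_nonneg (norm_nonneg _) _)]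

/-- Polar coordinates. This is the source of the normalisation (d - b) / |S^{d-1}|. -/
theorem integral_norm_rpow {b : ℝ} (hb : b < d) {R : ℝ} (hR : 0 < R) :
    ∫ u in Metric.ball (0 : Eu d) R, ‖u‖ ^ (-b) = sphereArea d * (R ^ (d - b) / (d - b)) := by
  have hd : 1 ≤ d := NeZero.one_le
  have : Nontrivial (Eu d) := Module.nontrivial_of_finrank_pos (R := ℝ)
    (by rw [finrank_euclideanSpace, Fintype.card_fin]; omega)
  rw [← integral_indicator measurableSet_ball]
  have e : ((Metric.ball (0 : Eu d) R).indicator fun u => ‖u‖ ^ (-b)) =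
      fun u => (Iio R).indicator (fun r : ℝ => r ^ (-b)) ‖u‖ := by
    funext u
    by_cases h : ‖u‖ < R <;> simp [h]
  rw [e, integral_fun_norm_addHaar volume, sphereArea_eq, finrank_euclideanSpace, Fintype.card_fin]
  have e2 : ∫ y in Ioi (0 : ℝ), y ^ (d - 1) • (Iio R).indicator (fun r : ℝ => r ^ (-b)) y =
      ∫ y in (0 : ℝ)..R, y ^ ((d : ℝ) - b - 1) := by
    rw [intervalIntegral.integral_of_le hR.le, integral_Ioc_eq_integral_Ioo,
      ← integral_indicator measurableSet_Ioi, ← integral_indicator measurableSet_Ioo]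
    congr 1
    funext y
    by_cases h0 : 0 < y
    · by_cases h1 : y < R
      · simp only [indicator, mem_Ioi, mem_Iio, mem_Ioo, h0, h1, and_self, if_true, smul_eq_mul]
        rw [← Real.rpow_natCast, ← Real.rpow_add h0, Nat.cast_sub hd]
        congr 1
        push_cast; ring
      · simp [h1]
    · simp [h0]
  rw [e2, integral_rpow (Or.inl (by linarith)), nsmul_eq_mul, smul_eq_mul,
    Real.zero_rpow (by linarith)]
  rw [show (d : ℝ) - b - 1 + 1 = d - b by ring]
  ring

/-- The kernel `(D / |x - y|) ^ b`. -/
def riesz (D b : ℝ) (x y : Eu d) : ℝ≥0∞ := ENNReal.ofReal (Real.exp (b * logDist D x y))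

theorem riesz_comm (D b : ℝ) (x y : Eu d) : riesz D b x y = riesz D b y x := by
  rw [riesz, logDist_comm, riesz]

theorem riesz_sq (D b : ℝ) (x y : Eu d) : riesz D (b / 2) x y ^ 2 = riesz D b x y := by
  rw [riesz, riesz, ← ENNReal.ofReal_pow (Real.exp_pos _).le, ← Real.exp_nat_mul]
  congr 2
  push_cast; ring

theorem measurable_logDist (D : ℝ) : Measurable fun p : Eu d × Eu d => logDist D p.1 p.2 :=
  Real.measurable_log.comp (measurable_const.div (measurable_fst.sub measurable_snd).norm)

@[fun_prop]
theorem measurable_riesz {α : Type*} [MeasurableSpace α] {u v : α → Eu d} (D b : ℝ)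
    (hu : Measurable u) (hv : Measurable v) : Measurable fun a => riesz D b (u a) (v a) :=
  (((measurable_logDist D).comp (hu.prodMk hv)).const_mul b).exp.ennreal_ofReal

theorem riesz_le (D b : ℝ) (hD : 0 < D) (hb : 0 ≤ b) (x y : Eu d) :
    riesz D b x y ≤ 1 + (Metric.ball (0 : Eu d) D).indicator
      (fun u => ENNReal.ofReal (D ^ b * ‖u‖ ^ (-b))) (x - y) := by
  rw [riesz]
  -- On the diagonal the conventions D / 0 = 0 and log 0 = 0 make the kernel equal to 1. The summand
  -- 1 covers this case as well as the distances at least D.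
  rcases eq_or_ne x y with rfl | hne
  · simp [logDist]
  have h0 : 0 < ‖x - y‖ := norm_pos_iff.2 (sub_ne_zero.2 hne)
  by_cases h : ‖x - y‖ < D
  · rw [indicator_of_mem (by simpa using h)]
    refine le_trans (le_of_eq ?_) le_add_self
    rw [logDist, mul_comm b, ← Real.rpow_def_of_pos (by positivity), Real.div_rpow hD.le h0.le,
      Real.rpow_neg h0.le, div_eq_mul_inv]
  · refine le_trans ?_ le_self_add
    rw [ENNReal.ofReal_le_one, Real.exp_le_one_iff]
    refine mul_nonpos_of_nonneg_of_nonpos hb (Real.log_nonpos (by positivity) ?_)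
    exact (div_le_one h0).2 (not_lt.1 h)

/-- The only divergence as b ↗ d is the simple pole of the radial integral. The constant is uniform
in b because D^b D^{d-b} = D^d. -/
theorem exists_lintegral_riesz_le {K : Set (Eu d)} (hK : IsCompact K) {D : ℝ} (hD : 0 < D) :
    ∃ A : ℝ, 0 < A ∧ ∀ b : ℝ, 0 < b → b < d → ∀ x : Eu d,
      ∫⁻ y in K, riesz D b x y ≤ ENNReal.ofReal (A / (d - b)) := by
  refine ⟨volume.real K * d + sphereArea d * D ^ (d : ℝ), ?_, fun b hb hbd x => ?_⟩
  · have := sphereArea_pos (d := d)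
    positivity
  have hdb : 0 < (d : ℝ) - b := sub_pos.2 hbd
  calc ∫⁻ y in K, riesz D b x y
      ≤ ∫⁻ y in K, (1 + (Metric.ball (0 : Eu d) D).indicator
          (fun u => ENNReal.ofReal (D ^ b * ‖u‖ ^ (-b))) (x - y)) :=
        lintegral_mono fun y => riesz_le D b hD hb.le x y
    _ = volume K + ∫⁻ y in K, (Metric.ball (0 : Eu d) D).indicator
          (fun u => ENNReal.ofReal (D ^ b * ‖u‖ ^ (-b))) (x - y) := by
        rw [lintegral_add_left measurable_const]
        simp
    _ ≤ volume K + ∫⁻ y, (Metric.ball (0 : Eu d) D).indicator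
          (fun u => ENNReal.ofReal (D ^ b * ‖u‖ ^ (-b))) (x - y) := by
        gcongr
        exact Measure.restrict_le_self
    _ = volume K + ENNReal.ofReal (D ^ b * (sphereArea d * (D ^ (d - b) / (d - b)))) := by
        rw [lintegral_sub_left_eq_self (μ := volume) ((Metric.ball (0 : Eu d) D).indicator
          (fun u => ENNReal.ofReal (D ^ b * ‖u‖ ^ (-b)))) x,
          lintegral_indicator measurableSet_ball, ← integral_norm_rpow hbd hD,
          ← integral_const_mul, ofReal_integral_eq_lintegral_ofReal
            ((integrableOn_norm_rpow hbd D).const_mul _) (ae_of_all _ fun u => by positivity)]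
    _ ≤ _ := by
        rw [← ENNReal.ofReal_toReal hK.measure_lt_top.ne, ← ENNReal.ofReal_add
          ENNReal.toReal_nonneg (by have := sphereArea_pos (d := d); positivity)]
        refine ENNReal.ofReal_le_ofReal ?_
        have e : D ^ b * (sphereArea d * (D ^ ((d : ℝ) - b) / (d - b))) =
            sphereArea d * D ^ (d : ℝ) / (d - b) := by
          rw [show (d : ℝ) = b + (d - b) by ring, Real.rpow_add hD]
          ring_nf
        rw [e, add_div]
        gcongr
        rw [le_div_iff₀ hdb]
        change volume.real K * (d - b) ≤ volume.real K * d
        exact mul_le_mul_of_nonneg_left (by linarith) measureReal_nonneg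

end Riesz

/-! ### Iterated integrals over four points and their symmetries. -/

section FourPoint

open scoped ENNReal

variable {d : ℕ} [NeZero d]

/-- The iterated integral of a function of four points of `K`. -/
def fourPoint (K : Set (Eu d)) (F : Eu d → Eu d → Eu d → Eu d → ℝ≥0∞) : ℝ≥0∞ :=
  ∫⁻ x in K, ∫⁻ y in K, ∫⁻ z in K, ∫⁻ t in K, F x y z t

/-- Joint measurability of a function of four points. -/
def FourMeasurable (F : Eu d → Eu d → Eu d → Eu d → ℝ≥0∞) : Prop :=
  Measurable fun p : Eu d × Eu d × Eu d × Eu d => F p.1 p.2.1 p.2.2.1 p.2.2.2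

variable {K : Set (Eu d)} {F G : Eu d → Eu d → Eu d → Eu d → ℝ≥0∞}

theorem fourPoint_mono (h : ∀ x y z t, F x y z t ≤ G x y z t) : fourPoint K F ≤ fourPoint K G :=
  lintegral_mono fun x => lintegral_mono fun y => lintegral_mono fun z => lintegral_mono fun t =>
    h x y z t

theorem FourMeasurable.comp (hF : FourMeasurable F) {α : Type*} [MeasurableSpace α]
    {u₁ u₂ u₃ u₄ : α → Eu d} (h₁ : Measurable u₁) (h₂ : Measurable u₂) (h₃ : Measurable u₃)
    (h₄ : Measurable u₄) : Measurable fun a => F (u₁ a) (u₂ a) (u₃ a) (u₄ a) :=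
  Measurable.comp (g := fun p : Eu d × Eu d × Eu d × Eu d => F p.1 p.2.1 p.2.2.1 p.2.2.2) hF
    (h₁.prodMk (h₂.prodMk (h₃.prodMk h₄)))

theorem fourPoint_add (hF : FourMeasurable F) :
    fourPoint K (fun x y z t => F x y z t + G x y z t) = fourPoint K F + fourPoint K G := by
  have h1 : ∀ x y z, Measurable fun t => F x y z t := fun x y z =>
    hF.comp measurable_const measurable_const measurable_const measurable_id
  have h2 : ∀ x y, Measurable fun z => ∫⁻ t in K, F x y z t := fun x y =>
    Measurable.lintegral_prod_right' (f := fun p : Eu d × Eu d => F x y p.1 p.2)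
      (hF.comp measurable_const measurable_const (by fun_prop) (by fun_prop))
  have h3 : ∀ x, Measurable fun y => ∫⁻ z in K, ∫⁻ t in K, F x y z t := fun x => by
    refine Measurable.lintegral_prod_right' (f := fun p : Eu d × Eu d => ∫⁻ t in K, F x p.1 p.2 t) ?_
    exact Measurable.lintegral_prod_right' (f := fun p : (Eu d × Eu d) × Eu d => F x p.1.1 p.1.2 p.2)
      (hF.comp measurable_const (by fun_prop) (by fun_prop) (by fun_prop))
  have h4 : Measurable fun x => ∫⁻ y in K, ∫⁻ z in K, ∫⁻ t in K, F x y z t := by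
    refine Measurable.lintegral_prod_right'
      (f := fun p : Eu d × Eu d => ∫⁻ z in K, ∫⁻ t in K, F p.1 p.2 z t) ?_
    refine Measurable.lintegral_prod_right'
      (f := fun p : (Eu d × Eu d) × Eu d => ∫⁻ t in K, F p.1.1 p.1.2 p.2 t) ?_
    exact Measurable.lintegral_prod_right'
      (f := fun p : ((Eu d × Eu d) × Eu d) × Eu d => F p.1.1.1 p.1.1.2 p.1.2 p.2)
      (hF.comp (by fun_prop) (by fun_prop) (by fun_prop) (by fun_prop))
  unfold fourPoint
  simp only [lintegral_add_left (h1 _ _ _), lintegral_add_left (h2 _ _), lintegral_add_left (h3 _),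
    lintegral_add_left h4]

theorem fourPoint_const_mul (c : ℝ≥0∞) (hc : c ≠ ∞) :
    fourPoint K (fun x y z t => c * F x y z t) = c * fourPoint K F := by
  unfold fourPoint
  simp only [lintegral_const_mul' c _ hc]

theorem fourPoint_swap34 (hF : FourMeasurable F) :
    fourPoint K (fun x y z t => F x y t z) = fourPoint K F := by
  unfold fourPoint
  refine lintegral_congr fun x => lintegral_congr fun y => ?_
  refine lintegral_lintegral_swap (f := fun z t => F x y t z) (Measurable.aemeasurable ?_)
  exact hF.comp measurable_const measurable_const measurable_snd measurable_fst

theorem fourPoint_swap23 (hF : FourMeasurable F) :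
    fourPoint K (fun x y z t => F x z y t) = fourPoint K F := by
  unfold fourPoint
  refine lintegral_congr fun x => ?_
  refine lintegral_lintegral_swap (f := fun y z => ∫⁻ t in K, F x z y t) (Measurable.aemeasurable ?_)
  exact Measurable.lintegral_prod_right' (f := fun p : (Eu d × Eu d) × Eu d => F x p.1.2 p.1.1 p.2)
    (hF.comp measurable_const (by fun_prop) (by fun_prop) (by fun_prop))

theorem fourPoint_swap12 (hF : FourMeasurable F) :
    fourPoint K (fun x y z t => F y x z t) = fourPoint K F := by
  unfold fourPoint
  refine lintegral_lintegral_swap (f := fun x y => ∫⁻ z in K, ∫⁻ t in K, F y x z t)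
    (Measurable.aemeasurable ?_)
  refine Measurable.lintegral_prod_right'
    (f := fun p : (Eu d × Eu d) × Eu d => ∫⁻ t in K, F p.1.2 p.1.1 p.2 t) ?_
  exact Measurable.lintegral_prod_right'
    (f := fun p : ((Eu d × Eu d) × Eu d) × Eu d => F p.1.1.2 p.1.1.1 p.1.2 p.2)
    (hF.comp (by fun_prop) (by fun_prop) (by fun_prop) (by fun_prop))

theorem fourPoint_rotate (hF : FourMeasurable F) :
    fourPoint K (fun x y z t => F x t y z) = fourPoint K F := by
  have h : FourMeasurable fun x y z t => F x z y t :=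
    hF.comp (by fun_prop) (by fun_prop) (by fun_prop) (by fun_prop)
  rw [← fourPoint_swap23 hF, ← fourPoint_swap34 h]

theorem fourPoint_exchange (hF : FourMeasurable F) :
    fourPoint K (fun x y z t => F z t x y) = fourPoint K F := by
  have h1 : FourMeasurable fun x y z t => F x z y t :=
    hF.comp (by fun_prop) (by fun_prop) (by fun_prop) (by fun_prop)
  have h2 : FourMeasurable fun x y z t => F y z x t :=
    hF.comp (by fun_prop) (by fun_prop) (by fun_prop) (by fun_prop)
  have h3 : FourMeasurable fun x y z t => F y t x z :=
    hF.comp (by fun_prop) (by fun_prop) (by fun_prop) (by fun_prop)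
  rw [← fourPoint_swap23 hF, ← fourPoint_swap12 h1, ← fourPoint_swap34 h2, ← fourPoint_swap23 h3]

/-- Points are integrated out one at a time, the last first, each factor being uniformly integrable
in its newest point. Only finite constants are pulled out of integrals, so no measurability is
required. -/
theorem fourPoint_mul_le {k : Eu d → Eu d → ℝ≥0∞} {l : Eu d → Eu d → Eu d → ℝ≥0∞}
    {m : Eu d → Eu d → Eu d → Eu d → ℝ≥0∞} {c₁ c₂ c₃ : ℝ≥0∞} (hk : ∀ x y, k x y ≠ ∞)
    (hl : ∀ x y z, l x y z ≠ ∞) (hc₂ : c₂ ≠ ∞) (hc₃ : c₃ ≠ ∞)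
    (h₁ : ∀ x, ∫⁻ y in K, k x y ≤ c₁) (h₂ : ∀ x y, ∫⁻ z in K, l x y z ≤ c₂)
    (h₃ : ∀ x y z, ∫⁻ t in K, m x y z t ≤ c₃) :
    fourPoint K (fun x y z t => k x y * (l x y z * m x y z t)) ≤ volume K * (c₁ * (c₂ * c₃)) := by
  unfold fourPoint
  calc ∫⁻ x in K, ∫⁻ y in K, ∫⁻ z in K, ∫⁻ t in K, k x y * (l x y z * m x y z t)
      ≤ ∫⁻ x in K, c₁ * (c₂ * c₃) := by
        refine lintegral_mono fun x => ?_
        calc ∫⁻ y in K, ∫⁻ z in K, ∫⁻ t in K, k x y * (l x y z * m x y z t)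
            ≤ ∫⁻ y in K, k x y * (c₂ * c₃) := by
              refine lintegral_mono fun y => ?_
              simp only [lintegral_const_mul' _ _ (hk x y)]
              refine mul_le_mul_right ?_ (k x y)
              calc ∫⁻ z in K, ∫⁻ t in K, l x y z * m x y z t ≤ ∫⁻ z in K, l x y z * c₃ := by
                    refine lintegral_mono fun z => ?_
                    simp only [lintegral_const_mul' _ _ (hl x y z)]
                    exact mul_le_mul_right (h₃ x y z) (l x y z)
                _ ≤ c₂ * c₃ := by
                    rw [lintegral_mul_const' _ _ hc₃]
                    exact mul_le_mul_left (h₂ x y) c₃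
          _ ≤ c₁ * (c₂ * c₃) := by
              rw [lintegral_mul_const' _ _ (ENNReal.mul_ne_top hc₂ hc₃)]
              exact mul_le_mul_left (h₁ x) _
    _ = volume K * (c₁ * (c₂ * c₃)) := by
        rw [lintegral_const, Measure.restrict_apply MeasurableSet.univ, univ_inter, mul_comm]

end FourPoint

/-! ### Orders of divergence of pairings and chains. -/

section Pairings

open scoped ENNReal

variable {d : ℕ} [NeZero d]

/-- The interaction of the two pairs `p, q` and `r, t`. -/
def pairRiesz (D b : ℝ) (p q r t : Eu d) : ℝ≥0∞ := riesz D b p q * riesz D b r t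

/-- The interaction of a pair `p, q` with two further points forming a tree with it. -/
def chainRiesz (D b : ℝ) (p q r t : Eu d) : ℝ≥0∞ :=
  riesz D b p q * ((riesz D (b / 2) r p + riesz D (b / 2) r q) *
    (riesz D (b / 2) t p + riesz D (b / 2) t q + riesz D (b / 2) t r)) +
  riesz D b p q * ((riesz D (b / 2) t p + riesz D (b / 2) t q) * riesz D (b / 2) r t)

open Classical in
/-- The interaction of the two pairs `p, q` and `r, t` away from the configurations in which the
pairs have diameter less than `ρ` and their distance is at least `δ`. -/
def farPairRiesz (D b ρ δ : ℝ) (p q r t : Eu d) : ℝ≥0∞ :=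
  if ‖p - q‖ < ρ ∧ ‖r - t‖ < ρ ∧ δ ≤ ‖p - r‖ then 0 else pairRiesz D b p q r t

theorem fourMeasurable_pairRiesz (D b : ℝ) : FourMeasurable (pairRiesz (d := d) D b) := by
  unfold FourMeasurable pairRiesz
  fun_prop

theorem fourMeasurable_chainRiesz (D b : ℝ) : FourMeasurable (chainRiesz (d := d) D b) := by
  unfold FourMeasurable chainRiesz
  fun_prop

theorem fourMeasurable_farPairRiesz (D b ρ δ : ℝ) :
    FourMeasurable (farPairRiesz (d := d) D b ρ δ) := by
  unfold FourMeasurable farPairRiesz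
  refine Measurable.ite ?_ measurable_const (fourMeasurable_pairRiesz D b)
  have h1 : Measurable fun p : Eu d × Eu d × Eu d × Eu d => ‖p.1 - p.2.1‖ := by fun_prop
  have h2 : Measurable fun p : Eu d × Eu d × Eu d × Eu d => ‖p.2.2.1 - p.2.2.2‖ := by fun_prop
  have h3 : Measurable fun p : Eu d × Eu d × Eu d × Eu d => ‖p.1 - p.2.2.1‖ := by fun_prop
  exact (measurableSet_lt h1 measurable_const).inter
    ((measurableSet_lt h2 measurable_const).inter (measurableSet_le measurable_const h3))

theorem riesz_ne_top (D b : ℝ) (x y : Eu d) : riesz D b x y ≠ ∞ := ENNReal.ofReal_ne_top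

-- Each full exponent b costs a factor 1/(d - b), while kernels of exponent b/2 ≤ d/2 are integrable
-- uniformly. A pairing has two full exponents and a chain only one. In the last estimate, either
-- one of the pairs has diameter at least ρ and its kernel is bounded, which leaves one pole, or the
-- two pairs are within δ, which leaves both poles but the volume of a small ball as a factor.
open Classical in
theorem exists_fourPoint_le {K : Set (Eu d)} (hK : IsCompact K) {D : ℝ} (hD : 0 < D) :
    ∃ A : ℝ, 0 < A ∧
      (∀ b : ℝ, 0 < b → b < d → fourPoint K (pairRiesz D b) ≤ ENNReal.ofReal (A / (d - b) ^ 2)) ∧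
      (∀ b : ℝ, 0 < b → b < d → fourPoint K (chainRiesz D b) ≤ ENNReal.ofReal (A / (d - b))) ∧
      ∀ ρ δ : ℝ, 0 < ρ → ∃ N : ℝ, 0 < N ∧ ∀ b : ℝ, 0 < b → b < d →
        fourPoint K (farPairRiesz D b ρ δ) ≤ ENNReal.ofReal (N / (d - b)) +
          ENNReal.ofReal (A * volume.real (Metric.ball (0 : Eu d) δ) / (d - b) ^ 2) := by
  obtain ⟨A₀, hA₀, hA⟩ := exists_lintegral_riesz_le hK hD
  have hd : (0 : ℝ) < d := by exact_mod_cast NeZero.pos d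
  set V : ℝ := volume.real K with hV
  have hV0 : 0 ≤ V := measureReal_nonneg
  have hVK : volume K = ENNReal.ofReal V := (ENNReal.ofReal_toReal hK.measure_lt_top.ne).symm
  -- For exponents b/2 with b < d one has A₀ / (d - b/2) ≤ 2 A₀ / d.
  set a : ℝ := 2 * A₀ / d with ha
  have ha0 : 0 < a := by positivity
  have hA' : ∀ b : ℝ, 0 < b → b < d → ∀ x : Eu d, ∫⁻ y in K, riesz D b y x ≤
      ENNReal.ofReal (A₀ / (d - b)) := fun b hb hbd x => by
    simp only [riesz_comm D b _ x]
    exact hA b hb hbd x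
  have hu : ∀ b : ℝ, 0 < b → b < d → ∀ x : Eu d, ∫⁻ y in K, riesz D (b / 2) y x ≤
      ENNReal.ofReal a := fun b hb hbd x => by
    refine (hA' (b / 2) (by positivity) (by linarith) x).trans (ENNReal.ofReal_le_ofReal ?_)
    rw [ha, div_le_div_iff₀ (by linarith) hd]
    nlinarith
  have hm : ∀ (b : ℝ) (x : Eu d), Measurable fun y => riesz D b y x := fun b x => by fun_prop
  have hu2 : ∀ b : ℝ, 0 < b → b < d → ∀ x y : Eu d,
      ∫⁻ z in K, (riesz D (b / 2) z x + riesz D (b / 2) z y) ≤ ENNReal.ofReal (2 * a) := by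
    intro b hb hbd x y
    rw [lintegral_add_left (hm _ _), two_mul, ENNReal.ofReal_add ha0.le ha0.le]
    exact add_le_add (hu b hb hbd x) (hu b hb hbd y)
  have hu3 : ∀ b : ℝ, 0 < b → b < d → ∀ x y z : Eu d,
      ∫⁻ t in K, (riesz D (b / 2) t x + riesz D (b / 2) t y + riesz D (b / 2) t z) ≤
        ENNReal.ofReal (3 * a) := by
    intro b hb hbd x y z
    rw [lintegral_add_right _ (hm _ _), show 3 * a = 2 * a + a by ring,
      ENNReal.ofReal_add (by positivity) ha0.le]
    exact add_le_add (hu2 b hb hbd x y) (hu b hb hbd z)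
  have hVint : ∫⁻ _ in K, 1 ≤ ENNReal.ofReal V := by
    rw [lintegral_const, Measure.restrict_apply MeasurableSet.univ, univ_inter, one_mul, hVK]
  refine ⟨V * (V * A₀ ^ 2) + V * (A₀ * (8 * a ^ 2)) + V * A₀ ^ 2 + 1, by positivity,
    fun b hb hbd => ?_, fun b hb hbd => ?_, fun ρ δ hρ => ?_⟩
  · have hdb : 0 < (d : ℝ) - b := sub_pos.2 hbd
    have h := fourPoint_mul_le (K := K) (k := riesz D b) (l := fun _ _ _ => 1)
      (m := fun _ _ z t => riesz D b z t) (riesz_ne_top D b) (fun _ _ _ => ENNReal.one_ne_top)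
      ENNReal.ofReal_ne_top ENNReal.ofReal_ne_top (hA b hb hbd) (fun _ _ => hVint)
      (fun _ _ z => hA b hb hbd z)
    simp only [one_mul] at h
    refine h.trans ?_
    rw [hVK, ← ENNReal.ofReal_mul hV0, ← ENNReal.ofReal_mul (by positivity),
      ← ENNReal.ofReal_mul hV0]
    refine ENNReal.ofReal_le_ofReal ?_
    rw [le_div_iff₀ (by positivity)]
    have e : V * (A₀ / (d - b) * (V * (A₀ / (d - b)))) * (d - b) ^ 2 = V * (V * A₀ ^ 2) := by
      field_simp
    rw [e]
    have : 0 ≤ V * (A₀ * (8 * a ^ 2)) + V * A₀ ^ 2 := by positivity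
    linarith
  · have hdb : 0 < (d : ℝ) - b := sub_pos.2 hbd
    have hne : ∀ x y : Eu d, riesz D (b / 2) x y ≠ ∞ := riesz_ne_top D (b / 2)
    have h1 := fourPoint_mul_le (K := K) (k := riesz D b)
      (l := fun x y z => riesz D (b / 2) z x + riesz D (b / 2) z y)
      (m := fun x y z t => riesz D (b / 2) t x + riesz D (b / 2) t y + riesz D (b / 2) t z)
      (riesz_ne_top D b) (fun _ _ _ => ENNReal.add_ne_top.2 ⟨hne _ _, hne _ _⟩)
      ENNReal.ofReal_ne_top ENNReal.ofReal_ne_top (hA b hb hbd) (hu2 b hb hbd) (hu3 b hb hbd)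
    have h2 := fourPoint_mul_le (K := K) (k := riesz D b)
      (l := fun x y z => riesz D (b / 2) z x + riesz D (b / 2) z y)
      (m := fun x y z t => riesz D (b / 2) t z)
      (riesz_ne_top D b) (fun _ _ _ => ENNReal.add_ne_top.2 ⟨hne _ _, hne _ _⟩)
      ENNReal.ofReal_ne_top ENNReal.ofReal_ne_top (hA b hb hbd) (hu2 b hb hbd)
      (fun _ _ z => hu b hb hbd z)
    rw [← fourPoint_swap34 (by unfold FourMeasurable; fun_prop)] at h2
    unfold chainRiesz
    rw [fourPoint_add (by unfold FourMeasurable; fun_prop)]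
    refine (add_le_add h1 h2).trans ?_
    rw [hVK, ← ENNReal.ofReal_mul (by positivity), ← ENNReal.ofReal_mul (by positivity),
      ← ENNReal.ofReal_mul hV0, ← ENNReal.ofReal_mul (by positivity),
      ← ENNReal.ofReal_mul (by positivity), ← ENNReal.ofReal_mul hV0,
      ← ENNReal.ofReal_add (by positivity) (by positivity)]
    refine ENNReal.ofReal_le_ofReal ?_
    rw [le_div_iff₀ hdb]
    have e : (V * (A₀ / (d - b) * (2 * a * (3 * a))) + V * (A₀ / (d - b) * (2 * a * a))) * (d - b) =
        V * (A₀ * (8 * a ^ 2)) := by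
      field_simp; ring
    rw [e]
    have : 0 ≤ V * (V * A₀ ^ 2) + V * A₀ ^ 2 := by positivity
    linarith
  · set N₀ : ℝ := Real.exp (d * |Real.log (D / ρ)|) with hN₀
    have hfar : ∀ b : ℝ, 0 < b → b < d → ∀ x y : Eu d,
        (if ‖x - y‖ < ρ then 0 else riesz D b x y) ≤ ENNReal.ofReal N₀ := by
      intro b hb hbd x y
      split_ifs with h
      · exact zero_le
      · refine ENNReal.ofReal_le_ofReal (Real.exp_le_exp.2 ?_)
        have h0 : 0 < ‖x - y‖ := hρ.trans_le (not_lt.1 h)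
        have h1 : logDist D x y ≤ |Real.log (D / ρ)| :=
          (Real.log_le_log (by positivity) (div_le_div_of_nonneg_left hD.le hρ (not_lt.1 h))).trans
            (le_abs_self _)
        exact (mul_le_mul_of_nonneg_left h1 hb.le).trans
          (mul_le_mul_of_nonneg_right hbd.le (abs_nonneg _))
    have hfar' : ∀ b : ℝ, 0 < b → b < d → ∀ x : Eu d,
        ∫⁻ y in K, (if ‖x - y‖ < ρ then 0 else riesz D b x y) ≤ ENNReal.ofReal (N₀ * V) := by
      intro b hb hbd x
      refine (lintegral_mono (hfar b hb hbd x)).trans (le_of_eq ?_)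
      rw [lintegral_const, Measure.restrict_apply MeasurableSet.univ, univ_inter, hVK,
        ENNReal.ofReal_mul (Real.exp_pos _).le]
    have hmfar : ∀ b : ℝ, Measurable fun p : Eu d × Eu d =>
        (if ‖p.1 - p.2‖ < ρ then 0 else riesz D b p.1 p.2) := fun b =>
      Measurable.ite (measurableSet_lt (measurable_fst.sub measurable_snd).norm measurable_const)
        measurable_const (by fun_prop)
    have hfarne : ∀ (b : ℝ) (x y : Eu d), (if ‖x - y‖ < ρ then 0 else riesz D b x y) ≠ ∞ := by
      intro b x y
      split_ifs
      · exact ENNReal.zero_ne_top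
      · exact riesz_ne_top _ _ _ _
    set κ : ℝ := volume.real (Metric.ball (0 : Eu d) δ) with hκ
    have hκ0 : 0 ≤ κ := measureReal_nonneg
    have hball : ∀ x : Eu d, ∫⁻ z in K, (if δ ≤ ‖x - z‖ then 0 else (1 : ℝ≥0∞)) ≤
        ENNReal.ofReal κ := by
      intro x
      have e : (fun z : Eu d => (if δ ≤ ‖x - z‖ then 0 else (1 : ℝ≥0∞))) =
          (Metric.ball x δ).indicator 1 := by
        funext z
        by_cases h : δ ≤ ‖x - z‖
        · rw [if_pos h, indicator_of_notMem]
          rw [Metric.mem_ball, dist_comm, dist_eq_norm]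
          exact not_lt.2 h
        · rw [if_neg h, indicator_of_mem]
          · rfl
          · rw [Metric.mem_ball, dist_comm, dist_eq_norm]
            exact not_le.1 h
      rw [e, lintegral_indicator_one measurableSet_ball]
      refine (Measure.restrict_apply_le _ _).trans (le_of_eq ?_)
      rw [Measure.addHaar_ball_center, hκ, measureReal_def,
        ENNReal.ofReal_toReal measure_ball_lt_top.ne]
    refine ⟨V * (N₀ * V * V * A₀) * 2 + 1, by positivity, fun b hb hbd => ?_⟩
    have hdb : 0 < (d : ℝ) - b := sub_pos.2 hbd
    have h1 := fourPoint_mul_le (K := K) (k := fun x y => if ‖x - y‖ < ρ then 0 else riesz D b x y)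
      (l := fun _ _ _ => 1) (m := fun _ _ z t => riesz D b z t) (hfarne b)
      (fun _ _ _ => ENNReal.one_ne_top)
      ENNReal.ofReal_ne_top ENNReal.ofReal_ne_top (hfar' b hb hbd) (fun _ _ => hVint)
      (fun _ _ z => hA b hb hbd z)
    have h2 := fourPoint_mul_le (K := K) (k := riesz D b)
      (l := fun _ _ _ => 1) (m := fun _ _ x y => if ‖x - y‖ < ρ then 0 else riesz D b x y)
      (riesz_ne_top D b) (fun _ _ _ => ENNReal.one_ne_top)
      ENNReal.ofReal_ne_top ENNReal.ofReal_ne_top (hA b hb hbd) (fun _ _ => hVint)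
      (fun _ _ z => hfar' b hb hbd z)
    have h3 := fourPoint_mul_le (K := K) (k := riesz D b)
      (l := fun x _ z => if δ ≤ ‖x - z‖ then 0 else (1 : ℝ≥0∞)) (m := fun _ _ z t => riesz D b z t)
      (riesz_ne_top D b) (fun _ _ _ => by split_ifs <;> simp)
      ENNReal.ofReal_ne_top ENNReal.ofReal_ne_top (hA b hb hbd) (fun x _ => hball x)
      (fun _ _ z => hA b hb hbd z)
    simp only [one_mul] at h1 h2
    have hle : ∀ x y z t : Eu d, farPairRiesz D b ρ δ x y z t ≤
        (if ‖x - y‖ < ρ then 0 else riesz D b x y) * riesz D b z t +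
        (riesz D b x y * (if ‖z - t‖ < ρ then 0 else riesz D b z t) +
         riesz D b x y * ((if δ ≤ ‖x - z‖ then 0 else (1 : ℝ≥0∞)) * riesz D b z t)) := by
      intro x y z t
      unfold farPairRiesz pairRiesz
      by_cases c1 : ‖x - y‖ < ρ
      · by_cases c2 : ‖z - t‖ < ρ
        · by_cases c3 : δ ≤ ‖x - z‖ <;> simp [c1, c2, c3]
        · simp only [c1, c2, if_true, if_false, false_and, and_false]
          exact le_self_add.trans le_add_self
      · simp only [c1, if_false, false_and]
        exact le_self_add
    refine (fourPoint_mono hle).trans ?_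
    rw [fourPoint_add, fourPoint_add]
    · refine (add_le_add h1 (add_le_add h2 h3)).trans ?_
      rw [hVK, ← ENNReal.ofReal_mul hV0, ← ENNReal.ofReal_mul (by positivity),
        ← ENNReal.ofReal_mul hV0, ← ENNReal.ofReal_mul hV0, ← ENNReal.ofReal_mul (by positivity),
        ← ENNReal.ofReal_mul hV0, ← ENNReal.ofReal_mul hκ0, ← ENNReal.ofReal_mul (by positivity),
        ← ENNReal.ofReal_mul hV0, ← add_assoc,
        ← ENNReal.ofReal_add (by positivity) (by positivity)]
      refine add_le_add (ENNReal.ofReal_le_ofReal ?_) (ENNReal.ofReal_le_ofReal ?_)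
      · rw [le_div_iff₀ hdb]
        have e : (V * (N₀ * V * (V * (A₀ / (d - b)))) + V * (A₀ / (d - b) * (V * (N₀ * V)))) *
            (d - b) = V * (N₀ * V * V * A₀) * 2 := by
          field_simp; ring
        rw [e]; linarith
      · rw [le_div_iff₀ (by positivity)]
        have e : V * (A₀ / (d - b) * (κ * (A₀ / (d - b)))) * (d - b) ^ 2 = V * A₀ ^ 2 * κ := by
          field_simp
        rw [e]
        refine mul_le_mul_of_nonneg_right ?_ hκ0
        have : 0 ≤ V * (V * A₀ ^ 2) + V * (A₀ * (8 * a ^ 2)) := by positivity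
        linarith
    · have := (hmfar b).comp (f := fun p : Eu d × Eu d × Eu d × Eu d => (p.2.2.1, p.2.2.2))
        (by fun_prop)
      exact Measurable.mul (by fun_prop) this
    · have := (hmfar b).comp (f := fun p : Eu d × Eu d × Eu d × Eu d => (p.1, p.2.1))
        (by fun_prop)
      exact Measurable.mul this (by fun_prop)

end Pairings

/-! ### The majorant of the four-point function and its smallness. -/

section Majorant

open scoped ENNReal

variable {d : ℕ} [NeZero d]

/-- The majorant attached to the pairing `{p, q}, {r, t}`. -/
def pairMajorant (D b ρ δ : ℝ) (τ N : ℝ≥0∞) (p q r t : Eu d) : ℝ≥0∞ :=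
  τ * pairRiesz D b p q r t +
    N * (farPairRiesz D b ρ δ p q r t + (chainRiesz D b p q r t + chainRiesz D b r t p q))

/-- The sum of the majorants over the three pairings of four points. -/
def majorant (D b ρ δ : ℝ) (τ N : ℝ≥0∞) (x y z t : Eu d) : ℝ≥0∞ :=
  pairMajorant D b ρ δ τ N x y z t +
    (pairMajorant D b ρ δ τ N x z y t + pairMajorant D b ρ δ τ N x t y z)

theorem fourMeasurable_pairMajorant (D b ρ δ : ℝ) (τ N : ℝ≥0∞) :
    FourMeasurable (pairMajorant (d := d) D b ρ δ τ N) := by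
  have h1 := fourMeasurable_pairRiesz (d := d) D b
  have h2 := fourMeasurable_farPairRiesz (d := d) D b ρ δ
  have h3 := fourMeasurable_chainRiesz (d := d) D b
  exact (h1.const_mul τ).add ((h2.add (h3.add (h3.comp (by fun_prop) (by fun_prop) (by fun_prop)
    (by fun_prop)))).const_mul N)

theorem fourPoint_majorant {K : Set (Eu d)} (D b ρ δ : ℝ) {τ N : ℝ≥0∞} (hτ : τ ≠ ∞) (hN : N ≠ ∞) :
    fourPoint K (majorant D b ρ δ τ N) = 3 * (τ * fourPoint K (pairRiesz D b) +
      N * (fourPoint K (farPairRiesz D b ρ δ) +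
        (fourPoint K (chainRiesz D b) + fourPoint K (chainRiesz D b)))) := by
  have h := fourMeasurable_pairMajorant (d := d) D b ρ δ τ N
  have h1 := fourMeasurable_pairRiesz (d := d) D b
  have h2 := fourMeasurable_farPairRiesz (d := d) D b ρ δ
  have h3 := fourMeasurable_chainRiesz (d := d) D b
  have e : fourPoint K (pairMajorant D b ρ δ τ N) = τ * fourPoint K (pairRiesz D b) +
      N * (fourPoint K (farPairRiesz D b ρ δ) +
        (fourPoint K (chainRiesz D b) + fourPoint K (chainRiesz D b))) := by
    unfold pairMajorant
    have h1' : FourMeasurable fun x y z t => τ * pairRiesz (d := d) D b x y z t := h1.const_mul τ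
    rw [fourPoint_add h1', fourPoint_const_mul _ hτ, fourPoint_const_mul _ hN,
      fourPoint_add h2, fourPoint_add h3, fourPoint_exchange h3]
  unfold majorant
  have h' : FourMeasurable fun x y z t => pairMajorant (d := d) D b ρ δ τ N x z y t :=
    h.comp (by fun_prop) (by fun_prop) (by fun_prop) (by fun_prop)
  rw [fourPoint_add h, fourPoint_add h', fourPoint_swap23 h, fourPoint_rotate h]
  change fourPoint K (pairMajorant D b ρ δ τ N) + (fourPoint K (pairMajorant D b ρ δ τ N) +
    fourPoint K (pairMajorant D b ρ δ τ N)) = _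
  rw [e]
  ring

theorem exists_volume_ball_le {ε : ℝ} (hε : 0 < ε) :
    ∃ δ : ℝ, 0 < δ ∧ volume.real (Metric.ball (0 : Eu d) δ) ≤ ε := by
  set v := volume.real (Metric.ball (0 : Eu d) 1) with hv
  have hv0 : 0 ≤ v := measureReal_nonneg
  refine ⟨min 1 (ε / (v + 1)), by positivity, ?_⟩
  set δ := min 1 (ε / (v + 1)) with hδ
  have hδ0 : 0 < δ := by positivity
  have e : volume.real (Metric.ball (0 : Eu d) δ) = δ ^ d * v := by
    rw [measureReal_def, Measure.addHaar_ball _ _ hδ0.le, ENNReal.toReal_mul,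
      ENNReal.toReal_ofReal (by positivity), finrank_euclideanSpace, Fintype.card_fin]
    rfl
  rw [e]
  calc δ ^ d * v ≤ δ * v := mul_le_mul_of_nonneg_right
        (pow_le_of_le_one hδ0.le (min_le_left _ _) (NeZero.ne d)) hv0
    _ ≤ ε / (v + 1) * v := mul_le_mul_of_nonneg_right (min_le_right _ _) hv0
    _ ≤ ε := by
        rw [div_mul_eq_mul_div, div_le_iff₀ (by positivity)]
        nlinarith

/-- Three contributions of at most ε/3 each: τ times the double pole, the close pairs through the
volume of the δ-ball, and the simple poles, which vanish after multiplication by (d - b)². The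
numbers τ and δ are fixed before ρ because in the application ρ depends on them. The constant
depending on ρ sits at a simple pole and is absorbed by letting b ↗ d. -/
theorem exists_fourPoint_majorant_le {K : Set (Eu d)} (hK : IsCompact K) {D : ℝ} (hD : 0 < D)
    {N ε : ℝ} (hN : 0 < N) (hε : 0 < ε) :
    ∃ τ δ : ℝ, 0 < τ ∧ 0 < δ ∧ ∀ ρ : ℝ, 0 < ρ → ∀ᶠ b in 𝓝[<] (d : ℝ),
      ENNReal.ofReal ((d - b) ^ 2) * fourPoint K (majorant D b ρ δ (ENNReal.ofReal τ)
        (ENNReal.ofReal N)) ≤ ENNReal.ofReal ε := by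
  obtain ⟨A, hA, hpair, hchain, hfar⟩ := exists_fourPoint_le hK hD
  obtain ⟨δ, hδ, hball⟩ := exists_volume_ball_le (d := d) (ε := ε / (9 * N * A)) (by positivity)
  have hd : (0 : ℝ) < d := by exact_mod_cast NeZero.pos d
  refine ⟨ε / (9 * A), δ, by positivity, hδ, fun ρ hρ => ?_⟩
  obtain ⟨N₁, hN₁, hfar⟩ := hfar ρ δ hρ
  set κ := volume.real (Metric.ball (0 : Eu d) δ) with hκ
  have hκ0 : 0 ≤ κ := measureReal_nonneg
  have hm : max 0 (d - ε / (9 * N * (N₁ + 2 * A))) < (d : ℝ) :=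
    max_lt hd (sub_lt_self _ (by positivity))
  filter_upwards [Ioo_mem_nhdsLT hm] with b hb
  have hbd : b < d := hb.2
  have hb0 : 0 < b := (le_max_left _ _).trans_lt hb.1
  have hb1 : (d : ℝ) - b ≤ ε / (9 * N * (N₁ + 2 * A)) := by
    have := (le_max_right 0 (d - ε / (9 * N * (N₁ + 2 * A)))).trans_lt hb.1
    linarith
  have hdb : 0 < (d : ℝ) - b := sub_pos.2 hbd
  rw [fourPoint_majorant D b ρ δ ENNReal.ofReal_ne_top ENNReal.ofReal_ne_top]
  calc ENNReal.ofReal ((d - b) ^ 2) * (3 * (ENNReal.ofReal (ε / (9 * A)) *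
        fourPoint K (pairRiesz D b) + ENNReal.ofReal N * (fourPoint K (farPairRiesz D b ρ δ) +
        (fourPoint K (chainRiesz D b) + fourPoint K (chainRiesz D b)))))
      ≤ ENNReal.ofReal ((d - b) ^ 2) * (ENNReal.ofReal 3 * (ENNReal.ofReal (ε / (9 * A)) *
        ENNReal.ofReal (A / (d - b) ^ 2) + ENNReal.ofReal N * ((ENNReal.ofReal (N₁ / (d - b)) +
          ENNReal.ofReal (A * κ / (d - b) ^ 2)) +
        (ENNReal.ofReal (A / (d - b)) + ENNReal.ofReal (A / (d - b)))))) := by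
        rw [show ENNReal.ofReal 3 = 3 by simp]
        gcongr
        exacts [hpair b hb0 hbd, hfar b hb0 hbd, hchain b hb0 hbd, hchain b hb0 hbd]
    _ = ENNReal.ofReal ((d - b) ^ 2 * (3 * (ε / (9 * A) * (A / (d - b) ^ 2) +
          N * ((N₁ / (d - b) + A * κ / (d - b) ^ 2) + (A / (d - b) + A / (d - b)))))) := by
        rw [← ENNReal.ofReal_add (by positivity) (by positivity),
          ← ENNReal.ofReal_add (by positivity) (by positivity),
          ← ENNReal.ofReal_add (by positivity) (by positivity),
          ← ENNReal.ofReal_mul (by positivity), ← ENNReal.ofReal_mul (by positivity),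
          ← ENNReal.ofReal_add (by positivity) (by positivity),
          ← ENNReal.ofReal_mul (by positivity), ← ENNReal.ofReal_mul (by positivity)]
    _ ≤ ENNReal.ofReal ε := by
        refine ENNReal.ofReal_le_ofReal ?_
        have e : (d - b) ^ 2 * (3 * (ε / (9 * A) * (A / (d - b) ^ 2) +
            N * ((N₁ / (d - b) + A * κ / (d - b) ^ 2) + (A / (d - b) + A / (d - b))))) =
            ε / 3 + 3 * N * A * κ + 3 * N * (N₁ + 2 * A) * (d - b) := by
          field_simp
          ring
        rw [e]
        have h1 : 3 * N * A * κ ≤ ε / 3 := by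
          calc 3 * N * A * κ ≤ 3 * N * A * (ε / (9 * N * A)) := by gcongr
            _ = ε / 3 := by field_simp; norm_num
        have h2 : 3 * N * (N₁ + 2 * A) * (d - b) ≤ ε / 3 := by
          calc 3 * N * (N₁ + 2 * A) * (d - b) ≤
              3 * N * (N₁ + 2 * A) * (ε / (9 * N * (N₁ + 2 * A))) := by gcongr
            _ = ε / 3 := by field_simp; norm_num
        linarith

end Majorant

/-! ### Exponential integrals over the interpolation parameters. -/

section ExpIntegrals

open scoped ENNReal

theorem integral_exp_mul_eq {a : ℝ} (ha : 0 < a) :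
    ∫ s in (0 : ℝ)..1, Real.exp (a * s) = (Real.exp a - 1) / a := by
  rw [intervalIntegral.integral_comp_mul_left (fun s => Real.exp s) ha.ne', integral_exp]
  simp only [mul_zero, mul_one, Real.exp_zero, smul_eq_mul]
  field_simp

theorem integral_exp_mul_le_div {a : ℝ} (ha : 0 < a) :
    ∫ s in (0 : ℝ)..1, Real.exp (a * s) ≤ Real.exp a / a := by
  rw [integral_exp_mul_eq ha]
  gcongr
  linarith

theorem integral_exp_mul_le {a : ℝ} (ha : 0 ≤ a) :
    ∫ s in (0 : ℝ)..1, Real.exp (a * s) ≤ Real.exp a := by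
  calc ∫ s in (0 : ℝ)..1, Real.exp (a * s) ≤ ∫ s in (0 : ℝ)..1, Real.exp a := by
        refine intervalIntegral.integral_mono_on zero_le_one
          (Continuous.intervalIntegrable (by fun_prop) _ _) (by simp) fun s hs => ?_
        exact Real.exp_le_exp.2 (mul_le_of_le_one_right ha hs.2)
    _ = Real.exp a := by simp

/-- The integration over s gains the inverse of kl, exactly compensating the logarithmic prefactor
l. Without it the four-point function would exceed the order of the pairings by logarithms. -/
theorem integral_add_mul_exp_le {M l k : ℝ} (hM : 0 ≤ M) (hl : 0 ≤ l) (hk : 0 < k) :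
    ∫ s in (0 : ℝ)..1, (M + l) * Real.exp (k * l * s) ≤ (M + 1 / k) * Real.exp (k * l) := by
  rw [intervalIntegral.integral_const_mul, add_mul, add_mul]
  refine add_le_add (mul_le_mul_of_nonneg_left (integral_exp_mul_le (by positivity)) hM) ?_
  rcases hl.eq_or_lt with rfl | hl
  · rw [zero_mul]; positivity
  calc l * ∫ s in (0 : ℝ)..1, Real.exp (k * l * s) ≤ l * (Real.exp (k * l) / (k * l)) :=
        mul_le_mul_of_nonneg_left (integral_exp_mul_le_div (by positivity)) hl.le
    _ = 1 / k * Real.exp (k * l) := by field_simp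

/-- The factor 1 - s vanishes where the exponential is largest, which gains a second power of 1/a.
-/
theorem integral_one_sub_mul_exp_le {a : ℝ} (ha : 0 < a) :
    ∫ s in (0 : ℝ)..1, (1 - s) * Real.exp (a * s) ≤ Real.exp a / a ^ 2 := by
  have h : ∀ s ∈ uIcc (0 : ℝ) 1, HasDerivAt
      (fun s => ((1 - s) / a + 1 / a ^ 2) * Real.exp (a * s)) ((1 - s) * Real.exp (a * s)) s := by
    intro s _
    have h1 : HasDerivAt (fun s : ℝ => (1 - s) / a + 1 / a ^ 2) (-1 / a) s :=
      (((hasDerivAt_id s).const_sub 1).div_const a).add_const _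
    have h2 : HasDerivAt (fun s : ℝ => Real.exp (a * s)) (Real.exp (a * s) * (a * 1)) s :=
      ((hasDerivAt_id s).const_mul a).exp
    refine (h1.mul h2).congr_deriv ?_
    field_simp
    ring
  rw [intervalIntegral.integral_eq_sub_of_hasDerivAt h
    (Continuous.intervalIntegrable (by fun_prop) _ _)]
  simp only [mul_one, mul_zero, Real.exp_zero, sub_self, zero_div, zero_add, sub_zero]
  have : 0 < 1 / a + 1 / a ^ 2 := by positivity
  rw [div_eq_mul_inv (Real.exp a), one_div (a ^ 2)]
  linarith [mul_comm (Real.exp a) (a ^ 2)⁻¹, one_div (a ^ 2)]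

theorem lintegral_unitInterval_ofReal {α : ℝ → ℝ} (hα : Continuous α)
    (h0 : ∀ s ∈ Icc (0 : ℝ) 1, 0 ≤ α s) :
    ∫⁻ s : unitInterval, ENNReal.ofReal (α s) = ENNReal.ofReal (∫ s in (0 : ℝ)..1, α s) := by
  rw [← integral_unitInterval, ofReal_integral_eq_lintegral_ofReal]
  · exact ((hα.comp continuous_subtype_val).integrable_of_hasCompactSupport
      (HasCompactSupport.of_compactSpace _))
  · exact ae_of_all _ fun s => h0 s s.2

theorem lintegral_unitInterval_mul {α β : ℝ → ℝ} {k : ℝ} (hk : 0 ≤ k) (hα : Continuous α)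
    (hβ : Continuous β) (hα0 : ∀ s ∈ Icc (0 : ℝ) 1, 0 ≤ α s)
    (hβ0 : ∀ s ∈ Icc (0 : ℝ) 1, 0 ≤ β s) :
    ∫⁻ s : unitInterval, ∫⁻ s' : unitInterval, ENNReal.ofReal (k * (α s * β s')) =
      ENNReal.ofReal (k * ((∫ s in (0 : ℝ)..1, α s) * ∫ s in (0 : ℝ)..1, β s)) := by
  have e : ∀ s s' : unitInterval, ENNReal.ofReal (k * (α s * β s')) =
      ENNReal.ofReal k * ENNReal.ofReal (α s) * ENNReal.ofReal (β s') := fun s s' => by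
    rw [ENNReal.ofReal_mul hk, ENNReal.ofReal_mul (hα0 s s.2), mul_assoc]
  simp only [e]
  simp only [lintegral_const_mul' _ _ (ENNReal.mul_ne_top ENNReal.ofReal_ne_top
    ENNReal.ofReal_ne_top), lintegral_unitInterval_ofReal hβ hβ0]
  rw [lintegral_mul_const' _ _ ENNReal.ofReal_ne_top, lintegral_const_mul' _ _ ENNReal.ofReal_ne_top,
    lintegral_unitInterval_ofReal hα hα0, ENNReal.ofReal_mul hk, ENNReal.ofReal_mul
      (intervalIntegral.integral_nonneg zero_le_one hα0), mul_assoc]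

theorem lintegral_unitInterval_le {F : ℝ → ℝ → ℝ} {k₁ k₂ m₁ m₁' m₂ m₂' : ℝ}
    {α₁ α₁' α₂ α₂' : ℝ → ℝ} (hk₁ : 0 ≤ k₁) (hk₂ : 0 ≤ k₂)
    (c₁ : Continuous α₁) (c₁' : Continuous α₁') (c₂ : Continuous α₂) (c₂' : Continuous α₂')
    (p₁ : ∀ s ∈ Icc (0 : ℝ) 1, 0 ≤ α₁ s) (p₁' : ∀ s ∈ Icc (0 : ℝ) 1, 0 ≤ α₁' s)
    (p₂ : ∀ s ∈ Icc (0 : ℝ) 1, 0 ≤ α₂ s) (p₂' : ∀ s ∈ Icc (0 : ℝ) 1, 0 ≤ α₂' s)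
    (h₁ : ∫ s in (0 : ℝ)..1, α₁ s ≤ m₁) (h₁' : ∫ s in (0 : ℝ)..1, α₁' s ≤ m₁')
    (h₂ : ∫ s in (0 : ℝ)..1, α₂ s ≤ m₂) (h₂' : ∫ s in (0 : ℝ)..1, α₂' s ≤ m₂')
    (hF : ∀ s ∈ Icc (0 : ℝ) 1, ∀ s' ∈ Icc (0 : ℝ) 1,
      F s s' ≤ k₁ * (α₁ s * α₁' s') + k₂ * (α₂ s * α₂' s')) :
    ∫⁻ s : unitInterval, ∫⁻ s' : unitInterval, ENNReal.ofReal (F s s') ≤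
      ENNReal.ofReal (k₁ * (m₁ * m₁') + k₂ * (m₂ * m₂')) := by
  have i₁ := intervalIntegral.integral_nonneg (μ := volume) zero_le_one p₁
  have i₁' := intervalIntegral.integral_nonneg (μ := volume) zero_le_one p₁'
  have i₂ := intervalIntegral.integral_nonneg (μ := volume) zero_le_one p₂
  have i₂' := intervalIntegral.integral_nonneg (μ := volume) zero_le_one p₂'
  calc ∫⁻ s : unitInterval, ∫⁻ s' : unitInterval, ENNReal.ofReal (F s s')
      ≤ ∫⁻ s : unitInterval, ∫⁻ s' : unitInterval, (ENNReal.ofReal (k₁ * (α₁ s * α₁' s')) +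
          ENNReal.ofReal (k₂ * (α₂ s * α₂' s'))) :=
        lintegral_mono fun s => lintegral_mono fun s' =>
          (ENNReal.ofReal_le_ofReal (hF s s.2 s' s'.2)).trans ENNReal.ofReal_add_le
    _ = ENNReal.ofReal (k₁ * ((∫ s in (0 : ℝ)..1, α₁ s) * ∫ s in (0 : ℝ)..1, α₁' s)) +
        ENNReal.ofReal (k₂ * ((∫ s in (0 : ℝ)..1, α₂ s) * ∫ s in (0 : ℝ)..1, α₂' s)) := by
        have hm : Measurable fun p : unitInterval × unitInterval =>
            ENNReal.ofReal (k₁ * (α₁ p.1 * α₁' p.2)) :=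
          Measurable.ennreal_ofReal (Continuous.measurable (by fun_prop))
        rw [← lintegral_unitInterval_mul hk₁ c₁ c₁' p₁ p₁',
          ← lintegral_unitInterval_mul hk₂ c₂ c₂' p₂ p₂', ← lintegral_add_left]
        · refine lintegral_congr fun s => ?_
          rw [lintegral_add_left]
          exact hm.comp (f := fun s' => (s, s')) (by fun_prop)
        · exact Measurable.lintegral_prod_right' hm
    _ ≤ _ := by
        rw [← ENNReal.ofReal_add (by positivity) (by positivity)]
        refine ENNReal.ofReal_le_ofReal ?_
        have a₁ := mul_le_mul h₁ h₁' i₁' (i₁.trans h₁)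
        have a₂ := mul_le_mul h₂ h₂' i₂' (i₂.trans h₂)
        exact add_le_add (mul_le_mul_of_nonneg_left a₁ hk₁) (mul_le_mul_of_nonneg_left a₂ hk₂)

end ExpIntegrals

/-! ### Logarithmic kernels and pointwise domination by pairings and chains. -/

section Pointwise

open scoped ENNReal

variable {d : ℕ} [NeZero d]

/-- A kernel on `K` with a logarithmic singularity satisfying an Onsager type inequality. -/
structure IsLogKernelOn (K : Set (Eu d)) (D M : ℝ) (C : Eu d → Eu d → ℝ) : Prop where
  pos : 0 < D
  nonneg : 0 ≤ M
  norm_sub_le : ∀ x ∈ K, ∀ y ∈ K, ‖x - y‖ ≤ D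
  sub_log : ∀ x ∈ K, ∀ y ∈ K, x ≠ y → |C x y - logDist D x y| ≤ M
  equicontinuous : ∀ δ : ℝ, 0 < δ → ∀ ω : ℝ, 0 < ω → ∃ ρ : ℝ, 0 < ρ ∧
    ∀ x ∈ K, ∀ y ∈ K, ∀ x' ∈ K, ∀ y' ∈ K, δ ≤ ‖x - x'‖ → ‖x - y‖ < ρ → ‖x' - y'‖ < ρ →
      |C y y' - C x x'| ≤ ω
  energy_le : ∀ x ∈ K, ∀ y ∈ K, ∀ x' ∈ K, ∀ y' ∈ K,
    x ≠ y → x ≠ x' → x ≠ y' → y ≠ x' → y ≠ y' → x' ≠ y' →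
    ∀ σ s s' : ℝ, σ ^ 2 = 1 → s ∈ Icc (0 : ℝ) 1 → s' ∈ Icc (0 : ℝ) 1 →
      energy C σ s s' x y x' y' ≤ (s ^ 2 * maxLog D x y x' y' + maxLog D y x x' y' +
        s' ^ 2 * maxLog D x' x y y' + maxLog D y' x y x') / 2 + M

/-- The truncated four-point correlation. -/
def fourCorr (C : Eu d → Eu d → ℝ) (b θ σ : ℝ) (x y x' y' : Eu d) (s s' : ℝ) : ℝ :=
  b ^ 2 * (C x y * C x' y') * (Real.exp (b * energy C σ s s' x y x' y') -
    θ * Real.exp (b * (s * C x y + s' * C x' y')))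

/-- The absolute truncated four-point correlation, integrated over the interpolation parameters. -/
def fourCorrInt (C : Eu d → Eu d → ℝ) (b θ σ : ℝ) (x y x' y' : Eu d) : ℝ≥0∞ :=
  ∫⁻ s : unitInterval, ∫⁻ s' : unitInterval,
    ENNReal.ofReal |fourCorr C b θ σ x y x' y' s s'|

variable {K : Set (Eu d)} {D M : ℝ} {C : Eu d → Eu d → ℝ}

theorem IsLogKernelOn.logDist_nonneg (h : IsLogKernelOn K D M C) {x y : Eu d} (hx : x ∈ K)
    (hy : y ∈ K) : 0 ≤ logDist D x y :=
  ImagChaos.logDist_nonneg (h.norm_sub_le x hx y hy)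

theorem IsLogKernelOn.abs_cov_le (h : IsLogKernelOn K D M C) {x y : Eu d} (hx : x ∈ K)
    (hy : y ∈ K) (hxy : x ≠ y) : |C x y| ≤ M + logDist D x y := by
  have h1 := abs_le.1 (h.sub_log x hx y hy hxy)
  have h2 := h.logDist_nonneg hx hy
  exact abs_le.2 ⟨by linarith [h1.1, h.nonneg], by linarith [h1.2]⟩

theorem IsLogKernelOn.neg_le (h : IsLogKernelOn K D M C) {x y : Eu d} (hx : x ∈ K)
    (hy : y ∈ K) (hxy : x ≠ y) : -M ≤ C x y := by
  have h1 := abs_le.1 (h.sub_log x hx y hy hxy)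
  have h2 := h.logDist_nonneg hx hy
  linarith [h1.1]

/-- Away from the diagonal the logarithmic interaction is at most |log(D / δ)|. The bound serves for
every pair of points on opposite sides of two distant clusters. -/
theorem IsLogKernelOn.abs_cov_le_of_far (h : IsLogKernelOn K D M C) {δ : ℝ} (hδ : 0 < δ) {x y : Eu d}
    (hx : x ∈ K) (hy : y ∈ K) (hxy : δ ≤ ‖x - y‖) : |C x y| ≤ M + |Real.log (D / δ)| := by
  have hne : x ≠ y := by
    rintro rfl
    rw [sub_self, norm_zero] at hxy
    linarith
  refine (h.abs_cov_le hx hy hne).trans (add_le_add_right ?_ M)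
  have := h.pos
  exact (Real.log_le_log (by have := hδ.trans_le hxy; positivity)
    (div_le_div_of_nonneg_left h.pos.le hδ hxy)).trans (le_abs_self _)

theorem le_logDist {D Λ : ℝ} (hD : 0 < D) {x y : Eu d} (hxy : x ≠ y)
    (h : ‖x - y‖ < D * Real.exp (-Λ)) : Λ ≤ logDist D x y := by
  have h0 : 0 < ‖x - y‖ := norm_pos_iff.2 (sub_ne_zero.2 hxy)
  rw [logDist, Real.le_log_iff_exp_le (by positivity), le_div_iff₀ h0]
  calc Real.exp Λ * ‖x - y‖ ≤ Real.exp Λ * (D * Real.exp (-Λ)) := by gcongr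
    _ = D * (Real.exp Λ * Real.exp (-Λ)) := by ring
    _ = D := by rw [← Real.exp_add, add_neg_cancel, Real.exp_zero, mul_one]

/-- The interaction dominating four-point configurations in which `p, q` is the closest pair. -/
theorem ofReal_exp_le_near (D b l l' : ℝ) (p q r t : Eu d)
    (hl : l = logDist D r p ∨ l = logDist D r q ∨ l = logDist D r t)
    (hl' : l' = logDist D t p ∨ l' = logDist D t q ∨ l' = logDist D t r) :
    ENNReal.ofReal (Real.exp (b * ((2 * logDist D p q + l + l') / 2))) ≤
      pairRiesz D b p q r t + chainRiesz D b p q r t := by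
  have e : ENNReal.ofReal (Real.exp (b * ((2 * logDist D p q + l + l') / 2))) =
      riesz D b p q * (ENNReal.ofReal (Real.exp (b / 2 * l)) *
        ENNReal.ofReal (Real.exp (b / 2 * l'))) := by
    rw [riesz, ← ENNReal.ofReal_mul (Real.exp_pos _).le, ← ENNReal.ofReal_mul (Real.exp_pos _).le,
      ← Real.exp_add, ← Real.exp_add]
    congr 2; ring
  have h1 : ENNReal.ofReal (Real.exp (b / 2 * l)) ≤
      riesz D (b / 2) r p + riesz D (b / 2) r q + riesz D (b / 2) r t := by
    rcases hl with rfl | rfl | rfl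
    · exact le_self_add.trans le_self_add
    · exact le_add_self.trans le_self_add
    · exact le_add_self
  have h2 : ENNReal.ofReal (Real.exp (b / 2 * l')) ≤
      riesz D (b / 2) t p + riesz D (b / 2) t q + riesz D (b / 2) t r := by
    rcases hl' with rfl | rfl | rfl
    · exact le_self_add.trans le_self_add
    · exact le_add_self.trans le_self_add
    · exact le_add_self
  rw [e]
  refine (mul_le_mul_right (mul_le_mul' h1 h2) _).trans (le_of_eq ?_)
  rw [pairRiesz, chainRiesz, ← riesz_sq D b r t, riesz_comm D (b / 2) t r]
  ring

/-- The sum over the three pairings of the interaction of two pairs. -/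
def allPairs (D b : ℝ) (x y z t : Eu d) : ℝ≥0∞ :=
  (pairRiesz D b x y z t + (chainRiesz D b x y z t + chainRiesz D b z t x y)) +
  ((pairRiesz D b x z y t + (chainRiesz D b x z y t + chainRiesz D b y t x z)) +
  (pairRiesz D b x t y z + (chainRiesz D b x t y z + chainRiesz D b y z x t)))

theorem pairRiesz_comm (D b : ℝ) (p q r t : Eu d) : pairRiesz D b p q r t = pairRiesz D b r t p q :=
  mul_comm _ _

/-- The closest pair p, q realises the largest interaction of both its points, so half of the sum
contains it with full weight. The other two points contribute half interactions. If these two select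
each other, their halves combine into a second full pair, otherwise the four points form a chain. -/
theorem ofReal_exp_maxLog_le (D b : ℝ) (x y x' y' : Eu d) :
    ENNReal.ofReal (Real.exp (b * ((maxLog D x y x' y' + maxLog D y x x' y' +
      maxLog D x' x y y' + maxLog D y' x y x') / 2))) ≤ allPairs D b x y x' y' := by
  have hmax : ∀ a u v w : Eu d, maxLog D a u v w = logDist D a u ∨ maxLog D a u v w = logDist D a v ∨
      maxLog D a u v w = logDist D a w := by
    intro a u v w
    unfold maxLog
    rcases max_choice (logDist D a u) (max (logDist D a v) (logDist D a w)) with h | h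
    · exact Or.inl h
    · rw [h]
      rcases max_choice (logDist D a v) (logDist D a w) with h | h
      · exact Or.inr (Or.inl h)
      · exact Or.inr (Or.inr h)
  -- The index of the closest pair among the six. Each case identifies the two maxima it determines
  -- and leaves the choice of the other two open.
  obtain ⟨i, hi⟩ := Finite.exists_max ![logDist D x y, logDist D x x', logDist D x y',
    logDist D y x', logDist D y y', logDist D x' y']
  have h0 := hi 0
  have h1 := hi 1
  have h2 := hi 2
  have h3 := hi 3
  have h4 := hi 4
  have h5 := hi 5
  have key : ∀ (p q r t : Eu d) (l l' S : ℝ) (B : ℝ≥0∞),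
      S = 2 * logDist D p q + l + l' →
      (l = logDist D r p ∨ l = logDist D r q ∨ l = logDist D r t) →
      (l' = logDist D t p ∨ l' = logDist D t q ∨ l' = logDist D t r) →
      pairRiesz D b p q r t + chainRiesz D b p q r t ≤ B →
      ENNReal.ofReal (Real.exp (b * (S / 2))) ≤ B := by
    intro p q r t l l' S B hS hl hl' hB
    rw [hS]
    exact (ofReal_exp_le_near D b l l' p q r t hl hl').trans hB
  have A : ∀ a c₁ c₂ : ℝ≥0∞, a + c₁ ≤ a + (c₁ + c₂) := fun a c₁ c₂ =>
    add_le_add_right le_self_add a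
  have B : ∀ a c₁ c₂ : ℝ≥0∞, a + c₂ ≤ a + (c₁ + c₂) := fun a c₁ c₂ =>
    add_le_add_right le_add_self a
  have e12 := logDist_comm D y x
  have e13 := logDist_comm D x' x
  have e14 := logDist_comm D y' x
  have e23 := logDist_comm D x' y
  have e24 := logDist_comm D y' y
  have e34 := logDist_comm D y' x'
  fin_cases i <;> simp only [Fin.isValue, Matrix.cons_val, Matrix.cons_val_zero,
    Matrix.cons_val_one, Fin.zero_eta, Fin.mk_one, Fin.reduceFinMk] at h0 h1 h2 h3 h4 h5
  · refine key x y x' y' (maxLog D x' x y y') (maxLog D y' x y x') _ _ ?_ (hmax _ _ _ _)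
      (hmax _ _ _ _) ((A _ _ _).trans le_self_add)
    rw [show maxLog D x y x' y' = logDist D x y from max_eq_left (max_le h1 h2),
      show maxLog D y x x' y' = logDist D x y by
        rw [maxLog, e12]; exact max_eq_left (max_le h3 h4)]
    ring
  · refine key x x' y y' (maxLog D y x x' y') (maxLog D y' x y x') _ _ ?_ (hmax _ _ _ _) ?_
      ((A _ _ _).trans (le_self_add.trans le_add_self))
    · rw [show maxLog D x y x' y' = logDist D x x' by
          rw [maxLog, max_eq_left h2]; exact max_eq_right h0,
        show maxLog D x' x y y' = logDist D x x' by
          rw [maxLog, e13, e23]; exact max_eq_left (max_le h3 h5)]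
      ring
    · rcases hmax y' x y x' with h | h | h <;> simp [h]
  · refine key x y' y x' (maxLog D y x x' y') (maxLog D x' x y y') _ _ ?_ ?_ ?_
      ((A _ _ _).trans (le_add_self.trans le_add_self))
    · rw [show maxLog D x y x' y' = logDist D x y' by
          rw [maxLog, max_eq_right h1]; exact max_eq_right h0,
        show maxLog D y' x y x' = logDist D x y' by
          rw [maxLog, e14, e24, e34]; exact max_eq_left (max_le h4 h5)]
      ring
    · rcases hmax y x x' y' with h | h | h <;> simp [h]
    · rcases hmax x' x y y' with h | h | h <;> simp [h]
  · refine key y x' x y' (maxLog D x y x' y') (maxLog D y' x y x') _ _ ?_ (hmax _ _ _ _) ?_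
      (le_trans (by rw [pairRiesz_comm]; exact B _ _ _) (le_add_self.trans le_add_self))
    · rw [show maxLog D y x x' y' = logDist D y x' by
          rw [maxLog, max_eq_left h4, e12]; exact max_eq_right h0,
        show maxLog D x' x y y' = logDist D y x' by
          rw [maxLog, e13, e23, max_eq_left h5]; exact max_eq_right h1]
      ring
    · rcases hmax y' x y x' with h | h | h <;> simp [h]
  · refine key y y' x x' (maxLog D x y x' y') (maxLog D x' x y y') _ _ ?_ ?_ ?_
      (le_trans (by rw [pairRiesz_comm]; exact B _ _ _) (le_self_add.trans le_add_self))
    · rw [show maxLog D y x x' y' = logDist D y y' by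
          rw [maxLog, max_eq_right h3, e12]; exact max_eq_right h0,
        show maxLog D y' x y x' = logDist D y y' by
          rw [maxLog, e14, e24, e34, max_eq_left h5]; exact max_eq_right h2]
      ring
    · rcases hmax x y x' y' with h | h | h <;> simp [h]
    · rcases hmax x' x y y' with h | h | h <;> simp [h]
  · refine key x' y' x y (maxLog D x y x' y') (maxLog D y x x' y') _ _ ?_ ?_ ?_
      (le_trans (by rw [pairRiesz_comm]; exact B _ _ _) le_self_add)
    · rw [show maxLog D x' x y y' = logDist D x' y' by
          rw [maxLog, e13, e23, max_eq_right h3]; exact max_eq_right h1,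
        show maxLog D y' x y x' = logDist D x' y' by
          rw [maxLog, e14, e24, e34, max_eq_right h4]; exact max_eq_right h2]
      ring
    · rcases hmax x y x' y' with h | h | h <;> simp [h]
    · rcases hmax y x x' y' with h | h | h <;> simp [h]

end Pointwise

/-! ### The uniform bound for the four-point function. -/

section PointwiseBounds

open scoped ENNReal

variable {d : ℕ} [NeZero d] {K : Set (Eu d)} {D M : ℝ} {C : Eu d → Eu d → ℝ}

theorem exp_le_exp_of_le_of_le {b B a c : ℝ} (hb : 0 ≤ b) (hbB : b ≤ B) (hc : 0 ≤ c)
    {e : ℝ} (h : e ≤ a + c) : Real.exp (b * e) ≤ Real.exp (B * c) * Real.exp (b * a) := by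
  rw [← Real.exp_add, Real.exp_le_exp]
  nlinarith [mul_le_mul_of_nonneg_left h hb, mul_le_mul_of_nonneg_right hbB hc]

/-- The quadratic dependence on s in the Onsager bound is linearised by s² ≤ s, so that the integral
over s becomes explicit. -/
theorem add_mul_exp_sq_le {M l b s : ℝ} (hM : 0 ≤ M) (hl : 0 ≤ l) (hb : 0 ≤ b)
    (hs : s ∈ Icc (0 : ℝ) 1) :
    (M + l) * Real.exp (b * (s ^ 2 * l / 2)) ≤ (M + l) * Real.exp (b / 2 * l * s) := by
  refine mul_le_mul_of_nonneg_left (Real.exp_le_exp.2 ?_) (by positivity)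
  have h1 : s ^ 2 ≤ s := by nlinarith [hs.1, hs.2]
  have h2 : 0 ≤ b * l / 2 := by positivity
  nlinarith [mul_le_mul_of_nonneg_left h1 h2]

/-- Uniform bound for the four-point correlation. -/
theorem IsLogKernelOn.exists_fourCorrInt_le (h : IsLogKernelOn K D M C) :
    ∃ N : ℝ, 0 < N ∧ ∀ b : ℝ, (d : ℝ) / 2 ≤ b → b ≤ d → ∀ θ σ : ℝ, |θ| ≤ 1 → σ ^ 2 = 1 →
      ∀ x ∈ K, ∀ y ∈ K, ∀ x' ∈ K, ∀ y' ∈ K,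
      x ≠ y → x ≠ x' → x ≠ y' → y ≠ x' → y ≠ y' → x' ≠ y' →
      fourCorrInt C b θ σ x y x' y' ≤ ENNReal.ofReal N * allPairs D b x y x' y' := by
  have hd : (0 : ℝ) < d := by exact_mod_cast NeZero.pos d
  have hM := h.nonneg
  -- An upper bound for M + 1/κ with κ = b/2 or κ = b, since b ≥ d/2.
  set N₀ : ℝ := M + 4 / d with hN₀
  set k : ℝ := (d : ℝ) ^ 2 * Real.exp (d * (2 * M)) with hk
  have hk0 : 0 < k := by positivity
  -- One copy for the exponential of the energy and one for the subtracted product, which is itself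
  -- dominated by the pairing of x, y with x', y'.
  refine ⟨2 * (k * N₀ ^ 2), by positivity, ?_⟩
  intro b hb hbd θ σ hθ hσ x hx y hy x' hx' y' hy' h1 h2 h3 h4 h5 h6
  have hb0 : 0 < b := lt_of_lt_of_le (by positivity) hb
  set lx := maxLog D x y x' y' with hlx
  set ly := maxLog D y x x' y' with hly
  set lx' := maxLog D x' x y y' with hlx'
  set ly' := maxLog D y' x y x' with hly'
  set L := logDist D x y with hL
  set L' := logDist D x' y' with hL'
  have hL0 : 0 ≤ L := h.logDist_nonneg hx hy
  have hL'0 : 0 ≤ L' := h.logDist_nonneg hx' hy'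
  have hLx : L ≤ lx := le_max_left _ _
  have hLx' : L' ≤ lx' := (le_max_right _ _).trans (le_max_right _ _)
  have hC := h.abs_cov_le hx hy h1
  have hC' := h.abs_cov_le hx' hy' h6
  have hkinv : ∀ κ : ℝ, (d : ℝ) / 4 ≤ κ → M + 1 / κ ≤ N₀ := by
    intro κ hκ
    have : 1 / κ ≤ 1 / ((d : ℝ) / 4) := one_div_le_one_div_of_le (by positivity) hκ
    rw [one_div_div] at this
    linarith
  have hint : ∀ κ l : ℝ, (d : ℝ) / 4 ≤ κ → 0 ≤ l →
      ∫ s in (0 : ℝ)..1, (M + l) * Real.exp (κ * l * s) ≤ N₀ * Real.exp (κ * l) := by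
    intro κ l hκ hl
    exact (integral_add_mul_exp_le hM hl (lt_of_lt_of_le (by positivity) hκ)).trans
      (mul_le_mul_of_nonneg_right (hkinv κ hκ) (Real.exp_pos _).le)
  have hCC : b ^ 2 * |C x y * C x' y'| ≤ (d : ℝ) ^ 2 * ((M + L) * (M + L')) := by
    rw [abs_mul]
    gcongr
  -- The logarithmic prefactors are bounded by the largest interactions of x and x', the two points
  -- whose charges s and s' are integrated. The integral over s and s' can then absorb them.
  have hbound : ∀ s ∈ Icc (0 : ℝ) 1, ∀ s' ∈ Icc (0 : ℝ) 1,
      |fourCorr C b θ σ x y x' y' s s'| ≤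
        k * Real.exp (b * ((ly + ly') / 2)) * ((M + lx) * Real.exp (b / 2 * lx * s) *
          ((M + lx') * Real.exp (b / 2 * lx' * s'))) +
        k * ((M + L) * Real.exp (b * L * s) * ((M + L') * Real.exp (b * L' * s'))) := by
    intro s hs s' hs'
    rw [fourCorr, abs_mul, abs_mul, abs_of_nonneg (sq_nonneg b)]
    have hE := h.energy_le x hx y hy x' hx' y' hy' h1 h2 h3 h4 h5 h6 σ s s' hσ hs hs'
    have hE' : energy C σ s s' x y x' y' ≤
        ((ly + ly') / 2 + s ^ 2 * lx / 2 + s' ^ 2 * lx' / 2) + 2 * M := by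
      linarith
    have hE2 : s * C x y + s' * C x' y' ≤ (L * s + L' * s') + 2 * M := by
      have a1 := (mul_le_mul_of_nonneg_left ((le_abs_self _).trans hC) hs.1)
      have a2 := (mul_le_mul_of_nonneg_left ((le_abs_self _).trans hC') hs'.1)
      nlinarith [mul_le_mul_of_nonneg_right hs.2 hM, mul_le_mul_of_nonneg_right hs'.2 hM]
    have e1 := exp_le_exp_of_le_of_le hb0.le hbd (by positivity) hE'
    have e2 := exp_le_exp_of_le_of_le hb0.le hbd (by positivity) hE2
    have hsub : |Real.exp (b * energy C σ s s' x y x' y') -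
        θ * Real.exp (b * (s * C x y + s' * C x' y'))| ≤
        Real.exp (b * energy C σ s s' x y x' y') + Real.exp (b * (s * C x y + s' * C x' y')) := by
      refine (abs_sub _ _).trans ?_
      rw [abs_mul, abs_of_pos (Real.exp_pos _), abs_of_pos (Real.exp_pos _)]
      exact add_le_add_right (mul_le_of_le_one_left (Real.exp_pos _).le hθ) _
    have q1 := add_mul_exp_sq_le hM (hL0.trans hLx) hb0.le hs
    have q2 := add_mul_exp_sq_le hM (hL'0.trans hLx') hb0.le hs'
    have hlx0 := hL0.trans hLx
    have hlx'0 := hL'0.trans hLx'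
    calc b ^ 2 * |C x y * C x' y'| * |Real.exp (b * energy C σ s s' x y x' y') -
          θ * Real.exp (b * (s * C x y + s' * C x' y'))|
        ≤ (d : ℝ) ^ 2 * ((M + L) * (M + L')) *
          (Real.exp (b * energy C σ s s' x y x' y') +
            Real.exp (b * (s * C x y + s' * C x' y'))) := by
          gcongr
      _ ≤ (d : ℝ) ^ 2 * ((M + L) * (M + L')) *
          (Real.exp (d * (2 * M)) * Real.exp (b * ((ly + ly') / 2 + s ^ 2 * lx / 2 +
            s' ^ 2 * lx' / 2)) +
            Real.exp (d * (2 * M)) * Real.exp (b * (L * s + L' * s'))) := by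
          gcongr
      _ = k * ((M + L) * (M + L')) * Real.exp (b * ((ly + ly') / 2 + s ^ 2 * lx / 2 +
            s' ^ 2 * lx' / 2)) +
          k * ((M + L) * (M + L')) * Real.exp (b * (L * s + L' * s')) := by rw [hk]; ring
      _ ≤ k * ((M + lx) * (M + lx')) * Real.exp (b * ((ly + ly') / 2 + s ^ 2 * lx / 2 +
            s' ^ 2 * lx' / 2)) +
          k * ((M + L) * (M + L')) * Real.exp (b * (L * s + L' * s')) := by
          gcongr
      _ = k * Real.exp (b * ((ly + ly') / 2)) * (((M + lx) * Real.exp (b * (s ^ 2 * lx / 2))) *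
          ((M + lx') * Real.exp (b * (s' ^ 2 * lx' / 2)))) +
          k * ((M + L) * Real.exp (b * L * s) * ((M + L') * Real.exp (b * L' * s'))) := by
          rw [mul_add b, mul_add b, Real.exp_add, Real.exp_add, mul_add b, Real.exp_add,
            ← mul_assoc b, ← mul_assoc b L' s']
          ring
      _ ≤ _ := by gcongr
  have hlx0 := hL0.trans hLx
  have hlx'0 := hL'0.trans hLx'
  have main := lintegral_unitInterval_le
    (F := fun s s' => |fourCorr C b θ σ x y x' y' s s'|) (by positivity) hk0.le
    (by fun_prop) (by fun_prop) (by fun_prop) (by fun_prop)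
    (fun s _ => by positivity) (fun s _ => by positivity)
    (fun s _ => by positivity) (fun s _ => by positivity)
    (hint (b / 2) lx (by linarith) hlx0) (hint (b / 2) lx' (by linarith) hlx'0)
    (hint b L (by linarith) hL0) (hint b L' (by linarith) hL'0) hbound
  refine main.trans ?_
  have e : k * Real.exp (b * ((ly + ly') / 2)) * (N₀ * Real.exp (b / 2 * lx) *
      (N₀ * Real.exp (b / 2 * lx'))) + k * (N₀ * Real.exp (b * L) * (N₀ * Real.exp (b * L'))) =
      k * N₀ ^ 2 * (Real.exp (b * ((lx + ly + lx' + ly') / 2)) +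
        Real.exp (b * L) * Real.exp (b * L')) := by
    rw [show b * ((lx + ly + lx' + ly') / 2) = b * ((ly + ly') / 2) + b / 2 * lx + b / 2 * lx' by
      ring, Real.exp_add, Real.exp_add]
    ring
  clear_value k N₀
  have e2 : ENNReal.ofReal (2 * (k * N₀ ^ 2)) = ENNReal.ofReal (k * N₀ ^ 2) * 2 := by
    rw [mul_comm, ENNReal.ofReal_mul (by positivity), ENNReal.ofReal_ofNat]
  rw [e, ENNReal.ofReal_mul (show 0 ≤ k * N₀ ^ 2 by positivity), e2, mul_assoc]
  refine mul_le_mul' le_rfl ?_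
  rw [ENNReal.ofReal_add (by positivity) (by positivity), ENNReal.ofReal_mul (Real.exp_pos _).le,
    two_mul]
  exact add_le_add (ofReal_exp_maxLog_le D b x y x' y')
    (le_self_add.trans le_self_add)

end PointwiseBounds

/-! ### Two short pairs far apart: the pairing that carries the prefactor. -/

section GoodConfigurations

open scoped ENNReal

theorem abs_exp_sub_one_le_mul (w : ℝ) : |Real.exp w - 1| ≤ |w| * Real.exp |w| := by
  rcases le_total 0 w with h | h
  · rw [abs_of_nonneg h, abs_of_nonneg (sub_nonneg.2 (Real.one_le_exp h))]
    have h1 := Real.add_one_le_exp (-w)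
    have h2 : Real.exp w * Real.exp (-w) = 1 := by rw [← Real.exp_add, add_neg_cancel, Real.exp_zero]
    nlinarith [Real.exp_pos w]
  · rw [abs_of_nonpos h, abs_of_nonpos (sub_nonpos.2 (Real.exp_le_one_iff.2 h))]
    have h1 := Real.add_one_le_exp w
    have h2 : 1 ≤ Real.exp (-w) := Real.one_le_exp (neg_nonneg.2 h)
    nlinarith

/-- If all four covariances coincide with a, the form factorises as (1 - s)(1 - s') a, the
interaction of the two net charges. The differences contribute at most ω each. -/
theorem abs_bilinear_le {s s' a p q r N ω : ℝ} (hs : s ∈ Icc (0 : ℝ) 1) (hs' : s' ∈ Icc (0 : ℝ) 1)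
    (ha : |a| ≤ N) (hp : |p - a| ≤ ω) (hq : |q - a| ≤ ω) (hr : |r - a| ≤ ω) :
    |s * s' * a - s * p - s' * q + r| ≤ (1 - s) * (1 - s') * N + 3 * ω := by
  have e : s * s' * a - s * p - s' * q + r =
      (1 - s) * (1 - s') * a + (r - a) - s * (p - a) - s' * (q - a) := by ring
  have h0 : 0 ≤ (1 - s) * (1 - s') := mul_nonneg (by linarith [hs.2]) (by linarith [hs'.2])
  have h1 : |(1 - s) * (1 - s') * a| ≤ (1 - s) * (1 - s') * N := by
    rw [abs_mul, abs_of_nonneg h0]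
    exact mul_le_mul_of_nonneg_left ha h0
  have h2 : |s * (p - a)| ≤ ω := by
    rw [abs_mul, abs_of_nonneg hs.1]
    exact (mul_le_of_le_one_left (abs_nonneg _) hs.2).trans hp
  have h3 : |s' * (q - a)| ≤ ω := by
    rw [abs_mul, abs_of_nonneg hs'.1]
    exact (mul_le_of_le_one_left (abs_nonneg _) hs'.2).trans hq
  rw [e]
  rw [abs_le] at *
  constructor <;> linarith [h1.1, h1.2, h2.1, h2.2, h3.1, h3.2, hr.1, hr.2]

variable {d : ℕ} [NeZero d] {K : Set (Eu d)} {D M : ℝ} {C : Eu d → Eu d → ℝ}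

theorem ofReal_mul_pairRiesz {τ : ℝ} (hτ : 0 ≤ τ) (D b : ℝ) (p q r t : Eu d) :
    ENNReal.ofReal τ * pairRiesz D b p q r t = ENNReal.ofReal (τ *
      (Real.exp (b * logDist D p q) * Real.exp (b * logDist D r t))) := by
  rw [pairRiesz, riesz, riesz, ← ENNReal.ofReal_mul (Real.exp_pos _).le, ← ENNReal.ofReal_mul hτ]

theorem half_le_cross {δ ρ : ℝ} (hρ : ρ ≤ δ / 4) {p q r t : Eu d}
    (h1 : ‖p - q‖ < ρ) (h2 : ‖r - t‖ < ρ) (h3 : δ ≤ ‖p - r‖) :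
    δ / 2 ≤ ‖p - r‖ ∧ δ / 2 ≤ ‖p - t‖ ∧ δ / 2 ≤ ‖q - r‖ ∧ δ / 2 ≤ ‖q - t‖ := by
  have a1 : ‖p - r‖ ≤ ‖p - q‖ + ‖q - r‖ := norm_sub_le_norm_sub_add_norm_sub p q r
  have a2 : ‖p - r‖ ≤ ‖p - t‖ + ‖t - r‖ := norm_sub_le_norm_sub_add_norm_sub p t r
  have a3 : ‖q - r‖ ≤ ‖q - t‖ + ‖t - r‖ := norm_sub_le_norm_sub_add_norm_sub q t r
  have a4 : ‖t - r‖ = ‖r - t‖ := norm_sub_rev _ _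
  have h0 : 0 ≤ ‖p - q‖ := norm_nonneg _
  refine ⟨?_, ?_, ?_, ?_⟩ <;> linarith

theorem IsLogKernelOn.exp_sum_le (h : IsLogKernelOn K D M C) {b : ℝ} (hb : 0 ≤ b) (hbd : b ≤ d)
    {x y x' y' : Eu d} (hx : x ∈ K) (hy : y ∈ K) (hx' : x' ∈ K) (hy' : y' ∈ K) (h1 : x ≠ y)
    (h6 : x' ≠ y') {s s' : ℝ} (hs : s ∈ Icc (0 : ℝ) 1) (hs' : s' ∈ Icc (0 : ℝ) 1) :
    Real.exp (b * (s * C x y + s' * C x' y')) ≤ Real.exp (d * (2 * M)) *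
      (Real.exp (b * logDist D x y * s) * Real.exp (b * logDist D x' y' * s')) := by
  have hM := h.nonneg
  have hE2 : s * C x y + s' * C x' y' ≤ (logDist D x y * s + logDist D x' y' * s') + 2 * M := by
    have a1 := (mul_le_mul_of_nonneg_left ((le_abs_self _).trans (h.abs_cov_le hx hy h1)) hs.1)
    have a2 := (mul_le_mul_of_nonneg_left ((le_abs_self _).trans (h.abs_cov_le hx' hy' h6)) hs'.1)
    nlinarith [mul_le_mul_of_nonneg_right hs.2 hM, mul_le_mul_of_nonneg_right hs'.2 hM]
  refine (exp_le_exp_of_le_of_le hb hbd (by positivity) hE2).trans (le_of_eq ?_)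
  rw [mul_add b, Real.exp_add, ← mul_assoc b, ← mul_assoc b]

/-- Opposite charges, the pairing `{x, y}, {x', y'}`. -/
theorem IsLogKernelOn.exists_fourCorrInt_le_of_neg (h : IsLogKernelOn K D M C) {δ τ : ℝ}
    (hδ : 0 < δ) (hτ : 0 < τ) :
    ∃ ρ : ℝ, 0 < ρ ∧ ∀ b : ℝ, (d : ℝ) / 2 ≤ b → b ≤ d →
      ∀ x ∈ K, ∀ y ∈ K, ∀ x' ∈ K, ∀ y' ∈ K, x ≠ y → x' ≠ y' →
      ‖x - y‖ < ρ → ‖x' - y'‖ < ρ → δ ≤ ‖x - x'‖ →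
      fourCorrInt C b 1 (-1) x y x' y' ≤ ENNReal.ofReal τ * pairRiesz D b x y x' y' := by
  have hd : (0 : ℝ) < d := by exact_mod_cast NeZero.pos d
  have hM := h.nonneg
  have hD := h.pos
  set N : ℝ := M + |Real.log (D / (δ / 2))| with hN
  have hN0 : 0 ≤ N := by positivity
  set N₀ : ℝ := M + 2 / d with hN₀
  have hN₀0 : 0 < N₀ := by positivity
  -- The first factors bound b² and the error in the exponentials of the pair energies. The last
  -- comes from |e^w - 1| ≤ |w| e^{|w|} with |w| ≤ d (N + 3), where ω ≤ 1 is used.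
  set k : ℝ := (d : ℝ) ^ 2 * Real.exp (d * (2 * M)) * (d * Real.exp (d * (N + 3))) with hk
  have hk0 : 0 < k := by positivity
  -- Chosen so that the oscillation of the covariance over the two pairs costs at most τ/2. The
  -- other half of τ is paid for by taking Λ large.
  set ω : ℝ := min 1 (τ / (6 * k * N₀ ^ 2)) with hω
  have hω0 : 0 < ω := by positivity
  have hω1 : ω ≤ 1 := min_le_left _ _
  have hω2 : 3 * k * ω * N₀ ^ 2 ≤ τ / 2 := by
    calc 3 * k * ω * N₀ ^ 2 ≤ 3 * k * (τ / (6 * k * N₀ ^ 2)) * N₀ ^ 2 := by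
          gcongr; exact min_le_right _ _
      _ = τ / 2 := by field_simp; norm_num
  set c : ℝ := 8 / (d : ℝ) ^ 2 with hc
  have hc0 : 0 < c := by positivity
  set Λ : ℝ := 1 + M + 2 * k * N * c ^ 2 / τ with hΛ
  have hΛ1 : 1 ≤ Λ := by
    have : 0 ≤ 2 * k * N * c ^ 2 / τ := by positivity
    linarith
  have hΛM : M ≤ Λ := by
    have : 0 ≤ 2 * k * N * c ^ 2 / τ := by positivity
    linarith
  have hΛ2 : k * N * (c / Λ * (c / Λ)) ≤ τ / 2 := by
    have h1 : 2 * k * N * c ^ 2 / τ ≤ Λ := by linarith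
    have h2 : c / Λ ≤ c := div_le_self hc0.le hΛ1
    calc k * N * (c / Λ * (c / Λ)) ≤ k * N * (c / Λ * c) := by gcongr
      _ = k * N * c ^ 2 / Λ := by ring
      _ ≤ τ / 2 := by
        rw [div_le_iff₀ (by linarith)]
        rw [div_le_iff₀ hτ] at h1
        linarith
  obtain ⟨ρ₁, hρ₁, heq⟩ := h.equicontinuous (δ / 2) (by positivity) ω hω0
  refine ⟨min (δ / 4) (min ρ₁ (D * Real.exp (-Λ))), by positivity, ?_⟩
  intro b hb hbd x hx y hy x' hx' y' hy' h1 h6 hxy hxy' hxx'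
  have hb0 : 0 < b := lt_of_lt_of_le (by positivity) hb
  obtain ⟨g1, g2, g3, g4⟩ := half_le_cross (min_le_left _ _) hxy hxy' hxx'
  set L := logDist D x y with hL
  set L' := logDist D x' y' with hL'
  have hLΛ : Λ ≤ L := le_logDist hD h1
    (hxy.trans_le ((min_le_right _ _).trans (min_le_right _ _)))
  have hLΛ' : Λ ≤ L' := le_logDist hD h6
    (hxy'.trans_le ((min_le_right _ _).trans (min_le_right _ _)))
  have hL0 : 0 < L := by linarith
  have hL'0 : 0 < L' := by linarith
  have hxyρ : ‖x - y‖ < ρ₁ := hxy.trans_le ((min_le_right _ _).trans (min_le_left _ _))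
  have hxyρ' : ‖x' - y'‖ < ρ₁ := hxy'.trans_le ((min_le_right _ _).trans (min_le_left _ _))
  have hself : ∀ z : Eu d, ‖z - z‖ < ρ₁ := fun z => by rw [sub_self, norm_zero]; exact hρ₁
  have w1 := heq x hx y hy x' hx' y' hy' g1 hxyρ hxyρ'
  have w2 := heq x hx x hx x' hx' y' hy' g1 (hself x) hxyρ'
  have w3 := heq x hx y hy x' hx' x' hx' g1 hxyρ (hself x')
  have hfar := h.abs_cov_le_of_far (by positivity) hx hx' g1
  rw [← hN] at hfar
  have hint1 : ∀ l : ℝ, 0 < l →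
      ∫ s in (0 : ℝ)..1, (M + l) * Real.exp (b * l * s) ≤ N₀ * Real.exp (b * l) := by
    intro l hl
    refine (integral_add_mul_exp_le hM hl.le hb0).trans
      (mul_le_mul_of_nonneg_right ?_ (Real.exp_pos _).le)
    have : 1 / b ≤ 1 / ((d : ℝ) / 2) := one_div_le_one_div_of_le (by positivity) hb
    rw [one_div_div] at this
    linarith
  -- The prefactor M + l is at most 2l and the factor 1 - s gains (bl)^{-2}, so one inverse power of
  -- l ≥ Λ is left over.
  have hint2 : ∀ l : ℝ, Λ ≤ l →
      ∫ s in (0 : ℝ)..1, (M + l) * ((1 - s) * Real.exp (b * l * s)) ≤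
        c / Λ * Real.exp (b * l) := by
    intro l hl
    have hl0 : 0 < l := by linarith
    rw [intervalIntegral.integral_const_mul]
    calc (M + l) * ∫ s in (0 : ℝ)..1, (1 - s) * Real.exp (b * l * s)
        ≤ (l + l) * (Real.exp (b * l) / (b * l) ^ 2) := by
          gcongr
          · exact intervalIntegral.integral_nonneg zero_le_one fun s hs =>
              mul_nonneg (by linarith [hs.2]) (Real.exp_pos _).le
          · linarith
          · exact integral_one_sub_mul_exp_le (by positivity)
      _ = 2 / (b ^ 2 * l) * Real.exp (b * l) := by field_simp; norm_num
      _ ≤ 2 / (((d : ℝ) / 2) ^ 2 * Λ) * Real.exp (b * l) := by gcongr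
      _ = c / Λ * Real.exp (b * l) := by rw [hc]; field_simp; norm_num
  have hbound : ∀ s ∈ Icc (0 : ℝ) 1, ∀ s' ∈ Icc (0 : ℝ) 1,
      |fourCorr C b 1 (-1) x y x' y' s s'| ≤
        k * N * ((M + L) * ((1 - s) * Real.exp (b * L * s)) *
          ((M + L') * ((1 - s') * Real.exp (b * L' * s')))) +
        3 * k * ω * ((M + L) * Real.exp (b * L * s) * ((M + L') * Real.exp (b * L' * s'))) := by
    intro s hs s' hs'
    set B : ℝ := s * s' * C x x' - s * C x y' - s' * C y x' + C y y' with hB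
    -- The energy is the sum of the two pair energies and of the interaction B between the dipoles.
    -- The truncation replaces e^{bB} by e^{bB} - 1, which is small because B is nearly (1 - s)(1 -
    -- s') C(x, x').
    have e1 : fourCorr C b 1 (-1) x y x' y' s s' = b ^ 2 * (C x y * C x' y') *
        (Real.exp (b * (s * C x y + s' * C x' y')) * (Real.exp (b * B) - 1)) := by
      rw [fourCorr, show energy C (-1) s s' x y x' y' = (s * C x y + s' * C x' y') + B by
        rw [energy, hB]; ring, mul_add b, Real.exp_add]
      ring
    have p1 : 0 ≤ 1 - s := by linarith [hs.2]
    have p2 : 0 ≤ 1 - s' := by linarith [hs'.2]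
    have hp : (1 - s) * (1 - s') ≤ 1 := mul_le_one₀ (by linarith [hs.1]) p2 (by linarith [hs'.1])
    have hBabs : |B| ≤ (1 - s) * (1 - s') * N + 3 * ω := abs_bilinear_le hs hs' hfar w2 w3 w1
    have hBabs' : |B| ≤ N + 3 := by
      have := mul_le_mul_of_nonneg_right hp hN0
      linarith
    have hexp : |Real.exp (b * B) - 1| ≤
        (d * ((1 - s) * (1 - s') * N + 3 * ω)) * Real.exp (d * (N + 3)) := by
      refine (abs_exp_sub_one_le_mul _).trans ?_
      rw [abs_mul, abs_of_pos hb0]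
      gcongr
    have hsum := h.exp_sum_le hb0.le hbd hx hy hx' hy' h1 h6 hs hs'
    rw [e1, abs_mul, abs_mul, abs_mul, abs_mul, abs_of_nonneg (sq_nonneg b),
      abs_of_pos (Real.exp_pos _)]
    have hC := h.abs_cov_le hx hy h1
    have hC' := h.abs_cov_le hx' hy' h6
    calc b ^ 2 * (|C x y| * |C x' y'|) *
          (Real.exp (b * (s * C x y + s' * C x' y')) * |Real.exp (b * B) - 1|)
        ≤ (d : ℝ) ^ 2 * ((M + L) * (M + L')) * ((Real.exp (d * (2 * M)) *
            (Real.exp (b * L * s) * Real.exp (b * L' * s'))) *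
            ((d * ((1 - s) * (1 - s') * N + 3 * ω)) * Real.exp (d * (N + 3)))) := by
          gcongr
      _ = _ := by rw [hk]; ring
  have main := lintegral_unitInterval_le
    (F := fun s s' => |fourCorr C b 1 (-1) x y x' y' s s'|) (by positivity) (by positivity)
    (by fun_prop) (by fun_prop) (by fun_prop) (by fun_prop)
    (fun s hs => mul_nonneg (by positivity)
      (mul_nonneg (by linarith [hs.2]) (Real.exp_pos _).le))
    (fun s hs => mul_nonneg (by positivity)
      (mul_nonneg (by linarith [hs.2]) (Real.exp_pos _).le))
    (fun s _ => by positivity) (fun s _ => by positivity)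
    (hint2 L hLΛ) (hint2 L' hLΛ') (hint1 L hL0) (hint1 L' hL'0) hbound
  rw [ofReal_mul_pairRiesz hτ.le]
  refine main.trans (ENNReal.ofReal_le_ofReal ?_)
  have hpos : 0 ≤ Real.exp (b * L) * Real.exp (b * L') := by positivity
  calc k * N * (c / Λ * Real.exp (b * L) * (c / Λ * Real.exp (b * L'))) +
        3 * k * ω * (N₀ * Real.exp (b * L) * (N₀ * Real.exp (b * L')))
      = (k * N * (c / Λ * (c / Λ)) + 3 * k * ω * N₀ ^ 2) *
          (Real.exp (b * L) * Real.exp (b * L')) := by ring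
    _ ≤ τ * (Real.exp (b * L) * Real.exp (b * L')) :=
        mul_le_mul_of_nonneg_right (by linarith) hpos

/-- Equal charges, the pairing `{x, y}, {x', y'}`. -/
theorem IsLogKernelOn.exists_fourCorrInt_le_of_pos (h : IsLogKernelOn K D M C) {δ τ : ℝ}
    (hδ : 0 < δ) (hτ : 0 < τ) :
    ∃ ρ : ℝ, 0 < ρ ∧ ∀ b : ℝ, (d : ℝ) / 2 ≤ b → b ≤ d →
      ∀ x ∈ K, ∀ y ∈ K, ∀ x' ∈ K, ∀ y' ∈ K, x ≠ y → x' ≠ y' →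
      ‖x - y‖ < ρ → ‖x' - y'‖ < ρ → δ ≤ ‖x - x'‖ →
      fourCorrInt C b 0 1 x y x' y' ≤ ENNReal.ofReal τ * pairRiesz D b x y x' y' := by
  have hd : (0 : ℝ) < d := by exact_mod_cast NeZero.pos d
  have hM := h.nonneg
  have hD := h.pos
  set N : ℝ := M + |Real.log (D / (δ / 2))| with hN
  have hN0 : 0 ≤ N := by positivity
  set k : ℝ := (d : ℝ) ^ 2 * Real.exp (d * (2 * M + 4 * N)) with hk
  have hk0 : 0 < k := by positivity
  set c : ℝ := 16 / (d : ℝ) ^ 2 with hc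
  have hc0 : 0 < c := by positivity
  set Λ : ℝ := 1 + M + k * c ^ 2 / τ with hΛ
  have hΛ0 : 0 ≤ k * c ^ 2 / τ := by positivity
  have hΛ2 : k * (c / Λ * (c / Λ)) ≤ τ := by
    have h1 : k * c ^ 2 / τ ≤ Λ := by linarith
    have h2 : c / Λ ≤ c := div_le_self hc0.le (by linarith)
    calc k * (c / Λ * (c / Λ)) ≤ k * (c / Λ * c) := by gcongr
      _ = k * c ^ 2 / Λ := by ring
      _ ≤ τ := by
        rw [div_le_iff₀ (by linarith)]
        rw [div_le_iff₀ hτ] at h1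
        linarith
  refine ⟨min (δ / 4) (D * Real.exp (-Λ)), by positivity, ?_⟩
  intro b hb hbd x hx y hy x' hx' y' hy' h1 h6 hxy hxy' hxx'
  have hb0 : 0 < b := lt_of_lt_of_le (by positivity) hb
  obtain ⟨g1, g2, g3, g4⟩ := half_le_cross (min_le_left _ _) hxy hxy' hxx'
  set L := logDist D x y with hL
  set L' := logDist D x' y' with hL'
  have hLΛ : Λ ≤ L := le_logDist hD h1 (hxy.trans_le (min_le_right _ _))
  have hLΛ' : Λ ≤ L' := le_logDist hD h6 (hxy'.trans_le (min_le_right _ _))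
  -- For equal charges the exponential stays bounded, so only the logarithmic prefactors compete
  -- with the Riesz kernel. The constant c = 16/d² comes from e^u ≥ u²/2 at u = bl ≥ dl/2.
  have hgain : ∀ l : ℝ, Λ ≤ l → M + l ≤ c / Λ * Real.exp (b * l) := by
    intro l hl
    have hl0 : 0 < l := by linarith
    have hΛp : 0 < Λ := by linarith
    have q := Real.quadratic_le_exp_of_nonneg (x := b * l) (by positivity)
    have q2 : ((d : ℝ) / 2 * l) ^ 2 / 2 ≤ Real.exp (b * l) := by
      have : ((d : ℝ) / 2 * l) ^ 2 ≤ (b * l) ^ 2 := by gcongr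
      have : 0 ≤ b * l := by positivity
      linarith
    calc M + l ≤ 2 * l := by linarith
      _ = c / l * (((d : ℝ) / 2 * l) ^ 2 / 2) := by rw [hc]; field_simp; norm_num
      _ ≤ c / Λ * Real.exp (b * l) := by gcongr
  have hfar : ∀ {p q : Eu d}, p ∈ K → q ∈ K → δ / 2 ≤ ‖p - q‖ → |C p q| ≤ N := fun hp hq hpq =>
    h.abs_cov_le_of_far (by positivity) hp hq hpq
  have f1 := hfar hx hx' g1
  have f2 := hfar hx hy' g2
  have f3 := hfar hy hx' g3
  have f4 := hfar hy hy' g4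
  have n1 := h.neg_le hx hy h1
  have n2 := h.neg_le hx' hy' h6
  have hC := h.abs_cov_le hx hy h1
  have hC' := h.abs_cov_le hx' hy' h6
  have hbound : ∀ s ∈ Icc (0 : ℝ) 1, ∀ s' ∈ Icc (0 : ℝ) 1,
      |fourCorr C b 0 1 x y x' y' s s'| ≤
        k * ((M + L) * (M + L')) + 0 * (1 * 1) := by
    intro s hs s' hs'
    have hle : ∀ {u c : ℝ}, u ∈ Icc (0 : ℝ) 1 → |c| ≤ N → u * c ≤ N := fun {u c} hu hc =>
      (mul_le_mul_of_nonneg_left ((le_abs_self c).trans hc) hu.1).trans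
        (mul_le_of_le_one_left hN0 hu.2)
    have hle' : ∀ {u c : ℝ}, u ∈ Icc (0 : ℝ) 1 → -M ≤ c → -(u * c) ≤ M := fun {u c} hu hc => by
      nlinarith [hu.1, hu.2, mul_le_mul_of_nonneg_left hc hu.1, mul_le_mul_of_nonneg_right hu.2 hM]
    have hss : s * s' ∈ Icc (0 : ℝ) 1 :=
      ⟨mul_nonneg hs.1 hs'.1, mul_le_one₀ hs.2 hs'.1 hs'.2⟩
    -- Within each pair the charges repel, and C ≥ -M bounds their contribution from above. The four
    -- interactions across the pairs are at macroscopic distance.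
    have hE : energy C 1 s s' x y x' y' ≤ 0 + (2 * M + 4 * N) := by
      unfold energy
      have := hle hss f1
      have := hle hs f2
      have := hle hs' f3
      have := (le_abs_self _).trans f4
      have := hle' hs n1
      have := hle' hs' n2
      linarith
    have e1 := exp_le_exp_of_le_of_le hb0.le hbd (by positivity) hE
    rw [mul_zero, Real.exp_zero, mul_one] at e1
    have hL0 : 0 ≤ M + L := by linarith
    have hL'0 : 0 ≤ M + L' := by linarith
    rw [fourCorr, zero_mul, sub_zero, abs_mul, abs_mul, abs_mul, abs_of_nonneg (sq_nonneg b),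
      abs_of_pos (Real.exp_pos _), zero_mul, add_zero]
    calc b ^ 2 * (|C x y| * |C x' y'|) * Real.exp (b * energy C 1 s s' x y x' y')
        ≤ (d : ℝ) ^ 2 * ((M + L) * (M + L')) * Real.exp (d * (2 * M + 4 * N)) := by gcongr
      _ = k * ((M + L) * (M + L')) := by rw [hk]; ring
  have i1 : ∀ c : ℝ, ∫ _ in (0 : ℝ)..1, c ≤ c := fun c => by simp
  have main := lintegral_unitInterval_le
    (F := fun s s' => |fourCorr C b 0 1 x y x' y' s s'|) hk0.le le_rfl
    continuous_const continuous_const continuous_const continuous_const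
    (fun s hs => by linarith) (fun s hs => by linarith)
    (fun s _ => zero_le_one) (fun s _ => zero_le_one)
    ((i1 _).trans (hgain L hLΛ)) ((i1 _).trans (hgain L' hLΛ')) (i1 1) (i1 1) hbound
  rw [ofReal_mul_pairRiesz hτ.le]
  refine main.trans (ENNReal.ofReal_le_ofReal ?_)
  have hpos : 0 ≤ Real.exp (b * L) * Real.exp (b * L') := by positivity
  calc k * (c / Λ * Real.exp (b * L) * (c / Λ * Real.exp (b * L'))) + 0 * (1 * 1)
      = (k * (c / Λ * (c / Λ))) * (Real.exp (b * L) * Real.exp (b * L')) := by ring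
    _ ≤ τ * (Real.exp (b * L) * Real.exp (b * L')) := mul_le_mul_of_nonneg_right hΛ2 hpos

/-- Integrating e^{bLs} over s gains 1/(bL) ≤ 2/(dΛ). One such gain suffices, and the constant term
is smaller than the main one because e^u ≥ u. -/
theorem lintegral_unitInterval_le_of_exp {F : ℝ → ℝ → ℝ} {b k Λ L L' : ℝ}
    (hb : (d : ℝ) / 2 ≤ b) (hk : 0 ≤ k) (hΛ : 0 < Λ) (hL : Λ ≤ L) (hL' : 0 ≤ L')
    (hF : ∀ s ∈ Icc (0 : ℝ) 1, ∀ s' ∈ Icc (0 : ℝ) 1,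
      F s s' ≤ k * (Real.exp (b * L * s) * Real.exp (b * L')) + k * (1 * 1)) :
    ∫⁻ s : unitInterval, ∫⁻ s' : unitInterval, ENNReal.ofReal (F s s') ≤
      ENNReal.ofReal (k * 4 / (d * Λ) * (Real.exp (b * L) * Real.exp (b * L'))) := by
  have hd : (0 : ℝ) < d := by exact_mod_cast NeZero.pos d
  have hb0 : 0 < b := lt_of_lt_of_le (by positivity) hb
  have hL0 : 0 < L := hΛ.trans_le hL
  have i1 : ∀ c : ℝ, ∫ _ in (0 : ℝ)..1, c ≤ c := fun c => by simp
  refine (lintegral_unitInterval_le hk hk (by fun_prop) continuous_const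
    continuous_const continuous_const (fun s _ => by positivity) (fun s _ => by positivity)
    (fun s _ => zero_le_one) (fun s _ => zero_le_one)
    (integral_exp_mul_le_div (a := b * L) (by positivity)) (i1 _) (i1 1) (i1 1) hF).trans
    (ENNReal.ofReal_le_ofReal ?_)
  have h1 : Real.exp (b * L) / (b * L) ≤ 2 / (d * Λ) * Real.exp (b * L) := by
    calc Real.exp (b * L) / (b * L) ≤ Real.exp (b * L) / ((d : ℝ) / 2 * Λ) := by gcongr
      _ = 2 / (d * Λ) * Real.exp (b * L) := by field_simp
  have h2 : 1 ≤ Real.exp (b * L) / (b * L) := by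
    rw [one_le_div (by positivity)]
    linarith [Real.add_one_le_exp (b * L)]
  have h3 : 1 ≤ Real.exp (b * L') := Real.one_le_exp (by positivity)
  have h4 : 1 * 1 ≤ 2 / (d * Λ) * Real.exp (b * L) * Real.exp (b * L') :=
    mul_le_mul (h2.trans h1) h3 zero_le_one (by positivity)
  calc k * (Real.exp (b * L) / (b * L) * Real.exp (b * L')) + k * (1 * 1)
      ≤ k * (2 / (d * Λ) * Real.exp (b * L) * Real.exp (b * L')) +
        k * (2 / (d * Λ) * Real.exp (b * L) * Real.exp (b * L')) := by gcongr
    _ = k * 4 / (d * Λ) * (Real.exp (b * L) * Real.exp (b * L')) := by ring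

end GoodConfigurations

/-! ### The crossed pairings, and the final bound by the majorant. -/

section CrossPairings

open scoped ENNReal

variable {d : ℕ} [NeZero d] {K : Set (Eu d)} {D M : ℝ} {C : Eu d → Eu d → ℝ}

/-- In a crossed pairing x, y and x', y' are far apart, so the prefactor and the subtracted term are
bounded and no cancellation is needed. It is enough that one singular interaction carries the factor
s. -/
theorem fourCorrInt_le_of_energy_le {b θ σ N k Λ L L' M : ℝ} {x y x' y' : Eu d} (hM : 0 ≤ M)
    (hb : (d : ℝ) / 2 ≤ b) (hbd : b ≤ d) (hθ : |θ| ≤ 1)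
    (hC : |C x y| ≤ N) (hC' : |C x' y'| ≤ N)
    (hk : k = (d : ℝ) ^ 2 * N ^ 2 * Real.exp (d * (4 * N + 2 * M)))
    (hΛ : 0 < Λ) (hL : Λ ≤ L) (hL' : 0 ≤ L')
    (hE : ∀ s ∈ Icc (0 : ℝ) 1, ∀ s' ∈ Icc (0 : ℝ) 1,
      energy C σ s s' x y x' y' ≤ (L * s + L') + (4 * N + 2 * M)) :
    fourCorrInt C b θ σ x y x' y' ≤
      ENNReal.ofReal (k * 4 / (d * Λ) * (Real.exp (b * L) * Real.exp (b * L'))) := by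
  have hd : (0 : ℝ) < d := by exact_mod_cast NeZero.pos d
  have hN : 0 ≤ N := (abs_nonneg _).trans hC
  have hb0 : 0 < b := lt_of_lt_of_le (by positivity) hb
  refine lintegral_unitInterval_le_of_exp (F := fun s s' => |fourCorr C b θ σ x y x' y' s s'|)
    hb (by rw [hk]; positivity) hΛ hL hL' fun s hs s' hs' => ?_
  have hle : ∀ {u c : ℝ}, u ∈ Icc (0 : ℝ) 1 → |c| ≤ N → u * c ≤ N := fun {u c} hu hc =>
    (mul_le_mul_of_nonneg_left ((le_abs_self c).trans hc) hu.1).trans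
      (mul_le_of_le_one_left hN hu.2)
  have e1 := exp_le_exp_of_le_of_le hb0.le hbd (by positivity) (hE s hs s' hs')
  have e2 := exp_le_exp_of_le_of_le hb0.le hbd (c := 4 * N + 2 * M) (a := 0) (by positivity)
    (e := s * C x y + s' * C x' y') (by linarith [hle hs hC, hle hs' hC'])
  rw [mul_zero, Real.exp_zero, mul_one] at e2
  have hsub : |Real.exp (b * energy C σ s s' x y x' y') -
      θ * Real.exp (b * (s * C x y + s' * C x' y'))| ≤
      Real.exp (b * energy C σ s s' x y x' y') + Real.exp (b * (s * C x y + s' * C x' y')) := by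
    refine (abs_sub _ _).trans ?_
    rw [abs_mul, abs_of_pos (Real.exp_pos _), abs_of_pos (Real.exp_pos _)]
    exact add_le_add_right (mul_le_of_le_one_left (Real.exp_pos _).le hθ) _
  rw [fourCorr, abs_mul, abs_mul, abs_of_nonneg (sq_nonneg b), abs_mul]
  calc b ^ 2 * (|C x y| * |C x' y'|) * |Real.exp (b * energy C σ s s' x y x' y') -
        θ * Real.exp (b * (s * C x y + s' * C x' y'))|
      ≤ (d : ℝ) ^ 2 * (N * N) * (Real.exp (d * (4 * N + 2 * M)) * Real.exp (b * (L * s + L')) +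
          Real.exp (d * (4 * N + 2 * M))) := by
        gcongr
        exact hsub.trans (add_le_add e1 e2)
    _ = k * (Real.exp (b * L * s) * Real.exp (b * L')) + k * (1 * 1) := by
        rw [hk, mul_add b, Real.exp_add, ← mul_assoc b]; ring

/-- The pairing `{x, x'}, {y, y'}`. -/
theorem IsLogKernelOn.exists_fourCorrInt_le_parallel (h : IsLogKernelOn K D M C) {δ τ : ℝ}
    (hδ : 0 < δ) (hτ : 0 < τ) :
    ∃ ρ : ℝ, 0 < ρ ∧ ∀ b : ℝ, (d : ℝ) / 2 ≤ b → b ≤ d → ∀ θ σ : ℝ, |θ| ≤ 1 → |σ| = 1 →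
      ∀ x ∈ K, ∀ y ∈ K, ∀ x' ∈ K, ∀ y' ∈ K, x ≠ x' → y ≠ y' →
      ‖x - x'‖ < ρ → ‖y - y'‖ < ρ → δ ≤ ‖x - y‖ →
      fourCorrInt C b θ σ x y x' y' ≤ ENNReal.ofReal τ * pairRiesz D b x x' y y' := by
  have hd : (0 : ℝ) < d := by exact_mod_cast NeZero.pos d
  have hM := h.nonneg
  have hD := h.pos
  set N : ℝ := M + |Real.log (D / (δ / 2))| with hN
  have hN0 : 0 ≤ N := by positivity
  set k : ℝ := (d : ℝ) ^ 2 * N ^ 2 * Real.exp (d * (4 * N + 2 * M)) with hk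
  have hk0 : 0 ≤ k := by positivity
  set Λ : ℝ := 1 + k * 4 / (d * τ) with hΛ
  have hΛ1 : 0 ≤ k * 4 / (d * τ) := by positivity
  have hΛ0 : 0 < Λ := by linarith
  have hΛ2 : k * 4 / (d * Λ) ≤ τ := by
    have h1 : k * 4 / (d * τ) ≤ Λ := by linarith
    rw [div_le_iff₀ (by positivity)] at h1 ⊢
    linarith
  refine ⟨min (δ / 4) (D * Real.exp (-Λ)), by positivity, ?_⟩
  intro b hb hbd θ σ hθ hσ x hx y hy x' hx' y' hy' h2 h5 hxx hyy hxy
  obtain ⟨g1, g2, g3, g4⟩ := half_le_cross (min_le_left _ _) hxx hyy hxy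
  have hLΛ : Λ ≤ logDist D x x' := le_logDist hD h2 (hxx.trans_le (min_le_right _ _))
  have hfar : ∀ {p q : Eu d}, p ∈ K → q ∈ K → δ / 2 ≤ ‖p - q‖ → |C p q| ≤ N := fun hp hq hpq =>
    h.abs_cov_le_of_far (by positivity) hp hq hpq
  have f1 := hfar hx hy g1
  have f2 := hfar hx hy' g2
  have f3 := hfar hy hx' (by rwa [norm_sub_rev])
  have f4 := hfar hx' hy' g4
  rw [ofReal_mul_pairRiesz hτ.le]
  refine (fourCorrInt_le_of_energy_le hM hb hbd hθ f1 f4 hk hΛ0 hLΛ (h.logDist_nonneg hy hy')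
    fun s hs s' hs' => ?_).trans (ENNReal.ofReal_le_ofReal
      (mul_le_mul_of_nonneg_right hΛ2 (by positivity)))
  have hle : ∀ {u c : ℝ}, u ∈ Icc (0 : ℝ) 1 → |c| ≤ N → |u * σ * c| ≤ N := fun {u c} hu hc => by
    rw [abs_mul, abs_mul, hσ, mul_one, abs_of_nonneg hu.1]
    exact (mul_le_of_le_one_left (abs_nonneg _) hu.2).trans hc
  have a1 := (neg_le_abs _).trans (hle hs f1)
  have a2 := (le_abs_self _).trans (hle hs f2)
  have a3 := (le_abs_self _).trans (hle hs' f3)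
  have a4 := (neg_le_abs _).trans (hle hs' f4)
  have c1 := (le_abs_self _).trans (h.abs_cov_le hx hx' h2)
  have c2 := (le_abs_self _).trans (h.abs_cov_le hy hy' h5)
  have hL0 : 0 ≤ logDist D x x' := h.logDist_nonneg hx hx'
  -- Dropping s' keeps a linear dependence on s of the singular interaction of x and x'. The one of
  -- y and y' carries no parameter.
  have c3 : s * s' * C x x' ≤ logDist D x x' * s + M := by
    have hss : s * s' ≤ s := mul_le_of_le_one_right hs.1 hs'.2
    have hss0 : 0 ≤ s * s' := mul_nonneg hs.1 hs'.1
    calc s * s' * C x x' ≤ s * s' * (M + logDist D x x') := mul_le_mul_of_nonneg_left c1 hss0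
      _ ≤ s * (M + logDist D x x') := mul_le_mul_of_nonneg_right hss (by positivity)
      _ ≤ logDist D x x' * s + M := by nlinarith [hs.2]
  unfold energy
  linarith

/-- The pairing `{x, y'}, {y, x'}`. -/
theorem IsLogKernelOn.exists_fourCorrInt_le_cross (h : IsLogKernelOn K D M C) {δ τ : ℝ}
    (hδ : 0 < δ) (hτ : 0 < τ) :
    ∃ ρ : ℝ, 0 < ρ ∧ ∀ b : ℝ, (d : ℝ) / 2 ≤ b → b ≤ d → ∀ θ σ : ℝ, |θ| ≤ 1 → |σ| = 1 →
      ∀ x ∈ K, ∀ y ∈ K, ∀ x' ∈ K, ∀ y' ∈ K, x ≠ y' → y ≠ x' →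
      ‖x - y'‖ < ρ → ‖y - x'‖ < ρ → δ ≤ ‖x - y‖ →
      fourCorrInt C b θ σ x y x' y' ≤ ENNReal.ofReal τ * pairRiesz D b x y' y x' := by
  have hd : (0 : ℝ) < d := by exact_mod_cast NeZero.pos d
  have hM := h.nonneg
  have hD := h.pos
  set N : ℝ := M + |Real.log (D / (δ / 2))| with hN
  have hN0 : 0 ≤ N := by positivity
  set k : ℝ := (d : ℝ) ^ 2 * N ^ 2 * Real.exp (d * (4 * N + 2 * M)) with hk
  have hk0 : 0 ≤ k := by positivity
  set Λ : ℝ := 1 + k * 4 / (d * τ) with hΛ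
  have hΛ1 : 0 ≤ k * 4 / (d * τ) := by positivity
  have hΛ0 : 0 < Λ := by linarith
  have hΛ2 : k * 4 / (d * Λ) ≤ τ := by
    have h1 : k * 4 / (d * τ) ≤ Λ := by linarith
    rw [div_le_iff₀ (by positivity)] at h1 ⊢
    linarith
  refine ⟨min (δ / 4) (D * Real.exp (-Λ)), by positivity, ?_⟩
  intro b hb hbd θ σ hθ hσ x hx y hy x' hx' y' hy' h3 h4 hxx hyy hxy
  obtain ⟨g1, g2, g3, g4⟩ := half_le_cross (min_le_left _ _) hxx hyy hxy
  have hLΛ : Λ ≤ logDist D x y' := le_logDist hD h3 (hxx.trans_le (min_le_right _ _))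
  have hfar : ∀ {p q : Eu d}, p ∈ K → q ∈ K → δ / 2 ≤ ‖p - q‖ → |C p q| ≤ N := fun hp hq hpq =>
    h.abs_cov_le_of_far (by positivity) hp hq hpq
  have f1 := hfar hx hy g1
  have f2 := hfar hx hx' g2
  have f3 := hfar hy hy' (by rwa [norm_sub_rev])
  have f4 := hfar hx' hy' (by rwa [norm_sub_rev])
  rw [ofReal_mul_pairRiesz hτ.le]
  refine (fourCorrInt_le_of_energy_le hM hb hbd hθ f1 f4 hk hΛ0 hLΛ (h.logDist_nonneg hy hx')
    fun s hs s' hs' => ?_).trans (ENNReal.ofReal_le_ofReal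
      (mul_le_mul_of_nonneg_right hΛ2 (by positivity)))
  have hle : ∀ {u c R : ℝ}, u ∈ Icc (0 : ℝ) 1 → |c| ≤ R → |u * σ * c| ≤ u * R :=
    fun {u c R} hu hc => by
      rw [abs_mul, abs_mul, hσ, mul_one, abs_of_nonneg hu.1]
      exact mul_le_mul_of_nonneg_left hc hu.1
  have hL0 : 0 ≤ logDist D x y' := h.logDist_nonneg hx hy'
  have hL'0 : 0 ≤ logDist D y x' := h.logDist_nonneg hy hx'
  have a1 := (neg_le_abs _).trans (hle hs f1)
  have a2 := (le_abs_self _).trans f2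
  have a3 := (le_abs_self _).trans f3
  have a4 := (neg_le_abs _).trans (hle hs' f4)
  have c1 := (le_abs_self _).trans (hle hs (h.abs_cov_le hx hy' h3))
  have c2 := (le_abs_self _).trans (hle hs' (h.abs_cov_le hy hx' h4))
  have b1 : s * N ≤ N := mul_le_of_le_one_left hN0 hs.2
  have b2 : s' * N ≤ N := mul_le_of_le_one_left hN0 hs'.2
  have b3 : s * M ≤ M := mul_le_of_le_one_left hM hs.2
  -- Here both singular interactions carry a parameter, but the gain from s alone is enough, so s'
  -- is discarded.
  have b4 : s' * (M + logDist D y x') ≤ M + logDist D y x' :=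
    mul_le_of_le_one_left (by positivity) hs'.2
  have b5 : s * s' * C x x' ≤ N := (mul_le_mul_of_nonneg_left a2 (mul_nonneg hs.1 hs'.1)).trans
    (mul_le_of_le_one_left hN0 (mul_le_one₀ hs.2 hs'.1 hs'.2))
  unfold energy
  linarith [mul_comm (logDist D x y') s, mul_add s M (logDist D x y')]

/-- Four pairwise distinct points of `K`. -/
def IsProper (K : Set (Eu d)) (x y x' y' : Eu d) : Prop :=
  (x ∈ K ∧ y ∈ K ∧ x' ∈ K ∧ y' ∈ K) ∧ x ≠ y ∧ x ≠ x' ∧ x ≠ y' ∧ y ≠ x' ∧ y ≠ y' ∧ x' ≠ y'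

-- If the configuration consists of two short pairs far apart for one of the three pairings, the
-- corresponding estimate gives τ times that pairing. Otherwise all three configurations count as
-- far, so the truncated kernels in the majorant equal the full ones and the uniform bound applies.
-- The constant N does not depend on δ, τ or ρ.
open Classical in
theorem IsLogKernelOn.exists_fourCorrInt_le_majorant (h : IsLogKernelOn K D M C) {θ σ : ℝ}
    (hθσ : θ = 1 ∧ σ = -1 ∨ θ = 0 ∧ σ = 1) :
    ∃ N : ℝ, 0 < N ∧ ∀ δ τ : ℝ, 0 < δ → 0 < τ → ∃ ρ : ℝ, 0 < ρ ∧
      ∀ b : ℝ, (d : ℝ) / 2 ≤ b → b ≤ d → ∀ x y x' y' : Eu d, IsProper K x y x' y' →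
        fourCorrInt C b θ σ x y x' y' ≤
          majorant D b ρ δ (ENNReal.ofReal τ) (ENNReal.ofReal N) x y x' y' := by
  obtain ⟨N, hN, hNle⟩ := h.exists_fourCorrInt_le
  have hθ : |θ| ≤ 1 := by rcases hθσ with ⟨rfl, _⟩ | ⟨rfl, _⟩ <;> simp
  have hσ : |σ| = 1 := by rcases hθσ with ⟨_, rfl⟩ | ⟨_, rfl⟩ <;> simp
  have hσ2 : σ ^ 2 = 1 := by rw [← sq_abs, hσ, one_pow]
  refine ⟨N, hN, fun δ τ hδ hτ => ?_⟩
  obtain ⟨ρ₁, hρ₁, h₁⟩ : ∃ ρ : ℝ, 0 < ρ ∧ ∀ b : ℝ, (d : ℝ) / 2 ≤ b → b ≤ d →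
      ∀ x ∈ K, ∀ y ∈ K, ∀ x' ∈ K, ∀ y' ∈ K, x ≠ y → x' ≠ y' →
      ‖x - y‖ < ρ → ‖x' - y'‖ < ρ → δ ≤ ‖x - x'‖ →
      fourCorrInt C b θ σ x y x' y' ≤ ENNReal.ofReal τ * pairRiesz D b x y x' y' := by
    rcases hθσ with ⟨rfl, rfl⟩ | ⟨rfl, rfl⟩
    · exact h.exists_fourCorrInt_le_of_neg hδ hτ
    · exact h.exists_fourCorrInt_le_of_pos hδ hτ
  obtain ⟨ρ₂, hρ₂, h₂⟩ := h.exists_fourCorrInt_le_parallel hδ hτ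
  obtain ⟨ρ₃, hρ₃, h₃⟩ := h.exists_fourCorrInt_le_cross hδ hτ
  refine ⟨min ρ₁ (min ρ₂ ρ₃), by positivity, ?_⟩
  intro b hb hbd x y x' y' ⟨⟨hx, hy, hx', hy'⟩, n1, n2, n3, n4, n5, n6⟩
  set ρ := min ρ₁ (min ρ₂ ρ₃) with hρ
  have r1 : ρ ≤ ρ₁ := min_le_left _ _
  have r2 : ρ ≤ ρ₂ := (min_le_right _ _).trans (min_le_left _ _)
  have r3 : ρ ≤ ρ₃ := (min_le_right _ _).trans (min_le_right _ _)
  by_cases c1 : ‖x - y‖ < ρ ∧ ‖x' - y'‖ < ρ ∧ δ ≤ ‖x - x'‖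
  · exact (h₁ b hb hbd x hx y hy x' hx' y' hy' n1 n6 (c1.1.trans_le r1) (c1.2.1.trans_le r1)
      c1.2.2).trans (le_self_add.trans le_self_add)
  by_cases c2 : ‖x - x'‖ < ρ ∧ ‖y - y'‖ < ρ ∧ δ ≤ ‖x - y‖
  · exact (h₂ b hb hbd θ σ hθ hσ x hx y hy x' hx' y' hy' n2 n5 (c2.1.trans_le r2)
      (c2.2.1.trans_le r2) c2.2.2).trans (le_self_add.trans (le_self_add.trans le_add_self))
  by_cases c3 : ‖x - y'‖ < ρ ∧ ‖y - x'‖ < ρ ∧ δ ≤ ‖x - y‖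
  · exact (h₃ b hb hbd θ σ hθ hσ x hx y hy x' hx' y' hy' n3 n4 (c3.1.trans_le r3)
      (c3.2.1.trans_le r3) c3.2.2).trans (le_self_add.trans (le_add_self.trans le_add_self))
  refine (hNle b hb hbd θ σ hθ hσ2 x hx y hy x' hx' y' hy' n1 n2 n3 n4 n5 n6).trans ?_
  unfold allPairs majorant pairMajorant farPairRiesz
  rw [if_neg c1, if_neg c2, if_neg c3, mul_add (ENNReal.ofReal N) (_ + _) (_ + _),
    mul_add (ENNReal.ofReal N) (_ + _) (_ + _)]
  exact add_le_add le_add_self (add_le_add le_add_self le_add_self)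

open Classical in
/-- The rescaled truncated four-point functions vanish in the limit `b ↗ d`. -/
theorem IsLogKernelOn.eventually_fourPoint_le (h : IsLogKernelOn K D M C) (hK : IsCompact K)
    {θ σ : ℝ} (hθσ : θ = 1 ∧ σ = -1 ∨ θ = 0 ∧ σ = 1) {ε : ℝ} (hε : 0 < ε) :
    ∀ᶠ b in 𝓝[<] (d : ℝ), ENNReal.ofReal ((d - b) ^ 2) * fourPoint K (fun x y x' y' =>
      if IsProper K x y x' y' then fourCorrInt C b θ σ x y x' y' else 0) ≤ ENNReal.ofReal ε := by
  have hd : (0 : ℝ) < d := by exact_mod_cast NeZero.pos d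
  obtain ⟨N, hN, hmaj⟩ := h.exists_fourCorrInt_le_majorant hθσ
  obtain ⟨τ, δ, hτ, hδ, hint⟩ := exists_fourPoint_majorant_le hK h.pos hN hε
  obtain ⟨ρ, hρ, hle⟩ := hmaj δ τ hδ hτ
  filter_upwards [hint ρ hρ, Ioo_mem_nhdsLT (half_lt_self hd)] with b hb hb'
  refine le_trans (mul_le_mul_right (fourPoint_mono fun x y x' y' => ?_) _) hb
  split_ifs with hp
  · exact hle b hb'.1.le hb'.2.le x y x' y' hp
  · exact zero_le

end CrossPairings

/-! ### The covariance of the field is a logarithmic kernel on compact sets. -/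

section LogCovKernel

variable {d : ℕ} [NeZero d] {Ω : Type*} [MeasurableSpace Ω] {P : Measure Ω}
  [IsProbabilityMeasure P] {U : Opens (Eu d)} {g : Eu d × Eu d → ℝ}
  {X : Ω → (𝓢(Eu d, ℝ) →L[ℝ] ℝ)}

theorem tendsto_mollCov_diag (hg : IsLogCovKernel U g) (η : Mollifier d) {x y : Eu d}
    (hx : x ∈ U) (hy : y ∈ U) (hxy : x ≠ y) :
    Tendsto (fun ε => mollCov U g η ε ε x y) (𝓝[>] 0) (𝓝 (logCov U g x y)) :=
  (tendsto_mollCov hg η hx hy hxy).comp (tendsto_id.prodMk tendsto_id)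

/-- Uniform continuity on the compact set of pairs in K at distance at least δ/2. The radius ρ ≤ δ/4
keeps the perturbed pairs in this set. -/
theorem logCov_equicontinuous (hg : IsLogCovKernel U g) {K : Set (Eu d)} (hK : IsCompact K)
    (hKU : K ⊆ U) {δ : ℝ} (hδ : 0 < δ) {ω : ℝ} (hω : 0 < ω) : ∃ ρ : ℝ, 0 < ρ ∧
    ∀ x ∈ K, ∀ y ∈ K, ∀ x' ∈ K, ∀ y' ∈ K, δ ≤ ‖x - x'‖ → ‖x - y‖ < ρ → ‖x' - y'‖ < ρ →
      |logCov U g y y' - logCov U g x x'| ≤ ω := by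
  set S : Set (Eu d × Eu d) := (K ×ˢ K) ∩ {p | δ / 2 ≤ ‖p.1 - p.2‖} with hS
  have hScompact : IsCompact S :=
    (hK.prod hK).inter_right (isClosed_le continuous_const (by fun_prop))
  have hcont : ContinuousOn (fun p : Eu d × Eu d => logCov U g p.1 p.2) S := by
    rintro ⟨x, y⟩ ⟨⟨hx, hy⟩, hxy⟩
    refine (continuousAt_logCov hg (hKU hx) (hKU hy) ?_).continuousWithinAt
    intro e
    simp only [mem_ofPred_eq, sub_eq_zero.2 e, norm_zero] at hxy
    linarith
  obtain ⟨ρ, hρ, h⟩ := Metric.uniformContinuousOn_iff.1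
    (hScompact.uniformContinuousOn_of_continuous hcont) ω hω
  refine ⟨min ρ (δ / 4), by positivity, fun x hx y hy x' hx' y' hy' h1 h2 h3 => ?_⟩
  obtain ⟨g1, g2, g3, g4⟩ := half_le_cross (min_le_right ρ (δ / 4)) h2 h3 h1
  have := h (y, y') ⟨⟨hy, hy'⟩, g4⟩ (x, x') ⟨⟨hx, hx'⟩, g1⟩ (by
    rw [Prod.dist_eq, max_lt_iff]
    constructor
    · rw [dist_comm, dist_eq_norm]; exact h2.trans_le (min_le_left _ _)
    · rw [dist_comm, dist_eq_norm]; exact h3.trans_le (min_le_left _ _))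
  rw [Real.dist_eq] at this
  exact this.le

/-- The covariance kernel on a compact subset of `U`, with bounds for its mollifications which are
uniform in the mollification parameter. -/
theorem exists_isLogKernelOn (hg : IsLogCovKernel U g) (hX : IsLogCorrelatedField P U g X)
    (η : Mollifier d) {K : Set (Eu d)} (hK : IsCompact K) (hKU : K ⊆ U) :
    ∃ ε₀ D M : ℝ, 0 < ε₀ ∧ IsLogKernelOn K D M (logCov U g) ∧
      (∀ ε δ : ℝ, 0 < ε → ε < ε₀ → 0 < δ → δ < ε₀ → ∀ x ∈ K, ∀ y ∈ K, x ≠ y →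
        |mollCov U g η ε δ x y| ≤ M + logDist D x y) ∧
      ∀ ε : ℝ, 0 < ε → ε < ε₀ → ∀ x ∈ K, ∀ y ∈ K, ∀ x' ∈ K, ∀ y' ∈ K,
        x ≠ y → x ≠ x' → x ≠ y' → y ≠ x' → y ≠ y' → x' ≠ y' →
        ∀ σ s s' : ℝ, σ ^ 2 = 1 → s ∈ Icc (0 : ℝ) 1 → s' ∈ Icc (0 : ℝ) 1 →
          energy (mollCov U g η ε ε) σ s s' x y x' y' ≤
            (s ^ 2 * maxLog D x y x' y' + maxLog D y x x' y' + s' ^ 2 * maxLog D x' x y y' +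
              maxLog D y' x y x') / 2 + M := by
  obtain ⟨R, hR, hKR⟩ : ∃ R : ℝ, 0 < R ∧ ∀ x ∈ K, ∀ y ∈ K, ‖x - y‖ ≤ R := by
    obtain ⟨R, hR, h⟩ := hK.isBounded.exists_pos_norm_le
    refine ⟨2 * R, by positivity, fun x hx y hy => ?_⟩
    linarith [norm_sub_le x y, h x hx, h y hy]
  obtain ⟨ε₁, M₁, hε₁, hM₁, h₁⟩ := exists_energy_mollCov_le hg hX η hK hKU hR hKR
  obtain ⟨ε₂, M₂, hε₂, hM₂, h₂⟩ := exists_bound_mollCov_sub_log hg η hK hKU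
  obtain ⟨M₃, hM₃⟩ := (hK.prod hK).exists_bound_of_continuousOn
    (hg.continuousOn.mono (prod_mono hKU hKU))
  -- The summands are the Onsager error, the mollification error, the supremum of g on K × K, the
  -- passage from log(1/r) to log(R/r), and a lower bound for the logarithm at the largest
  -- admissible scale.
  set M := M₁ + M₂ + |M₃| + |Real.log R| + |Real.log (max R ε₂)| with hM
  have n3 := abs_nonneg M₃
  have nR := abs_nonneg (Real.log R)
  have nR' := abs_nonneg (Real.log (max R ε₂))
  have hlog : ∀ x y : Eu d, x ≠ y → logDist R x y = Real.log R + Real.log (1 / ‖x - y‖) := by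
    intro x y hxy
    have h0 : 0 < ‖x - y‖ := norm_pos_iff.2 (sub_ne_zero.2 hxy)
    rw [logDist, Real.log_div hR.ne' h0.ne', one_div, Real.log_inv, sub_eq_add_neg]
  have henergy : ∀ ε : ℝ, 0 < ε → ε < min ε₁ ε₂ → ∀ x ∈ K, ∀ y ∈ K, ∀ x' ∈ K, ∀ y' ∈ K,
        x ≠ y → x ≠ x' → x ≠ y' → y ≠ x' → y ≠ y' → x' ≠ y' →
        ∀ σ s s' : ℝ, σ ^ 2 = 1 → s ∈ Icc (0 : ℝ) 1 → s' ∈ Icc (0 : ℝ) 1 →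
          energy (mollCov U g η ε ε) σ s s' x y x' y' ≤
            (s ^ 2 * maxLog R x y x' y' + maxLog R y x x' y' + s' ^ 2 * maxLog R x' x y y' +
              maxLog R y' x y x') / 2 + M := by
    intro ε hε hε' x hx y hy x' hx' y' hy' n1 n2 n3 n4 n5 n6 σ s s' hσ hs hs'
    have := h₁ ε hε (hε'.trans_le (min_le_left _ _)) x hx y hy x' hx' y' hy' n1 n2 n3 n4 n5 n6
      σ s s' hσ hs hs'
    linarith
  refine ⟨min ε₁ ε₂, R, M, lt_min hε₁ hε₂, ⟨hR, by positivity, hKR, ?_, ?_, ?_⟩, ?_, henergy⟩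
  · intro x hx y hy hxy
    rw [logCov_of_mem (hKU hx) (hKU hy), hlog x y hxy]
    have h3 := abs_le.1 ((hM₃ (x, y) ⟨hx, hy⟩).trans (le_abs_self _))
    have h4 := neg_abs_le (Real.log R)
    have h5 := le_abs_self (Real.log R)
    rw [abs_le]
    constructor <;> linarith [h3.1, h3.2]
  · intro δ hδ ω hω
    exact logCov_equicontinuous hg hK hKU hδ hω
  · intro x hx y hy x' hx' y' hy' n1 n2 n3 n4 n5 n6 σ s s' hσ hs hs'
    have t : ∀ {p q : Eu d}, p ∈ K → q ∈ K → p ≠ q →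
        Tendsto (fun ε => mollCov U g η ε ε p q) (𝓝[>] 0) (𝓝 (logCov U g p q)) :=
      fun hp hq hpq => tendsto_mollCov_diag hg η (hKU hp) (hKU hq) hpq
    -- Positive definiteness is available through the mollified field. As the four points are
    -- distinct, the inequality passes to the limit ε → 0.
    refine le_of_tendsto (f := fun ε => energy (mollCov U g η ε ε) σ s s' x y x' y')
      (x := 𝓝[>] 0) ?_ ?_
    · unfold energy
      exact ((((((t hx hy n1).const_mul (s * σ)).neg.add ((t hx hx' n2).const_mul (s * s'))).add
        ((t hx hy' n3).const_mul (s * σ))).add ((t hy hx' n4).const_mul (s' * σ))).add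
        (t hy hy' n5)).sub ((t hx' hy' n6).const_mul (s' * σ))
    · filter_upwards [Ioo_mem_nhdsGT (lt_min hε₁ hε₂)] with ε hε
      exact henergy ε hε.1 hε.2 x hx y hy x' hx' y' hy' n1 n2 n3 n4 n5 n6 σ s s' hσ hs hs'
  · intro ε δ hε hε' hδ hδ' x hx y hy hxy
    have hε2 := hε'.trans_le (min_le_right ε₁ ε₂)
    have hδ2 := hδ'.trans_le (min_le_right ε₁ ε₂)
    have h0 : 0 < ‖x - y‖ := norm_pos_iff.2 (sub_ne_zero.2 hxy)
    have h3 := abs_le.1 (h₂ ε δ hε hε2 hδ hδ2 x hx y hy)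
    have h4 : Real.log (1 / max ‖x - y‖ (max ε δ)) ≤ Real.log (1 / ‖x - y‖) :=
      Real.log_le_log (by positivity) (one_div_le_one_div_of_le h0 (le_max_left _ _))
    have h5 : -Real.log (max R ε₂) ≤ Real.log (1 / max ‖x - y‖ (max ε δ)) := by
      rw [one_div, Real.log_inv, neg_le_neg_iff]
      exact Real.log_le_log (by positivity)
        (max_le ((hKR x hx y hy).trans (le_max_left _ _)) ((max_lt hε2 hδ2).le.trans
          (le_max_right _ _)))
    have h6 := logDist_nonneg (hKR x hx y hy)
    have h7 := hlog x y hxy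
    have h8 := neg_abs_le (Real.log R)
    have h9 := le_abs_self (Real.log (max R ε₂))
    rw [abs_le]
    constructor <;> linarith [h3.1, h3.2]

end LogCovKernel

/-! ### The critical Riesz kernel as an approximate identity. -/

section ApproximateIdentity

variable {d : ℕ} [NeZero d] {U : Opens (Eu d)} {g : Eu d × Eu d → ℝ}

/-- The measures `(d - b) / |S| |u| ^ (-b) du` on a ball concentrate at the origin as `b ↗ d`. -/
theorem tendsto_integral_norm_rpow_mul {R : ℝ} (hR : 0 < R) {h : ℝ → Eu d → ℂ} {A : ℝ} {ℓ : ℂ}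
    (hm : ∀ b, AEStronglyMeasurable (h b) (volume.restrict (Metric.ball 0 R)))
    (hA : ∀ b ∈ Ioo (0 : ℝ) d, ∀ u, ‖h b u‖ ≤ A)
    (hlim : Tendsto (Function.uncurry h) (𝓝[<] (d : ℝ) ×ˢ 𝓝 0) (𝓝 ℓ)) :
    Tendsto (fun b : ℝ => (((d - b) / sphereArea d : ℝ) : ℂ) *
      ∫ u in Metric.ball (0 : Eu d) R, ((‖u‖ ^ (-b) : ℝ) : ℂ) * h b u) (𝓝[<] (d : ℝ)) (𝓝 ℓ) := by
  have hd : (0 : ℝ) < d := by exact_mod_cast NeZero.pos d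
  have hS := sphereArea_pos (d := d)
  set W : ℝ := volume.real (Metric.ball (0 : Eu d) R) with hW
  have hsub : Tendsto (fun b : ℝ => (d : ℝ) - b) (𝓝[<] (d : ℝ)) (𝓝 0) := by
    have : Tendsto (fun b : ℝ => (d : ℝ) - b) (𝓝 (d : ℝ)) (𝓝 ((d : ℝ) - d)) :=
      tendsto_const_nhds.sub tendsto_id
    rw [sub_self] at this
    exact this.mono_left nhdsWithin_le_nhds
  have hpow : Tendsto (fun b : ℝ => R ^ ((d : ℝ) - b)) (𝓝[<] (d : ℝ)) (𝓝 1) := by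
    have := (Real.continuous_const_rpow hR.ne').continuousAt.tendsto.comp hsub
    simpa [Function.comp_def] using this
  have hI : ∀ b < (d : ℝ), IntegrableOn (fun u : Eu d => ‖u‖ ^ (-b)) (Metric.ball 0 R) :=
    fun b hb => integrableOn_norm_rpow hb R
  have hIh : ∀ b ∈ Ioo (0 : ℝ) d, IntegrableOn (fun u : Eu d => ((‖u‖ ^ (-b) : ℝ) : ℂ) * h b u)
      (Metric.ball 0 R) := fun b hb =>
    (hI b hb.2).ofReal.mul_bdd (c := A) (hm b) (ae_of_all _ (hA b hb))
  have key : ∀ ε : ℝ, 0 < ε → ∃ N : ℝ, ∀ᶠ b in 𝓝[<] (d : ℝ),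
      ‖(((d - b) / sphereArea d : ℝ) : ℂ) * (∫ u in Metric.ball (0 : Eu d) R,
        ((‖u‖ ^ (-b) : ℝ) : ℂ) * h b u) - ((R ^ ((d : ℝ) - b) : ℝ) : ℂ) * ℓ‖ ≤
        ε * R ^ ((d : ℝ) - b) + (d - b) * N := by
    intro ε hε
    have hev := (Metric.tendsto_nhds.1 hlim) ε hε
    rw [eventually_prod_iff] at hev
    obtain ⟨p, hp, q, hq, hpq⟩ := hev
    obtain ⟨r, hr, hrq⟩ := Metric.eventually_nhds_iff.1 hq
    -- Bounds the integrand outside the ball of radius r uniformly in b ∈ (0, d). There the kernel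
    -- has no singularity, and the prefactor d - b makes the contribution vanish.
    set B : ℝ := (A + ‖ℓ‖) * (max 1 r⁻¹) ^ d with hB
    refine ⟨B * W / sphereArea d, ?_⟩
    filter_upwards [hp, Ioo_mem_nhdsLT hd] with b hpb hb
    have hdb : 0 < (d : ℝ) - b := sub_pos.2 hb.2
    have e1 : ((R ^ ((d : ℝ) - b) : ℝ) : ℂ) * ℓ = (((d - b) / sphereArea d : ℝ) : ℂ) *
        ∫ u in Metric.ball (0 : Eu d) R, ((‖u‖ ^ (-b) : ℝ) : ℂ) * ℓ := by
      rw [integral_mul_const, integral_complex_ofReal, integral_norm_rpow hb.2 hR, ← mul_assoc,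
        ← Complex.ofReal_mul]
      congr 2
      field_simp
    have hIl : IntegrableOn (fun u : Eu d => ((‖u‖ ^ (-b) : ℝ) : ℂ) * ℓ) (Metric.ball 0 R) :=
      (hI b hb.2).ofReal.mul_const ℓ
    rw [e1, ← mul_sub, ← integral_sub (hIh b hb) hIl, norm_mul,
      Complex.norm_real, Real.norm_of_nonneg (by positivity)]
    have hpt : ∀ u : Eu d, ‖((‖u‖ ^ (-b) : ℝ) : ℂ) * h b u - ((‖u‖ ^ (-b) : ℝ) : ℂ) * ℓ‖ ≤
        ε * ‖u‖ ^ (-b) + B := by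
      intro u
      have hpos : 0 ≤ ‖u‖ ^ (-b) := Real.rpow_nonneg (norm_nonneg _) _
      have hA0 : 0 ≤ A := (norm_nonneg _).trans (hA b hb u)
      have hB0 : 0 ≤ B := by positivity
      rw [← mul_sub, norm_mul, Complex.norm_real, Real.norm_of_nonneg hpos]
      by_cases hu : ‖u‖ < r
      · have := hpq hpb (hrq (by rwa [dist_zero_right]))
        rw [dist_eq_norm] at this
        have h2 := mul_le_mul_of_nonneg_left this.le hpos
        change ‖u‖ ^ (-b) * ‖h b u - ℓ‖ ≤ _ at h2
        linarith
      · have h1 : ‖u‖ ^ (-b) ≤ (max 1 r⁻¹) ^ d := by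
          have hru : r ≤ ‖u‖ := not_lt.1 hu
          calc ‖u‖ ^ (-b) = (‖u‖⁻¹) ^ b := by
                rw [Real.rpow_neg (norm_nonneg _), Real.inv_rpow (norm_nonneg _)]
            _ ≤ (max 1 r⁻¹) ^ b := Real.rpow_le_rpow (by positivity)
                ((inv_anti₀ hr hru).trans (le_max_right _ _)) hb.1.le
            _ ≤ (max 1 r⁻¹) ^ (d : ℝ) := Real.rpow_le_rpow_of_exponent_le (le_max_left _ _) hb.2.le
            _ = _ := Real.rpow_natCast _ _
        have h2 : ‖h b u - ℓ‖ ≤ A + ‖ℓ‖ := (norm_sub_le _ _).trans (add_le_add_left (hA b hb u) _)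
        have h3 : ‖u‖ ^ (-b) * ‖h b u - ℓ‖ ≤ B := by
          rw [hB, mul_comm]
          gcongr
        have h4 : 0 ≤ ε * ‖u‖ ^ (-b) := by positivity
        linarith
    have hfin : IsFiniteMeasure (volume.restrict (Metric.ball (0 : Eu d) R)) :=
      ⟨by rw [Measure.restrict_apply_univ]; exact measure_ball_lt_top⟩
    have hint : IntegrableOn (fun u : Eu d => ε * ‖u‖ ^ (-b) + B) (Metric.ball 0 R) :=
      ((hI b hb.2).const_mul ε).add (integrable_const B)
    have hle := norm_integral_le_of_norm_le hint (ae_of_all _ hpt)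
    rw [integral_add ((hI b hb.2).const_mul ε) (integrable_const B), integral_const_mul,
      integral_norm_rpow hb.2 hR, integral_const, smul_eq_mul, measureReal_restrict_apply_univ] at hle
    calc (d - b) / sphereArea d * ‖∫ u in Metric.ball (0 : Eu d) R, (((‖u‖ ^ (-b) : ℝ) : ℂ) * h b u -
          ((‖u‖ ^ (-b) : ℝ) : ℂ) * ℓ)‖
        ≤ (d - b) / sphereArea d *
          (ε * (sphereArea d * (R ^ ((d : ℝ) - b) / (d - b))) + W * B) := by gcongr
      _ = ε * R ^ ((d : ℝ) - b) + (d - b) * (B * W / sphereArea d) := by field_simp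
  have hzero : Tendsto (fun b : ℝ => (((d - b) / sphereArea d : ℝ) : ℂ) *
      (∫ u in Metric.ball (0 : Eu d) R, ((‖u‖ ^ (-b) : ℝ) : ℂ) * h b u) -
      ((R ^ ((d : ℝ) - b) : ℝ) : ℂ) * ℓ) (𝓝[<] (d : ℝ)) (𝓝 0) := by
    rw [Metric.tendsto_nhds]
    intro ε hε
    obtain ⟨N, hN⟩ := key (ε / 2) (by positivity)
    have ht : Tendsto (fun b : ℝ => ε / 2 * R ^ ((d : ℝ) - b) + (d - b) * N) (𝓝[<] (d : ℝ))
        (𝓝 (ε / 2 * 1 + 0 * N)) := (hpow.const_mul _).add (hsub.mul_const N)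
    filter_upwards [hN, ht.eventually (gt_mem_nhds (show ε / 2 * 1 + 0 * N < ε by linarith))]
      with b hb hb'
    rw [dist_zero_right]
    exact hb.trans_lt hb'
  have hfinal := hzero.add
    (((Complex.continuous_ofReal.tendsto 1).comp hpow).mul_const ℓ)
  simpa using hfinal

end ApproximateIdentity

/-! ### The limit of the two-point integral. -/

section FirstMoment

variable {d : ℕ} [NeZero d] {U : Opens (Eu d)} {g : Eu d × Eu d → ℝ}

theorem IsLogCovKernel.measurable_indicator (hg : IsLogCovKernel U g) :
    Measurable (((U : Set (Eu d)) ×ˢ (U : Set (Eu d))).indicator g) := by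
  classical
  rw [← piecewise_eq_indicator]
  exact hg.continuousOn.measurable_piecewise continuousOn_const
    (U.isOpen.measurableSet.prod U.isOpen.measurableSet)

theorem IsLogCovKernel.measurable_logCov (hg : IsLogCovKernel U g) :
    Measurable fun p : Eu d × Eu d => logCov U g p.1 p.2 := by
  have h1 : Measurable fun z : Eu d × Eu d => Real.log (1 / ‖z.1 - z.2‖) :=
    Real.measurable_log.comp (measurable_const.div (measurable_fst.sub measurable_snd).norm)
  have e : (fun p : Eu d × Eu d => logCov U g p.1 p.2) = fun p =>
      ((U : Set (Eu d)) ×ˢ (U : Set (Eu d))).indicator (fun z => Real.log (1 / ‖z.1 - z.2‖)) p +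
      ((U : Set (Eu d)) ×ˢ (U : Set (Eu d))).indicator g p := by
    funext p
    exact congrFun (indicator_add _ _ _) p
  rw [e]
  exact (h1.indicator (U.isOpen.measurableSet.prod U.isOpen.measurableSet)).add
    hg.measurable_indicator

theorem integrable_exp_logDist {K : Set (Eu d)} (hK : IsCompact K) {D : ℝ} (hD : 0 < D) {b : ℝ}
    (hb : 0 < b) (hbd : b < d) :
    Integrable (fun p : Eu d × Eu d => Real.exp (b * logDist D p.1 p.2))
      ((volume.restrict K).prod (volume.restrict K)) := by
  obtain ⟨A, hA, h⟩ := exists_lintegral_riesz_le hK hD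
  have hm : Measurable fun p : Eu d × Eu d => Real.exp (b * logDist D p.1 p.2) :=
    ((measurable_logDist D).const_mul b).exp
  refine ⟨hm.aestronglyMeasurable, ?_⟩
  rw [hasFiniteIntegral_iff_ofReal (ae_of_all _ fun p => (Real.exp_pos _).le),
    lintegral_prod _ hm.ennreal_ofReal.aemeasurable]
  calc ∫⁻ x in K, ∫⁻ y in K, riesz D b x y ≤ ∫⁻ _ in K, ENNReal.ofReal (A / (d - b)) :=
        lintegral_mono fun x => h b hb hbd x
    _ < ⊤ := by
        rw [lintegral_const, Measure.restrict_apply_univ]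
        exact ENNReal.mul_lt_top ENNReal.ofReal_lt_top hK.measure_lt_top

theorem isFiniteMeasure_restrict_of_isCompact {K : Set (Eu d)} (hK : IsCompact K) :
    IsFiniteMeasure (volume.restrict K) :=
  ⟨by rw [Measure.restrict_apply_univ]; exact hK.measure_lt_top⟩

variable {K : Set (Eu d)} {f : Eu d → ℂ}

theorem integrable_exp_logCov (hg : IsLogCovKernel U g) (hK : IsCompact K) {D M : ℝ}
    (h : IsLogKernelOn K D M (logCov U g)) {b : ℝ} (hb : 0 < b) (hbd : b < d) :
    Integrable (fun p : Eu d × Eu d => Real.exp (b * logCov U g p.1 p.2))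
      ((volume.restrict K).prod (volume.restrict K)) := by
  have hmK := hK.measurableSet
  refine ((integrable_exp_logDist hK h.pos hb hbd).const_mul (Real.exp (b * M))).mono'
    ((hg.measurable_logCov.const_mul b).exp).aestronglyMeasurable ?_
  have h1 : ∀ᵐ p : Eu d × Eu d ∂((volume.restrict K).prod (volume.restrict K)),
      p ∈ K ×ˢ K := by
    rw [Measure.prod_restrict]
    exact ae_restrict_mem (hmK.prod hmK)
  have h2 : ∀ᵐ p : Eu d × Eu d ∂((volume.restrict K).prod (volume.restrict K)), p.1 ≠ p.2 := by
    rw [Measure.prod_restrict]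
    exact ae_restrict_of_ae ae_ne_prod
  filter_upwards [h1, h2] with p hp hne
  rw [Real.norm_of_nonneg (Real.exp_pos _).le, ← Real.exp_add, Real.exp_le_exp, ← mul_add]
  exact mul_le_mul_of_nonneg_left ((le_abs_self _).trans (h.abs_cov_le hp.1 hp.2 hne)) hb.le

/-- Substitution u = x - y, after which e^{b log(1/|u|)} is the Riesz kernel |u|^{-b} and the
remaining factor is bounded. Both domains may be changed freely because f vanishes outside K. -/
theorem setIntegral_exp_logCov_eq (hKU : K ⊆ U) (hf0 : ∀ x ∉ K, f x = 0)
    {R : ℝ} (hKR : ∀ x ∈ K, ∀ y ∈ K, ‖x - y‖ < R) {b : ℝ} {x : Eu d} (hx : x ∈ K) :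
    ∫ y in K, f x * (starRingEnd ℂ) (f y) * ((Real.exp (b * logCov U g x y) : ℝ) : ℂ) =
      ∫ u in Metric.ball (0 : Eu d) R, ((‖u‖ ^ (-b) : ℝ) : ℂ) *
        (f x * (starRingEnd ℂ) (f (x - u)) * ((Real.exp (b *
          ((U : Set (Eu d)) ×ˢ (U : Set (Eu d))).indicator g (x, x - u)) : ℝ) : ℂ)) := by
  set φ : Eu d → ℂ := fun y => f x * (starRingEnd ℂ) (f y) *
    ((Real.exp (b * logCov U g x y) : ℝ) : ℂ) with hφ
  have e1 : ∫ y in K, φ y = ∫ y, φ y := by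
    refine setIntegral_eq_integral_of_forall_compl_eq_zero fun y hy => ?_
    simp [hφ, hf0 y hy]
  have e2 : ∫ u in Metric.ball (0 : Eu d) R, φ (x - u) = ∫ u, φ (x - u) := by
    refine setIntegral_eq_integral_of_forall_compl_eq_zero fun u hu => ?_
    have : x - u ∉ K := fun h => hu (by
      have := hKR x hx _ h
      rwa [sub_sub_cancel, ← mem_ball_zero_iff] at this)
    simp [hφ, hf0 _ this]
  rw [e1, ← integral_sub_left_eq_self φ volume x, ← e2]
  refine setIntegral_congr_ae measurableSet_ball ?_
  filter_upwards [compl_mem_ae_iff.2 (measure_singleton (0 : Eu d))] with u hu _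
  by_cases hxu : x - u ∈ K
  · have h0 : 0 < ‖u‖ := norm_pos_iff.2 hu
    have hmem : (x, x - u) ∈ (U : Set (Eu d)) ×ˢ (U : Set (Eu d)) := ⟨hKU hx, hKU hxu⟩
    rw [hφ, indicator_of_mem hmem]
    simp only
    rw [logCov_of_mem (hKU hx) (hKU hxu), sub_sub_cancel, mul_add, Real.exp_add,
      show Real.exp (b * Real.log (1 / ‖u‖)) = ‖u‖ ^ (-b) by
        rw [Real.rpow_def_of_pos h0, one_div, Real.log_inv]; congr 1; ring]
    push_cast
    ring
  · simp [hφ, hf0 _ hxu]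

/-- For each x the inner integral is tested against the approximate identity (d - b)/|S^{d-1}|
|u|^{-b}, which evaluates f̄(x - u) e^{b g(x, x - u)} at u = 0 and b = d. Dominated convergence in x
concludes, and the subtracted 1 disappears with the factor d - b. -/
theorem tendsto_first_moment (hg : IsLogCovKernel U g) (hK : IsCompact K) (hKU : K ⊆ U) {D M : ℝ}
    (h : IsLogKernelOn K D M (logCov U g)) (hf : Continuous f) (hf0 : ∀ x ∉ K, f x = 0) :
    Tendsto (fun b : ℝ => (((d - b) / sphereArea d : ℝ) : ℂ) *
      ∫ p : Eu d × Eu d, f p.1 * (starRingEnd ℂ) (f p.2) *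
        (((Real.exp (b * logCov U g p.1 p.2) : ℝ) : ℂ) - 1)
        ∂((volume.restrict K).prod (volume.restrict K))) (𝓝[<] (d : ℝ))
      (𝓝 ((∫ x in K, ‖f x‖ ^ 2 * Real.exp (d * g (x, x)) : ℝ) : ℂ)) := by
  have hd : (0 : ℝ) < d := by exact_mod_cast NeZero.pos d
  have hS := sphereArea_pos (d := d)
  have hfinK := isFiniteMeasure_restrict_of_isCompact hK
  set lam := volume.restrict K with hlam
  obtain ⟨Cf, hCf⟩ : ∃ C, ∀ x, ‖f x‖ ≤ C := by
    obtain ⟨C, hC⟩ := hK.exists_bound_of_continuousOn hf.continuousOn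
    refine ⟨max C 0, fun x => ?_⟩
    by_cases hx : x ∈ K
    · exact (hC x hx).trans (le_max_left _ _)
    · rw [hf0 x hx, norm_zero]; exact le_max_right _ _
  obtain ⟨G, hG⟩ := (hK.prod hK).exists_bound_of_continuousOn
    (hg.continuousOn.mono (prod_mono hKU hKU))
  have hCf0 : 0 ≤ Cf := (norm_nonneg _).trans (hCf 0)
  set gU := ((U : Set (Eu d)) ×ˢ (U : Set (Eu d))).indicator g with hgU
  have hgUm : Measurable gU := hg.measurable_indicator
  -- The differences of points of K have norm at most D. The margin 1 places them in the open ball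
  -- of radius R.
  set R := D + 1 with hR
  have hR0 : 0 < R := by linarith [h.pos]
  have hKR : ∀ x ∈ K, ∀ y ∈ K, ‖x - y‖ < R := fun x hx y hy => by
    linarith [h.norm_sub_le x hx y hy]
  set A : ℝ := Cf * Cf * Real.exp (d * |G|) with hA
  have hA0 : 0 ≤ A := by positivity
  have hsub : Tendsto (fun b : ℝ => (d : ℝ) - b) (𝓝[<] (d : ℝ)) (𝓝 0) := by
    have : Tendsto (fun b : ℝ => (d : ℝ) - b) (𝓝 (d : ℝ)) (𝓝 ((d : ℝ) - d)) :=
      tendsto_const_nhds.sub tendsto_id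
    rw [sub_self] at this
    exact this.mono_left nhdsWithin_le_nhds
  set k : Eu d → ℝ → Eu d → ℂ := fun x b u => f x * (starRingEnd ℂ) (f (x - u)) *
    ((Real.exp (b * gU (x, x - u)) : ℝ) : ℂ) with hk
  have hkA : ∀ x ∈ K, ∀ b ∈ Ioo (0 : ℝ) d, ∀ u, ‖k x b u‖ ≤ A := by
    intro x hx b hb u
    simp only [hk]
    by_cases hu : x - u ∈ K
    · rw [norm_mul, norm_mul, RCLike.norm_conj, Complex.norm_real,
        Real.norm_of_nonneg (Real.exp_pos _).le]
      have h1 : b * gU (x, x - u) ≤ d * |G| := by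
        rw [hgU, indicator_of_mem (show (x, x - u) ∈ (U : Set (Eu d)) ×ˢ (U : Set (Eu d)) from
          ⟨hKU hx, hKU hu⟩)]
        have h2 : g (x, x - u) ≤ |G| := (le_abs_self _).trans ((hG _ ⟨hx, hu⟩).trans (le_abs_self _))
        exact (mul_le_mul_of_nonneg_left h2 hb.1.le).trans
          (mul_le_mul_of_nonneg_right hb.2.le (abs_nonneg _))
      exact mul_le_mul (mul_le_mul (hCf _) (hCf _) (norm_nonneg _) hCf0)
        (Real.exp_le_exp.2 h1) (Real.exp_pos _).le (by positivity)
    · rw [hf0 _ hu]; simpa using hA0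
  have hkm : ∀ x b, Measurable (k x b) := by
    intro x b
    have h1 : Measurable fun u : Eu d => f (x - u) := hf.measurable.comp (by fun_prop)
    have h2 : Measurable fun u : Eu d => gU (x, x - u) := hgUm.comp (by fun_prop)
    exact ((Complex.continuous_conj.measurable.comp h1).const_mul (f x)).mul
      (Complex.measurable_ofReal.comp ((h2.const_mul b).exp))
  have hklim : ∀ x ∈ K, Tendsto (Function.uncurry (k x)) (𝓝[<] (d : ℝ) ×ˢ 𝓝 0)
      (𝓝 (f x * (starRingEnd ℂ) (f x) * ((Real.exp (d * g (x, x)) : ℝ) : ℂ))) := by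
    intro x hx
    have hxx : (x, x) ∈ (U : Set (Eu d)) ×ˢ (U : Set (Eu d)) := ⟨hKU hx, hKU hx⟩
    have hnh := (U.isOpen.prod U.isOpen).mem_nhds hxx
    have hgc : ContinuousAt gU (x, x) := by
      refine (hg.continuousOn.continuousAt hnh).congr ?_
      filter_upwards [hnh] with z hz
      rw [hgU, indicator_of_mem hz]
    have hgc' : ContinuousAt (fun p : ℝ × Eu d => gU (x, x - p.2)) ((d : ℝ), 0) := by
      refine ContinuousAt.comp' (f := fun p : ℝ × Eu d => (x, x - p.2)) (g := gU) ?_ (by fun_prop)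
      simpa using hgc
    have hfc : Continuous fun p : ℝ × Eu d => f x * (starRingEnd ℂ) (f (x - p.2)) :=
      continuous_const.mul (Complex.continuous_conj.comp (hf.comp (by fun_prop)))
    have hc : ContinuousAt (Function.uncurry (k x)) ((d : ℝ), 0) :=
      hfc.continuousAt.mul (Complex.continuous_ofReal.continuousAt.comp
        ((continuousAt_fst.mul hgc').rexp))
    have hval : Function.uncurry (k x) ((d : ℝ), 0) =
        f x * (starRingEnd ℂ) (f x) * ((Real.exp (d * g (x, x)) : ℝ) : ℂ) := by
      simp only [Function.uncurry, hk, sub_zero]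
      rw [hgU, indicator_of_mem hxx]
    rw [← hval]
    refine hc.tendsto.mono_left ?_
    rw [nhds_prod_eq]
    exact Filter.prod_mono nhdsWithin_le_nhds le_rfl
  have hlimx : ∀ x ∈ K, Tendsto (fun b : ℝ => (((d - b) / sphereArea d : ℝ) : ℂ) *
      ∫ y in K, f x * (starRingEnd ℂ) (f y) * ((Real.exp (b * logCov U g x y) : ℝ) : ℂ))
      (𝓝[<] (d : ℝ))
      (𝓝 (f x * (starRingEnd ℂ) (f x) * ((Real.exp (d * g (x, x)) : ℝ) : ℂ))) := by
    intro x hx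
    have := tendsto_integral_norm_rpow_mul hR0 (fun b => (hkm x b).aestronglyMeasurable)
      (hkA x hx) (hklim x hx)
    refine this.congr fun b => ?_
    rw [setIntegral_exp_logCov_eq hKU hf0 hKR hx]
  have hbnd : ∀ x ∈ K, ∀ b ∈ Ioo (0 : ℝ) d, ‖(((d - b) / sphereArea d : ℝ) : ℂ) *
      ∫ y in K, f x * (starRingEnd ℂ) (f y) * ((Real.exp (b * logCov U g x y) : ℝ) : ℂ)‖ ≤
      A * max 1 R ^ (d : ℝ) := by
    intro x hx b hb
    have hdb : 0 < (d : ℝ) - b := sub_pos.2 hb.2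
    rw [setIntegral_exp_logCov_eq hKU hf0 hKR hx, norm_mul, Complex.norm_real,
      Real.norm_of_nonneg (by positivity)]
    have h1 := norm_integral_le_of_norm_le ((integrableOn_norm_rpow hb.2 R).const_mul A)
      (ae_of_all _ fun u : Eu d => show ‖((‖u‖ ^ (-b) : ℝ) : ℂ) * k x b u‖ ≤ A * ‖u‖ ^ (-b) by
        rw [norm_mul, Complex.norm_real, Real.norm_of_nonneg (Real.rpow_nonneg (norm_nonneg _) _),
          mul_comm]
        exact mul_le_mul_of_nonneg_right (hkA x hx b hb u) (Real.rpow_nonneg (norm_nonneg _) _))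
    rw [integral_const_mul, integral_norm_rpow hb.2 hR0] at h1
    refine (mul_le_mul_of_nonneg_left h1 (by positivity)).trans ?_
    have e : (d - b) / sphereArea d * (A * (sphereArea d * (R ^ ((d : ℝ) - b) / (d - b)))) =
        A * R ^ ((d : ℝ) - b) := by field_simp
    rw [e]
    refine mul_le_mul_of_nonneg_left ?_ hA0
    exact (Real.rpow_le_rpow hR0.le (le_max_right 1 R) hdb.le).trans
      (Real.rpow_le_rpow_of_exponent_le (le_max_left _ _) (by linarith [hb.1]))
  have hfm : Measurable fun p : Eu d × Eu d => f p.1 * (starRingEnd ℂ) (f p.2) :=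
    (hf.measurable.comp measurable_fst).mul
      (Complex.continuous_conj.measurable.comp (hf.measurable.comp measurable_snd))
  have hfb : ∀ p : Eu d × Eu d, ‖f p.1 * (starRingEnd ℂ) (f p.2)‖ ≤ Cf * Cf := fun p => by
    rw [norm_mul, RCLike.norm_conj]
    exact mul_le_mul (hCf _) (hCf _) (norm_nonneg _) hCf0
  have hint0 : Integrable (fun p : Eu d × Eu d => f p.1 * (starRingEnd ℂ) (f p.2))
      (lam.prod lam) := Integrable.of_bound hfm.aestronglyMeasurable (Cf * Cf) (ae_of_all _ hfb)
  have hint1 : ∀ b ∈ Ioo (0 : ℝ) d, Integrable (fun p : Eu d × Eu d =>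
      f p.1 * (starRingEnd ℂ) (f p.2) * ((Real.exp (b * logCov U g p.1 p.2) : ℝ) : ℂ))
      (lam.prod lam) := fun b hb =>
    ((integrable_exp_logCov hg hK h hb.1 hb.2).ofReal).bdd_mul (c := Cf * Cf)
      hfm.aestronglyMeasurable (ae_of_all _ hfb)
  have hmain : Tendsto (fun b : ℝ => ∫ x in K, (((d - b) / sphereArea d : ℝ) : ℂ) *
      ∫ y in K, f x * (starRingEnd ℂ) (f y) * ((Real.exp (b * logCov U g x y) : ℝ) : ℂ))
      (𝓝[<] (d : ℝ))
      (𝓝 (∫ x in K, f x * (starRingEnd ℂ) (f x) * ((Real.exp (d * g (x, x)) : ℝ) : ℂ))) := by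
    refine tendsto_integral_filter_of_dominated_convergence (fun _ => A * max 1 R ^ (d : ℝ))
      ?_ ?_ (integrable_const _) ?_
    · filter_upwards [Ioo_mem_nhdsLT hd] with b hb
      exact ((hint1 b hb).aestronglyMeasurable.integral_prod_right').const_mul _
    · filter_upwards [Ioo_mem_nhdsLT hd] with b hb
      filter_upwards [ae_restrict_mem hK.measurableSet] with x hx
      exact hbnd x hx b hb
    · filter_upwards [ae_restrict_mem hK.measurableSet] with x hx
      exact hlimx x hx
  have hconst : Tendsto (fun b : ℝ => (((d - b) / sphereArea d : ℝ) : ℂ) *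
      ∫ p : Eu d × Eu d, f p.1 * (starRingEnd ℂ) (f p.2) ∂(lam.prod lam)) (𝓝[<] (d : ℝ))
      (𝓝 0) := by
    have h1 : Tendsto (fun b : ℝ => (((d - b) / sphereArea d : ℝ) : ℂ)) (𝓝[<] (d : ℝ))
        (𝓝 ((0 / sphereArea d : ℝ) : ℂ)) :=
      (Complex.continuous_ofReal.tendsto _).comp (hsub.div_const _)
    simpa using h1.mul_const (∫ p : Eu d × Eu d, f p.1 * (starRingEnd ℂ) (f p.2) ∂(lam.prod lam))
  have hlast := hmain.sub hconst
  have e : ∫ x in K, f x * (starRingEnd ℂ) (f x) * ((Real.exp (d * g (x, x)) : ℝ) : ℂ) =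
      ((∫ x in K, ‖f x‖ ^ 2 * Real.exp (d * g (x, x)) : ℝ) : ℂ) := by
    rw [← integral_complex_ofReal]
    refine integral_congr_ae (ae_of_all _ fun x => ?_)
    simp only
    rw [Complex.mul_conj, Complex.normSq_eq_norm_sq]
    push_cast
    ring
  rw [e, sub_zero] at hlast
  refine hlast.congr' ?_
  filter_upwards [Ioo_mem_nhdsLT hd] with b hb
  have e2 : ∫ p : Eu d × Eu d, f p.1 * (starRingEnd ℂ) (f p.2) *
        (((Real.exp (b * logCov U g p.1 p.2) : ℝ) : ℂ) - 1) ∂(lam.prod lam) =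
      (∫ p : Eu d × Eu d, f p.1 * (starRingEnd ℂ) (f p.2) *
        ((Real.exp (b * logCov U g p.1 p.2) : ℝ) : ℂ) ∂(lam.prod lam)) -
      ∫ p : Eu d × Eu d, f p.1 * (starRingEnd ℂ) (f p.2) ∂(lam.prod lam) := by
    rw [← integral_sub (hint1 b hb) hint0]
    refine integral_congr_ae (ae_of_all _ fun p => ?_)
    simp only
    ring
  rw [e2, mul_sub, integral_prod _ (hint1 b hb), integral_const_mul]

end FirstMoment

/-! ### First and second moments of the bilinear functionals. -/

section PairMoments

variable {d : ℕ} [NeZero d] {V Ω : Type*} [AddCommGroup V] [Module ℝ V] [TopologicalSpace V]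
  [MeasurableSpace Ω] {P : Measure Ω} {X : Ω → V →L[ℝ] ℝ} {q : LinearMap.BilinForm ℝ V}
  {μ : Measure (Eu d)} [IsFiniteMeasure μ] {Φ : Eu d → V} {M : ℝ} {f f' : Eu d → ℂ} {C : ℝ}

/-- The parameter space of the bilinear functionals `pairFun`. -/
abbrev PairParam (d : ℕ) := unitInterval × Eu d × Eu d

/-- The product of the test functions at the four points. -/
def fourTest (f f' : Eu d → ℂ) (p : PairParam d × PairParam d) : ℂ :=
  f p.1.2.1 * f' p.1.2.2 * (starRingEnd ℂ) (f p.2.2.1 * f' p.2.2.2)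

theorem measurable_energy {C : Eu d → Eu d → ℝ} (hC : Measurable fun p : Eu d × Eu d => C p.1 p.2)
    (σ : ℝ) : Measurable fun p : PairParam d × PairParam d =>
      energy C σ p.1.1 p.2.1 p.1.2.1 p.1.2.2 p.2.2.1 p.2.2.2 := by
  have hcomp : ∀ u v : PairParam d × PairParam d → Eu d, Measurable u → Measurable v →
      Measurable fun p => C (u p) (v p) := fun u v hu hv => hC.comp (hu.prodMk hv)
  have hs1 : Measurable fun p : PairParam d × PairParam d => (p.1.1 : ℝ) :=
    measurable_subtype_coe.comp (measurable_fst.comp measurable_fst)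
  have hs2 : Measurable fun p : PairParam d × PairParam d => (p.2.1 : ℝ) :=
    measurable_subtype_coe.comp (measurable_fst.comp measurable_snd)
  have c1 := hcomp (fun p => p.1.2.1) (fun p => p.1.2.2) (by fun_prop) (by fun_prop)
  have c2 := hcomp (fun p => p.1.2.1) (fun p => p.2.2.1) (by fun_prop) (by fun_prop)
  have c3 := hcomp (fun p => p.1.2.1) (fun p => p.2.2.2) (by fun_prop) (by fun_prop)
  have c4 := hcomp (fun p => p.1.2.2) (fun p => p.2.2.1) (by fun_prop) (by fun_prop)
  have c5 := hcomp (fun p => p.1.2.2) (fun p => p.2.2.2) (by fun_prop) (by fun_prop)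
  have c6 := hcomp (fun p => p.2.2.1) (fun p => p.2.2.2) (by fun_prop) (by fun_prop)
  unfold energy
  exact ((((((hs1.mul_const _).mul c1).neg.add ((hs1.mul hs2).mul c2)).add
    ((hs1.mul_const _).mul c3)).add ((hs2.mul_const _).mul c4)).add c5).sub
    ((hs2.mul_const _).mul c6)

theorem measurable_fourTest {f f' : Eu d → ℂ} (hf : Measurable f) (hf' : Measurable f') :
    Measurable (fourTest (d := d) f f') := by
  unfold fourTest
  have := Complex.continuous_conj.measurable
  fun_prop

theorem norm_fourTest_le {f f' : Eu d → ℂ} {B : ℝ} (hB : ∀ a, ‖f a‖ ≤ B) (hB' : ∀ a, ‖f' a‖ ≤ B)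
    (p : PairParam d × PairParam d) : ‖fourTest f f' p‖ ≤ B * B * (B * B) := by
  have hC0 : 0 ≤ B := (norm_nonneg _).trans (hB 0)
  rw [fourTest, norm_mul, norm_mul, RCLike.norm_conj, norm_mul]
  exact mul_le_mul (mul_le_mul (hB _) (hB' _) (norm_nonneg _) hC0)
    (mul_le_mul (hB _) (hB' _) (norm_nonneg _) hC0) (by positivity) (by positivity)

/-- The diagonal covariances in the Wick factors cancel those in the variance of the test vector, as
σ² = 1. Only the interaction of the charges s and σ is left. -/
theorem integral_pairFun (hG : IsCenteredGaussian P X q) (hΦ : IsRegularFamily X q Φ M)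
    (hf : Measurable f) (hf' : Measurable f') (hC : ∀ a, ‖f a‖ ≤ C) (hC' : ∀ a, ‖f' a‖ ≤ C)
    (β : ℝ) {β' σ : ℝ} (hβ' : β' = σ * β) (hσ : σ ^ 2 = 1) :
    ∫ ω, pairFun μ X q β β' f f' Φ ω ∂P = ∫ p : PairParam d,
      ((β ^ 2 * q (Φ p.2.1) (Φ p.2.2) *
        Real.exp (β ^ 2 * (-((p.1 : ℝ) * σ * q (Φ p.2.1) (Φ p.2.2)))) : ℝ) : ℂ) *
        (f p.2.1 * f' p.2.2) ∂((volume : Measure unitInterval).prod (μ.prod μ)) := by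
  rw [pairFun, integral_phaseIntegral hG (hΦ.measurable_pairVec β β')
    (hΦ.measurable_pairWeight hf hf' β) (hΦ.norm_pairWeight_le hC hC' β)]
  refine integral_congr_ae (ae_of_all _ fun p => ?_)
  simp only [pairWeight]
  have e : Real.exp (β ^ 2 * (-((p.1 : ℝ) * σ * q (Φ p.2.1) (Φ p.2.2)))) =
      Real.exp (((p.1 : ℝ) * β) ^ 2 * q (Φ p.2.1) (Φ p.2.1) / 2) *
      Real.exp (β ^ 2 * q (Φ p.2.2) (Φ p.2.2) / 2) *
      Real.exp (-(q (pairVec β β' Φ p) (pairVec β β' Φ p)) / 2) := by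
    rw [← Real.exp_add, ← Real.exp_add]
    congr 1
    simp only [pairVec, map_add, map_smul, LinearMap.add_apply, LinearMap.smul_apply, smul_eq_mul]
    rw [hG.symm (Φ p.2.2) (Φ p.2.1), hβ']
    linear_combination (β ^ 2 * q (Φ p.2.2) (Φ p.2.2) / 2) * hσ
  rw [← Complex.ofReal_exp, e]
  push_cast
  ring

/-- Conjugation negates the second pair of charges, which gives the configuration s, σ, -s', -σ.
Wick ordering again removes the self-energies. -/
theorem integral_pairFun_mul_conj (hG : IsCenteredGaussian P X q) (hΦ : IsRegularFamily X q Φ M)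
    (hf : Measurable f) (hf' : Measurable f') (hC : ∀ a, ‖f a‖ ≤ C) (hC' : ∀ a, ‖f' a‖ ≤ C)
    (β : ℝ) {β' σ : ℝ} (hβ' : β' = σ * β) (hσ : σ ^ 2 = 1) :
    ∫ ω, pairFun μ X q β β' f f' Φ ω * (starRingEnd ℂ) (pairFun μ X q β β' f f' Φ ω) ∂P =
      ∫ p : PairParam d × PairParam d,
        (((β ^ 2) ^ 2 * (q (Φ p.1.2.1) (Φ p.1.2.2) * q (Φ p.2.2.1) (Φ p.2.2.2)) *
          Real.exp (β ^ 2 * energy (fun x y => q (Φ x) (Φ y)) σ p.1.1 p.2.1 p.1.2.1 p.1.2.2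
            p.2.2.1 p.2.2.2) : ℝ) : ℂ) * fourTest f f' p
        ∂(((volume : Measure unitInterval).prod (μ.prod μ)).prod
          ((volume : Measure unitInterval).prod (μ.prod μ))) := by
  simp only [pairFun]
  rw [integral_phaseIntegral_mul_conj hG (hΦ.measurable_pairVec β β')
    (hΦ.measurable_pairWeight hf hf' β) (hΦ.norm_pairWeight_le hC hC' β)
    (hΦ.measurable_pairVec β β')
    (hΦ.measurable_pairWeight hf hf' β) (hΦ.norm_pairWeight_le hC hC' β)]
  refine integral_congr_ae (ae_of_all _ fun p => ?_)
  obtain ⟨⟨s, x, y⟩, ⟨s', x', y'⟩⟩ := p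
  simp only [pairWeight, fourTest]
  have e : Real.exp (β ^ 2 * energy (fun x y => q (Φ x) (Φ y)) σ s s' x y x' y') =
      Real.exp (((s : ℝ) * β) ^ 2 * q (Φ x) (Φ x) / 2) * Real.exp (β ^ 2 * q (Φ y) (Φ y) / 2) *
      (Real.exp (((s' : ℝ) * β) ^ 2 * q (Φ x') (Φ x') / 2) *
        Real.exp (β ^ 2 * q (Φ y') (Φ y') / 2)) *
      Real.exp (-(q (pairVec β β' Φ (s, x, y) - pairVec β β' Φ (s', x', y'))
        (pairVec β β' Φ (s, x, y) - pairVec β β' Φ (s', x', y'))) / 2) := by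
    rw [← Real.exp_add, ← Real.exp_add, ← Real.exp_add, ← Real.exp_add]
    congr 1
    simp only [pairVec, map_add, map_sub, map_smul, LinearMap.add_apply, LinearMap.sub_apply,
      LinearMap.smul_apply, smul_eq_mul, energy]
    rw [hG.symm (Φ y) (Φ x), hG.symm (Φ x') (Φ x), hG.symm (Φ y') (Φ x), hG.symm (Φ x') (Φ y),
      hG.symm (Φ y') (Φ y), hG.symm (Φ y') (Φ x'), hβ']
    linear_combination (β ^ 2 * q (Φ y) (Φ y) / 2 + β ^ 2 * q (Φ y') (Φ y') / 2 -
      β ^ 2 * q (Φ y) (Φ y')) * hσ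
  rw [← Complex.ofReal_exp, e, map_mul, Complex.conj_ofReal, map_mul]
  push_cast
  ring

/-- For opposite charges the square of the mean is written as a double integral and subtracted under
the integral sign, which makes the cancellation pointwise. For equal charges nothing is subtracted,
since that functional is to vanish in L². -/
theorem integral_normSq_pairFun_sub (hG : IsCenteredGaussian P X q) (hΦ : IsRegularFamily X q Φ M)
    (hf : Measurable f) (hf' : Measurable f') (hC : ∀ a, ‖f a‖ ≤ C) (hC' : ∀ a, ‖f' a‖ ≤ C)
    (β : ℝ) {β' σ θ : ℝ} (hβ' : β' = σ * β) (hθσ : θ = 1 ∧ σ = -1 ∨ θ = 0 ∧ σ = 1) :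
    ((∫ ω, ‖pairFun μ X q β β' f f' Φ ω‖ ^ 2 ∂P -
      θ * ‖∫ ω, pairFun μ X q β β' f f' Φ ω ∂P‖ ^ 2 : ℝ) : ℂ) =
      ∫ p : PairParam d × PairParam d,
        (fourCorr (fun x y => q (Φ x) (Φ y)) (β ^ 2) θ σ p.1.2.1 p.1.2.2 p.2.2.1 p.2.2.2
          p.1.1 p.2.1 : ℂ) * fourTest f f' p
        ∂(((volume : Measure unitInterval).prod (μ.prod μ)).prod
          ((volume : Measure unitInterval).prod (μ.prod μ))) := by
  have hP := hG.isProbabilityMeasure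
  have hσ : σ ^ 2 = 1 := by rcases hθσ with ⟨_, rfl⟩ | ⟨_, rfl⟩ <;> norm_num
  set ν := (volume : Measure unitInterval).prod (μ.prod μ) with hν
  have h2 := integral_pairFun_mul_conj (μ := μ) hG hΦ hf hf' hC hC' β hβ' hσ
  have e0 : ((∫ ω, ‖pairFun μ X q β β' f f' Φ ω‖ ^ 2 ∂P : ℝ) : ℂ) =
      ∫ ω, pairFun μ X q β β' f f' Φ ω * (starRingEnd ℂ) (pairFun μ X q β β' f f' Φ ω) ∂P := by
    rw [← integral_complex_ofReal]
    simp only [Complex.mul_conj, Complex.normSq_eq_norm_sq]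
  have hcov : Measurable fun p : Eu d × Eu d => q (Φ p.1) (Φ p.2) := hΦ.measurable_cov
  have hcomp : ∀ u v : PairParam d × PairParam d → Eu d, Measurable u → Measurable v →
      Measurable fun p => q (Φ (u p)) (Φ (v p)) := fun u v hu hv => hcov.comp (hu.prodMk hv)
  have hbd := hΦ.bounded
  have hM0 : 0 ≤ M := (abs_nonneg _).trans (hbd 0 0)
  have hC0 : 0 ≤ C := (norm_nonneg _).trans (hC 0)
  rcases hθσ with ⟨rfl, rfl⟩ | ⟨rfl, rfl⟩
  · have h1 := integral_pairFun (μ := μ) hG hΦ hf hf' hC hC' β hβ' hσ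
    have e1 : ((1 * ‖∫ ω, pairFun μ X q β β' f f' Φ ω ∂P‖ ^ 2 : ℝ) : ℂ) =
        ∫ p : PairParam d × PairParam d,
          (((β ^ 2) ^ 2 * (q (Φ p.1.2.1) (Φ p.1.2.2) * q (Φ p.2.2.1) (Φ p.2.2.2)) *
            Real.exp (β ^ 2 * (p.1.1 * q (Φ p.1.2.1) (Φ p.1.2.2) +
              p.2.1 * q (Φ p.2.2.1) (Φ p.2.2.2))) : ℝ) : ℂ) * fourTest f f' p ∂(ν.prod ν) := by
      rw [one_mul, ← Complex.normSq_eq_norm_sq, ← Complex.mul_conj, h1, ← integral_conj,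
        ← integral_prod_mul]
      refine integral_congr_ae (ae_of_all _ fun p => ?_)
      simp only [fourTest, map_mul, Complex.conj_ofReal, mul_add, Real.exp_add]
      push_cast
      ring_nf
    have hs1 : Measurable fun p : PairParam d × PairParam d => (p.1.1 : ℝ) :=
      measurable_subtype_coe.comp (measurable_fst.comp measurable_fst)
    have hs2 : Measurable fun p : PairParam d × PairParam d => (p.2.1 : ℝ) :=
      measurable_subtype_coe.comp (measurable_fst.comp measurable_snd)
    have hmE := measurable_energy (C := fun x y => q (Φ x) (Φ y)) hcov (-1)
    have hmt := measurable_fourTest (d := d) hf hf'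
    have hbt := norm_fourTest_le hC hC'
    have c1 := hcomp (fun p => p.1.2.1) (fun p => p.1.2.2) (by fun_prop) (by fun_prop)
    have c6 := hcomp (fun p => p.2.2.1) (fun p => p.2.2.2) (by fun_prop) (by fun_prop)
    have hint : ∀ G : PairParam d × PairParam d → ℝ, Measurable G → (∀ p, G p ≤ 6 * M) →
        Integrable (fun p : PairParam d × PairParam d =>
          (((β ^ 2) ^ 2 * (q (Φ p.1.2.1) (Φ p.1.2.2) * q (Φ p.2.2.1) (Φ p.2.2.2)) *
            Real.exp (β ^ 2 * G p) : ℝ) : ℂ) * fourTest f f' p) (ν.prod ν) := by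
      intro G hGm hGb
      refine integrable_of_norm_le (C := (β ^ 2) ^ 2 * (M * M) * Real.exp (β ^ 2 * (6 * M)) *
        (C * C * (C * C))) ?_ fun p => ?_
      · exact ((Complex.measurable_ofReal.comp ((((c1.mul c6).const_mul _).mul
          ((hGm.const_mul _).exp)))).mul hmt).aestronglyMeasurable
      · rw [norm_mul, Complex.norm_real, Real.norm_eq_abs, abs_mul, abs_mul, abs_mul, Real.abs_exp,
          abs_of_nonneg (sq_nonneg (β ^ 2))]
        gcongr
        exacts [hbd _ _, hbd _ _, hGb p, hbt p]
    have hI : ∀ s : unitInterval, |(s : ℝ)| ≤ 1 := fun s => by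
      rw [abs_of_nonneg s.2.1]; exact s.2.2
    have hle : ∀ (a c : ℝ), |a| ≤ 1 → |c| ≤ M → |a * c| ≤ M := fun a c ha hc => by
      rw [abs_mul]
      exact (mul_le_of_le_one_left (abs_nonneg _) ha).trans hc
    rw [Complex.ofReal_sub, e0, e1, h2, ← integral_sub]
    · refine integral_congr_ae (ae_of_all _ fun p => ?_)
      simp only [fourCorr]
      push_cast
      ring
    · refine hint _ hmE fun p => ?_
      unfold energy
      have hss : |((p.1.1 : ℝ)) * (p.2.1 : ℝ)| ≤ 1 := by
        rw [abs_mul]; exact mul_le_one₀ (hI _) (abs_nonneg _) (hI _)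
      have a1 := le_abs_self _ |>.trans (hle _ _ (hI p.1.1) (hbd p.1.2.1 p.1.2.2))
      have a2 := le_abs_self _ |>.trans (hle _ _ hss (hbd p.1.2.1 p.2.2.1))
      have a3 := neg_le_abs _ |>.trans (hle _ _ (hI p.1.1) (hbd p.1.2.1 p.2.2.2))
      have a4 := neg_le_abs _ |>.trans (hle _ _ (hI p.2.1) (hbd p.1.2.2 p.2.2.1))
      have a5 := le_abs_self _ |>.trans (hbd p.1.2.2 p.2.2.2)
      have a6 := le_abs_self _ |>.trans (hle _ _ (hI p.2.1) (hbd p.2.2.1 p.2.2.2))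
      linarith
    · refine hint _ ((hs1.mul c1).add (hs2.mul c6)) fun p => ?_
      have a1 := le_abs_self _ |>.trans (hle _ _ (hI p.1.1) (hbd p.1.2.1 p.1.2.2))
      have a6 := le_abs_self _ |>.trans (hle _ _ (hI p.2.1) (hbd p.2.2.1 p.2.2.2))
      linarith
  · rw [zero_mul, sub_zero, e0, h2]
    refine integral_congr_ae (ae_of_all _ fun p => ?_)
    simp only [fourCorr, zero_mul, sub_zero]

end PairMoments

/-! ### Reduction of integrals over the parameters to four-point integrals. -/

section PairMeasure

open scoped ENNReal

variable {d : ℕ} [NeZero d] {K : Set (Eu d)}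

/-- The reference measure on the parameters of the bilinear functionals over `K`. -/
def pairMeasure (K : Set (Eu d)) : Measure (PairParam d) :=
  (volume : Measure unitInterval).prod ((volume.restrict K).prod (volume.restrict K))

instance : SFinite (pairMeasure K) := by unfold pairMeasure; infer_instance

theorem lintegral_pairMeasure {G : PairParam d → ℝ≥0∞} (hG : Measurable G) :
    ∫⁻ p, G p ∂pairMeasure K = ∫⁻ x in K, ∫⁻ y in K, ∫⁻ s : unitInterval, G (s, x, y) := by
  rw [pairMeasure, lintegral_prod_symm _ hG.aemeasurable, lintegral_prod]
  exact (Measurable.lintegral_prod_left' hG).aemeasurable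

theorem lintegral_pairMeasure_prod {G : PairParam d × PairParam d → ℝ≥0∞} (hG : Measurable G) :
    ∫⁻ p, G p ∂(pairMeasure K).prod (pairMeasure K) = fourPoint K fun x y x' y' =>
      ∫⁻ s : unitInterval, ∫⁻ s' : unitInterval, G ((s, x, y), (s', x', y')) := by
  rw [lintegral_prod _ hG.aemeasurable, lintegral_pairMeasure hG.lintegral_prod_right']
  unfold fourPoint
  refine lintegral_congr fun x => lintegral_congr fun y => ?_
  have h1 : ∀ s : unitInterval, Measurable fun p : PairParam d => G ((s, x, y), p) := fun s =>
    hG.comp measurable_prodMk_left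
  have h2 : ∀ s : unitInterval, ∫⁻ p, G ((s, x, y), p) ∂pairMeasure K =
      ∫⁻ q : Eu d × Eu d, ∫⁻ s' : unitInterval, G ((s, x, y), (s', q.1, q.2)) ∂volume
        ∂((volume.restrict K).prod (volume.restrict K)) := fun s => by
    rw [pairMeasure, lintegral_prod_symm _ (h1 s).aemeasurable]
  have hm : Measurable fun r : (unitInterval × (Eu d × Eu d)) × unitInterval =>
      G ((r.1.1, x, y), (r.2, r.1.2.1, r.1.2.2)) := hG.comp (by fun_prop)
  simp only [h2]
  rw [lintegral_lintegral_swap hm.lintegral_prod_right'.aemeasurable, lintegral_prod]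
  have hm' : Measurable fun r : ((Eu d × Eu d) × unitInterval) × unitInterval =>
      G ((r.1.2, x, y), (r.2, r.1.1.1, r.1.1.2)) := hG.comp (by fun_prop)
  exact (Measurable.lintegral_prod_right' hm'.lintegral_prod_right').aemeasurable

theorem ae_prod_restrict (hK : MeasurableSet K) :
    ∀ᵐ p ∂((volume.restrict K).prod (volume.restrict K) : Measure (Eu d × Eu d)),
      (p.1 ∈ K ∧ p.2 ∈ K) ∧ p.1 ≠ p.2 := by
  rw [Measure.prod_restrict, ← Measure.volume_eq_prod]
  exact (ae_restrict_mem (hK.prod hK)).and (ae_restrict_of_ae ae_ne_prod)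

theorem ae_pairMeasure (hK : MeasurableSet K) :
    ∀ᵐ p ∂pairMeasure K, (p.2.1 ∈ K ∧ p.2.2 ∈ K) ∧ p.2.1 ≠ p.2.2 :=
  Measure.quasiMeasurePreserving_snd.ae (ae_prod_restrict hK)

/-- Coincidence of two points is a null event, since the diagonal has measure zero for each of the
six pairs. The covariance needs to be controlled off the diagonal only. -/
theorem ae_isProper (hK : MeasurableSet K) :
    ∀ᵐ p ∂(pairMeasure K).prod (pairMeasure K), IsProper K p.1.2.1 p.1.2.2 p.2.2.1 p.2.2.2 := by
  have q1 : Measure.QuasiMeasurePreserving (fun p : PairParam d => p.2.1) (pairMeasure K)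
      (volume.restrict K) :=
    Measure.quasiMeasurePreserving_fst.comp Measure.quasiMeasurePreserving_snd
  have q2 : Measure.QuasiMeasurePreserving (fun p : PairParam d => p.2.2) (pairMeasure K)
      (volume.restrict K) :=
    Measure.quasiMeasurePreserving_snd.comp Measure.quasiMeasurePreserving_snd
  have h := ae_prod_restrict hK
  filter_upwards [Measure.quasiMeasurePreserving_fst.ae (ae_pairMeasure hK),
    Measure.quasiMeasurePreserving_snd.ae (ae_pairMeasure hK), (QuasiMeasurePreserving.prodMap q1 q1).ae h,
    (QuasiMeasurePreserving.prodMap q1 q2).ae h, (QuasiMeasurePreserving.prodMap q2 q1).ae h, (QuasiMeasurePreserving.prodMap q2 q2).ae h] with p a1 a2 a3 a4 a5 a6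
  exact ⟨⟨a1.1.1, a1.1.2, a2.1.1, a2.1.2⟩, a1.2, a3.2, a4.2, a5.2, a6.2, a2.2⟩

theorem measurableSet_isProper (hK : MeasurableSet K) :
    MeasurableSet {p : PairParam d × PairParam d | IsProper K p.1.2.1 p.1.2.2 p.2.2.1 p.2.2.2} := by
  have hn : ∀ u v : PairParam d × PairParam d → Eu d, Measurable u → Measurable v →
      MeasurableSet {p | u p ≠ v p} := fun u v hu hv => (measurableSet_eq_fun hu hv).compl
  have hk : ∀ u : PairParam d × PairParam d → Eu d, Measurable u →
      MeasurableSet {p | u p ∈ K} := fun u hu => hu hK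
  exact ((hk _ (by fun_prop)).inter ((hk _ (by fun_prop)).inter ((hk _ (by fun_prop)).inter
    (hk _ (by fun_prop))))).inter ((hn _ _ (by fun_prop) (by fun_prop)).inter
    ((hn _ _ (by fun_prop) (by fun_prop)).inter ((hn _ _ (by fun_prop) (by fun_prop)).inter
    ((hn _ _ (by fun_prop) (by fun_prop)).inter ((hn _ _ (by fun_prop) (by fun_prop)).inter
    (hn _ _ (by fun_prop) (by fun_prop)))))))

theorem measurable_fourCorr {C : Eu d → Eu d → ℝ}
    (hC : Measurable fun p : Eu d × Eu d => C p.1 p.2) (b θ σ : ℝ) :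
    Measurable fun p : PairParam d × PairParam d =>
      fourCorr C b θ σ p.1.2.1 p.1.2.2 p.2.2.1 p.2.2.2 p.1.1 p.2.1 := by
  have hs1 : Measurable fun p : PairParam d × PairParam d => (p.1.1 : ℝ) :=
    measurable_subtype_coe.comp (measurable_fst.comp measurable_fst)
  have hs2 : Measurable fun p : PairParam d × PairParam d => (p.2.1 : ℝ) :=
    measurable_subtype_coe.comp (measurable_fst.comp measurable_snd)
  have c1 : Measurable fun p : PairParam d × PairParam d => C p.1.2.1 p.1.2.2 :=
    hC.comp (f := fun p : PairParam d × PairParam d => (p.1.2.1, p.1.2.2)) (by fun_prop)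
  have c6 : Measurable fun p : PairParam d × PairParam d => C p.2.2.1 p.2.2.2 :=
    hC.comp (f := fun p : PairParam d × PairParam d => (p.2.2.1, p.2.2.2)) (by fun_prop)
  unfold fourCorr
  exact ((c1.mul c6).const_mul _).mul (((measurable_energy hC σ).const_mul _).exp.sub
    ((((hs1.mul c1).add (hs2.mul c6)).const_mul _).exp.const_mul _))

open Classical in
theorem lintegral_fourCorr (hK : MeasurableSet K) {C : Eu d → Eu d → ℝ}
    (hC : Measurable fun p : Eu d × Eu d => C p.1 p.2) (b θ σ : ℝ) :
    ∫⁻ p : PairParam d × PairParam d,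
      ENNReal.ofReal |fourCorr C b θ σ p.1.2.1 p.1.2.2 p.2.2.1 p.2.2.2 p.1.1 p.2.1|
      ∂(pairMeasure K).prod (pairMeasure K) = fourPoint K fun x y x' y' =>
        if IsProper K x y x' y' then fourCorrInt C b θ σ x y x' y' else 0 := by
  have h1 : ∀ᵐ p : PairParam d × PairParam d ∂(pairMeasure K).prod (pairMeasure K),
      ENNReal.ofReal |fourCorr C b θ σ p.1.2.1 p.1.2.2 p.2.2.1 p.2.2.2 p.1.1 p.2.1| =
      if IsProper K p.1.2.1 p.1.2.2 p.2.2.1 p.2.2.2 then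
        ENNReal.ofReal |fourCorr C b θ σ p.1.2.1 p.1.2.2 p.2.2.1 p.2.2.2 p.1.1 p.2.1| else 0 := by
    filter_upwards [ae_isProper hK] with p hp
    rw [if_pos hp]
  have hm : Measurable fun p : PairParam d × PairParam d =>
      ENNReal.ofReal |fourCorr C b θ σ p.1.2.1 p.1.2.2 p.2.2.1 p.2.2.2 p.1.1 p.2.1| :=
    (measurable_fourCorr hC b θ σ).norm.ennreal_ofReal
  rw [lintegral_congr_ae h1, lintegral_pairMeasure_prod (Measurable.ite (measurableSet_isProper hK)
    hm measurable_const)]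
  unfold fourPoint
  refine lintegral_congr fun x => lintegral_congr fun y => lintegral_congr fun x' =>
    lintegral_congr fun y' => ?_
  by_cases h : IsProper K x y x' y'
  · simp only [if_pos h]
    rfl
  · simp only [if_neg h, lintegral_zero]

end PairMeasure

/-! ### Removing the mollification from the four-point functions. -/

section KernelLimits

open scoped ENNReal

variable {d : ℕ} [NeZero d] {K : Set (Eu d)} {D M : ℝ} {C : Eu d → Eu d → ℝ}

/-- Half the sum of the largest logarithmic interactions of the four points. -/
def halfMaxLog (D : ℝ) (x y x' y' : Eu d) : ℝ :=
  (maxLog D x y x' y' + maxLog D y x x' y' + maxLog D x' x y y' + maxLog D y' x y x') / 2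

/-- Uniform bounds satisfied by a measurable kernel and by its regularisations. -/
structure IsBoundedKernel (K : Set (Eu d)) (D M : ℝ) (C : Eu d → Eu d → ℝ) : Prop where
  measurable : Measurable fun p : Eu d × Eu d => C p.1 p.2
  abs_le : ∀ x ∈ K, ∀ y ∈ K, x ≠ y → |C x y| ≤ M + logDist D x y
  energy_le : ∀ x y x' y' : Eu d, IsProper K x y x' y' →
    ∀ σ s s' : ℝ, σ ^ 2 = 1 → s ∈ Icc (0 : ℝ) 1 → s' ∈ Icc (0 : ℝ) 1 →
      energy C σ s s' x y x' y' ≤ halfMaxLog D x y x' y' + M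

/-- A family of kernels converging to `C` off the diagonal, with uniform bounds. -/
structure IsKernelApprox (K : Set (Eu d)) (D M : ℝ) (C : Eu d → Eu d → ℝ)
    (C' : ℝ → Eu d → Eu d → ℝ) : Prop where
  isCompact : IsCompact K
  kernel : IsLogKernelOn K D M C
  bounded : IsBoundedKernel K D M C
  eventually : ∀ᶠ ε in 𝓝[>] (0 : ℝ), IsBoundedKernel K D M (C' ε)
  tendsto : ∀ x ∈ K, ∀ y ∈ K, x ≠ y → Tendsto (fun ε => C' ε x y) (𝓝[>] 0) (𝓝 (C x y))

theorem fourPoint_allPairs_lt_top (hK : IsCompact K) (hD : 0 < D) {b : ℝ} (hb : 0 < b)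
    (hbd : b < d) : fourPoint K (allPairs D b) < ∞ := by
  obtain ⟨A, hA, h1, h2, -⟩ := exists_fourPoint_le hK hD
  -- With ρ = 0 no pair is short, so nothing is removed and the formula for the majorant computes
  -- the full sum over pairings.
  have hfar : ∀ p q r t : Eu d, farPairRiesz D b 0 0 p q r t = pairRiesz D b p q r t := by
    intro p q r t
    rw [farPairRiesz, if_neg]
    exact fun h => absurd h.1 (norm_nonneg _).not_gt
  have e : allPairs (d := d) D b = majorant D b 0 0 0 1 := by
    funext x y z t
    simp only [allPairs, majorant, pairMajorant, hfar, zero_mul, one_mul, zero_add]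
  have hfar' : farPairRiesz (d := d) D b 0 0 = pairRiesz D b := by
    funext p q r t
    exact hfar p q r t
  rw [e, fourPoint_majorant D b 0 0 ENNReal.zero_ne_top ENNReal.one_ne_top, hfar', zero_mul,
    zero_add, one_mul]
  have a1 := (h1 b hb hbd).trans_lt ENNReal.ofReal_lt_top
  have a2 := (h2 b hb hbd).trans_lt ENNReal.ofReal_lt_top
  exact ENNReal.mul_lt_top (by norm_num) (ENNReal.add_lt_top.2 ⟨a1, ENNReal.add_lt_top.2 ⟨a2, a2⟩⟩)

theorem measurable_maxLog {α : Type*} [MeasurableSpace α] {u v w z : α → Eu d} (D : ℝ)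
    (hu : Measurable u) (hv : Measurable v) (hw : Measurable w) (hz : Measurable z) :
    Measurable fun p => maxLog D (u p) (v p) (w p) (z p) := by
  have hcomp : ∀ u v : α → Eu d, Measurable u → Measurable v →
      Measurable fun p => logDist D (u p) (v p) := fun u v hu hv => by
    have h := (measurable_logDist D).comp (hu.prodMk hv)
    exact h
  exact (hcomp u v hu hv).max ((hcomp u w hu hw).max (hcomp u z hu hz))

theorem measurable_halfMaxLog (D : ℝ) : Measurable fun p : PairParam d × PairParam d =>
    halfMaxLog D p.1.2.1 p.1.2.2 p.2.2.1 p.2.2.2 := by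
  have hx : Measurable fun p : PairParam d × PairParam d => p.1.2.1 := by fun_prop
  have hy : Measurable fun p : PairParam d × PairParam d => p.1.2.2 := by fun_prop
  have hx' : Measurable fun p : PairParam d × PairParam d => p.2.2.1 := by fun_prop
  have hy' : Measurable fun p : PairParam d × PairParam d => p.2.2.2 := by fun_prop
  have h1 := measurable_maxLog D hx hy hx' hy'
  have h2 := measurable_maxLog D hy hx hx' hy'
  have h3 := measurable_maxLog D hx' hx hy hy'
  have h4 := measurable_maxLog D hy' hx hy hx'
  unfold halfMaxLog
  exact (((h1.add h2).add h3).add h4).div_const 2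

theorem integrable_exp_halfMaxLog (hK : IsCompact K) (hD : 0 < D) {b : ℝ} (hb : 0 < b)
    (hbd : b < d) : Integrable (fun p : PairParam d × PairParam d =>
      Real.exp (b * halfMaxLog D p.1.2.1 p.1.2.2 p.2.2.1 p.2.2.2))
      ((pairMeasure K).prod (pairMeasure K)) := by
  have hm := ((measurable_halfMaxLog (d := d) D).const_mul b).exp
  refine ⟨hm.aestronglyMeasurable, ?_⟩
  rw [hasFiniteIntegral_iff_ofReal (ae_of_all _ fun p => (Real.exp_pos _).le),
    lintegral_pairMeasure_prod hm.ennreal_ofReal]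
  refine (fourPoint_mono fun x y x' y' => ?_).trans_lt (fourPoint_allPairs_lt_top hK hD hb hbd)
  simp only [lintegral_const, measure_univ, mul_one]
  exact ofReal_exp_maxLog_le D b x y x' y'

theorem logDist_add_le_halfMaxLog (D : ℝ) (x y x' y' : Eu d) :
    logDist D x y + logDist D x' y' ≤ halfMaxLog D x y x' y' := by
  have h1 : logDist D x y ≤ maxLog D x y x' y' := le_max_left _ _
  have h2 : logDist D x y ≤ maxLog D y x x' y' := by
    rw [logDist_comm]; exact le_max_left _ _
  have h3 : logDist D x' y' ≤ maxLog D x' x y y' := le_max_of_le_right (le_max_right _ _)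
  have h4 : logDist D x' y' ≤ maxLog D y' x y x' := by
    rw [logDist_comm]; exact le_max_of_le_right (le_max_right _ _)
  unfold halfMaxLog
  linarith

theorem sq_le_mul_exp {κ t : ℝ} (hκ : 0 < κ) (ht : 0 ≤ t) : t ^ 2 ≤ 2 / κ ^ 2 * Real.exp (κ * t) := by
  have h := Real.quadratic_le_exp_of_nonneg (mul_nonneg hκ.le ht)
  have h2 : (κ * t) ^ 2 / 2 ≤ Real.exp (κ * t) := by nlinarith [mul_nonneg hκ.le ht]
  calc t ^ 2 = 2 / κ ^ 2 * ((κ * t) ^ 2 / 2) := by field_simp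
    _ ≤ _ := by gcongr

/-- Domination of the four-point correlation by an integrable function. -/
theorem IsBoundedKernel.abs_fourCorr_le (h : IsBoundedKernel K D M C) (hM : 0 ≤ M)
    (hKD : ∀ x ∈ K, ∀ y ∈ K, ‖x - y‖ ≤ D) {b b' : ℝ} (hb : 0 < b) (hbb : b < b') {θ σ : ℝ}
    (hθ : |θ| ≤ 1) (hσ : σ ^ 2 = 1) {x y x' y' : Eu d} (hp : IsProper K x y x' y') {s s' : ℝ}
    (hs : s ∈ Icc (0 : ℝ) 1) (hs' : s' ∈ Icc (0 : ℝ) 1) :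
    |fourCorr C b θ σ x y x' y' s s'| ≤
      b ^ 2 * (2 / (b' - b) ^ 2) * (2 * Real.exp (2 * b' * M)) *
        Real.exp (b' * halfMaxLog D x y x' y') := by
  obtain ⟨⟨hx, hy, hx', hy'⟩, h1, -, -, -, -, h6⟩ := id hp
  have hE := h.energy_le x y x' y' hp σ s s' hσ hs hs'
  have hL := logDist_nonneg (hKD x hx y hy)
  have hL' := logDist_nonneg (hKD x' hx' y' hy')
  have hS := logDist_add_le_halfMaxLog D x y x' y'
  have a1 := h.abs_le x hx y hy h1
  have a2 := h.abs_le x' hx' y' hy' h6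
  set S := halfMaxLog D x y x' y' with hSdef
  set L := logDist D x y
  set L' := logDist D x' y'
  have hκ : 0 < b' - b := sub_pos.2 hbb
  have e1 : s * C x y ≤ M + L := by
    have := mul_le_mul_of_nonneg_left ((le_abs_self _).trans a1) hs.1
    nlinarith [hs.2]
  have e2 : s' * C x' y' ≤ M + L' := by
    have := mul_le_mul_of_nonneg_left ((le_abs_self _).trans a2) hs'.1
    nlinarith [hs'.2]
  have b1 : Real.exp (b * energy C σ s s' x y x' y') ≤ Real.exp (b * (S + 2 * M)) :=
    Real.exp_le_exp.2 (mul_le_mul_of_nonneg_left (by linarith) hb.le)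
  have b2 : Real.exp (b * (s * C x y + s' * C x' y')) ≤ Real.exp (b * (S + 2 * M)) :=
    Real.exp_le_exp.2 (mul_le_mul_of_nonneg_left (by linarith) hb.le)
  have b3 : |Real.exp (b * energy C σ s s' x y x' y') -
      θ * Real.exp (b * (s * C x y + s' * C x' y'))| ≤ 2 * Real.exp (b * (S + 2 * M)) := by
    refine (abs_sub _ _).trans ?_
    rw [abs_mul, Real.abs_exp, Real.abs_exp]
    have := mul_le_mul hθ b2 (Real.exp_pos _).le zero_le_one
    linarith
  have b4 : |C x y * C x' y'| ≤ (S + 2 * M) ^ 2 := by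
    rw [abs_mul, sq]
    exact mul_le_mul (by linarith) (by linarith) (abs_nonneg _) (by linarith)
  -- The product of the two covariances is at most the square of a logarithmic quantity. It is
  -- absorbed by raising the exponent from b to b', at the price of (b' - b)^{-2}, harmless for
  -- fixed b.
  have b5 := sq_le_mul_exp hκ (show 0 ≤ S + 2 * M by linarith)
  rw [fourCorr, abs_mul, abs_mul, abs_of_nonneg (sq_nonneg b)]
  calc b ^ 2 * |C x y * C x' y'| * |Real.exp (b * energy C σ s s' x y x' y') -
      θ * Real.exp (b * (s * C x y + s' * C x' y'))|
      ≤ b ^ 2 * (2 / (b' - b) ^ 2 * Real.exp ((b' - b) * (S + 2 * M))) *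
        (2 * Real.exp (b * (S + 2 * M))) :=
        mul_le_mul (mul_le_mul_of_nonneg_left (b4.trans b5) (sq_nonneg b)) b3 (abs_nonneg _)
          (by positivity)
    _ = _ := by
      rw [show 2 * b' * M = b' * (2 * M) by ring]
      have : Real.exp (b' * (2 * M)) * Real.exp (b' * S) =
          Real.exp ((b' - b) * (S + 2 * M)) * Real.exp (b * (S + 2 * M)) := by
        rw [← Real.exp_add, ← Real.exp_add]
        ring_nf
      linear_combination (-(4 * b ^ 2 / (b' - b) ^ 2)) * this

theorem tendsto_fourCorr {ι : Type*} {l : Filter ι} {C' : ι → Eu d → Eu d → ℝ} {x y x' y' : Eu d}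
    (hp : IsProper K x y x' y')
    (h : ∀ x ∈ K, ∀ y ∈ K, x ≠ y → Tendsto (fun ε => C' ε x y) l (𝓝 (C x y))) (b θ σ s s' : ℝ) :
    Tendsto (fun ε => fourCorr (C' ε) b θ σ x y x' y' s s') l
      (𝓝 (fourCorr C b θ σ x y x' y' s s')) := by
  obtain ⟨⟨hx, hy, hx', hy'⟩, h1, h2, h3, h4, h5, h6⟩ := hp
  have c1 := h x hx y hy h1
  have c2 := h x hx x' hx' h2
  have c3 := h x hx y' hy' h3
  have c4 := h y hy x' hx' h4
  have c5 := h y hy y' hy' h5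
  have c6 := h x' hx' y' hy' h6
  unfold fourCorr energy
  exact ((c1.mul c6).const_mul _).mul ((Real.continuous_exp.tendsto _ |>.comp
    (((((((c1.const_mul _).neg.add (c2.const_mul _)).add (c3.const_mul _)).add
      (c4.const_mul _)).add c5).sub (c6.const_mul _)).const_mul _)).sub
    ((Real.continuous_exp.tendsto _ |>.comp
      (((c1.const_mul _).add (c6.const_mul _)).const_mul _)).const_mul _))

theorem IsKernelApprox.tendsto_integral_fourCorr {C' : ℝ → Eu d → Eu d → ℝ}
    (h : IsKernelApprox K D M C C') {b : ℝ} (hb : 0 < b) (hbd : b < d) {θ σ : ℝ}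
    (hθ : |θ| ≤ 1) (hσ : σ ^ 2 = 1) {f f' : Eu d → ℂ} (hf : Measurable f) (hf' : Measurable f')
    {B : ℝ} (hB : ∀ a, ‖f a‖ ≤ B) (hB' : ∀ a, ‖f' a‖ ≤ B) :
    Tendsto (fun ε => ∫ p : PairParam d × PairParam d,
      (fourCorr (C' ε) b θ σ p.1.2.1 p.1.2.2 p.2.2.1 p.2.2.2 p.1.1 p.2.1 : ℂ) * fourTest f f' p
        ∂(pairMeasure K).prod (pairMeasure K)) (𝓝[>] 0)
      (𝓝 (∫ p : PairParam d × PairParam d,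
      (fourCorr C b θ σ p.1.2.1 p.1.2.2 p.2.2.1 p.2.2.2 p.1.1 p.2.1 : ℂ) * fourTest f f' p
        ∂(pairMeasure K).prod (pairMeasure K))) := by
  -- An exponent strictly between b and d: larger than b to absorb the logarithmic prefactors, still
  -- subcritical so that the dominating function is integrable.
  obtain ⟨b', hbb, hbd'⟩ := exists_between hbd
  have hae := ae_isProper (d := d) h.isCompact.measurableSet
  have hmt := measurable_fourTest (d := d) hf hf'
  refine tendsto_integral_filter_of_dominated_convergence
    (fun p => b ^ 2 * (2 / (b' - b) ^ 2) * (2 * Real.exp (2 * b' * M)) *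
        Real.exp (b' * halfMaxLog D p.1.2.1 p.1.2.2 p.2.2.1 p.2.2.2) * (B * B * (B * B))) ?_ ?_ ?_ ?_
  · filter_upwards [h.eventually] with ε hε
    exact ((Complex.measurable_ofReal.comp (measurable_fourCorr hε.measurable b θ σ)).mul
      hmt).aestronglyMeasurable
  · filter_upwards [h.eventually] with ε hε
    filter_upwards [hae] with p hp
    rw [norm_mul, Complex.norm_real, Real.norm_eq_abs]
    exact mul_le_mul (hε.abs_fourCorr_le h.kernel.nonneg h.kernel.norm_sub_le hb hbb hθ hσ hp
      p.1.1.2 p.2.1.2) (norm_fourTest_le hB hB' p) (norm_nonneg _) (by positivity)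
  · exact ((integrable_exp_halfMaxLog h.isCompact h.kernel.pos (hb.trans hbb) hbd').const_mul
      _).mul_const _
  · filter_upwards [hae] with p hp
    exact ((Complex.continuous_ofReal.tendsto _).comp
      (tendsto_fourCorr hp h.tendsto b θ σ _ _)).mul_const _

open Classical in
theorem norm_integral_fourCorr_le (hK : MeasurableSet K)
    (hC : Measurable fun p : Eu d × Eu d => C p.1 p.2) (b θ σ : ℝ) {f f' : Eu d → ℂ}
    {B : ℝ} (hB : ∀ a, ‖f a‖ ≤ B) (hB' : ∀ a, ‖f' a‖ ≤ B) :
    ENNReal.ofReal ‖∫ p : PairParam d × PairParam d,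
      (fourCorr C b θ σ p.1.2.1 p.1.2.2 p.2.2.1 p.2.2.2 p.1.1 p.2.1 : ℂ) * fourTest f f' p
        ∂(pairMeasure K).prod (pairMeasure K)‖ ≤ ENNReal.ofReal (B * B * (B * B)) *
      fourPoint K fun x y x' y' =>
        if IsProper K x y x' y' then fourCorrInt C b θ σ x y x' y' else 0 := by
  rw [← lintegral_fourCorr hK hC, ← lintegral_const_mul' _ _ ENNReal.ofReal_ne_top,
    ofReal_norm]
  refine (enorm_integral_le_lintegral_enorm _).trans (lintegral_mono fun p => ?_)
  have hB0 : 0 ≤ B * B * (B * B) := by have := mul_self_nonneg B; positivity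
  rw [← ofReal_norm, ← ENNReal.ofReal_mul hB0, norm_mul, Complex.norm_real,
    Real.norm_eq_abs, mul_comm]
  exact ENNReal.ofReal_le_ofReal (mul_le_mul_of_nonneg_right (norm_fourTest_le hB hB' p)
    (abs_nonneg _))

end KernelLimits

/-! ### L¹ distances bounded by variance and bias. -/

section SecondMoment

theorem integral_norm_le_sqrt {Ω : Type*} [MeasurableSpace Ω] {P : Measure Ω}
    [IsProbabilityMeasure P] {T : Ω → ℂ} (hT : MemLp T 2 P) :
    ∫ ω, ‖T ω‖ ∂P ≤ √(∫ ω, ‖T ω‖ ^ 2 ∂P) := by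
  refine Real.le_sqrt_of_sq_le ?_
  have h := variance_nonneg (fun ω => ‖T ω‖) P
  rw [variance_eq_sub hT.norm] at h
  exact sub_nonneg.1 h

/-- Cauchy–Schwarz and the decomposition of the mean square distance to a constant into variance and
squared bias. -/
theorem integral_norm_sub_le_sqrt {Ω : Type*} [MeasurableSpace Ω] {P : Measure Ω}
    [IsProbabilityMeasure P] {T : Ω → ℂ} (hT : MemLp T 2 P) (a : ℂ) :
    ∫ ω, ‖T ω - a‖ ∂P ≤
      √(∫ ω, ‖T ω‖ ^ 2 ∂P - ‖∫ ω, T ω ∂P‖ ^ 2 + ‖(∫ ω, T ω ∂P) - a‖ ^ 2) := by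
  refine (integral_norm_le_sqrt (hT.sub (memLp_const a))).trans (Real.sqrt_le_sqrt (le_of_eq ?_))
  have h1 : Integrable T P := hT.integrable one_le_two
  have e1 : ∀ ω, ‖T ω - a‖ ^ 2 = ‖T ω‖ ^ 2 - 2 * inner ℝ a (T ω) + ‖a‖ ^ 2 := fun ω => by
    rw [norm_sub_sq_real, real_inner_comm]
  have h2 : Integrable (fun ω => ‖T ω‖ ^ 2) P := hT.norm.integrable_sq
  have h3 : Integrable (fun ω => 2 * inner ℝ a (T ω)) P := (h1.const_inner a).const_mul 2
  simp only [Pi.sub_apply, e1]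
  have e2 := integral_add (h2.sub h3) (integrable_const (μ := P) (‖a‖ ^ 2))
  simp only [Pi.sub_apply] at e2
  rw [e2, integral_sub h2 h3, integral_const_mul, integral_inner h1, norm_sub_sq_real,
    real_inner_comm, integral_const, probReal_univ, one_smul]
  ring

end SecondMoment

/-! ### Removing the mollification from the first moment. -/

section FirstMoment

variable {d : ℕ} [NeZero d] {K : Set (Eu d)} {D M : ℝ} {C : Eu d → Eu d → ℝ}

/-- The linear logarithmic prefactor is absorbed by raising the exponent from b to b', using κw ≤
e^{κw} with κ = b' - b. -/
theorem IsBoundedKernel.abs_mul_exp_le (h : IsBoundedKernel K D M C) {b b' : ℝ} (hb : 0 < b)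
    (hbb : b < b') {x y : Eu d} (hx : x ∈ K) (hy : y ∈ K) (hxy : x ≠ y) {u : ℝ} (hu : |u| ≤ 1) :
    |b * C x y * Real.exp (b * (u * C x y))| ≤
      b * (1 / (b' - b)) * Real.exp (b' * M) * Real.exp (b' * logDist D x y) := by
  have a1 := h.abs_le x hx y hy hxy
  set w := M + logDist D x y with hw
  have hκ : 0 < b' - b := sub_pos.2 hbb
  have h1 : |C x y| ≤ 1 / (b' - b) * Real.exp ((b' - b) * w) := by
    have := Real.add_one_le_exp ((b' - b) * w)
    rw [div_mul_eq_mul_div, one_mul, le_div_iff₀ hκ]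
    nlinarith
  have h2 : Real.exp (b * (u * C x y)) ≤ Real.exp (b * w) := by
    refine Real.exp_le_exp.2 (mul_le_mul_of_nonneg_left ?_ hb.le)
    calc u * C x y ≤ |u * C x y| := le_abs_self _
      _ = |u| * |C x y| := abs_mul _ _
      _ ≤ 1 * |C x y| := mul_le_mul_of_nonneg_right hu (abs_nonneg _)
      _ ≤ w := by rw [one_mul]; exact a1
  rw [abs_mul, abs_mul, abs_of_pos hb, Real.abs_exp]
  calc b * |C x y| * Real.exp (b * (u * C x y))
      ≤ b * (1 / (b' - b) * Real.exp ((b' - b) * w)) * Real.exp (b * w) :=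
        mul_le_mul (mul_le_mul_of_nonneg_left h1 hb.le) h2 (Real.exp_pos _).le (by positivity)
    _ = _ := by
      have : Real.exp ((b' - b) * w) * Real.exp (b * w) =
          Real.exp (b' * M) * Real.exp (b' * logDist D x y) := by
        rw [← Real.exp_add, ← Real.exp_add, hw]
        ring_nf
      linear_combination (b * (1 / (b' - b))) * this

theorem measurable_firstWeight (hC : Measurable fun p : Eu d × Eu d => C p.1 p.2) (b : ℝ) :
    Measurable fun p : PairParam d =>
      b * C p.2.1 p.2.2 * Real.exp (b * (-((p.1 : ℝ) * (-1) * C p.2.1 p.2.2))) := by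
  have c1 : Measurable fun p : PairParam d => C p.2.1 p.2.2 := hC.comp measurable_snd
  have hs : Measurable fun p : PairParam d => (p.1 : ℝ) := measurable_subtype_coe.comp measurable_fst
  exact (c1.const_mul b).mul ((((hs.mul_const _).mul c1).neg.const_mul b).exp)

theorem abs_neg_mul_neg_one_le (s : unitInterval) : |(-((s : ℝ) * (-1)))| ≤ 1 := by
  rw [mul_neg_one, neg_neg, abs_of_nonneg s.2.1]
  exact s.2.2

theorem integrable_exp_logDist_pairMeasure (hK : IsCompact K) (hD : 0 < D) {b : ℝ} (hb : 0 < b)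
    (hbd : b < d) : Integrable (fun p : PairParam d => Real.exp (b * logDist D p.2.1 p.2.2))
      (pairMeasure K) :=
  (integrable_exp_logDist hK hD hb hbd).comp_snd _

/-- Dominated convergence in ε. In the limit the integrand is the derivative of s ↦ e^{b s C}, so
the integral over s is e^{bC} - 1. -/
theorem IsKernelApprox.tendsto_integral_firstWeight {C' : ℝ → Eu d → Eu d → ℝ}
    (h : IsKernelApprox K D M C C') {b : ℝ} (hb : 0 < b) (hbd : b < d)
    {f f' : Eu d → ℂ} (hf : Measurable f) (hf' : Measurable f')
    {B : ℝ} (hB : ∀ a, ‖f a‖ ≤ B) (hB' : ∀ a, ‖f' a‖ ≤ B) :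
    Tendsto (fun ε => ∫ p : PairParam d, ((b * C' ε p.2.1 p.2.2 *
        Real.exp (b * (-((p.1 : ℝ) * (-1) * C' ε p.2.1 p.2.2))) : ℝ) : ℂ) * (f p.2.1 * f' p.2.2)
        ∂pairMeasure K) (𝓝[>] 0)
      (𝓝 (∫ q : Eu d × Eu d, f q.1 * f' q.2 * (((Real.exp (b * C q.1 q.2) : ℝ) : ℂ) - 1)
        ∂((volume.restrict K).prod (volume.restrict K)))) := by
  obtain ⟨b', hbb, hbd'⟩ := exists_between hbd
  have hB0 : 0 ≤ B := (norm_nonneg _).trans (hB 0)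
  have hae := ae_pairMeasure (d := d) h.isCompact.measurableSet
  have hmt : Measurable fun p : PairParam d => f p.2.1 * f' p.2.2 := by fun_prop
  set N := b * (1 / (b' - b)) * Real.exp (b' * M) with hN
  have hbound : ∀ {C₀ : Eu d → Eu d → ℝ}, IsBoundedKernel K D M C₀ → ∀ p : PairParam d,
      (p.2.1 ∈ K ∧ p.2.2 ∈ K) ∧ p.2.1 ≠ p.2.2 → ‖((b * C₀ p.2.1 p.2.2 *
        Real.exp (b * (-((p.1 : ℝ) * (-1) * C₀ p.2.1 p.2.2))) : ℝ) : ℂ) * (f p.2.1 * f' p.2.2)‖ ≤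
      N * Real.exp (b' * logDist D p.2.1 p.2.2) * (B * B) := by
    intro C₀ hC₀ p hp
    have hκ : 0 < b' - b := sub_pos.2 hbb
    rw [norm_mul, Complex.norm_real, Real.norm_eq_abs, norm_mul, ← neg_mul]
    exact mul_le_mul (hC₀.abs_mul_exp_le hb hbb hp.1.1 hp.1.2 hp.2 (abs_neg_mul_neg_one_le p.1))
      (mul_le_mul (hB _) (hB' _) (norm_nonneg _) hB0) (by positivity) (by positivity)
  have hint : Integrable (fun p : PairParam d =>
      N * Real.exp (b' * logDist D p.2.1 p.2.2) * (B * B)) (pairMeasure K) :=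
    ((integrable_exp_logDist_pairMeasure h.isCompact h.kernel.pos (hb.trans hbb) hbd').const_mul
      _).mul_const _
  have hlim : ∫ p : PairParam d, ((b * C p.2.1 p.2.2 *
        Real.exp (b * (-((p.1 : ℝ) * (-1) * C p.2.1 p.2.2))) : ℝ) : ℂ) * (f p.2.1 * f' p.2.2)
        ∂pairMeasure K = ∫ q : Eu d × Eu d, f q.1 * f' q.2 *
        (((Real.exp (b * C q.1 q.2) : ℝ) : ℂ) - 1)
        ∂((volume.restrict K).prod (volume.restrict K)) := by
    have hi : Integrable (fun p : PairParam d => ((b * C p.2.1 p.2.2 *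
        Real.exp (b * (-((p.1 : ℝ) * (-1) * C p.2.1 p.2.2))) : ℝ) : ℂ) * (f p.2.1 * f' p.2.2))
        (pairMeasure K) := by
      refine hint.mono' ((Complex.measurable_ofReal.comp (measurable_firstWeight
        h.bounded.measurable b)).mul hmt).aestronglyMeasurable ?_
      filter_upwards [hae] with p hp
      exact hbound h.bounded p hp
    rw [pairMeasure, integral_prod_symm _ hi]
    refine integral_congr_ae (ae_of_all _ fun q => ?_)
    simp only
    rw [integral_mul_const, integral_complex_ofReal, integral_unitInterval (fun s : ℝ =>
      b * C q.1 q.2 * Real.exp (b * (-(s * (-1) * C q.1 q.2))))]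
    have hder : ∀ s : ℝ, HasDerivAt (fun s => Real.exp (b * (-(s * (-1) * C q.1 q.2))))
        (b * C q.1 q.2 * Real.exp (b * (-(s * (-1) * C q.1 q.2)))) s := by
      intro s
      have h1 := (((((hasDerivAt_id s).mul_const (-1)).mul_const (C q.1 q.2)).neg).const_mul b).exp
      refine h1.congr_deriv ?_
      simp only [id, Pi.neg_apply]
      ring
    rw [intervalIntegral.integral_eq_sub_of_hasDerivAt (fun s _ => hder s)
      (Continuous.intervalIntegrable (by fun_prop) _ _)]
    simp
    ring
  rw [← hlim]
  refine tendsto_integral_filter_of_dominated_convergence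
    (fun p => N * Real.exp (b' * logDist D p.2.1 p.2.2) * (B * B)) ?_ ?_ hint ?_
  · filter_upwards [h.eventually] with ε hε
    exact ((Complex.measurable_ofReal.comp (measurable_firstWeight hε.measurable b)).mul
      hmt).aestronglyMeasurable
  · filter_upwards [h.eventually] with ε hε
    filter_upwards [hae] with p hp
    exact hbound hε p hp
  · filter_upwards [hae] with p hp
    have c1 := h.tendsto _ hp.1.1 _ hp.1.2 hp.2
    exact ((Complex.continuous_ofReal.tendsto _).comp ((c1.const_mul b).mul
      ((Real.continuous_exp.tendsto _).comp ((c1.const_mul _).neg.const_mul b)))).mul_const _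

end FirstMoment

/-! ### The mollified field as an approximating family of kernels. -/

section FieldApprox

variable {d : ℕ} [NeZero d] {Ω : Type*} [MeasurableSpace Ω] {P : Measure Ω}
  [IsProbabilityMeasure P] {U : Opens (Eu d)} {g : Eu d × Eu d → ℝ} {X : Ω → (𝓢(Eu d, ℝ) →L[ℝ] ℝ)} {K : Set (Eu d)}
  {D M : ℝ}

/-- Written as the expectation of a jointly measurable product of field values, the covariance is a
parameter integral. -/
theorem measurable_mollCov (hX : IsLogCorrelatedField P U g X) (η : Mollifier d)
    {ε δ : ℝ} (hε : 0 < ε) (hδ : 0 < δ) :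
    Measurable fun p : Eu d × Eu d => mollCov U g η ε δ p.1 p.2 := by
  have e : (fun p : Eu d × Eu d => mollCov U g η ε δ p.1 p.2) =
      fun p => ∫ ω, X ω (η.bump ε p.1) * X ω (η.bump δ p.2) ∂P := by
    funext p
    rw [← hX.covForm_bump, hX.covForm_apply]
  rw [e]
  have h1 := measurable_field_bump hX.measurable η hε
  have h2 := measurable_field_bump hX.measurable η hδ
  have hm : Measurable fun r : (Eu d × Eu d) × Ω =>
      X r.2 (η.bump ε r.1.1) * X r.2 (η.bump δ r.1.2) :=
    (h1.comp ((measurable_fst.comp measurable_fst).prodMk measurable_snd)).mul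
      (h2.comp ((measurable_snd.comp measurable_fst).prodMk measurable_snd))
  exact hm.stronglyMeasurable.integral_prod_right'.measurable

theorem exists_isRegularFamily (hg : IsLogCovKernel U g) (hX : IsLogCorrelatedField P U g X)
    (η : Mollifier d) {ε : ℝ} (hε : 0 < ε) : ∃ M, IsRegularFamily X hX.covForm (η.bump ε) M := by
  obtain ⟨M, hM⟩ := exists_bound_mollCov hg η hε
  refine ⟨M, measurable_field_bump hX.measurable η hε, ?_, ?_⟩
  · simp only [hX.covForm_bump]
    exact measurable_mollCov hX η hε hε
  · intro x y
    rw [hX.covForm_bump]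
    exact hM x y

theorem exists_isKernelApprox (hg : IsLogCovKernel U g) (hX : IsLogCorrelatedField P U g X)
    (η : Mollifier d) (hK : IsCompact K) (hKU : K ⊆ U) : ∃ ε₀ D M : ℝ, 0 < ε₀ ∧
      (∀ ε δ : ℝ, 0 < ε → ε < ε₀ → 0 < δ → δ < ε₀ → ∀ x ∈ K, ∀ y ∈ K, x ≠ y →
        |mollCov U g η ε δ x y| ≤ M + logDist D x y) ∧
      IsKernelApprox K D M (logCov U g) fun ε => mollCov U g η ε ε := by
  obtain ⟨ε₀, D, M, hε₀, hlog, hbd, hen⟩ := exists_isLogKernelOn hg hX η hK hKU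
  have hev : ∀ᶠ ε in 𝓝[>] (0 : ℝ), IsBoundedKernel K D M (mollCov U g η ε ε) := by
    filter_upwards [Ioo_mem_nhdsGT hε₀] with ε hε
    refine ⟨measurable_mollCov hX η hε.1 hε.1, hbd ε ε hε.1 hε.2 hε.1 hε.2, ?_⟩
    rintro x y x' y' ⟨⟨hx, hy, hx', hy'⟩, h1, h2, h3, h4, h5, h6⟩ σ s s' hσ hs hs'
    refine (hen ε hε.1 hε.2 x hx y hy x' hx' y' hy' h1 h2 h3 h4 h5 h6 σ s s' hσ hs hs').trans ?_
    have hnn := fun {a : Eu d} (ha : a ∈ K) {b : Eu d} (hb : b ∈ K) =>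
      logDist_nonneg (hlog.norm_sub_le a ha b hb)
    have n1 : 0 ≤ maxLog D x y x' y' := (hnn hx hy).trans (le_max_left _ _)
    have n2 : 0 ≤ maxLog D x' x y y' := (hnn hx' hx).trans (le_max_left _ _)
    have q1 : s ^ 2 ≤ 1 := pow_le_one₀ hs.1 hs.2
    have q2 : s' ^ 2 ≤ 1 := pow_le_one₀ hs'.1 hs'.2
    unfold halfMaxLog
    nlinarith
  have htd : ∀ x ∈ K, ∀ y ∈ K, x ≠ y →
      Tendsto (fun ε => mollCov U g η ε ε x y) (𝓝[>] 0) (𝓝 (logCov U g x y)) :=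
    fun x hx y hy hxy => tendsto_mollCov_diag hg η (hKU hx) (hKU hy) hxy
  refine ⟨ε₀, D, M, hε₀, hbd, hK, hlog, ⟨hg.measurable_logCov, fun x hx y hy hxy =>
    hlog.abs_cov_le hx hy hxy, ?_⟩, hev, htd⟩
  intro x y x' y' hp σ s s' hσ hs hs'
  obtain ⟨⟨hx, hy, hx', hy'⟩, h1, h2, h3, h4, h5, h6⟩ := id hp
  refine le_of_tendsto (f := fun ε => energy (mollCov U g η ε ε) σ s s' x y x' y')
    (x := 𝓝[>] (0 : ℝ)) ?_ (hev.mono fun ε hε => hε.energy_le x y x' y' hp σ s s' hσ hs hs')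
  have c1 := htd x hx y hy h1
  have c2 := htd x hx x' hx' h2
  have c3 := htd x hx y' hy' h3
  have c4 := htd y hy x' hx' h4
  have c5 := htd y hy y' hy' h5
  have c6 := htd x' hx' y' hy' h6
  unfold energy
  exact ((((((c1.const_mul _).neg.add (c2.const_mul _)).add (c3.const_mul _)).add
    (c4.const_mul _)).add c5).sub (c6.const_mul _))

end FieldApprox

/-! ### The Stein bound after removal of the mollification, for fixed β. -/

section CharFunLimit

variable {d : ℕ} [NeZero d] {Ω : Type*} [MeasurableSpace Ω] {P : Measure Ω}
  [IsProbabilityMeasure P] {U : Opens (Eu d)} {g : Eu d × Eu d → ℝ}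
  {X : Ω → (𝓢(Eu d, ℝ) →L[ℝ] ℝ)} {K : Set (Eu d)} {D M : ℝ} {f f' : Eu d → ℂ} {B : ℝ}

/-- The truncated second moment of the bilinear functional with kernel `C`. -/
def truncMoment (K : Set (Eu d)) (C : Eu d → Eu d → ℝ) (b θ σ : ℝ) (f f' : Eu d → ℂ) : ℂ :=
  ∫ p : PairParam d × PairParam d,
    (fourCorr C b θ σ p.1.2.1 p.1.2.2 p.2.2.1 p.2.2.2 p.1.1 p.2.1 : ℂ) * fourTest f f' p
      ∂(pairMeasure K).prod (pairMeasure K)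

/-- The first moment of the bilinear functional with kernel `C`. -/
def firstMoment (K : Set (Eu d)) (C : Eu d → Eu d → ℝ) (b : ℝ) (f f' : Eu d → ℂ) : ℂ :=
  ∫ q : Eu d × Eu d, f q.1 * f' q.2 * (((Real.exp (b * C q.1 q.2) : ℝ) : ℂ) - 1)
    ∂((volume.restrict K).prod (volume.restrict K))

theorem memLp_pairFun {V : Type*} [AddCommGroup V] [Module ℝ V] [TopologicalSpace V]
    {X : Ω → V →L[ℝ] ℝ} {q : LinearMap.BilinForm ℝ V} {Φ : Eu d → V} {μ : Measure (Eu d)}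
    [IsFiniteMeasure μ] (hΦ : IsRegularFamily X q Φ M)
    (hf : Measurable f) (hf' : Measurable f') (hB : ∀ a, ‖f a‖ ≤ B) (hB' : ∀ a, ‖f' a‖ ≤ B)
    (β β' : ℝ) : MemLp (pairFun μ X q β β' f f' Φ) 2 P :=
  MemLp.of_bound (measurable_phaseIntegral (hΦ.measurable_pairVec β β')
    (hΦ.measurable_pairWeight hf hf' β)).aestronglyMeasurable _
    (ae_of_all _ (norm_phaseIntegral_le (hΦ.norm_pairWeight_le hB hB' β)))

/-- For each ε > 0 the quantity is the real part of the four-point integral with the mollified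
kernel, so the convergence of those integrals applies. -/
theorem IsKernelApprox.tendsto_truncMoment (hX : IsLogCorrelatedField P U g X)
    (hg : IsLogCovKernel U g) {η : Mollifier d}
    (h : IsKernelApprox K D M (logCov U g) fun ε => mollCov U g η ε ε) {β : ℝ} (hβ : 0 < β ^ 2)
    (hβd : β ^ 2 < d) {θ σ : ℝ} (hθσ : θ = 1 ∧ σ = -1 ∨ θ = 0 ∧ σ = 1) (hf : Measurable f)
    (hf' : Measurable f') (hB : ∀ a, ‖f a‖ ≤ B) (hB' : ∀ a, ‖f' a‖ ≤ B) :
    Tendsto (fun ε => ∫ ω, ‖pairFun (volume.restrict K) X hX.covForm β (σ * β) f f'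
        (η.bump ε) ω‖ ^ 2 ∂P - θ * ‖∫ ω, pairFun (volume.restrict K) X hX.covForm β (σ * β) f f'
        (η.bump ε) ω ∂P‖ ^ 2) (𝓝[>] 0)
      (𝓝 (truncMoment K (logCov U g) (β ^ 2) θ σ f f').re) := by
  have := isFiniteMeasure_restrict_of_isCompact h.isCompact
  have hθ : |θ| ≤ 1 := by rcases hθσ with ⟨rfl, _⟩ | ⟨rfl, _⟩ <;> simp
  have hσ : σ ^ 2 = 1 := by rcases hθσ with ⟨_, rfl⟩ | ⟨_, rfl⟩ <;> norm_num
  have h1 := (Complex.continuous_re.tendsto _).comp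
    (h.tendsto_integral_fourCorr hβ hβd hθ hσ hf hf' hB hB')
  refine h1.congr' ?_
  filter_upwards [self_mem_nhdsWithin] with ε hε
  obtain ⟨M', hΦ⟩ := exists_isRegularFamily hg hX η hε
  have h2 := integral_normSq_pairFun_sub (μ := volume.restrict K) hX.isCenteredGaussian hΦ hf hf'
    hB hB' β (β' := σ * β) rfl hθσ
  simp only [hX.covForm_bump] at h2
  rw [Function.comp_apply, pairMeasure, ← h2, Complex.ofReal_re]

theorem IsKernelApprox.tendsto_firstMoment (hX : IsLogCorrelatedField P U g X)
    (hg : IsLogCovKernel U g) {η : Mollifier d}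
    (h : IsKernelApprox K D M (logCov U g) fun ε => mollCov U g η ε ε) {β : ℝ} (hβ : 0 < β ^ 2)
    (hβd : β ^ 2 < d) (hf : Measurable f) (hf' : Measurable f') (hB : ∀ a, ‖f a‖ ≤ B)
    (hB' : ∀ a, ‖f' a‖ ≤ B) :
    Tendsto (fun ε => ∫ ω, pairFun (volume.restrict K) X hX.covForm β (-1 * β) f f'
        (η.bump ε) ω ∂P) (𝓝[>] 0) (𝓝 (firstMoment K (logCov U g) (β ^ 2) f f')) := by
  have := isFiniteMeasure_restrict_of_isCompact h.isCompact
  refine (h.tendsto_integral_firstWeight hβ hβd hf hf' hB hB').congr' ?_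
  filter_upwards [self_mem_nhdsWithin] with ε hε
  obtain ⟨M', hΦ⟩ := exists_isRegularFamily hg hX η hε
  have h2 := integral_pairFun (μ := volume.restrict K) hX.isCenteredGaussian hΦ hf hf'
    hB hB' β (β' := -1 * β) rfl (by norm_num)
  simp only [hX.covForm_bump] at h2
  rw [pairMeasure, h2]

/-- The characteristic function of a limit of regularised chaoses. -/
theorem IsKernelApprox.norm_sub_exp_le (hX : IsLogCorrelatedField P U g X)
    (hg : IsLogCovKernel U g) {η : Mollifier d}
    (h : IsKernelApprox K D M (logCov U g) fun ε => mollCov U g η ε ε) {β : ℝ} (hβ : 0 < β ^ 2)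
    (hβd : β ^ 2 < d) (hf : Measurable f) (hB : ∀ a, ‖f a‖ ≤ B) (t : ℂ) {v : ℝ} (hv : 0 ≤ v)
    {φ : ℂ} (hφ : Tendsto (fun ε => ∫ ω, Complex.exp (Complex.I * ((starRingEnd ℂ) t *
      chaosFun (volume.restrict K) X hX.covForm β f (η.bump ε) ω).re) ∂P) (𝓝[>] 0) (𝓝 φ)) :
    ‖φ - Real.exp (-(‖t‖ ^ 2 * v / 4))‖ ≤ Real.exp (‖t‖ ^ 2 * v / 4) *
      (‖t‖ * ‖∫ x in K, f x‖ + ‖t‖ ^ 2 *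
        (√((truncMoment K (logCov U g) (β ^ 2) 1 (-1) f fun a => (starRingEnd ℂ) (f a)).re +
          ‖firstMoment K (logCov U g) (β ^ 2) f (fun a => (starRingEnd ℂ) (f a)) - v‖ ^ 2) +
          √(truncMoment K (logCov U g) (β ^ 2) 0 1 f f).re)) := by
  have := isFiniteMeasure_restrict_of_isCompact h.isCompact
  have hf' : Measurable fun a => (starRingEnd ℂ) (f a) := Complex.continuous_conj.measurable.comp hf
  have hB' : ∀ a, ‖(starRingEnd ℂ) (f a)‖ ≤ B := fun a => by rw [RCLike.norm_conj]; exact hB a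
  have l1 := h.tendsto_truncMoment hX hg hβ hβd (Or.inl ⟨rfl, rfl⟩) hf hf' hB hB'
  have l2 := h.tendsto_truncMoment hX hg hβ hβd (Or.inr ⟨rfl, rfl⟩) hf hf hB hB
  have l3 := h.tendsto_firstMoment hX hg hβ hβd hf hf' hB hB'
  simp only [one_mul, zero_mul, sub_zero] at l1 l2
  have l4 := ((l1.add ((l3.sub_const (v : ℂ)).norm.pow 2)).sqrt.add l2.sqrt)
  refine le_of_tendsto_of_tendsto (hφ.sub_const _).norm
    (((l4.const_mul (‖t‖ ^ 2)).const_add (‖t‖ * ‖∫ x in K, f x‖)).const_mul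
      (Real.exp (‖t‖ ^ 2 * v / 4))) ?_
  filter_upwards [self_mem_nhdsWithin] with ε hε
  obtain ⟨M', hΦ⟩ := exists_isRegularFamily hg hX η hε
  refine (norm_charFun_chaosFun_sub_le (μ := volume.restrict K) hX.isCenteredGaussian hΦ hf hB β t
    hv).trans ?_
  have e1 := integral_norm_sub_le_sqrt (P := P) (memLp_pairFun (μ := volume.restrict K) hΦ hf hf'
    hB hB' β (-β)) (v : ℂ)
  have e2 := integral_norm_le_sqrt (P := P) (memLp_pairFun (μ := volume.restrict K) hΦ hf hf
    hB hB β β)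
  rw [neg_one_mul]
  gcongr

end CharFunLimit

/-! ### The limit b ↗ d. -/

section CriticalLimit

variable {d : ℕ} [NeZero d] {K : Set (Eu d)} {D M : ℝ} {C : Eu d → Eu d → ℝ}
  {f f' : Eu d → ℂ} {B : ℝ}

/-- The normalisation `√((d - b) / |S^{d-1}|)`. -/
def critScale (d : ℕ) (b : ℝ) : ℝ := √((d - b) / sphereArea d)

theorem critScale_sq {b : ℝ} (hb : b < d) : critScale d b ^ 2 = (d - b) / sphereArea d :=
  Real.sq_sqrt (div_nonneg (sub_nonneg.2 hb.le) sphereArea_pos.le)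

theorem tendsto_critScale : Tendsto (critScale d) (𝓝[<] (d : ℝ)) (𝓝 0) := by
  have h : Tendsto (fun b : ℝ => √((d - b) / sphereArea d)) (𝓝 (d : ℝ))
      (𝓝 √((d - d) / sphereArea d)) := by
    have : Continuous fun b : ℝ => √((d - b) / sphereArea d) := by fun_prop
    exact this.tendsto _
  rw [sub_self, zero_div, Real.sqrt_zero] at h
  exact h.mono_left nhdsWithin_le_nhds

/-- The four test functions carry four normalising factors, that is (d - b)² / |S^{d-1}|², exactly
the power for which the four-point integral was shown to be negligible. -/
theorem tendsto_truncMoment_zero (h : IsLogKernelOn K D M C) (hK : IsCompact K)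
    (hC : Measurable fun p : Eu d × Eu d => C p.1 p.2)
    {θ σ : ℝ} (hθσ : θ = 1 ∧ σ = -1 ∨ θ = 0 ∧ σ = 1) (hB : ∀ a, ‖f a‖ ≤ B)
    (hB' : ∀ a, ‖f' a‖ ≤ B) :
    Tendsto (fun b => truncMoment K C b θ σ (fun a => (critScale d b : ℂ) * f a)
      (fun a => (critScale d b : ℂ) * f' a)) (𝓝[<] (d : ℝ)) (𝓝 0) := by
  have hB0 : 0 ≤ B := (norm_nonneg _).trans (hB 0)
  have hS := sphereArea_pos (d := d)
  rw [tendsto_zero_iff_norm_tendsto_zero, Metric.tendsto_nhds]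
  intro ε hε
  set k : ℝ := B * B * (B * B) / sphereArea d ^ 2 with hk
  have hk0 : 0 ≤ k := by positivity
  filter_upwards [h.eventually_fourPoint_le hK hθσ (ε := ε / (2 * (k + 1))) (by positivity),
    self_mem_nhdsWithin] with b hb hbd
  have hbd' : b < d := hbd
  have hs0 : 0 ≤ critScale d b := Real.sqrt_nonneg _
  have hn : ∀ {u : Eu d → ℂ}, (∀ a, ‖u a‖ ≤ B) → ∀ a,
      ‖(critScale d b : ℂ) * u a‖ ≤ critScale d b * B := by
    intro u hu a
    rw [norm_mul, Complex.norm_real, Real.norm_of_nonneg hs0]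
    exact mul_le_mul_of_nonneg_left (hu a) hs0
  have h1 := norm_integral_fourCorr_le hK.measurableSet hC b θ σ (hn hB) (hn hB')
  have e : critScale d b * B * (critScale d b * B) * (critScale d b * B * (critScale d b * B)) =
      k * (d - b) ^ 2 := by
    have := critScale_sq (d := d) hbd'
    calc _ = (critScale d b ^ 2) ^ 2 * (B * B * (B * B)) := by ring
      _ = _ := by rw [this, hk]; field_simp
  rw [e, ENNReal.ofReal_mul hk0, mul_assoc] at h1
  have h2 := h1.trans (mul_le_mul_right hb _)
  rw [← ENNReal.ofReal_mul hk0, ENNReal.ofReal_le_ofReal_iff (by positivity)] at h2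
  rw [Real.dist_eq, sub_zero, abs_of_nonneg (norm_nonneg _)]
  refine h2.trans_lt ?_
  rw [mul_div_assoc', div_lt_iff₀ (by positivity)]
  nlinarith

/-- Two normalising factors produce (d - b)/|S^{d-1}|, the weight of the approximate identity. -/
theorem tendsto_firstMoment_critical {U : Opens (Eu d)} {g : Eu d × Eu d → ℝ}
    (hg : IsLogCovKernel U g) (hK : IsCompact K) (hKU : K ⊆ U)
    (h : IsLogKernelOn K D M (logCov U g)) (hf : Continuous f) (hf0 : ∀ x ∉ K, f x = 0) :
    Tendsto (fun b => firstMoment K (logCov U g) b (fun a => (critScale d b : ℂ) * f a)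
      (fun a => (starRingEnd ℂ) ((critScale d b : ℂ) * f a))) (𝓝[<] (d : ℝ))
      (𝓝 ((∫ x in K, ‖f x‖ ^ 2 * Real.exp (d * g (x, x)) : ℝ) : ℂ)) := by
  refine (tendsto_first_moment hg hK hKU h hf hf0).congr' ?_
  filter_upwards [self_mem_nhdsWithin] with b hb
  rw [firstMoment, ← critScale_sq hb, ← integral_const_mul]
  refine integral_congr_ae (ae_of_all _ fun p => ?_)
  simp only [map_mul, Complex.conj_ofReal]
  push_cast
  ring

/-- Convergence of the characteristic functions of the normalised chaoses as `b = β²` tends to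
the dimension. -/
theorem tendsto_charFun_critical {Ω : Type*} [MeasurableSpace Ω] {P : Measure Ω}
    [IsProbabilityMeasure P] {U : Opens (Eu d)} {g : Eu d × Eu d → ℝ}
    {X : Ω → (𝓢(Eu d, ℝ) →L[ℝ] ℝ)} (hX : IsLogCorrelatedField P U g X)
    (hg : IsLogCovKernel U g) {η : Mollifier d} (hKU : K ⊆ U)
    (h : IsKernelApprox K D M (logCov U g) fun ε => mollCov U g η ε ε)
    (hf : Continuous f) (hf0 : ∀ x ∉ K, f x = 0) (t : ℂ) {ι : Type*} {l : Filter ι} {β : ι → ℝ}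
    (hβ : ∀ i, 0 < β i ^ 2 ∧ β i ^ 2 < d) (hl : Tendsto (fun i => β i ^ 2) l (𝓝[<] (d : ℝ)))
    {φ : ι → ℂ} (hφ : ∀ i, Tendsto (fun ε => ∫ ω, Complex.exp (Complex.I * ((starRingEnd ℂ) t *
      chaosFun (volume.restrict K) X hX.covForm (β i)
        (fun a => (critScale d (β i ^ 2) : ℂ) * f a) (η.bump ε) ω).re) ∂P) (𝓝[>] 0) (𝓝 (φ i))) :
    Tendsto φ l (𝓝 (Real.exp (-(‖t‖ ^ 2 *
      (∫ x in K, ‖f x‖ ^ 2 * Real.exp (d * g (x, x))) / 4)) : ℝ)) := by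
  set v := ∫ x in K, ‖f x‖ ^ 2 * Real.exp (d * g (x, x)) with hv
  have hv0 : 0 ≤ v := integral_nonneg fun x => by positivity
  have hc : HasCompactSupport f := HasCompactSupport.intro h.isCompact hf0
  obtain ⟨B, hB⟩ := hc.exists_bound_of_continuous hf
  have hB' : ∀ a, ‖(starRingEnd ℂ) (f a)‖ ≤ B := fun a => by rw [RCLike.norm_conj]; exact hB a
  have l1 := (tendsto_truncMoment_zero h.kernel h.isCompact h.bounded.measurable
    (Or.inl ⟨rfl, rfl⟩) hB hB').comp hl
  have l2 := (tendsto_truncMoment_zero h.kernel h.isCompact h.bounded.measurable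
    (Or.inr ⟨rfl, rfl⟩) hB hB).comp hl
  have l3 := (tendsto_firstMoment_critical hg h.isCompact hKU h.kernel hf hf0).comp hl
  rw [← hv] at l3
  have l4 := ((tendsto_critScale (d := d)).comp hl).mul_const ‖∫ x in K, f x‖
  have hre := Complex.continuous_re.tendsto (0 : ℂ)
  have key := ((l4.const_mul ‖t‖).add (((((hre.comp l1).add
    ((l3.sub_const (v : ℂ)).norm.pow 2)).sqrt).add (hre.comp l2).sqrt).const_mul
    (‖t‖ ^ 2))).const_mul (Real.exp (‖t‖ ^ 2 * v / 4))
  simp only [sub_self, norm_zero, zero_mul, mul_zero, Complex.zero_re, add_zero, ne_eq,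
    OfNat.ofNat_ne_zero, not_false_eq_true, zero_pow, Real.sqrt_zero] at key
  -- The Stein bound is applied with v equal to the limiting variance for every β. Variance, bias
  -- and the mean |∫ f| all vanish in the limit while the prefactors do not depend on β.
  rw [tendsto_iff_norm_sub_tendsto_zero]
  refine squeeze_zero (fun _ => norm_nonneg _) (fun i => ?_) key
  have hs0 : 0 ≤ critScale d (β i ^ 2) := Real.sqrt_nonneg _
  have h1 := h.norm_sub_exp_le hX hg (hβ i).1 (hβ i).2
    (f := fun a => (critScale d (β i ^ 2) : ℂ) * f a) (B := critScale d (β i ^ 2) * B)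
    (measurable_const.mul hf.measurable) (fun a => by
      rw [norm_mul, Complex.norm_real, Real.norm_of_nonneg hs0]
      exact mul_le_mul_of_nonneg_left (hB a) hs0) t hv0 (hφ i)
  refine h1.trans (le_of_eq ?_)
  rw [integral_const_mul, norm_mul, Complex.norm_real, Real.norm_of_nonneg hs0]
  simp only [Function.comp_apply, map_mul, Complex.conj_ofReal]

end CriticalLimit

/-! ### Existence of the imaginary chaos in L². -/

section Existence

/-- Expanding ‖F p - F q‖² gives two squared norms minus twice the real part of the inner product.
All of these have the same limit when both indices move independently, so the family is Cauchy. -/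
theorem exists_tendsto_of_tendsto_inner {E ι : Type*} [NormedAddCommGroup E]
    [InnerProductSpace ℂ E] [CompleteSpace E] {l : Filter ι} [l.NeBot] {F : ι → E} {G : ℂ}
    (h : Tendsto (fun p : ι × ι => inner ℂ (F p.1) (F p.2)) (l ×ˢ l) (𝓝 G)) :
    ∃ x, Tendsto F l (𝓝 x) := by
  refine CompleteSpace.complete (cauchy_map_iff.2 ⟨inferInstance, ?_⟩)
  rw [tendsto_uniformity_iff_dist_tendsto_zero]
  have hre : ∀ {u : ι × ι → ι × ι}, Tendsto u (l ×ˢ l) (l ×ˢ l) →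
      Tendsto (fun p => (inner ℂ (F (u p).1) (F (u p).2)).re) (l ×ˢ l) (𝓝 G.re) := fun hu =>
    (Complex.continuous_re.tendsto _).comp (h.comp hu)
  have h1 := hre (u := fun p => (p.1, p.1)) (tendsto_fst.prodMk tendsto_fst)
  have h2 := hre (u := fun p => (p.2, p.2)) (tendsto_snd.prodMk tendsto_snd)
  have h3 := hre (u := fun p => p) tendsto_id
  have h4 := (((h1.sub (h3.const_mul 2)).add h2)).sqrt
  rw [show G.re - 2 * G.re + G.re = 0 by ring, Real.sqrt_zero] at h4
  refine h4.congr fun p => ?_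
  rw [dist_eq_norm, ← Real.sqrt_sq (norm_nonneg (F p.1 - F p.2)), @norm_sub_sq ℂ]
  congr 2
  · congr 1
    exact inner_self_eq_norm_sq (𝕜 := ℂ) (F p.1)
  · exact inner_self_eq_norm_sq (𝕜 := ℂ) (F p.2)

variable {d : ℕ} [NeZero d] {Ω : Type*} [MeasurableSpace Ω] {P : Measure Ω}
  [IsProbabilityMeasure P] {U : Opens (Eu d)} {g : Eu d × Eu d → ℝ}
  {X : Ω → (𝓢(Eu d, ℝ) →L[ℝ] ℝ)} {K : Set (Eu d)} {D M : ℝ} {f : Eu d → ℂ} {B : ℝ}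

theorem approxChaos_eq_chaosFun (hX : IsLogCorrelatedField P U g X) (η : Mollifier d) (β ε : ℝ)
    (φ : 𝓓(U, ℂ)) (ω : Ω) : approxChaos P X η U β ε φ ω =
      chaosFun (volume.restrict (tsupport φ)) X hX.covForm β φ (η.bump ε) ω := by
  have h0 : ∀ x ∉ tsupport φ, φ x = 0 := fun x hx => image_eq_zero_of_notMem_tsupport hx
  rw [approxChaos, chaosFun, phaseIntegral,
    setIntegral_eq_integral_of_forall_compl_eq_zero,
    setIntegral_eq_integral_of_forall_compl_eq_zero]
  · refine integral_congr_ae (ae_of_all _ fun x => ?_)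
    simp only [approxChaosDensity, mollifiedField, phase, hX.covForm_apply, map_smul, smul_eq_mul,
      ← sq]
    rw [Complex.exp_add, Complex.ofReal_exp]
    ring_nf
  · intro x hx
    rw [h0 x hx, mul_zero, zero_mul]
  · intro x hx
    rw [h0 x fun h => hx (TestFunction.tsupport_subset φ h), zero_mul]

theorem memLp_approxChaos (hX : IsLogCorrelatedField P U g X) (hg : IsLogCovKernel U g)
    (η : Mollifier d) (β ε : ℝ) (φ : 𝓓(U, ℂ)) : MemLp (approxChaos P X η U β ε φ) 2 P := by
  rcases lt_or_ge 0 ε with hε | hε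
  · have := isFiniteMeasure_restrict_of_isCompact (TestFunction.hasCompactSupport φ).isCompact
    obtain ⟨M, hΦ⟩ := exists_isRegularFamily hg hX η hε
    obtain ⟨B, hB⟩ := (TestFunction.hasCompactSupport φ).exists_bound_of_continuous
      (TestFunction.continuous φ)
    rw [funext (approxChaos_eq_chaosFun hX η β ε φ)]
    exact MemLp.of_bound (hΦ.measurable_chaosFun
      (TestFunction.continuous φ).measurable β).aestronglyMeasurable _
      (ae_of_all _ (hΦ.norm_chaosFun_le hB β))
  -- For ε ≤ 0 the bump is zero by convention and the approximation is a constant. Covering these ε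
  -- gives measurability along the whole family.
  · have h0 : ∀ x, η.bump ε x = 0 := fun x => dif_neg hε.not_gt
    have e : approxChaos P X η U β ε φ = fun _ => ∫ x in (U : Set (Eu d)), φ x := by
      funext ω
      simp [approxChaos, approxChaosDensity, mollifiedField, h0]
    rw [e]
    exact memLp_const _

theorem integral_chaosFun_mul_conj (hX : IsLogCorrelatedField P U g X) (hg : IsLogCovKernel U g)
    (η : Mollifier d) (hK : IsCompact K) (hf : Measurable f) (hB : ∀ a, ‖f a‖ ≤ B) (β : ℝ)
    {ε δ : ℝ} (hε : 0 < ε) (hδ : 0 < δ) :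
    ∫ ω, chaosFun (volume.restrict K) X hX.covForm β f (η.bump ε) ω *
      (starRingEnd ℂ) (chaosFun (volume.restrict K) X hX.covForm β f (η.bump δ) ω) ∂P =
      ∫ p : Eu d × Eu d, ((Real.exp (β ^ 2 * mollCov U g η ε δ p.1 p.2) : ℝ) : ℂ) *
        (f p.1 * (starRingEnd ℂ) (f p.2))
        ∂((volume.restrict K).prod (volume.restrict K)) := by
  have := isFiniteMeasure_restrict_of_isCompact hK
  have hG := hX.isCenteredGaussian
  obtain ⟨M, hΦ⟩ := exists_isRegularFamily hg hX η hε
  obtain ⟨M', hΦ'⟩ := exists_isRegularFamily hg hX η hδ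
  refine (integral_phaseIntegral_mul_conj (μ := volume.restrict K) (μ' := volume.restrict K) hG
    (hΦ.measurable_smul β) (hΦ.measurable_chaosWeight hf β)
    (hΦ.norm_chaosWeight_le hB β) (hΦ'.measurable_smul β) (hΦ'.measurable_chaosWeight hf β)
    (hΦ'.norm_chaosWeight_le hB β)).trans ?_
  refine integral_congr_ae (ae_of_all _ fun p => ?_)
  have e : Real.exp (β ^ 2 * mollCov U g η ε δ p.1 p.2) =
      Real.exp (β ^ 2 * hX.covForm (η.bump ε p.1) (η.bump ε p.1) / 2) *
      Real.exp (β ^ 2 * hX.covForm (η.bump δ p.2) (η.bump δ p.2) / 2) *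
      Real.exp (-(hX.covForm (β • η.bump ε p.1 - β • η.bump δ p.2)
        (β • η.bump ε p.1 - β • η.bump δ p.2)) / 2) := by
    rw [← Real.exp_add, ← Real.exp_add, ← hX.covForm_bump]
    congr 1
    simp only [map_sub, map_smul, LinearMap.sub_apply, LinearMap.smul_apply, smul_eq_mul]
    rw [hG.symm (η.bump δ p.2) (η.bump ε p.1)]
    ring
  simp only [chaosWeight]
  rw [← Complex.ofReal_exp, e, map_mul, Complex.conj_ofReal]
  push_cast
  ring

/-- The two-point function is e^{b C_{ε,δ}}, dominated uniformly in both scales by a Riesz kernel of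
exponent b < d, which is integrable. Off the diagonal it converges pointwise. -/
theorem tendsto_integral_chaosFun_mul_conj (hX : IsLogCorrelatedField P U g X)
    (hg : IsLogCovKernel U g) (η : Mollifier d) (hK : IsCompact K) (hKU : K ⊆ U)
    (hf : Measurable f) (hB : ∀ a, ‖f a‖ ≤ B) {β : ℝ} (hβ : 0 < β ^ 2) (hβd : β ^ 2 < d) :
    Tendsto (fun p : ℝ × ℝ => ∫ ω, chaosFun (volume.restrict K) X hX.covForm β f (η.bump p.1) ω *
      (starRingEnd ℂ) (chaosFun (volume.restrict K) X hX.covForm β f (η.bump p.2) ω) ∂P)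
      (𝓝[>] 0 ×ˢ 𝓝[>] 0)
      (𝓝 (∫ p : Eu d × Eu d, ((Real.exp (β ^ 2 * logCov U g p.1 p.2) : ℝ) : ℂ) *
        (f p.1 * (starRingEnd ℂ) (f p.2))
        ∂((volume.restrict K).prod (volume.restrict K)))) := by
  obtain ⟨ε₀, D, M, hε₀, hbd, hA⟩ := exists_isKernelApprox hg hX η hK hKU
  have hB0 : 0 ≤ B := (norm_nonneg _).trans (hB 0)
  have hev : ∀ᶠ r : ℝ × ℝ in 𝓝[>] 0 ×ˢ 𝓝[>] 0, r.1 ∈ Ioo 0 ε₀ ∧ r.2 ∈ Ioo 0 ε₀ :=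
    prod_mem_prod (Ioo_mem_nhdsGT hε₀) (Ioo_mem_nhdsGT hε₀)
  have hae := ae_prod_restrict (d := d) hK.measurableSet
  have hmt : Measurable fun p : Eu d × Eu d => f p.1 * (starRingEnd ℂ) (f p.2) := by
    have := Complex.continuous_conj.measurable
    fun_prop
  have key : Tendsto (fun r : ℝ × ℝ => ∫ p : Eu d × Eu d,
      ((Real.exp (β ^ 2 * mollCov U g η r.1 r.2 p.1 p.2) : ℝ) : ℂ) *
        (f p.1 * (starRingEnd ℂ) (f p.2))
        ∂((volume.restrict K).prod (volume.restrict K))) (𝓝[>] 0 ×ˢ 𝓝[>] 0)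
      (𝓝 (∫ p : Eu d × Eu d, ((Real.exp (β ^ 2 * logCov U g p.1 p.2) : ℝ) : ℂ) *
        (f p.1 * (starRingEnd ℂ) (f p.2))
        ∂((volume.restrict K).prod (volume.restrict K)))) := by
    refine tendsto_integral_filter_of_dominated_convergence
      (fun p => Real.exp (β ^ 2 * M) * Real.exp (β ^ 2 * logDist D p.1 p.2) * (B * B)) ?_ ?_ ?_ ?_
    · filter_upwards [hev] with r hr
      exact ((Complex.measurable_ofReal.comp ((measurable_mollCov hX η hr.1.1 hr.2.1).const_mul
        _).exp).mul hmt).aestronglyMeasurable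
    · filter_upwards [hev] with r hr
      filter_upwards [hae] with p hp
      rw [norm_mul, norm_mul, RCLike.norm_conj, Complex.norm_real, Real.norm_eq_abs, Real.abs_exp,
        ← Real.exp_add, ← mul_add]
      exact mul_le_mul (Real.exp_le_exp.2 (mul_le_mul_of_nonneg_left ((le_abs_self _).trans
        (hbd _ _ hr.1.1 hr.1.2 hr.2.1 hr.2.2 _ hp.1.1 _ hp.1.2 hp.2)) hβ.le))
        (mul_le_mul (hB _) (hB _) (norm_nonneg _) hB0) (by positivity) (by positivity)
    · exact ((integrable_exp_logDist hK hA.kernel.pos hβ hβd).const_mul _).mul_const _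
    · filter_upwards [hae] with p hp
      exact ((Complex.continuous_ofReal.tendsto _).comp ((Real.continuous_exp.tendsto _).comp
        ((tendsto_mollCov hg η (hKU hp.1.1) (hKU hp.1.2) hp.2).const_mul _))).mul_const _
  refine key.congr' ?_
  filter_upwards [hev] with r hr
  exact (integral_chaosFun_mul_conj hX hg η hK hf hB β hr.1.1 hr.2.1).symm

/-- Convergence of the mixed second moments makes the mollified chaoses Cauchy in L², and an L²
limit is a limit in probability. -/
theorem exists_isImaginaryChaos (hX : IsLogCorrelatedField P U g X) (hg : IsLogCovKernel U g)
    (η : Mollifier d) {β : ℝ} (hβ : 0 < β ^ 2) (hβd : β ^ 2 < d) :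
    ∃ μ, IsImaginaryChaos P X η U β μ := by
  have hlim : ∀ φ : 𝓓(U, ℂ), ∃ Z : Lp ℂ 2 P, Tendsto (fun ε =>
      (memLp_approxChaos hX hg η β ε φ).toLp) (𝓝[>] (0 : ℝ)) (𝓝 Z) := by
    intro φ
    obtain ⟨B, hB⟩ := (TestFunction.hasCompactSupport φ).exists_bound_of_continuous
      (TestFunction.continuous φ)
    have h := tendsto_integral_chaosFun_mul_conj hX hg η
      (TestFunction.hasCompactSupport φ).isCompact (TestFunction.tsupport_subset φ)
      (TestFunction.continuous φ).measurable hB hβ hβd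
    refine exists_tendsto_of_tendsto_inner ((h.comp tendsto_prod_swap).congr fun p => ?_)
    rw [L2.inner_def]
    refine integral_congr_ae ?_
    filter_upwards [(memLp_approxChaos hX hg η β p.1 φ).coeFn_toLp,
      (memLp_approxChaos hX hg η β p.2 φ).coeFn_toLp] with ω h1 h2
    rw [h1, h2, approxChaos_eq_chaosFun hX, approxChaos_eq_chaosFun hX, RCLike.inner_apply]
    rfl
  choose Z hZ using hlim
  refine ⟨fun φ => Z φ, fun φ => (Lp.aestronglyMeasurable _).aemeasurable, fun φ => ?_⟩
  exact (tendstoInMeasure_of_tendsto_Lp (hZ φ)).congr_left fun ε =>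
    (memLp_approxChaos hX hg η β ε φ).coeFn_toLp

end Existence

/-! ### Characteristic functions and convergence in law. -/

section Law

theorem real_inner_eq_re (z t : ℂ) : inner ℝ z t = ((starRingEnd ℂ) t * z).re := by
  rw [Complex.inner]
  simp only [Complex.mul_re, Complex.conj_re, Complex.conj_im]
  ring

theorem charFun_complexGaussian (v : ℝ≥0) (t : ℂ) :
    charFun (complexGaussian v) t = ((Real.exp (-(‖t‖ ^ 2 * v / 4)) : ℝ) : ℂ) := by
  rw [charFun_apply, integral_complexGaussian]
  have e : ∀ p : ℝ × ℝ, Complex.exp ((inner ℝ ((p.1 : ℂ) + p.2 * Complex.I) t : ℝ) * Complex.I) =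
      Complex.exp (t.re * p.1 * Complex.I) * Complex.exp (t.im * p.2 * Complex.I) := by
    intro p
    rw [← Complex.exp_add, real_inner_eq_re]
    congr 1
    simp
    ring
  simp only [e]
  rw [integral_prod_mul (fun x : ℝ => Complex.exp (t.re * x * Complex.I))
    (fun x : ℝ => Complex.exp (t.im * x * Complex.I)), ← charFun_apply_real, ← charFun_apply_real,
    charFun_gaussianReal, charFun_gaussianReal, ← Complex.exp_add, Complex.ofReal_exp,
    Complex.sq_norm, Complex.normSq_apply]
  congr 1
  push_cast
  ring

variable {Ω : Type*} [MeasurableSpace Ω] {P : Measure Ω} [IsProbabilityMeasure P]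

theorem charFun_map_eq_integral {Y : Ω → ℂ} (hY : AEMeasurable Y P) (t : ℂ) :
    charFun (P.map Y) t = ∫ ω, Complex.exp (Complex.I * ((starRingEnd ℂ) t * Y ω).re) ∂P := by
  rw [charFun_apply, integral_map hY (by fun_prop)]
  simp only [real_inner_eq_re, mul_comm]

/-- Convergence in probability implies convergence in law, hence of characteristic functions.
Through this the Stein bound, proved for the mollified chaos, reaches any version of the imaginary
chaos. -/
theorem tendsto_integral_exp_of_tendstoInMeasure {ι : Type*} {l : Filter ι} [l.NeBot]
    [l.IsCountablyGenerated] {Y : ι → Ω → ℂ} {Z : Ω → ℂ} (h : TendstoInMeasure P Y l Z)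
    (hY : ∀ i, AEMeasurable (Y i) P) (hZ : AEMeasurable Z P) (t : ℂ) :
    Tendsto (fun i => ∫ ω, Complex.exp (Complex.I * ((starRingEnd ℂ) t * Y i ω).re) ∂P) l
      (𝓝 (∫ ω, Complex.exp (Complex.I * ((starRingEnd ℂ) t * Z ω).re) ∂P)) := by
  have h1 := (h.tendstoInDistribution hY).tendsto
  have h2 := (ProbabilityMeasure.tendsto_iff_forall_integral_rclike_tendsto ℂ).1 h1 (BoundedContinuousFunction.innerProbChar t)
  simp only [ProbabilityMeasure.coe_mk, ← charFun_eq_integral_innerProbChar] at h2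
  rw [charFun_map_eq_integral hZ] at h2
  exact h2.congr fun i => charFun_map_eq_integral (hY i) t

/-- Lévy's continuity theorem along sequences. The filter is countably generated, so sequences
detect convergence. -/
theorem tendstoInDistribution_of_tendsto_charFun {ι : Type*} {l : Filter ι}
    [l.IsCountablyGenerated] {Y : ι → Ω → ℂ} {ν : Measure ℂ} [IsProbabilityMeasure ν]
    (hY : ∀ i, AEMeasurable (Y i) P)
    (h : ∀ t : ℂ, Tendsto (fun i => ∫ ω, Complex.exp (Complex.I * ((starRingEnd ℂ) t * Y i ω).re) ∂P)
      l (𝓝 (charFun ν t))) :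
    TendstoInDistribution Y l (id : ℂ → ℂ) (fun _ => P) ν := by
  refine ⟨hY, aemeasurable_id, tendsto_of_seq_tendsto fun u hu => ?_⟩
  refine ProbabilityMeasure.tendsto_of_tendsto_charFun fun t => ?_
  simp only [ProbabilityMeasure.coe_mk, Measure.map_id]
  exact ((h t).comp hu).congr fun n => (charFun_map_eq_integral (hY _) t).symm

theorem chaosFun_const_mul {A V : Type*} [MeasurableSpace A] [AddCommGroup V] [Module ℝ V]
    [TopologicalSpace V] (μ : Measure A) (X : Ω → V →L[ℝ] ℝ) (q : LinearMap.BilinForm ℝ V) (β : ℝ)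
    (c : ℂ) (f : A → ℂ) (Φ : A → V) (ω : Ω) :
    chaosFun μ X q β (fun a => c * f a) Φ ω = c * chaosFun μ X q β f Φ ω := by
  simp only [chaosFun, phaseIntegral]
  rw [← integral_const_mul]
  refine integral_congr_ae (ae_of_all _ fun a => ?_)
  simp only
  ring

theorem tendsto_sq_nhdsLT_sqrt (d : ℕ) :
    Tendsto (fun β : Ioo 0 √(d : ℝ) => (β : ℝ) ^ 2) (comap Subtype.val (𝓝[<] √(d : ℝ)))
      (𝓝[<] (d : ℝ)) := by
  refine tendsto_nhdsWithin_iff.2 ⟨?_, Eventually.of_forall fun β => ?_⟩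
  · have h : Tendsto (fun x : ℝ => x ^ 2) (𝓝 √(d : ℝ)) (𝓝 (d : ℝ)) := by
      have := (continuous_pow 2).tendsto √(d : ℝ)
      rwa [Real.sq_sqrt (Nat.cast_nonneg d)] at this
    exact (h.mono_left nhdsWithin_le_nhds).comp tendsto_comap
  · exact (Real.lt_sqrt β.2.1.le).1 β.2.2

end Law

end ImagChaos

end

/-! ### Assembly of the theorem. -/

theorem mainTheorem8 {d : ℕ} (hd : 0 < d)
    (U : TopologicalSpace.Opens (EuclideanSpace ℝ (Fin d)))
    (g : EuclideanSpace ℝ (Fin d) × EuclideanSpace ℝ (Fin d) → ℝ)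
    (hg : ImagChaos.IsLogCovKernel U g)
    {Ω : Type*} [MeasurableSpace Ω] (P : MeasureTheory.Measure Ω)
    [MeasureTheory.IsProbabilityMeasure P]
    (X : Ω → (𝓢(EuclideanSpace ℝ (Fin d), ℝ) →L[ℝ] ℝ))
    (hX : ImagChaos.IsLogCorrelatedField P U g X)
    (η : ImagChaos.Mollifier d) (f : 𝓓(U, ℂ)) :
    (∀ β ∈ Set.Ioo 0 √(d : ℝ), ∃ μ, ImagChaos.IsImaginaryChaos P X η U β μ) ∧
    ∀ μ : Set.Ioo 0 √(d : ℝ) → 𝓓(U, ℂ) → Ω → ℂ,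
      (∀ β : Set.Ioo 0 √(d : ℝ), ImagChaos.IsImaginaryChaos P X η U (β : ℝ) (μ β)) →
      MeasureTheory.TendstoInDistribution
        (fun (β : Set.Ioo 0 √(d : ℝ)) (ω : Ω) =>
          ((√(((d : ℝ) - (β : ℝ) ^ 2) / ImagChaos.sphereArea d) : ℝ) : ℂ) * μ β f ω)
        (Filter.comap Subtype.val (𝓝[<] √(d : ℝ)))
        (id : ℂ → ℂ)
        (fun _ => P)
        (ImagChaos.whiteNoiseIntegralLaw U
          (fun x => f x * ((Real.exp ((d : ℝ) / 2 * g (x, x)) : ℝ) : ℂ))) := by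
  have : NeZero d := ⟨hd.ne'⟩
  have hsq : ∀ β ∈ Set.Ioo 0 √(d : ℝ), 0 < β ^ 2 ∧ β ^ 2 < d := fun β hβ =>
    ⟨pow_pos hβ.1 2, (Real.lt_sqrt hβ.1.le).1 hβ.2⟩
  refine ⟨fun β hβ => ImagChaos.exists_isImaginaryChaos hX hg η (hsq β hβ).1 (hsq β hβ).2,
    fun μ hμ => ?_⟩
  have hK := (TestFunction.hasCompactSupport f).isCompact
  have hKU := TestFunction.tsupport_subset f
  have hf0 : ∀ x ∉ tsupport f, f x = 0 := fun x hx => image_eq_zero_of_notMem_tsupport hx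
  obtain ⟨-, D, M, -, -, hA⟩ := ImagChaos.exists_isKernelApprox hg hX η hK hKU
  refine ImagChaos.tendstoInDistribution_of_tendsto_charFun
    (fun β => ((hμ β).aemeasurable f).const_mul _) fun t => ?_
  -- The variance of the white noise integral over U lives on the support of f, where it agrees with
  -- the limit of the first moments: the square of e^{d g/2} is e^{d g}.
  have hvar : ∫ x in (U : Set (EuclideanSpace ℝ (Fin d))),
      ‖f x * ((Real.exp ((d : ℝ) / 2 * g (x, x)) : ℝ) : ℂ)‖ ^ 2 =
      ∫ x in tsupport f, ‖f x‖ ^ 2 * Real.exp (d * g (x, x)) := by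
    rw [setIntegral_eq_integral_of_forall_compl_eq_zero,
      setIntegral_eq_integral_of_forall_compl_eq_zero]
    · refine integral_congr_ae (ae_of_all _ fun x => ?_)
      simp only
      rw [norm_mul, Complex.norm_real, Real.norm_eq_abs, Real.abs_exp, mul_pow, ← Real.exp_nat_mul]
      congr 2
      push_cast
      ring
    · intro x hx
      rw [hf0 x hx, norm_zero, zero_pow two_ne_zero, zero_mul]
    · intro x hx
      rw [hf0 x fun h => hx (hKU h), zero_mul, norm_zero, zero_pow two_ne_zero]
  rw [ImagChaos.whiteNoiseIntegralLaw, ImagChaos.charFun_complexGaussian, hvar,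
    Real.coe_toNNReal _ (integral_nonneg fun x => by positivity)]
  refine ImagChaos.tendsto_charFun_critical hX hg hKU hA (TestFunction.continuous f) hf0 t
    (fun β : Set.Ioo 0 √(d : ℝ) => hsq β β.2) (ImagChaos.tendsto_sq_nhdsLT_sqrt d) fun β => ?_
  -- Convergence in probability is given for the unnormalised chaos. Evaluating its characteristic
  -- function at the rescaled argument yields that of the normalised one.
  have h := ImagChaos.tendsto_integral_exp_of_tendstoInMeasure ((hμ β).tendsto f)
    (fun ε => (ImagChaos.memLp_approxChaos hX hg η β ε f).aestronglyMeasurable.aemeasurable)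
    ((hμ β).aemeasurable f)
    ((ImagChaos.critScale d ((β : ℝ) ^ 2) : ℂ) * t)
  simp only [map_mul, Complex.conj_ofReal, ImagChaos.approxChaos_eq_chaosFun hX] at h
  simp only [ImagChaos.chaosFun_const_mul]
  have e : ∀ z : ℂ, (ImagChaos.critScale d ((β : ℝ) ^ 2) : ℂ) * (starRingEnd ℂ) t * z =
      (starRingEnd ℂ) t * ((√(((d : ℝ) - (β : ℝ) ^ 2) / ImagChaos.sphereArea d) : ℝ) * z) :=
    fun z => by rw [ImagChaos.critScale]; ring
  simp only [e] at h
  exact h
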